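/- **Model.** For an integer $n\ge 1$ and $p,q,s\in[0,1]$, $(G_1,G_2)\sim\mathrm{CSBM}(n,p,q,s)$ is generated as follows. The labels $\sigma_*(i)\in\{-1,+1\}$, $i\in[n]$, are i.i.d. uniform. Given $\sigma_*$, a parent graph $G$ on $[n]$ has each edge $\{i,j\}$ independently, with probability $p$ if $\sigma_*(i)=\sigma_*(j)$ and $q$ otherwise. Given $G$, the graphs $G_1$ and $G_2'$ are two independent subsamples of $G$, each keeping every edge independently with probability $s$. Finally $G_2$ is $G_2'$ with vertex $i$ renamed $\pi_*(i)$, for an independent uniformly random permutation $\pi_*$ of $[n]$. For labelings $\sigma,\tau$ put $\mathsf{ov}(\sigma,\tau)=\frac1n\left|\sum_i\sigma(i)\tau(i)\right|$, and let $\mathrm{T_c}(\alpha,\beta)=\frac{\alpha+\beta}2$ and $\mathrm{D_+}(\alpha,\beta)=\frac{(\sqrt\alpha-\sqrt\beta)^2}{2}$. **Algorithm**, on input $(G_1,G_2)$, $k$, $\epsilon$, with $\alpha,\beta,s$ known. "Vote" means majority if $\alpha>\beta$ and minority if $\alpha<\beta$; ties and all other choices left open are arbitrary. 1. *Matching.*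 A $k$-core matching is a pair $(M,\mu)$, $M\subseteq[n]$, $\mu:M\to[n]$ injective, such that every $i\in M$ has at least $k$ neighbours $j\in M$ in $G_1$ for which $\{\mu(i),\mu(j)\}$ is an edge of $G_2$. Take one with $|M|$ maximal; let $F=[n]\setminus M$. Below, $G_1\vee_\mu G_2$ is the graph on $M$ of the pairs $\{i,j\}$ with $\{i,j\}\in G_1$ or $\{\mu(i),\mu(j)\}\in G_2$, and $G_1\setminus_\mu G_2$ that of the pairs with $\{i,j\}\in G_1$ and $\{\mu(i),\mu(j)\}\notin G_2$. 2. *Preliminary labeling $\hat\sigma_1$ of $G_1$.* The spectral method on a graph with at least two vertices labels the vertices by the signs of an eigenvector of the adjacency matrix, for its second largest eigenvalue if $\alpha>\beta$ and for its smallest eigenvalue if $\alpha<\beta$ (zero entries may get either label). Choose a positive integer $m$ with $\left(\log\frac{\epsilon m}{200\max\{1,s\alpha,s\beta\}}-1\right)\frac{\epsilon}{2}>1$, and put each vertex independently and uniformly into one of $U_1,\dots,U_m$. Let $(U_+,U_-)$ be the result of the spectral method on $G_1$, and $(U_{i,+},U_{i,-})$ its result on $G_1\{[n]\setminus U_i\}$,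 these two sets being swapped if $|U_{i,+}\,\Delta\, U_+|\ge n/2$. Label each $v\in U_i$ by the vote of its neighbours in $U_{i,+}\cup U_{i,-}$. 3. *Expansion.* Starting from $[n]\setminus\mu(M)$, repeatedly add a vertex that has at least two neighbours in the current set with respect to $G_2$, until there is none; let $F'$ be the result and $\overline F=[n]\setminus\mu^{-1}([n]\setminus F')\supseteq F$. 4. *Labeling of $M$.* Label each $i\in[n]\setminus\overline F$ by the vote of the $\hat\sigma_1$-labels of its neighbours in $(G_1\vee_\mu G_2)\{[n]\setminus\overline F\}$. Then label each $i\in\overline F\setminus F$ by the vote of the new labels of its neighbours in $[n]\setminus\overline F$ with respect to $G_1\setminus_\mu G_2$. 5. *Labeling of $F$.* Label each $i\in F$ by the vote of the labels of its $G_1$-neighbours in $M$. **Theorem.** Fix $\alpha,\beta>0$ and $s\in[0,1]$ with $$\left(1-(1-s)^2\right)\mathrm{D_+}(\alpha,\beta)>1\qquad\text{and}\qquad s^2\,\mathrm{T_c}(\alpha,\beta)+s(1-s)\,\mathrm{D_+}(\alpha,\beta)>1,$$ and let $(G_1,G_2)\sim\mathrm{CSBM}\left(n,\frac{\alpha\log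 n}{n},\frac{\beta\log n}{n},s\right)$ ($n$ large enough that these are probabilities). Then: (a) There is an estimator $\hat\sigma=\hat\sigma(G_1,G_2)$ with $\lim_{n\to\infty}\mathbb P\left(\mathsf{ov}(\hat\sigma,\sigma_*)=1\right)=1$. (b) There are $\epsilon$ with $$\left(1-(1-s)^2\right)\mathrm{D_+}(\alpha,\beta)>1+2\epsilon\left|\log(\alpha/\beta)\right|\qquad\text{and}\qquad 0<\epsilon\le\frac{s\,\mathrm{D_+}(\alpha,\beta)}{4\left|\log(\alpha/\beta)\right|}.\qquad(*)$$ (c) For every $\epsilon$ satisfying $(*)$ an admissible $m$ exists, and for every fixed admissible $m$ the algorithm with $k=13$ and this $\epsilon$ recovers the communities exactly with probability tending to $1$ (over the graphs and the random partition): with probability tending to $1$, the algorithm produces an output, and every output $\hat\sigma$ it can produce satisfies $\mathsf{ov}(\hat\sigma,\sigma_*)=1$. -/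

import Mathlib

noncomputable section

namespace CorrSBM

/-! ### The model -/

open Classical in
/-- The pairs `{i, j}` with `i ≠ j`. -/
def pairs (n : ℕ) : Finset (Sym2 (Fin n)) :=
  Finset.univ.filter fun e => ¬ e.IsDiag

open Classical in
/-- The probability that the random graph in which each pair `e` is an edge with probability `w e`,
independently over all pairs, equals `G`. -/
def graphMass {n : ℕ} (w : Sym2 (Fin n) → unitInterval) (G : SimpleGraph (Fin n)) : ℝ :=
  ∏ e ∈ pairs n, if e ∈ G.edgeSet then (w e : ℝ) else 1 - (w e : ℝ)

theorem graphMass_nonneg {n : ℕ} (w : Sym2 (Fin n) → unitInterval) (G : SimpleGraph (Fin n)) :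
    0 ≤ graphMass w G := by
  refine Finset.prod_nonneg fun e _ => ?_
  split_ifs
  · exact (w e).2.1
  · exact sub_nonneg.2 (w e).2.2

open Classical in
theorem sum_graphMass {n : ℕ} (w : Sym2 (Fin n) → unitInterval) :
    ∑ G : SimpleGraph (Fin n), graphMass w G = 1 := by
  have h1 : ∏ e ∈ pairs n, ((w e : ℝ) + (1 - (w e : ℝ))) = 1 := by simp
  rw [Finset.prod_add] at h1
  rw [← h1]
  refine Finset.sum_bij' (fun G _ => (pairs n).filter (fun e => e ∈ G.edgeSet))
    (fun t _ => SimpleGraph.fromEdgeSet (t : Set (Sym2 (Fin n)))) ?_ ?_ ?_ ?_ ?_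
  · intro G _
    simp
  · intro t _
    simp
  · intro G _
    ext a b
    simp only [SimpleGraph.fromEdgeSet_adj, Finset.coe_filter, pairs]
    constructor
    · rintro ⟨h, _⟩
      simpa using h.2
    · intro h
      refine ⟨?_, h.ne⟩
      simpa [h.ne] using h
  · intro t ht
    ext e
    have ht' := Finset.mem_powerset.1 ht
    simp only [Finset.mem_filter, SimpleGraph.edgeSet_fromEdgeSet]
    constructor
    · rintro ⟨_, h⟩
      exact_mod_cast h.1
    · intro h
      have h' := ht' h
      refine ⟨h', ?_⟩
      have h2 : ¬ e.IsDiag := by simpa [pairs] using h'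
      exact ⟨by exact_mod_cast h, h2⟩
  · intro G _
    rw [graphMass, Finset.prod_ite, ← Finset.filter_not]

/-- The random graph on `[n]` in which each pair `e` is an edge with probability `w e`,
independently over all pairs. -/
def randomGraph {n : ℕ} (w : Sym2 (Fin n) → unitInterval) : PMF (SimpleGraph (Fin n)) :=
  PMF.ofFintype (fun G => ENNReal.ofReal (graphMass w G)) (by
    rw [← ENNReal.ofReal_sum_of_nonneg fun G _ => graphMass_nonneg w G, sum_graphMass,
      ENNReal.ofReal_one])

open Classical in
/-- The edge probabilities of the stochastic block model with community labels `σ`: a pair inside a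
community gets `p`, a pair across communities gets `q`. -/
def sbmWeight {n : ℕ} (p q : unitInterval) (σ : Fin n → ℤˣ) (e : Sym2 (Fin n)) : unitInterval :=
  if ∃ i j, e = s(i, j) ∧ σ i = σ j then p else q

open Classical in
/-- Edge subsampling: each edge of `G` is kept with probability `s`, independently, and non-edges
stay non-edges. -/
def subsample {n : ℕ} (s : unitInterval) (G : SimpleGraph (Fin n)) : PMF (SimpleGraph (Fin n)) :=
  randomGraph fun e => if e ∈ G.edgeSet then s else 0

/-- An outcome of the correlated stochastic block model: the hidden community labels (those of the
vertices of the first graph) and the two observed graphs. -/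
structure Outcome (n : ℕ) where
  labels : Fin n → ℤˣ
  G₁ : SimpleGraph (Fin n)
  G₂ : SimpleGraph (Fin n)

/-- The law of `(σ_*, G₁, G₂)` for `(G₁, G₂) ∼ CSBM(n, p, q, s)`. The labels are i.i.d. uniform,
the parent graph is drawn from the block model, `G₁` and `G₂'` are two independent subsamples of it,
and `G₂` is `G₂'` with vertex `i` renamed `π i` for an independent uniform permutation `π`. -/
def csbm (n : ℕ) (p q s : unitInterval) : PMF (Outcome n) := do
  let σ ← PMF.uniformOfFintype (Fin n → ℤˣ)
  let G ← randomGraph (sbmWeight p q σ)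
  let G₁ ← subsample s G
  let G₂' ← subsample s G
  let π ← PMF.uniformOfFintype (Equiv.Perm (Fin n))
  return ⟨σ, G₁, G₂'.map π⟩

/-- The edge probability `a log n / n`, truncated to `[0, 1]` (for `a ≥ 0` the truncation is void
for all large `n`). -/
def logProb (a : ℝ) (n : ℕ) : unitInterval :=
  Set.projIcc (0 : ℝ) 1 zero_le_one (a * Real.log n / n)

/-- The overlap of two labelings. -/
def ov {n : ℕ} (σ τ : Fin n → ℤˣ) : ℝ :=
  (1 / (n : ℝ)) * |∑ i, ((σ i : ℤ) : ℝ) * ((τ i : ℤ) : ℝ)|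

/-- `D₊(α, β)`. -/
def Dplus (α β : ℝ) : ℝ := ((√α - √β) / √2) ^ 2

/-- `T_c(α, β)`. -/
def Tc (α β : ℝ) : ℝ := (α + β) / 2

/-! ### Partial matchings of two graphs -/

/-- A matching `(M, μ)`. Only the restriction of `μ` to `M` matters. -/
structure Matching (n : ℕ) where
  M : Finset (Fin n)
  μ : Fin n → Fin n
  injOn : Set.InjOn μ M

namespace Matching

variable {n : ℕ}

/-- The union graph relative to the matching. The vertices outside `M`, which
do not belong to it, are kept as isolated vertices here and in the next two graphs. -/
def union (m : Matching n) (G₁ G₂ : SimpleGraph (Fin n)) : SimpleGraph (Fin n) where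
  Adj i j := i ∈ m.M ∧ j ∈ m.M ∧ (G₁.Adj i j ∨ G₂.Adj (m.μ i) (m.μ j))
  symm := ⟨fun _ _ h => ⟨h.2.1, h.1, h.2.2.imp (fun a => a.symm) (fun a => a.symm)⟩⟩
  loopless := ⟨fun _ h => h.2.2.elim (fun a => a.ne rfl) (fun a => a.ne rfl)⟩

/-- The intersection graph relative to the matching. -/
def inter (m : Matching n) (G₁ G₂ : SimpleGraph (Fin n)) : SimpleGraph (Fin n) where
  Adj i j := i ∈ m.M ∧ j ∈ m.M ∧ G₁.Adj i j ∧ G₂.Adj (m.μ i) (m.μ j)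
  symm := ⟨fun _ _ h => ⟨h.2.1, h.1, h.2.2.1.symm, h.2.2.2.symm⟩⟩
  loopless := ⟨fun _ h => h.2.2.1.ne rfl⟩

/-- The graph of the edges of `G₁` that are not in `G₂`, relative to the matching. -/
def diff (m : Matching n) (G₁ G₂ : SimpleGraph (Fin n)) : SimpleGraph (Fin n) where
  Adj i j := i ∈ m.M ∧ j ∈ m.M ∧ G₁.Adj i j ∧ ¬ G₂.Adj (m.μ i) (m.μ j)
  symm := ⟨fun _ _ h => ⟨h.2.1, h.1, h.2.2.1.symm, fun a => h.2.2.2 a.symm⟩⟩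
  loopless := ⟨fun _ h => h.2.2.1.ne rfl⟩

open Classical in
/-- A `k`-core matching: every matched vertex has degree at least `k` in the intersection graph. -/
def IsKCore (k : ℕ) (G₁ G₂ : SimpleGraph (Fin n)) (m : Matching n) : Prop :=
  ∀ i ∈ m.M, k ≤ (m.inter G₁ G₂).degree i

/-- A maximal `k`-core matching: one with the greatest number of matched vertices. -/
def IsMaxKCore (k : ℕ) (G₁ G₂ : SimpleGraph (Fin n)) (m : Matching n) : Prop :=
  m.IsKCore k G₁ G₂ ∧ ∀ m' : Matching n, m'.IsKCore k G₁ G₂ → m'.M.card ≤ m.M.card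

end Matching

/-! ### The algorithm

Each routine is given as the relation between its input and its possible outputs, so that all
choices it leaves open (a maximal matching, an eigenvector, the order of insertions, the way ties
in a vote are broken) are arbitrary. -/

/-- `x` is the label elected by votes with sum `S`: the majority label if `a > b`, the minority
label if `a < b`, and an arbitrary label in case of a tie. -/
def IsVote (a b : ℝ) (S : ℤ) (x : ℤˣ) : Prop :=
  (b < a → (0 < S → x = 1) ∧ (S < 0 → x = -1)) ∧
  (a < b → (0 < S → x = -1) ∧ (S < 0 → x = 1))

open Classical in
/-- The sum of the labels `τ` over the neighbours of `i` in `G` that lie in `A`. -/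
def nbrSum {V : Type} [Fintype V] (G : SimpleGraph V) (A : Set V) (τ : V → ℤˣ) (i : V) : ℤ :=
  ∑ j ∈ Finset.univ.filter (fun j => G.Adj i j ∧ j ∈ A), (τ j : ℤ)

open Classical in
/-- The adjacency matrix. -/
def adj {V : Type} (G : SimpleGraph V) : Matrix V V ℝ := G.adjMatrix ℝ

theorem adj_isHermitian {V : Type} (G : SimpleGraph V) : (adj G).IsHermitian := by
  classical
  ext i j
  simp [adj, SimpleGraph.adjMatrix_apply, SimpleGraph.adj_comm]

open Classical in
/-- The eigenvalues of the adjacency matrix in decreasing order, with multiplicity. -/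
def adjEig {V : Type} [Fintype V] (G : SimpleGraph V) : Fin (Fintype.card V) → ℝ :=
  (adj_isHermitian G).eigenvalues₀

/-- The spectral method: `τ` is a vector of signs of an eigenvector `u` of the adjacency matrix, for
its second largest eigenvalue if `a > b`, and for its smallest eigenvalue if `a < b`. -/
def IsSpectral {V : Type} [Fintype V] (a b : ℝ) (G : SimpleGraph V) (τ : V → ℤˣ) : Prop :=
  ∃ (h : 1 < Fintype.card V) (u : V → ℝ), u ≠ 0 ∧
    (b < a → (adj G).mulVec u = adjEig G ⟨1, h⟩ • u) ∧
    (a < b → (adj G).mulVec u = adjEig G ⟨Fintype.card V - 1, by omega⟩ • u) ∧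
    ∀ v, (0 < u v → τ v = 1) ∧ (u v < 0 → τ v = -1)

open Classical in
/-- Almost exact labeling of `G`, for the partition of the vertices into the `r` classes
`{v | c v = i}`. The labels `τ` come from the spectral method on `G`, the labels `ρ i` from the
spectral method on the graph induced outside the `i`-th class; `ρ i` is flipped if its positive part
and that of `τ` have a symmetric difference of size at least `n / 2`. Each vertex is labeled by the
vote of its neighbours outside its own class. -/
def IsAlmostExact {n r : ℕ} (a b : ℝ) (c : Fin n → Fin r) (G : SimpleGraph (Fin n))
    (σ : Fin n → ℤˣ) : Prop :=
  ∃ (τ : Fin n → ℤˣ) (ρ : (i : Fin r) → {v : Fin n // c v ≠ i} → ℤˣ),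
    IsSpectral a b G τ ∧
    (∀ i, IsSpectral a b (G.comap (Subtype.val : {v : Fin n // c v ≠ i} → Fin n)) (ρ i)) ∧
    ∀ v, IsVote a b
      (∑ w : {w : Fin n // c w ≠ c v},
        if G.Adj v w then
          ((if (n : ℝ) / 2 ≤
              ((symmDiff (Finset.univ.filter fun x => ∃ h : c x ≠ c v, ρ (c v) ⟨x, h⟩ = 1)
                (Finset.univ.filter fun x => τ x = 1)).card : ℝ)
            then - ρ (c v) w else ρ (c v) w : ℤˣ) : ℤ)
        else 0)
      (σ v)

open Classical in
/-- The number of neighbours of `v` in `U`. -/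
def nbrCount {n : ℕ} (G : SimpleGraph (Fin n)) (U : Finset (Fin n)) (v : Fin n) : ℕ :=
  (U.filter fun w => G.Adj v w).card

/-- One step of the Łuczak expansion: insert a vertex outside `U` with at least two neighbours
in `U`. -/
def LuczakStep {n : ℕ} (G : SimpleGraph (Fin n)) (U U' : Finset (Fin n)) : Prop :=
  ∃ v, v ∉ U ∧ 2 ≤ nbrCount G U v ∧ U' = insert v U

/-- The Łuczak expansion: iterate the step until no further one is possible. -/
def IsLuczak {n : ℕ} (G : SimpleGraph (Fin n)) (U W : Finset (Fin n)) : Prop :=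
  Relation.ReflTransGen (LuczakStep G) U W ∧ ∀ U', ¬ LuczakStep G W U'

open Classical in
/-- Labeling of the matched vertices. The labeling `σ` is constrained on `M` only. The graph `G₁` is
first labeled almost exactly by `σ₁`. The complement of `μ(M)` is expanded in `G₂` to `F'`, and `B`
is the complement of `μ⁻¹` of the complement of `F'`. Vertices outside `B` are labeled by the
votes of `σ₁` in the union graph induced outside `B`; then each matched vertex `i` in `B`
is labeled by the votes of `σ` of its neighbours outside `B` along edges of `G₁` not in `G₂`. -/
def IsCoreLabeling {n r : ℕ} (α β s : ℝ) (c : Fin n → Fin r) (G₁ G₂ : SimpleGraph (Fin n))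
    (m : Matching n) (σ : Fin n → ℤˣ) : Prop :=
  ∃ (σ₁ : Fin n → ℤˣ) (F' : Finset (Fin n)) (B : Set (Fin n)),
    IsAlmostExact (s * α) (s * β) c G₁ σ₁ ∧
    IsLuczak G₂ (m.M.image m.μ)ᶜ F' ∧
    B = {i | i ∈ m.M ∧ m.μ i ∉ F'}ᶜ ∧
    (∀ i, i ∉ B → IsVote α β (nbrSum (m.union G₁ G₂) Bᶜ σ₁ i) (σ i)) ∧
    (∀ i, i ∈ B → i ∈ m.M → IsVote α β (nbrSum (m.diff G₁ G₂) Bᶜ σ i) (σ i))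

/-- The possible outputs of the full recovery algorithm on `(G₁, G₂)`, when the random partition
used for the almost exact labeling is given by `c`: find a maximal `k`-core matching, label the
matched vertices, and label each unmatched vertex by the vote of its matched neighbours in `G₁`. -/
def recoveryOutputs {n r : ℕ} (α β s : ℝ) (k : ℕ) (c : Fin n → Fin r)
    (G₁ G₂ : SimpleGraph (Fin n)) : Set (Fin n → ℤˣ) :=
  {σ | ∃ m : Matching n, m.IsMaxKCore k G₁ G₂ ∧ IsCoreLabeling α β s c G₁ G₂ m σ ∧
    ∀ i, i ∉ m.M → IsVote α β (nbrSum G₁ (m.M : Set (Fin n)) σ i) (σ i)}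

/-- The condition on the parameter `ε`. -/
def EpsCondition (α β s ε : ℝ) : Prop :=
  1 + 2 * ε * |Real.log (α / β)| < (1 - (1 - s) ^ 2) * Dplus α β ∧
  0 < ε ∧ ε ≤ s * Dplus α β / (4 * |Real.log (α / β)|)

/-- The condition on the number `r` of classes of the random partition used for a single graph with
parameters `a`, `b`. -/
def ClassesCondition (a b ε : ℝ) (r : ℕ) : Prop :=
  1 < (Real.log (ε * r * (200 * max 1 (max a b))⁻¹) - 1) * ε / 2

/-- The joint law of the outcome of the model and of an independent random partition of `[n]` into
`r` classes, each vertex choosing its class uniformly and independently. -/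
def csbmWithPartition (n r : ℕ) [NeZero r] (p q s : unitInterval) : PMF (Outcome n × (Fin n → Fin r)) := do
  let ω ← csbm n p q s
  let c ← PMF.uniformOfFintype (Fin n → Fin r)
  return (ω, c)

end CorrSBM

end

/-! Write D for `Dplus α β`, T for `Tc α β`, H for the intersection graph and call the edges of the
first graph that are not in the second one exclusive. The outputs do not change when the second
graph is relabeled (`recoveryOutputs_map`), so the hidden permutation may be taken to be the
identity, and by `csbmWithPartition_le` it is enough to bound the failure probability for fixed,
nearly balanced labels and classes. The state of a pair is coded by three independent bits
(`edgeW`): membership in the second graph, retention in the first one given that, and membership in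
the first one otherwise. The last bit carries the exclusive edges and can be resampled without
touching the second graph or H.

Matching. If a 13-core matching moves d points, each has 13 incident edges of H. At most one of them
is mapped to itself, and keeping a third of the rest makes the pairs disjoint from their images,
which leaves weight 4d of independent coincidences (`exists_pairs_of_wrong`). Their probability,
about (d² log⁸n / n⁴)^d, beats the binom(n,d)·n^d possible maps (`eventually_matching`). Hence a
maximal matching is the identity on the 13-core of H.

Fringe. The expansion does not depend on the order of insertions (`isLuczak_iff`). It lies in the
expansion of the set of vertices with H-degree at most 13. That set has at most n^{1-s²T+δ}
vertices, and expansion at most triples it because small sets span few edges (`eventually_hull_le`).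
A vertex outside the fringe has at most one neighbour in it in the second graph, and boundedly many
along exclusive edges (`eventually_diff_fringe_le`). The fringe is a function of the first two bits,
so exclusive edges are independent of it (`Pr_mixY_le`). A given fringe vertex is misjudged by them
with probability about n^{-s(1-s)D}, and a union bound over the fringe alone succeeds by the second
threshold condition (`eventually_signed_diff`).

Preliminary labels. The centered adjacency matrix has operator norm o(log n): small sets are sparse
and the cut norm is small, which controls the discrepancy and then the quadratic form
(`eventually_quad`). So the spectral labels are wrong on a small set of vertices only, and this set
depends on the graph but not on the chosen eigenvector (`spectral_bad_set`). The edges at a class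
are independent of the graph outside the class, so no vertex has more than a bounded number of
wrongly labeled neighbours in any other class (`eventually_few_bad`), while neighbours in its own
class number at most (ε/2) log n (`eventually_ownClass_le`). The first condition gives every vertex
of the union graph a margin of order ε log n, which outweighs these errors (`eventually_signed`).

All these events are collected in `GoodOutcome`. On them each vote is forced to agree with the true
labels up to one global sign, whatever the arbitrary choices
(`GoodOutcome.eq_of_mem_recoveryOutputs`), and an output exists
(`GoodOutcome.recoveryOutputs_nonempty`). The deterministic estimator uses, for each n, a partition
that is at least as good as the random one (`exists_partition_ge`). -/

noncomputable section
namespace CorrSBM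

/-! ### Expectations under finite product weights. -/

section Product

variable {I X : Type*} [Fintype I] [DecidableEq I] [Fintype X]

/-- Expectation of `f` under the product of the weights `w i` on the finite set `X`. -/
def Ex (w : I → X → ℝ) (f : (I → X) → ℝ) : ℝ := ∑ ω : I → X, (∏ i, w i (ω i)) * f ω

/-- Each `w i` is a probability vector. -/
structure IsWeight (w : I → X → ℝ) : Prop where
  nonneg : ∀ i x, 0 ≤ w i x
  sum_one : ∀ i, ∑ x, w i x = 1

/-- Probability of `S` under the product of the weights `w i`. -/
def Pr (w : I → X → ℝ) (S : Set (I → X)) : ℝ := Ex w (S.indicator 1)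

theorem Ex_prod (w : I → X → ℝ) (f : I → X → ℝ) :
    Ex w (fun ω => ∏ i, f i (ω i)) = ∏ i, ∑ x, w i x * f i x := by
  simp only [Ex, ← Finset.prod_mul_distrib]
  rw [Finset.prod_univ_sum, Fintype.piFinset_univ]

/-- Independence of distinct coordinates: the coordinates that `ι` does not hit integrate to one. -/
theorem Ex_prod_injOn {w : I → X → ℝ} (hw : IsWeight w) {K : Type*} (T : Finset K) (ι : K → I)
    (hι : Set.InjOn ι T) (f : K → X → ℝ) :
    Ex w (fun ω => ∏ k ∈ T, f k (ω (ι k))) = ∏ k ∈ T, ∑ x, w (ι k) x * f k x := by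
  classical
  have h1 : ∀ ω : I → X, ∏ k ∈ T, f k (ω (ι k)) = ∏ i, ∏ k ∈ T with ι k = i, f k (ω i) := by
    intro ω
    rw [← Finset.prod_fiberwise T ι]
    refine Finset.prod_congr rfl fun i _ => Finset.prod_congr rfl fun k hk => ?_
    rw [(Finset.mem_filter.1 hk).2]
  simp_rw [h1]
  rw [Ex_prod w (fun i x => ∏ k ∈ T with ι k = i, f k x), ← Finset.prod_fiberwise T ι]
  refine Finset.prod_congr rfl fun i _ => ?_
  by_cases h : ∃ k ∈ T, ι k = i
  · obtain ⟨k, hk, rfl⟩ := h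
    have : {k' ∈ T | ι k' = ι k} = {k} := by
      ext k'
      simp only [Finset.mem_filter, Finset.mem_singleton]
      exact ⟨fun h => hι h.1 hk h.2, fun h => by subst h; exact ⟨hk, rfl⟩⟩
    simp [this]
  · have : {k' ∈ T | ι k' = i} = ∅ := by
      ext k'
      simp only [Finset.mem_filter, Finset.notMem_empty, iff_false]
      exact fun h' => h ⟨k', h'⟩
    simp [this, hw.sum_one]

variable {w : I → X → ℝ}

theorem Ex_mono (hw : IsWeight w) {f g : (I → X) → ℝ} (h : ∀ ω, f ω ≤ g ω) : Ex w f ≤ Ex w g :=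
  Finset.sum_le_sum fun ω _ =>
    mul_le_mul_of_nonneg_left (h ω) (Finset.prod_nonneg fun i _ => hw.nonneg i _)

theorem Ex_const (hw : IsWeight w) (c : ℝ) : Ex w (fun _ => c) = c := by
  have := Ex_prod w (fun _ _ => (1 : ℝ))
  simp only [Ex, Finset.prod_const_one, mul_one, hw.sum_one] at this
  rw [Ex, ← Finset.sum_mul, this, one_mul]

theorem Ex_sum {K : Type*} (T : Finset K) (f : K → (I → X) → ℝ) :
    Ex w (fun ω => ∑ k ∈ T, f k ω) = ∑ k ∈ T, Ex w (f k) := by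
  simp only [Ex, Finset.mul_sum]
  rw [Finset.sum_comm]

theorem Ex_const_mul (c : ℝ) (f : (I → X) → ℝ) : Ex w (fun ω => c * f ω) = c * Ex w f := by
  simp only [Ex, Finset.mul_sum]
  exact Finset.sum_congr rfl fun ω _ => by ring

theorem Pr_le_Ex (hw : IsWeight w) {S : Set (I → X)} {f : (I → X) → ℝ} (h0 : ∀ ω, 0 ≤ f ω)
    (h1 : ∀ ω ∈ S, 1 ≤ f ω) : Pr w S ≤ Ex w f := by
  refine Ex_mono hw fun ω => ?_
  by_cases h : ω ∈ S
  · simpa [h] using h1 ω h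
  · simpa [h] using h0 ω

theorem Pr_mono (hw : IsWeight w) {S T : Set (I → X)} (h : S ⊆ T) : Pr w S ≤ Pr w T :=
  Ex_mono hw fun _ => Set.indicator_le_indicator_of_subset h (fun _ => zero_le_one) _

theorem Pr_biUnion_le (hw : IsWeight w) {K : Type*} (T : Finset K) (S : K → Set (I → X))
    {A : Set (I → X)} (hA : ∀ ω ∈ A, ∃ k ∈ T, ω ∈ S k) : Pr w A ≤ ∑ k ∈ T, Pr w (S k) := by
  classical
  unfold Pr
  rw [← Ex_sum]
  refine Pr_le_Ex hw (fun ω => Finset.sum_nonneg fun k _ =>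
    Set.indicator_nonneg (fun _ _ => zero_le_one) ω) fun ω h => ?_
  obtain ⟨k, hk, hω⟩ := hA ω h
  have h2 : (S k).indicator (1 : (I → X) → ℝ) ω = 1 := by simp [hω]
  rw [← h2]
  exact Finset.single_le_sum (f := fun k => (S k).indicator (1 : (I → X) → ℝ) ω)
    (fun k _ => Set.indicator_nonneg (fun _ _ => zero_le_one) ω) hk

theorem Pr_union_le (hw : IsWeight w) (S T : Set (I → X)) : Pr w (S ∪ T) ≤ Pr w S + Pr w T := by
  have := Pr_biUnion_le hw (Finset.univ : Finset Bool) (fun b => if b then S else T)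
    (A := S ∪ T) (by
      rintro ω (h | h)
      · exact ⟨true, by simp, by simpa using h⟩
      · exact ⟨false, by simp, by simpa using h⟩)
  simpa using this

theorem Pr_le_one (hw : IsWeight w) (S : Set (I → X)) : Pr w S ≤ 1 := by
  rw [← Ex_const hw 1]
  exact Pr_le_Ex hw (fun _ => zero_le_one) fun _ _ => le_rfl

/-- Resampling: exchanging parts of each coordinate with an independent copy. -/
theorem Ex_mix (hw : IsWeight w) (m : I → X × X → X × X)
    (hm : ∀ i z, m i (m i z) = z) (hwm : ∀ i z, w i (m i z).1 * w i (m i z).2 = w i z.1 * w i z.2)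
    (f : (I → X) → ℝ) :
    Ex w f = Ex w (fun ω => Ex w (fun ω' => f (fun i => (m i (ω i, ω' i)).1))) := by
  have h1 : Ex w f = ∑ z : (I → X) × (I → X),
      (∏ i, w i (z.1 i)) * (∏ i, w i (z.2 i)) * f z.1 := by
    rw [Fintype.sum_prod_type]
    refine Finset.sum_congr rfl fun ω _ => ?_
    have := Ex_const hw (f ω)
    unfold Ex at this
    conv_lhs => rw [← this, Finset.mul_sum]
    exact Finset.sum_congr rfl fun ω' _ => by ring
  have h2 : Ex w (fun ω => Ex w (fun ω' => f (fun i => (m i (ω i, ω' i)).1))) =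
      ∑ z : (I → X) × (I → X), (∏ i, w i (z.1 i)) * (∏ i, w i (z.2 i)) *
        f (fun i => (m i (z.1 i, z.2 i)).1) := by
    rw [Fintype.sum_prod_type]
    refine Finset.sum_congr rfl fun ω _ => ?_
    simp only [Ex, Finset.mul_sum]
    exact Finset.sum_congr rfl fun ω' _ => by ring
  rw [h1, h2]
  -- On the doubled space `m` acts as an involution that preserves the product weight, so the sum
  -- can be reindexed along it.
  let e : (I → X) × (I → X) → (I → X) × (I → X) :=
    fun z => (fun i => (m i (z.1 i, z.2 i)).1, fun i => (m i (z.1 i, z.2 i)).2)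
  have he : Function.Involutive e := by
    intro z
    ext i
    · simp [e, hm]
    · simp [e, hm]
  symm
  refine Fintype.sum_bijective e he.bijective _ _ fun z => ?_
  simp only [e]
  rw [← Finset.prod_mul_distrib, ← Finset.prod_mul_distrib]
  congr 1
  exact Finset.prod_congr rfl fun i _ => (hwm i (z.1 i, z.2 i)).symm

/-- Chernoff-type bound: exponential moment of a weighted count of independent events. -/
theorem Ex_exp_sum_le (hw : IsWeight w) {K : Type*} (T : Finset K) (ι : K → I)
    (hι : Set.InjOn ι T) (b : K → X → Bool) (q θ : K → ℝ)
    (hq : ∀ k ∈ T, ∑ x, w (ι k) x * (if b k x then 1 else 0) = q k) :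
    Ex w (fun ω => Real.exp (∑ k ∈ T, if b k (ω (ι k)) then θ k else 0)) ≤
      Real.exp (∑ k ∈ T, q k * (Real.exp (θ k) - 1)) := by
  simp_rw [Real.exp_sum]
  rw [Ex_prod_injOn hw T ι hι (fun k x => Real.exp (if b k x then θ k else 0))]
  refine Finset.prod_le_prod
    (fun k _ => Finset.sum_nonneg fun x _ => mul_nonneg (hw.nonneg _ _) (Real.exp_pos _).le)
    fun k hk => ?_
  have : ∑ x, w (ι k) x * Real.exp (if b k x then θ k else 0) =
      q k * (Real.exp (θ k) - 1) + 1 := by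
    rw [← hq k hk, Finset.sum_mul]
    nth_rewrite 3 [← hw.sum_one (ι k)]
    rw [← Finset.sum_add_distrib]
    refine Finset.sum_congr rfl fun x _ => ?_
    by_cases h : b k x = true
    · simp only [h, if_true]
      ring
    · simp [h]
  rw [this]
  exact Real.add_one_le_exp _

end Product

end CorrSBM
end

noncomputable section
namespace CorrSBM

/-! ### The states of the pairs -/

/-- The state of a pair: membership in the second graph, retention in the first graph if it is in the
second one, and membership in the first graph if it is not in the second one. -/
abbrev St := Bool × Bool × Bool

def isG2 (x : St) : Bool := x.1
def isH (x : St) : Bool := x.1 && x.2.1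
def isD (x : St) : Bool := !x.1 && x.2.2
def isG1 (x : St) : Bool := (x.1 && x.2.1) || (!x.1 && x.2.2)
def isUn (x : St) : Bool := x.1 || x.2.2
-- Agrees with `isD` on pairs outside the second graph, but makes sense for every pair and is
-- independent of the first two bits. It is the part of the state that gets resampled.
def isY (x : St) : Bool := x.2.2

def bern (p : ℝ) (b : Bool) : ℝ := if b then p else 1 - p

/-- The law of the state of a pair which is a parent edge with probability `p`. -/
def edgeW (s p : ℝ) (x : St) : ℝ :=
  -- The last parameter is the conditional probability of being in the first graph given absence
  -- from the second one. Using it for all pairs makes the three bits independent.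
  bern (p * s) x.1 * bern s x.2.1 * bern (p * s * (1 - s) / (1 - p * s)) x.2.2

theorem bern_nonneg {p : ℝ} (h0 : 0 ≤ p) (h1 : p ≤ 1) (b : Bool) : 0 ≤ bern p b := by
  unfold bern; split_ifs <;> linarith

theorem edgeW_isWeight {I : Type*} [Fintype I] [DecidableEq I] {s : ℝ} (hs0 : 0 ≤ s) (hs1 : s ≤ 1)
    {P : I → ℝ} (hP0 : ∀ i, 0 ≤ P i) (hP1 : ∀ i, P i ≤ 1 / 2) :
    IsWeight (fun i => edgeW s (P i)) := by
  refine ⟨fun i x => ?_, fun i => ?_⟩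
  · have h1 : P i * s ≤ 1 / 2 := by nlinarith [hP0 i, hP1 i]
    have h0 : 0 ≤ P i * s := mul_nonneg (hP0 i) hs0
    refine mul_nonneg (mul_nonneg (bern_nonneg h0 (by linarith) _) (bern_nonneg hs0 hs1 _))
      (bern_nonneg ?_ ?_ _)
    · exact div_nonneg (mul_nonneg h0 (by linarith)) (by linarith)
    · rw [div_le_one (by linarith)]
      nlinarith
  · simp only [edgeW, bern, Fintype.sum_prod_type, Fintype.sum_bool, if_true, Bool.false_eq_true,
      if_false]
    ring

section EdgeProb
variable {s p : ℝ}

theorem edgeW_isG2 : ∑ x, edgeW s p x * (if isG2 x then 1 else 0) = p * s := by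
  simp [edgeW, bern, Fintype.sum_prod_type, isG2]
  ring

theorem edgeW_isH : ∑ x, edgeW s p x * (if isH x then 1 else 0) = p * s ^ 2 := by
  simp [edgeW, bern, Fintype.sum_prod_type, isH]
  ring

theorem edgeW_isY :
    ∑ x, edgeW s p x * (if isY x then 1 else 0) = p * s * (1 - s) / (1 - p * s) := by
  simp [edgeW, bern, Fintype.sum_prod_type, isY]
  ring

theorem edgeW_isG1 (h : p * s < 1) :
    ∑ x, edgeW s p x * (if isG1 x then 1 else 0) = p * s := by
  have : 1 - p * s ≠ 0 := by linarith
  simp [edgeW, bern, Fintype.sum_prod_type, isG1]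
  field_simp
  ring

theorem edgeW_isUn (h : p * s < 1) :
    ∑ x, edgeW s p x * (if isUn x then 1 else 0) = p * (1 - (1 - s) ^ 2) := by
  have : 1 - p * s ≠ 0 := by linarith
  simp [edgeW, bern, Fintype.sum_prod_type, isUn]
  field_simp
  ring

end EdgeProb

/-- The graph of the pairs whose state satisfies `b`. -/
def gr {n : ℕ} (b : St → Bool) (ω : Sym2 (Fin n) → St) : SimpleGraph (Fin n) where
  Adj i j := i ≠ j ∧ b (ω s(i, j)) = true
  symm := ⟨fun i j h => ⟨h.1.symm, by rw [Sym2.eq_swap]; exact h.2⟩⟩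
  loopless := ⟨fun _ h => h.1 rfl⟩

theorem gr_adj {n : ℕ} {b : St → Bool} {ω : Sym2 (Fin n) → St} {i j : Fin n} :
    (gr b ω).Adj i j ↔ i ≠ j ∧ b (ω s(i, j)) = true := Iff.rfl

/-! ### The law of the two graphs -/

open Classical in
-- Graphs on `[n]` are the subsets of the pairs, so this is the expansion of a product of sums.
theorem sum_graph_prod {n : ℕ} (F : Sym2 (Fin n) → Prop → ℝ) :
    ∑ G : SimpleGraph (Fin n), ∏ e ∈ pairs n, F e (e ∈ G.edgeSet) =
      ∏ e ∈ pairs n, (F e True + F e False) := by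
  rw [Finset.prod_add]
  refine Finset.sum_bij' (fun G _ => (pairs n).filter (fun e => e ∈ G.edgeSet))
    (fun t _ => SimpleGraph.fromEdgeSet (t : Set (Sym2 (Fin n)))) ?_ ?_ ?_ ?_ ?_
  · intro G _
    simp
  · intro t _
    simp
  · intro G _
    ext a b
    simp only [SimpleGraph.fromEdgeSet_adj, Finset.coe_filter, pairs]
    constructor
    · rintro ⟨h, _⟩
      simpa using h.2
    · intro h
      refine ⟨?_, h.ne⟩
      simpa [h.ne] using h
  · intro t ht
    ext e
    have ht' := Finset.mem_powerset.1 ht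
    simp only [Finset.mem_filter, SimpleGraph.edgeSet_fromEdgeSet]
    constructor
    · rintro ⟨_, h⟩
      exact_mod_cast h.1
    · intro h
      have h' := ht' h
      refine ⟨h', ?_⟩
      have h2 : ¬ e.IsDiag := by simpa [pairs] using h'
      exact ⟨by exact_mod_cast h, h2⟩
  · intro G _
    rw [← Finset.prod_filter_mul_prod_filter_not (pairs n) (fun e => e ∈ G.edgeSet),
      Finset.filter_not]
    congr 1
    · exact Finset.prod_congr rfl fun e he => by simp [(Finset.mem_filter.1 he).2]
    · refine Finset.prod_congr rfl fun e he => ?_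
      rw [Finset.mem_sdiff, Finset.mem_filter] at he
      have : e ∉ G.edgeSet := fun h => he.2 ⟨he.1, h⟩
      simp [this]

open Classical in
theorem gr_eq_iff {n : ℕ} {b : St → Bool} {ω : Sym2 (Fin n) → St} {G : SimpleGraph (Fin n)} :
    gr b ω = G ↔ ∀ e ∈ pairs n, (b (ω e) = true ↔ e ∈ G.edgeSet) := by
  constructor
  · rintro rfl e he
    induction e with
    | _ i j =>
      have : i ≠ j := by simpa [pairs] using he
      simp [gr_adj, this]
  · intro h
    ext i j
    by_cases hij : i = j
    · subst hij; simp
    · have := h s(i, j) (by simpa [pairs] using hij)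
      simp [gr_adj, hij, this]

open Classical in
/-- The law of the two subsamples of the parent graph is the image of the product law of states. -/
theorem sum_graphMass_eq_Ex {n : ℕ} (P : Sym2 (Fin n) → unitInterval) (s : unitInterval)
    (hP : ∀ e, (P e : ℝ) ≤ 1 / 2) (f : SimpleGraph (Fin n) → SimpleGraph (Fin n) → ℝ) :
    ∑ G : SimpleGraph (Fin n), graphMass P G *
      ∑ G₁ : SimpleGraph (Fin n), graphMass (fun e => if e ∈ G.edgeSet then s else 0) G₁ *
        ∑ G₂ : SimpleGraph (Fin n), graphMass (fun e => if e ∈ G.edgeSet then s else 0) G₂ *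
          f G₁ G₂ =
      Ex (fun e => edgeW s (P e)) (fun ω => f (gr isG1 ω) (gr isG2 ω)) := by
  have hw := edgeW_isWeight (I := Sym2 (Fin n)) s.2.1 s.2.2 (fun e => (P e).2.1) hP
  have h1 : Ex (fun e => edgeW s (P e)) (fun ω => f (gr isG1 ω) (gr isG2 ω)) =
      ∑ G₁ : SimpleGraph (Fin n), ∑ G₂ : SimpleGraph (Fin n), f G₁ G₂ *
        Ex (fun e => edgeW s (P e))
          (fun ω => ∏ e ∈ pairs n, if ((isG1 (ω e) = true ↔ e ∈ G₁.edgeSet) ∧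
            (isG2 (ω e) = true ↔ e ∈ G₂.edgeSet)) then 1 else 0) := by
    simp_rw [← Ex_const_mul, ← Ex_sum]
    congr 1
    ext ω
    rw [Finset.sum_eq_single (gr isG1 ω), Finset.sum_eq_single (gr isG2 ω)]
    · rw [Finset.prod_eq_one, mul_one]
      intro e he
      rw [if_pos ⟨gr_eq_iff.1 rfl e he, gr_eq_iff.1 rfl e he⟩]
    · intro G₂ _ h
      rw [Finset.prod_ite_zero, if_neg, mul_zero]
      exact fun h' => h (gr_eq_iff.2 fun e he => (h' e he).2).symm
    · simp
    · intro G₁ _ h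
      refine Finset.sum_eq_zero fun G₂ _ => ?_
      rw [Finset.prod_ite_zero, if_neg, mul_zero]
      exact fun h' => h (gr_eq_iff.2 fun e he => (h' e he).1).symm
    · simp
  rw [h1]
  simp_rw [Finset.mul_sum]
  rw [Finset.sum_comm]
  refine Finset.sum_congr rfl fun G₁ _ => ?_
  rw [Finset.sum_comm]
  refine Finset.sum_congr rfl fun G₂ _ => ?_
  rw [Ex_prod_injOn hw (pairs n) (fun e => e) (fun _ _ _ _ h => h)
    (fun e x => if ((isG1 x = true ↔ e ∈ G₁.edgeSet) ∧
            (isG2 x = true ↔ e ∈ G₂.edgeSet)) then 1 else 0)]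
  -- For fixed subsamples, the sum over parent graphs factorizes over pairs. What remains is an
  -- identity for a single pair, in four cases.
  obtain ⟨F, hF⟩ : ∃ F : Sym2 (Fin n) → Prop → ℝ, F = fun e q =>
        (if q then (P e : ℝ) else 1 - (P e : ℝ)) *
        (if e ∈ G₁.edgeSet then ((if q then s else 0 : unitInterval) : ℝ) else
          1 - ((if q then s else 0 : unitInterval) : ℝ)) *
        (if e ∈ G₂.edgeSet then ((if q then s else 0 : unitInterval) : ℝ) else
          1 - ((if q then s else 0 : unitInterval) : ℝ)) := ⟨_, rfl⟩
  have h2 : ∀ G : SimpleGraph (Fin n), graphMass P G *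
      (graphMass (fun e => if e ∈ G.edgeSet then s else 0) G₁ *
        (graphMass (fun e => if e ∈ G.edgeSet then s else 0) G₂ * f G₁ G₂)) =
      f G₁ G₂ * ∏ e ∈ pairs n, F e (e ∈ G.edgeSet) := by
    intro G
    have : ∏ e ∈ pairs n, F e (e ∈ G.edgeSet) = graphMass P G *
      graphMass (fun e => if e ∈ G.edgeSet then s else 0) G₁ *
        graphMass (fun e => if e ∈ G.edgeSet then s else 0) G₂ := by
      simp only [graphMass, ← Finset.prod_mul_distrib]
      refine Finset.prod_congr rfl fun e _ => ?_
      rw [hF]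
      by_cases h : e ∈ G.edgeSet <;> simp [h]
    rw [this]
    ring
  simp_rw [h2]
  rw [← Finset.mul_sum, sum_graph_prod, hF]
  congr 1
  refine Finset.prod_congr rfl fun e _ => ?_
  have hs1 := s.2.2
  have hs0 := s.2.1
  have h3 : 1 - (P e : ℝ) * s ≠ 0 := by nlinarith [hP e, (P e).2.1]
  by_cases he1 : e ∈ G₁.edgeSet <;> by_cases he2 : e ∈ G₂.edgeSet <;>
    simp [he1, he2, edgeW, bern, Fintype.sum_prod_type, isG1, isG2] <;> field_simp <;> ring

end CorrSBM
end

/-! ### Concentration of centered sums and typical labels and classes. -/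

noncomputable section
namespace CorrSBM

open Filter Topology

/-- By `exp x ≤ 1 + x + x²` for `|x| ≤ 1`, whose linear term vanishes in the mean. -/
theorem Ex_exp_centered_le {I X : Type*} [Fintype I] [DecidableEq I] [Fintype X]
    {w : I → X → ℝ} (hw : IsWeight w) {K : Type*} (T : Finset K) (ι : K → I)
    (hι : Set.InjOn ι T) (Y : K → X → ℝ) (v : K → ℝ) (t : ℝ) (ht : |t| ≤ 1)
    (hY : ∀ k ∈ T, ∀ x, |Y k x| ≤ 1) (hmean : ∀ k ∈ T, ∑ x, w (ι k) x * Y k x = 0)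
    (hvar : ∀ k ∈ T, ∑ x, w (ι k) x * Y k x ^ 2 ≤ v k) :
    Ex w (fun ω => Real.exp (t * ∑ k ∈ T, Y k (ω (ι k)))) ≤ Real.exp (t ^ 2 * ∑ k ∈ T, v k) := by
  simp_rw [Finset.mul_sum, Real.exp_sum]
  rw [Ex_prod_injOn hw T ι hι (fun k x => Real.exp (t * Y k x))]
  refine Finset.prod_le_prod
    (fun k _ => Finset.sum_nonneg fun x _ => mul_nonneg (hw.nonneg _ _) (Real.exp_pos _).le)
    fun k hk => ?_
  have h1 : ∀ x, Real.exp (t * Y k x) ≤ 1 + t * Y k x + t ^ 2 * Y k x ^ 2 := by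
    intro x
    have h := Real.abs_exp_sub_one_sub_id_le (x := t * Y k x) (by
      rw [abs_mul]
      exact mul_le_one₀ ht (abs_nonneg _) (hY k hk x))
    have := (abs_le.1 h).2
    nlinarith
  calc ∑ x, w (ι k) x * Real.exp (t * Y k x)
      ≤ ∑ x, (w (ι k) x + t * (w (ι k) x * Y k x) + t ^ 2 * (w (ι k) x * Y k x ^ 2)) :=
        Finset.sum_le_sum fun x _ => by
          have := mul_le_mul_of_nonneg_left (h1 x) (hw.nonneg (ι k) x)
          linarith
    _ = 1 + t ^ 2 * ∑ x, w (ι k) x * Y k x ^ 2 := by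
        rw [Finset.sum_add_distrib, Finset.sum_add_distrib, ← Finset.mul_sum, ← Finset.mul_sum,
          hmean k hk, hw.sum_one]
        ring
    _ ≤ t ^ 2 * v k + 1 := by
        have := mul_le_mul_of_nonneg_left (hvar k hk) (sq_nonneg t)
        linarith
    _ ≤ _ := Real.add_one_le_exp _

/-- Two-sided concentration for sums of independent centered variables. -/
theorem Pr_centered_le {I X : Type*} [Fintype I] [DecidableEq I] [Fintype X]
    {w : I → X → ℝ} (hw : IsWeight w) {K : Type*} (T : Finset K) (ι : K → I)
    (hι : Set.InjOn ι T) (Y : K → X → ℝ) (v : K → ℝ) (t a : ℝ) (ht : |t| ≤ 1) (ht0 : 0 ≤ t)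
    (hY : ∀ k ∈ T, ∀ x, |Y k x| ≤ 1) (hmean : ∀ k ∈ T, ∑ x, w (ι k) x * Y k x = 0)
    (hvar : ∀ k ∈ T, ∑ x, w (ι k) x * Y k x ^ 2 ≤ v k) :
    Pr w {ω | a < |∑ k ∈ T, Y k (ω (ι k))|} ≤ 2 * Real.exp (t ^ 2 * ∑ k ∈ T, v k - t * a) := by
  have key : ∀ u : ℝ, |u| ≤ 1 → u ^ 2 = t ^ 2 →
      Ex w (fun ω => Real.exp (- (t * a)) * Real.exp (u * ∑ k ∈ T, Y k (ω (ι k)))) ≤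
      Real.exp (t ^ 2 * ∑ k ∈ T, v k - t * a) := by
    intro u hu hut
    rw [Ex_const_mul]
    have := Ex_exp_centered_le hw T ι hι Y v u hu hY hmean hvar
    rw [hut] at this
    calc _ ≤ Real.exp (- (t * a)) * Real.exp (t ^ 2 * ∑ k ∈ T, v k) :=
          mul_le_mul_of_nonneg_left this (Real.exp_pos _).le
      _ = _ := by rw [← Real.exp_add]; ring_nf
  have h1 := Pr_biUnion_le hw (Finset.univ : Finset Bool)
    (fun b => {ω | t * a ≤ (if b then t else -t) * ∑ k ∈ T, Y k (ω (ι k))})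
    (A := {ω | a < |∑ k ∈ T, Y k (ω (ι k))|}) (by
      intro ω hω
      rcases lt_abs.1 (show a < |_| from hω) with h | h
      · exact ⟨true, by simp, by simpa using mul_le_mul_of_nonneg_left h.le ht0⟩
      · refine ⟨false, by simp, ?_⟩
        have := mul_le_mul_of_nonneg_left h.le ht0
        simpa using this)
  refine h1.trans ?_
  have h2 : ∀ b : Bool, Pr w {ω | t * a ≤ (if b then t else -t) * ∑ k ∈ T, Y k (ω (ι k))} ≤
      Real.exp (t ^ 2 * ∑ k ∈ T, v k - t * a) := by
    intro b
    refine (Pr_le_Ex hw (fun ω => (mul_pos (Real.exp_pos _) (Real.exp_pos _)).le) ?_).trans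
      (key (if b then t else -t) (by split_ifs <;> simpa using ht) (by split_ifs <;> simp))
    intro ω hω
    rw [← Real.exp_add, Real.one_le_exp_iff]
    have : t * a ≤ (if b then t else -t) * ∑ k ∈ T, Y k (ω (ι k)) := hω
    linarith
  calc _ ≤ ∑ b : Bool, Real.exp (t ^ 2 * ∑ k ∈ T, v k - t * a) :=
        Finset.sum_le_sum fun b _ => h2 b
    _ = _ := by simp

open Classical in
/-- The labeling and each class of the partition are nearly balanced, and the classes have nearly
equal sizes. -/
structure GoodPart {n r : ℕ} (δ : ℝ) (σ : Fin n → ℤˣ) (c : Fin n → Fin r) : Prop where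
  bal : |∑ v, ((σ v : ℤ) : ℝ)| ≤ δ * n
  balClass : ∀ i, |∑ v with c v = i, ((σ v : ℤ) : ℝ)| ≤ δ * n
  card : ∀ i, |((Finset.univ.filter fun v => c v = i).card : ℝ) - n / r| ≤ δ * n

theorem abs_units_cast (u : ℤˣ) : |((u : ℤ) : ℝ)| = 1 := by
  rcases Int.units_eq_one_or u with rfl | rfl <;> simp

/-- The centered variables whose sums are controlled by `GoodPart`. -/
def balanceVar {r : ℕ} : Option (Fin r × Bool) → ℤˣ × Fin r → ℝ
  | none, x => ((x.1 : ℤ) : ℝ)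
  | some (i, true), x => if x.2 = i then ((x.1 : ℤ) : ℝ) else 0
  | some (i, false), x => (if x.2 = i then (1 : ℝ) else 0) - (r : ℝ)⁻¹

theorem abs_balanceVar_le {r : ℕ} [NeZero r] (o : Option (Fin r × Bool)) (x : ℤˣ × Fin r) :
    |balanceVar o x| ≤ 1 := by
  have hr1 : (1 : ℝ) ≤ r := by exact_mod_cast Nat.one_le_iff_ne_zero.2 (NeZero.ne r)
  have hr2 : (r : ℝ)⁻¹ ≤ 1 := inv_le_one_of_one_le₀ hr1
  have hr3 : 0 < (r : ℝ)⁻¹ := by positivity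
  rcases o with _ | ⟨i, _ | _⟩
  · exact (abs_units_cast _).le
  · simp only [balanceVar]
    rw [abs_le]
    split_ifs <;> constructor <;> linarith
  · simp only [balanceVar]
    split_ifs
    · exact (abs_units_cast _).le
    · simp

theorem sum_balanceVar {r : ℕ} [NeZero r] (o : Option (Fin r × Bool)) :
    ∑ x, balanceVar o x = 0 := by
  rw [Fintype.sum_prod_type]
  rcases o with _ | ⟨i, _ | _⟩ <;> simp [balanceVar, Finset.sum_sub_distrib]

open Classical in
-- The pairs (label, class) are i.i.d. uniform, and balance amounts to `2 r + 1` centered sums being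
-- small. With exponential parameter `t = min 1 (δ/2)` the variance term `t² n` is at most half of
-- `t δ n`, so each sum fails with exponentially small probability.
theorem sum_not_goodPart_tendsto (r : ℕ) [NeZero r] (δ : ℝ) (hδ : 0 < δ) :
    ∀ η > 0, ∀ᶠ n : ℕ in atTop,
      ∑ σ : Fin n → ℤˣ, ((Fintype.card (Fin n → ℤˣ) : ℝ))⁻¹ *
        ∑ c : Fin n → Fin r, ((Fintype.card (Fin n → Fin r) : ℝ))⁻¹ *
          (if GoodPart δ σ c then 0 else 1) ≤ η := by
  intro η hη
  have hr : (0 : ℝ) < r := by exact_mod_cast Nat.pos_of_neZero r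
  have hlim : Tendsto (fun n : ℕ => (2 * r + 1 : ℝ) * (2 * Real.exp (-(min 1 (δ / 2) * (δ / 2)) * n)))
      atTop (𝓝 0) := by
    have h : 0 < min 1 (δ / 2) * (δ / 2) := by positivity
    have h1 : Tendsto (fun n : ℕ => -(min 1 (δ / 2) * (δ / 2)) * (n : ℝ)) atTop atBot :=
      tendsto_natCast_atTop_atTop.const_mul_atTop_of_neg (by linarith)
    simpa using ((Real.tendsto_exp_atBot.comp h1).const_mul 2).const_mul (2 * r + 1 : ℝ)
  filter_upwards [hlim.eventually_le_const hη] with n hn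
  let w : Fin n → ℤˣ × Fin r → ℝ := fun _ _ => (2 : ℝ)⁻¹ * (r : ℝ)⁻¹
  have hw : IsWeight w := by
    refine ⟨fun _ _ => by positivity, fun _ => ?_⟩
    simp only [w, Finset.sum_const, Finset.card_univ, Fintype.card_prod, Fintype.card_units_int,
      Fintype.card_fin, nsmul_eq_mul]
    push_cast
    field_simp
  have h1 : ∑ σ : Fin n → ℤˣ, ((Fintype.card (Fin n → ℤˣ) : ℝ))⁻¹ *
        ∑ c : Fin n → Fin r, ((Fintype.card (Fin n → Fin r) : ℝ))⁻¹ *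
          (if GoodPart δ σ c then 0 else 1) =
      Pr w {ω | ¬ GoodPart δ (fun v => (ω v).1) (fun v => (ω v).2)} := by
    simp_rw [Finset.mul_sum]
    rw [← Fintype.sum_prod_type', Pr, Ex]
    refine Fintype.sum_equiv (Equiv.arrowProdEquivProdArrow _ _ _).symm _ _ fun z => ?_
    have : (Equiv.arrowProdEquivProdArrow (Fin n) (fun _ => ℤˣ) (fun _ => Fin r)).symm z =
      fun v => (z.1 v, z.2 v) := rfl
    rw [this]
    by_cases h : GoodPart δ z.1 z.2
    · simp [h]
    · simp [h, w, mul_pow]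
  have hconc : ∀ Y : ℤˣ × Fin r → ℝ, (∀ x, |Y x| ≤ 1) → ∑ x, Y x = 0 →
      Pr w {ω | δ * n < |∑ v, Y (ω v)|} ≤ 2 * Real.exp (-(min 1 (δ / 2) * (δ / 2)) * n) := by
    intro Y hY hY0
    have ht0 : 0 ≤ min 1 (δ / 2) := by positivity
    have := Pr_centered_le hw Finset.univ (fun v => v) (fun _ _ _ _ h => h) (fun _ => Y)
      (fun _ => 1) (min 1 (δ / 2)) (δ * n) (by rw [abs_of_nonneg ht0]; exact min_le_left _ _) ht0
      (fun _ _ => hY) (fun _ _ => by rw [← Finset.mul_sum, hY0, mul_zero]) (fun v _ => by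
        rw [← hw.sum_one v]
        refine Finset.sum_le_sum fun x _ => ?_
        have h2 : Y x ^ 2 ≤ 1 := by
          rw [sq_le_one_iff_abs_le_one]; exact hY x
        simpa using mul_le_of_le_one_right (hw.nonneg v x) h2)
    refine this.trans ?_
    gcongr
    simp only [Finset.sum_const, Finset.card_univ, Fintype.card_fin, nsmul_eq_mul, mul_one]
    have h3 : min 1 (δ / 2) ^ 2 ≤ min 1 (δ / 2) * (δ / 2) := by
      rw [sq]; exact mul_le_mul_of_nonneg_left (min_le_right _ _) ht0
    have h4 : (0 : ℝ) ≤ n := by positivity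
    nlinarith [mul_le_mul_of_nonneg_right h3 h4]
  rw [h1]
  refine (Pr_biUnion_le hw (Finset.univ : Finset (Option (Fin r × Bool)))
    (fun o => {ω | δ * n < |∑ v, balanceVar o (ω v)|}) ?_).trans
    ((Finset.sum_le_sum (g := fun _ => 2 * Real.exp (-(min 1 (δ / 2) * (δ / 2)) * n))
      fun o _ => hconc _ (abs_balanceVar_le o) (sum_balanceVar o)).trans ?_)
  · intro ω hω
    by_contra hcon
    push Not at hcon
    have hcon' : ∀ o, |∑ v, balanceVar o (ω v)| ≤ δ * n := fun o =>
      not_lt.1 (hcon o (Finset.mem_univ o))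
    refine hω ⟨hcon' none, fun i => ?_, fun i => ?_⟩
    · rw [Finset.sum_filter]
      exact hcon' (some (i, true))
    · have := hcon' (some (i, false))
      simpa [balanceVar, Finset.sum_sub_distrib, div_eq_mul_inv] using this
  · simp only [Finset.sum_const, Finset.card_univ, Fintype.card_option, Fintype.card_prod,
      Fintype.card_fin, Fintype.card_bool, nsmul_eq_mul]
    push_cast
    refine le_trans (le_of_eq ?_) hn
    ring

/-! ### The probability of a set of outcomes -/

theorem toOuterMeasure_bind_ofReal {A B : Type*} [Fintype A] (p : PMF A) (f : A → PMF B)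
    (T : Set B) (m g : A → ℝ) (hm0 : ∀ a, 0 ≤ m a) (hg0 : ∀ a, 0 ≤ g a)
    (hm : ∀ a, p a = ENNReal.ofReal (m a))
    (hg : ∀ a, (f a).toOuterMeasure T = ENNReal.ofReal (g a)) :
    (p.bind f).toOuterMeasure T = ENNReal.ofReal (∑ a, m a * g a) := by
  rw [PMF.toOuterMeasure_bind_apply, tsum_fintype,
    ENNReal.ofReal_sum_of_nonneg fun a _ => mul_nonneg (hm0 a) (hg0 a)]
  exact Finset.sum_congr rfl fun a _ => by rw [hm, hg, ENNReal.ofReal_mul (hm0 a)]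

theorem uniformOfFintype_ofReal (A : Type*) [Fintype A] [Nonempty A] (a : A) :
    PMF.uniformOfFintype A a = ENNReal.ofReal ((Fintype.card A : ℝ)⁻¹) := by
  rw [PMF.uniformOfFintype_apply, ENNReal.ofReal_inv_of_pos (by exact_mod_cast Fintype.card_pos),
    ENNReal.ofReal_natCast]

open Classical in
theorem csbmWithPartition_toOuterMeasure (n r : ℕ) [NeZero r] (p q s : unitInterval)
    (hp : (p : ℝ) ≤ 1 / 2) (hq : (q : ℝ) ≤ 1 / 2) (T : Set (Outcome n × (Fin n → Fin r))) :
    (csbmWithPartition n r p q s).toOuterMeasure T = ENNReal.ofReal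
      (∑ σ : Fin n → ℤˣ, ((Fintype.card (Fin n → ℤˣ) : ℝ))⁻¹ *
        Ex (fun e => edgeW s (sbmWeight p q σ e)) (fun ω =>
          ∑ π : Equiv.Perm (Fin n), ((Fintype.card (Equiv.Perm (Fin n)) : ℝ))⁻¹ *
            ∑ c : Fin n → Fin r, ((Fintype.card (Fin n → Fin r) : ℝ))⁻¹ *
              (if ((⟨σ, gr isG1 ω, (gr isG2 ω).map π⟩ : Outcome n), c) ∈ T then 1 else 0))) := by
  have hcs : csbmWithPartition n r p q s =
    (PMF.uniformOfFintype (Fin n → ℤˣ)).bind fun σ =>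
      (randomGraph (sbmWeight p q σ)).bind fun G =>
        (subsample s G).bind fun G₁ => (subsample s G).bind fun G₂ =>
          (PMF.uniformOfFintype (Equiv.Perm (Fin n))).bind fun π =>
            (PMF.uniformOfFintype (Fin n → Fin r)).bind fun c =>
              PMF.pure ((⟨σ, G₁, G₂.map π⟩ : Outcome n), c) := by
    change (PMF.bind (PMF.bind _ fun σ => PMF.bind _ fun G => PMF.bind _ fun G₁ => PMF.bind _ fun G₂ =>
      PMF.bind _ fun π => PMF.pure _) fun ω => PMF.bind _ fun c => PMF.pure _) = _
    simp only [PMF.bind_bind, PMF.pure_bind]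
  rw [hcs]
  simp_rw [← fun σ => sum_graphMass_eq_Ex (sbmWeight p q σ) s
    (fun e => by unfold sbmWeight; split_ifs <;> assumption)
    (fun G₁ G₂ => ∑ π : Equiv.Perm (Fin n), ((Fintype.card (Equiv.Perm (Fin n)) : ℝ))⁻¹ *
            ∑ c : Fin n → Fin r, ((Fintype.card (Fin n → Fin r) : ℝ))⁻¹ *
              (if ((⟨σ, G₁, G₂.map π⟩ : Outcome n), c) ∈ T then 1 else 0))]
  have hc0 : ∀ σ G₁ (G₂ : SimpleGraph (Fin n)) (π : Equiv.Perm (Fin n)),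
      0 ≤ ∑ c : Fin n → Fin r, ((Fintype.card (Fin n → Fin r) : ℝ))⁻¹ *
              (if ((⟨σ, G₁, G₂.map π⟩ : Outcome n), c) ∈ T then (1 : ℝ) else 0) :=
    fun σ G₁ G₂ π => Finset.sum_nonneg fun c _ => by positivity
  have hπ0 : ∀ σ G₁ (G₂ : SimpleGraph (Fin n)),
      0 ≤ ∑ π : Equiv.Perm (Fin n), ((Fintype.card (Equiv.Perm (Fin n)) : ℝ))⁻¹ *
      ∑ c : Fin n → Fin r, ((Fintype.card (Fin n → Fin r) : ℝ))⁻¹ *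
              (if ((⟨σ, G₁, G₂.map π⟩ : Outcome n), c) ∈ T then (1 : ℝ) else 0) :=
    fun σ G₁ G₂ => Finset.sum_nonneg fun π _ => mul_nonneg (by positivity) (hc0 _ _ _ _)
  refine toOuterMeasure_bind_ofReal _ _ _ _ _ (fun _ => by positivity) (fun σ => ?_)
    (fun σ => uniformOfFintype_ofReal _ _) fun σ => ?_
  · exact Finset.sum_nonneg fun G _ => mul_nonneg (graphMass_nonneg _ _) <|
      Finset.sum_nonneg fun G₁ _ => mul_nonneg (graphMass_nonneg _ _) <|
      Finset.sum_nonneg fun G₂ _ => mul_nonneg (graphMass_nonneg _ _) <| hπ0 _ _ _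
  refine toOuterMeasure_bind_ofReal _ _ _ _ _ (fun _ => graphMass_nonneg _ _) (fun G => ?_)
    (fun G => rfl) fun G => ?_
  · exact Finset.sum_nonneg fun G₁ _ => mul_nonneg (graphMass_nonneg _ _) <|
      Finset.sum_nonneg fun G₂ _ => mul_nonneg (graphMass_nonneg _ _) <| hπ0 _ _ _
  refine toOuterMeasure_bind_ofReal _ _ _ _ _ (fun _ => graphMass_nonneg _ _) (fun G₁ => ?_)
    (fun G₁ => rfl) fun G₁ => ?_
  · exact Finset.sum_nonneg fun G₂ _ => mul_nonneg (graphMass_nonneg _ _) <| hπ0 _ _ _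
  refine toOuterMeasure_bind_ofReal _ _ _ _ _ (fun _ => graphMass_nonneg _ _) (fun G₂ => hπ0 _ _ _)
    (fun G₂ => rfl) fun G₂ => ?_
  refine toOuterMeasure_bind_ofReal _ _ _ _ _ (fun _ => by positivity) (fun π => hc0 _ _ _ _)
    (fun π => uniformOfFintype_ofReal _ _) fun π => ?_
  refine toOuterMeasure_bind_ofReal _ _ _ _ _ (fun _ => by positivity) (fun c => by positivity)
    (fun c => uniformOfFintype_ofReal _ _) fun c => ?_
  rw [PMF.toOuterMeasure_pure_apply]
  split_ifs <;> simp

/-- It suffices to bound the failure probability conditionally on good labels and classes. -/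
theorem csbmWithPartition_le (n r : ℕ) [NeZero r] (p q s : unitInterval)
    (hp : (p : ℝ) ≤ 1 / 2) (hq : (q : ℝ) ≤ 1 / 2) (T : Set (Outcome n × (Fin n → Fin r)))
    (good : (Fin n → ℤˣ) → (Fin n → Fin r) → Prop) [∀ σ c, Decidable (good σ c)]
    (η₁ η₂ : ℝ) (hη : 0 ≤ η₁)
    (h1 : ∀ σ c (π : Equiv.Perm (Fin n)), good σ c →
      Pr (fun e => edgeW s (sbmWeight p q σ e))
        {ω | ((⟨σ, gr isG1 ω, (gr isG2 ω).map π⟩ : Outcome n), c) ∈ T} ≤ η₁)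
    (h2 : ∑ σ : Fin n → ℤˣ, ((Fintype.card (Fin n → ℤˣ) : ℝ))⁻¹ *
        ∑ c : Fin n → Fin r, ((Fintype.card (Fin n → Fin r) : ℝ))⁻¹ *
          (if good σ c then 0 else 1) ≤ η₂) :
    (csbmWithPartition n r p q s).toOuterMeasure T ≤ ENNReal.ofReal (η₁ + η₂) := by
  classical
  rw [csbmWithPartition_toOuterMeasure n r p q s hp hq T]
  refine ENNReal.ofReal_le_ofReal ?_
  have hsum : ∀ (A : Type) [Fintype A] [Nonempty A] (x : ℝ),
      ∑ _a : A, ((Fintype.card A : ℝ))⁻¹ * x = x := by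
    intro A _ _ x
    have : (Fintype.card A : ℝ) ≠ 0 := by exact_mod_cast Fintype.card_ne_zero
    simp [this]
  have hkey : ∀ σ : Fin n → ℤˣ,
      Ex (fun e => edgeW s (sbmWeight p q σ e)) (fun ω =>
          ∑ π : Equiv.Perm (Fin n), ((Fintype.card (Equiv.Perm (Fin n)) : ℝ))⁻¹ *
            ∑ c : Fin n → Fin r, ((Fintype.card (Fin n → Fin r) : ℝ))⁻¹ *
              (if ((⟨σ, gr isG1 ω, (gr isG2 ω).map π⟩ : Outcome n), c) ∈ T then 1 else 0)) ≤
      η₁ + ∑ c : Fin n → Fin r, ((Fintype.card (Fin n → Fin r) : ℝ))⁻¹ *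
          (if good σ c then 0 else 1) := by
    intro σ
    have hw := edgeW_isWeight (I := Sym2 (Fin n)) s.2.1 s.2.2
      (P := fun e => (sbmWeight p q σ e : ℝ)) (fun e => (sbmWeight p q σ e).2.1)
      (fun e => by unfold sbmWeight; split_ifs <;> assumption)
    rw [Ex_sum]
    simp_rw [Ex_const_mul, Ex_sum, Ex_const_mul]
    rw [← hsum (Equiv.Perm (Fin n)) (η₁ + _)]
    refine Finset.sum_le_sum fun π _ => mul_le_mul_of_nonneg_left ?_ (by positivity)
    conv_rhs => rw [← hsum (Fin n → Fin r) η₁, ← Finset.sum_add_distrib]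
    refine Finset.sum_le_sum fun c _ => ?_
    rw [← mul_add]
    refine mul_le_mul_of_nonneg_left ?_ (by positivity)
    have heq : Ex (fun e => edgeW s (sbmWeight p q σ e)) (fun ω =>
        if ((⟨σ, gr isG1 ω, (gr isG2 ω).map π⟩ : Outcome n), c) ∈ T then 1 else 0) =
      Pr (fun e => edgeW s (sbmWeight p q σ e))
        {ω | ((⟨σ, gr isG1 ω, (gr isG2 ω).map π⟩ : Outcome n), c) ∈ T} := by
      unfold Pr
      congr 1
    rw [heq]
    by_cases hg : good σ c
    · simpa [hg] using h1 σ c π hg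
    · have := Pr_le_one hw {ω | ((⟨σ, gr isG1 ω, (gr isG2 ω).map π⟩ : Outcome n), c) ∈ T}
      simp only [hg, if_false]
      linarith
  calc _ ≤ ∑ σ : Fin n → ℤˣ, ((Fintype.card (Fin n → ℤˣ) : ℝ))⁻¹ *
        (η₁ + ∑ c : Fin n → Fin r, ((Fintype.card (Fin n → Fin r) : ℝ))⁻¹ *
          (if good σ c then 0 else 1)) :=
        Finset.sum_le_sum fun σ _ => mul_le_mul_of_nonneg_left (hkey σ) (by positivity)
    _ ≤ η₁ + η₂ := by
        simp_rw [mul_add]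
        rw [Finset.sum_add_distrib, hsum]
        linarith

theorem tendsto_one_of_compl {Ω : ℕ → Type} (p : (n : ℕ) → PMF (Ω n)) (S : (n : ℕ) → Set (Ω n))
    (h : ∀ η > 0, ∀ᶠ n in atTop, (p n).toOuterMeasure (S n)ᶜ ≤ ENNReal.ofReal η) :
    Tendsto (fun n => (p n).toOuterMeasure (S n)) atTop (𝓝 1) := by
  have h0 : Tendsto (fun n => (p n).toOuterMeasure (S n)ᶜ) atTop (𝓝 0) := by
    rw [ENNReal.tendsto_nhds_zero]
    intro ε hε
    by_cases htop : ε = ⊤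
    · simp [htop]
    · filter_upwards [h ε.toReal (ENNReal.toReal_pos hε.ne' htop)] with n hn
      rwa [ENNReal.ofReal_toReal htop] at hn
  have h1 : Tendsto (fun n => 1 - (p n).toOuterMeasure (S n)ᶜ) atTop (𝓝 (1 - 0)) :=
    ENNReal.Tendsto.sub tendsto_const_nhds h0 (Or.inl ENNReal.one_ne_top)
  rw [tsub_zero] at h1
  have huniv : ∀ n, (p n).toOuterMeasure Set.univ = 1 := fun n =>
    (PMF.toOuterMeasure_apply_eq_one_iff _ _).2 (Set.subset_univ _)
  refine tendsto_of_tendsto_of_tendsto_of_le_of_le h1 tendsto_const_nhds (fun n => ?_) (fun n => ?_)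
  · rw [tsub_le_iff_right, ← huniv n, ← Set.union_compl_self (S n)]
    exact MeasureTheory.measure_union_le _ _
  · rw [← huniv n]
    exact MeasureTheory.measure_mono (Set.subset_univ _)

end CorrSBM
end

/-! ### Perturbation theory for the spectral method. -/

noncomputable section
namespace CorrSBM

open Matrix

section Spectral

variable {V : Type} [Fintype V]

/-- The Euclidean norm. -/
def nrm (x : V → ℝ) : ℝ := ‖(WithLp.toLp 2 x : EuclideanSpace ℝ V)‖

theorem nrm_nonneg (x : V → ℝ) : 0 ≤ nrm x := norm_nonneg _

theorem inner_toLp (x y : V → ℝ) :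
    inner ℝ (WithLp.toLp 2 x : EuclideanSpace ℝ V) (WithLp.toLp 2 y) = x ⬝ᵥ y := by
  rw [EuclideanSpace.inner_toLp_toLp, dotProduct_comm]
  simp

theorem nrm_sq (x : V → ℝ) : nrm x ^ 2 = x ⬝ᵥ x := by
  rw [nrm, ← inner_toLp, real_inner_self_eq_norm_sq]

theorem nrm_smul (c : ℝ) (x : V → ℝ) : nrm (c • x) = |c| * nrm x := by
  rw [nrm, WithLp.toLp_smul, norm_smul, Real.norm_eq_abs, nrm]

theorem nrm_add_le (x y : V → ℝ) : nrm (x + y) ≤ nrm x + nrm y := by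
  rw [nrm, WithLp.toLp_add]
  exact norm_add_le _ _

theorem nrm_sub_ge (x y : V → ℝ) : nrm x - nrm y ≤ nrm (x - y) := by
  rw [nrm, nrm, nrm, WithLp.toLp_sub]
  exact norm_sub_norm_le _ _

theorem abs_dotProduct_le (x y : V → ℝ) : |x ⬝ᵥ y| ≤ nrm x * nrm y := by
  rw [← inner_toLp]
  exact abs_real_inner_le_norm _ _

theorem nrm_pos {x : V → ℝ} (hx : x ≠ 0) : 0 < nrm x := by
  refine norm_pos_iff.2 fun h => hx ?_
  simpa using h

/-- The operator norm of a symmetric matrix is controlled by its quadratic form. -/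
theorem nrm_mulVec_le {X : Matrix V V ℝ} (hX : Xᵀ = X) {K : ℝ} (hK : 0 < K)
    (h : ∀ x, |x ⬝ᵥ X *ᵥ x| ≤ K * (x ⬝ᵥ x)) (u : V → ℝ) : nrm (X *ᵥ u) ≤ K * nrm u := by
  have hsymm : ∀ x y : V → ℝ, x ⬝ᵥ X *ᵥ y = y ⬝ᵥ X *ᵥ x := by
    intro x y
    rw [dotProduct_mulVec, ← mulVec_transpose, hX, dotProduct_comm]
  have hbil : ∀ y : V → ℝ, 2 * (y ⬝ᵥ X *ᵥ u) ≤ K * (y ⬝ᵥ y + u ⬝ᵥ u) := by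
    intro y
    have h1 := (abs_le.1 (h (y + u))).2
    have h2 := (abs_le.1 (h (y - u))).1
    simp only [mulVec_add, mulVec_sub, add_dotProduct, sub_dotProduct, dotProduct_add,
      dotProduct_sub] at h1 h2
    have := hsymm u y
    have := dotProduct_comm u y
    nlinarith
  -- The polarized bound, tested on the multiple of `X u` by `1/K`, becomes `‖X u‖² ≤ K² ‖u‖²`.
  have h1 := hbil (K⁻¹ • (X *ᵥ u))
  simp only [smul_dotProduct, dotProduct_smul, smul_eq_mul, ← nrm_sq] at h1
  have h2 : nrm (X *ᵥ u) ^ 2 ≤ (K * nrm u) ^ 2 := by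
    have h3 : K * (K⁻¹ * (K⁻¹ * nrm (X *ᵥ u) ^ 2) + nrm u ^ 2) =
        K⁻¹ * nrm (X *ᵥ u) ^ 2 + K * nrm u ^ 2 := by field_simp
    rw [h3] at h1
    have h4 : K⁻¹ * nrm (X *ᵥ u) ^ 2 ≤ K * nrm u ^ 2 := by linarith
    rw [inv_mul_le_iff₀ hK] at h4
    linarith [h4, mul_pow K (nrm u) 2]
  exact (abs_le.1 (abs_le_of_sq_le_sq h2 (by have := nrm_nonneg u; positivity))).2

/-- An orthonormal eigenbasis of the adjacency matrix. -/
theorem exists_eigenbasis (G : SimpleGraph V) : ∃ f : Fin (Fintype.card V) → V → ℝ,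
    (∀ i j, f i ⬝ᵥ f j = if i = j then 1 else 0) ∧
    (∀ i, adj G *ᵥ f i = adjEig G i • f i) ∧
    (∀ x, x ⬝ᵥ x = ∑ i, (f i ⬝ᵥ x) ^ 2) ∧
    (∀ x, x ⬝ᵥ adj G *ᵥ x = ∑ i, adjEig G i * (f i ⬝ᵥ x) ^ 2) := by
  classical
  let hA := adj_isHermitian G
  let e : Fin (Fintype.card V) ≃ V := Fintype.equivOfCardEq (Fintype.card_fin _)
  let B := hA.eigenvectorBasis.reindex e.symm
  let f : Fin (Fintype.card V) → V → ℝ := fun i => (B i).ofLp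
  have hf : ∀ i, (WithLp.toLp 2 (f i) : EuclideanSpace ℝ V) = B i := fun i => rfl
  have heig : ∀ i, adj G *ᵥ f i = adjEig G i • f i := by
    intro i
    have := hA.mulVec_eigenvectorBasis (e i)
    have h2 : hA.eigenvalues (e i) = adjEig G i := by
      simp only [Matrix.IsHermitian.eigenvalues, adjEig]
      congr 1
      exact e.symm_apply_apply i
    rw [h2] at this
    simpa [f, B] using this
  have hsymm : ∀ x y : V → ℝ, x ⬝ᵥ adj G *ᵥ y = adj G *ᵥ x ⬝ᵥ y := by
    intro x y
    have h : (adj G)ᵀ = adj G := by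
      have := hA.eq
      rwa [conjTranspose_eq_transpose_of_trivial] at this
    rw [dotProduct_mulVec, ← mulVec_transpose, h]
  have hpars : ∀ x y : V → ℝ, x ⬝ᵥ y = ∑ i, (f i ⬝ᵥ x) * (f i ⬝ᵥ y) := by
    intro x y
    rw [← inner_toLp x y, ← B.sum_inner_mul_inner]
    refine Finset.sum_congr rfl fun i _ => ?_
    rw [← hf, inner_toLp, inner_toLp, dotProduct_comm x]
  refine ⟨f, fun i j => ?_, heig, fun x => ?_, fun x => ?_⟩
  · rw [← inner_toLp, hf, hf]
    exact orthonormal_iff_ite.1 B.orthonormal i j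
  · rw [hpars]
    exact Finset.sum_congr rfl fun i _ => (sq _).symm
  · rw [hpars]
    refine Finset.sum_congr rfl fun i _ => ?_
    rw [hsymm, heig, smul_dotProduct, smul_eq_mul]
    ring

theorem adjEig_antitone (G : SimpleGraph V) : Antitone (adjEig G) := by
  classical
  exact (adj_isHermitian G).eigenvalues₀_antitone

theorem exists_eigenvector (G : SimpleGraph V) (i : Fin (Fintype.card V)) :
    ∃ u : V → ℝ, u ≠ 0 ∧ adj G *ᵥ u = adjEig G i • u := by
  obtain ⟨f, h1, h2, -, -⟩ := exists_eigenbasis G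
  refine ⟨f i, fun h => ?_, h2 i⟩
  have := h1 i i
  simp [h] at this

theorem adjEig_last_le (G : SimpleGraph V) (h : 0 < Fintype.card V) (x : V → ℝ) :
    adjEig G ⟨Fintype.card V - 1, by omega⟩ * (x ⬝ᵥ x) ≤ x ⬝ᵥ adj G *ᵥ x := by
  obtain ⟨f, -, -, h3, h4⟩ := exists_eigenbasis G
  rw [h3, h4, Finset.mul_sum]
  refine Finset.sum_le_sum fun i _ => mul_le_mul_of_nonneg_right (adjEig_antitone G ?_) (sq_nonneg _)
  exact Fin.le_def.2 (by have := i.2; simp; omega)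

/-- Courant–Fischer: the span of `x` and `y` contains a nontrivial combination orthogonal to the top
eigenvector, and there the form is at most the second eigenvalue. -/
theorem le_adjEig_one (G : SimpleGraph V) (h : 1 < Fintype.card V) (x y : V → ℝ) :
    ∃ a b : ℝ, (a ≠ 0 ∨ b ≠ 0) ∧ (a • x + b • y) ⬝ᵥ adj G *ᵥ (a • x + b • y) ≤
      adjEig G ⟨1, h⟩ * ((a • x + b • y) ⬝ᵥ (a • x + b • y)) := by
  obtain ⟨f, -, -, h3, h4⟩ := exists_eigenbasis G
  have key : ∀ z : V → ℝ, f ⟨0, by omega⟩ ⬝ᵥ z = 0 →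
      z ⬝ᵥ adj G *ᵥ z ≤ adjEig G ⟨1, h⟩ * (z ⬝ᵥ z) := by
    intro z hz
    rw [h3, h4, Finset.mul_sum]
    refine Finset.sum_le_sum fun i _ => ?_
    by_cases hi : i = ⟨0, by omega⟩
    · rw [hi, hz]; simp
    · refine mul_le_mul_of_nonneg_right (adjEig_antitone G ?_) (sq_nonneg _)
      rw [Fin.le_def]
      have : (i : ℕ) ≠ 0 := fun h => hi (Fin.ext h)
      simp only
      omega
  by_cases hx : f ⟨0, by omega⟩ ⬝ᵥ x = 0
  · exact ⟨1, 0, by simp, key _ (by simp [hx])⟩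
  · refine ⟨f ⟨0, by omega⟩ ⬝ᵥ y, -(f ⟨0, by omega⟩ ⬝ᵥ x), Or.inr (by simpa using hx), key _ ?_⟩
    simp only [dotProduct_add, dotProduct_smul, smul_eq_mul]
    ring

/-- The dual half of Courant–Fischer: the span of the two top eigenvectors contains a nonzero vector
orthogonal to `z`. -/
theorem adjEig_one_le (G : SimpleGraph V) (h : 1 < Fintype.card V) (z : V → ℝ) :
    ∃ w : V → ℝ, w ≠ 0 ∧ z ⬝ᵥ w = 0 ∧
      adjEig G ⟨1, h⟩ * (w ⬝ᵥ w) ≤ w ⬝ᵥ adj G *ᵥ w := by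
  obtain ⟨f, h1, h2, -, -⟩ := exists_eigenbasis G
  set i0 : Fin (Fintype.card V) := ⟨0, by omega⟩
  set i1 : Fin (Fintype.card V) := ⟨1, h⟩
  have hne : i0 ≠ i1 := by simp [i0, i1, Fin.ext_iff]
  have h01 : adjEig G i1 ≤ adjEig G i0 := adjEig_antitone G (by simp [i0, i1, Fin.le_def])
  have key : ∀ a b : ℝ, (a ≠ 0 ∨ b ≠ 0) → a • f i0 + b • f i1 ≠ 0 ∧
      adjEig G i1 * ((a • f i0 + b • f i1) ⬝ᵥ (a • f i0 + b • f i1)) ≤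
        (a • f i0 + b • f i1) ⬝ᵥ adj G *ᵥ (a • f i0 + b • f i1) := by
    intro a b hab
    have h00 := h1 i0 i0
    have h11 := h1 i1 i1
    have h01' := h1 i0 i1
    have h10' := h1 i1 i0
    simp only [hne, hne.symm, if_true, if_false] at h00 h11 h01' h10'
    constructor
    · intro h0
      have ha := congrArg (fun z => f i0 ⬝ᵥ z) h0
      have hb := congrArg (fun z => f i1 ⬝ᵥ z) h0
      simp [dotProduct_add, h00, h11, h01', h10'] at ha hb
      rcases hab with h | h <;> contradiction
    · simp only [mulVec_add, mulVec_smul, h2, add_dotProduct, dotProduct_add, smul_dotProduct,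
        dotProduct_smul, smul_eq_mul, h00, h11, h01', h10']
      nlinarith [mul_le_mul_of_nonneg_right h01 (sq_nonneg a)]
  by_cases hz : z ⬝ᵥ f i0 = 0
  · have := key 1 0 (by simp)
    exact ⟨_, this.1, by simp [hz], this.2⟩
  · have := key (z ⬝ᵥ f i1) (-(z ⬝ᵥ f i0)) (Or.inr (by simpa using hz))
    refine ⟨_, this.1, ?_, this.2⟩
    simp only [dotProduct_add, dotProduct_smul, smul_eq_mul]
    ring

open Classical in
/-- The matrix of edge probabilities, including the diagonal. -/
def probMatrix (p q : ℝ) (σ : V → ℤˣ) : Matrix V V ℝ :=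
  Matrix.of fun i j => if σ i = σ j then p else q

/-- Labels as a real vector. -/
def rv (σ : V → ℤˣ) : V → ℝ := fun v => ((σ v : ℤ) : ℝ)

theorem rv_mul_self {V : Type} (σ : V → ℤˣ) (v : V) : rv σ v * rv σ v = 1 := by
  rcases Int.units_eq_one_or (σ v) with h | h <;> simp [rv, h]

theorem rv_dot_self (σ : V → ℤˣ) : rv σ ⬝ᵥ rv σ = Fintype.card V := by
  simp [dotProduct, rv_mul_self]

theorem one_dot_self : (1 : V → ℝ) ⬝ᵥ 1 = Fintype.card V := by
  simp [dotProduct]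

/-- The mean matrix has rank two. The label vector is the signal, with coefficient (p-q)/2, and the
constant vector is the nuisance direction, with coefficient (p+q)/2. -/
theorem probMatrix_mulVec (p q : ℝ) (σ : V → ℤˣ) (u : V → ℝ) :
    probMatrix p q σ *ᵥ u =
      ((p + q) / 2 * (1 ⬝ᵥ u)) • (1 : V → ℝ) + ((p - q) / 2 * (rv σ ⬝ᵥ u)) • rv σ := by
  ext i
  simp only [mulVec, dotProduct, probMatrix, of_apply, Pi.add_apply, Pi.smul_apply, Pi.one_apply,
    smul_eq_mul, mul_one, one_mul]
  rw [mul_assoc ((p - q) / 2), Finset.sum_mul, Finset.mul_sum, Finset.mul_sum,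
    ← Finset.sum_add_distrib]
  refine Finset.sum_congr rfl fun j _ => ?_
  rcases Int.units_eq_one_or (σ i) with h | h <;> rcases Int.units_eq_one_or (σ j) with h' | h' <;>
    simp [rv, h, h'] <;> ring

theorem probMatrix_quad (p q : ℝ) (σ : V → ℤˣ) (u : V → ℝ) :
    u ⬝ᵥ probMatrix p q σ *ᵥ u = (p + q) / 2 * (1 ⬝ᵥ u) ^ 2 + (p - q) / 2 * (rv σ ⬝ᵥ u) ^ 2 := by
  rw [probMatrix_mulVec, dotProduct_add, dotProduct_smul, dotProduct_smul, dotProduct_comm u 1,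
    dotProduct_comm u (rv σ)]
  simp only [smul_eq_mul]
  ring

theorem probMatrix_transpose {V : Type} (p q : ℝ) (σ : V → ℤˣ) : (probMatrix p q σ)ᵀ = probMatrix p q σ := by
  ext i j
  simp [probMatrix, eq_comm]

theorem adj_transpose {V : Type} (G : SimpleGraph V) : (adj G)ᵀ = adj G := by
  have := (adj_isHermitian G).eq
  rwa [conjTranspose_eq_transpose_of_trivial] at this

/-- An eigenvector of the adjacency matrix is close to a multiple of the label vector, if its
eigenvalue is far from `0` and from the average degree. -/
theorem eigenvector_close (G : SimpleGraph V) (σ : V → ℤˣ) {p q K ρ m l : ℝ} (hp : 0 ≤ p)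
    (hq : 0 ≤ q) (hK : 0 < K) (hm : 0 < m)
    (hX : ∀ x, |x ⬝ᵥ (adj G - probMatrix p q σ) *ᵥ x| ≤ K * (x ⬝ᵥ x))
    (hρ : |(1 : V → ℝ) ⬝ᵥ rv σ| ≤ ρ) (hl : m ≤ |l - (p + q) / 2 * Fintype.card V|)
    (u : V → ℝ) (hu : adj G *ᵥ u = l • u) :
    nrm (l • u - ((p - q) / 2 * (rv σ ⬝ᵥ u)) • rv σ) ≤
      ((p + q) / 2 * Fintype.card V * ((|p - q| / 2 * ρ + K) / m) + K) * nrm u := by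
  set N : ℝ := (Fintype.card V : ℝ) with hN
  set X := adj G - probMatrix p q σ with hXdef
  have hXt : Xᵀ = X := by rw [hXdef, transpose_sub, adj_transpose, probMatrix_transpose]
  have hop := nrm_mulVec_le hXt hK hX u
  have hn1 : nrm (1 : V → ℝ) ^ 2 = N := by rw [nrm_sq, one_dot_self]
  have hnσ : nrm (rv σ) ^ 2 = N := by rw [nrm_sq, rv_dot_self]
  have hnσ1 : nrm (rv σ) = nrm (1 : V → ℝ) :=
    (pow_left_inj₀ (nrm_nonneg _) (nrm_nonneg _) two_ne_zero).1 (hnσ.trans hn1.symm)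
  have h1 : l • u = ((p + q) / 2 * (1 ⬝ᵥ u)) • (1 : V → ℝ) +
      ((p - q) / 2 * (rv σ ⬝ᵥ u)) • rv σ + X *ᵥ u := by
    rw [← probMatrix_mulVec, hXdef, sub_mulVec, hu]
    abel
  have hu0 := nrm_nonneg u
  have h10 := nrm_nonneg (1 : V → ℝ)
  have hρ0 : 0 ≤ ρ := (abs_nonneg _).trans hρ
  -- Pairing the eigenvalue equation with the constant vector shows that `u` is nearly orthogonal to
  -- it, as `l` is far from the average degree.
  have h2 : (l - (p + q) / 2 * N) * (1 ⬝ᵥ u) =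
      (p - q) / 2 * (rv σ ⬝ᵥ u) * ((1 : V → ℝ) ⬝ᵥ rv σ) + 1 ⬝ᵥ X *ᵥ u := by
    have := congrArg (fun z => (1 : V → ℝ) ⬝ᵥ z) h1
    simp only [dotProduct_add, dotProduct_smul, smul_eq_mul, one_dot_self] at this
    linarith
  have h3 : m * |1 ⬝ᵥ u| ≤ (|p - q| / 2 * ρ + K) * (nrm (1 : V → ℝ) * nrm u) := by
    calc m * |1 ⬝ᵥ u| ≤ |l - (p + q) / 2 * N| * |1 ⬝ᵥ u| :=
          mul_le_mul_of_nonneg_right hl (abs_nonneg _)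
      _ = |(p - q) / 2 * (rv σ ⬝ᵥ u) * ((1 : V → ℝ) ⬝ᵥ rv σ) + 1 ⬝ᵥ X *ᵥ u| := by
          rw [← abs_mul, h2]
      _ ≤ |(p - q) / 2 * (rv σ ⬝ᵥ u) * ((1 : V → ℝ) ⬝ᵥ rv σ)| + |1 ⬝ᵥ X *ᵥ u| := abs_add_le _ _
      _ ≤ |p - q| / 2 * (nrm (1 : V → ℝ) * nrm u) * ρ + nrm (1 : V → ℝ) * (K * nrm u) := by
          rw [abs_mul, abs_mul, abs_div, abs_two]
          have ha := abs_dotProduct_le (rv σ) u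
          rw [hnσ1] at ha
          have hb := abs_dotProduct_le (1 : V → ℝ) (X *ᵥ u)
          gcongr
          exact hb.trans (mul_le_mul_of_nonneg_left hop h10)
      _ = _ := by ring
  have h4 : |1 ⬝ᵥ u| ≤ (|p - q| / 2 * ρ + K) / m * (nrm (1 : V → ℝ) * nrm u) := by
    rw [div_mul_eq_mul_div, le_div_iff₀ hm]
    linarith
  have h5 : l • u - ((p - q) / 2 * (rv σ ⬝ᵥ u)) • rv σ =
      ((p + q) / 2 * (1 ⬝ᵥ u)) • (1 : V → ℝ) + X *ᵥ u := by
    rw [h1]; abel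
  rw [h5]
  calc _ ≤ nrm (((p + q) / 2 * (1 ⬝ᵥ u)) • (1 : V → ℝ)) + nrm (X *ᵥ u) := nrm_add_le _ _
    _ ≤ (p + q) / 2 * ((|p - q| / 2 * ρ + K) / m * (nrm (1 : V → ℝ) * nrm u)) * nrm (1 : V → ℝ)
        + K * nrm u := by
        rw [nrm_smul, abs_mul, abs_of_nonneg (by positivity : 0 ≤ (p + q) / 2)]
        gcongr
    _ = _ := by rw [← hn1]; ring

open Classical in
-- By `hlow` no eigenvector is orthogonal to the labels, so the eigenspace is a line and one set `Z`
-- serves all eigenvectors. This is what makes the exceptional set independent of the arbitrary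
-- choice of an eigenvector. Its size is bounded because a vertex at which `l u` and `y σ` do not
-- have the same strict sign contributes at least `y²` to their squared distance.
theorem spectral_bad_set_aux (G : SimpleGraph V) (σ : V → ℤˣ) {m l E κ : ℝ}
    (hm : 0 < m) (hl0 : m ≤ |l|) (hE : E ≤ m / 2)
    (hclose : ∀ u : V → ℝ, adj G *ᵥ u = l • u →
      nrm (l • u - (κ * (rv σ ⬝ᵥ u)) • rv σ) ≤ E * nrm u) :
    ∃ Z : Finset V, (Z.card : ℝ) ≤ 4 * E ^ 2 / m ^ 2 * Fintype.card V ∧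
      ∀ u : V → ℝ, u ≠ 0 → adj G *ᵥ u = l • u → ∀ τ : V → ℤˣ,
        (∀ v, (0 < u v → τ v = 1) ∧ (u v < 0 → τ v = -1)) →
        ∃ η : ℤˣ, ∀ v, v ∉ Z → τ v = η * σ v := by
  by_cases hex : ∃ u : V → ℝ, u ≠ 0 ∧ adj G *ᵥ u = l • u
  swap
  · exact ⟨∅, by simp; positivity, fun u hu hu' => (hex ⟨u, hu, hu'⟩).elim⟩
  have hlow : ∀ u : V → ℝ, adj G *ᵥ u = l • u →
      m / 2 * nrm u ≤ |κ * (rv σ ⬝ᵥ u)| * nrm (rv σ) := by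
    intro u hu
    have h1 := hclose u hu
    have h2 := nrm_sub_ge (l • u) ((κ * (rv σ ⬝ᵥ u)) • rv σ)
    rw [nrm_smul, nrm_smul] at h2
    have h3 := mul_le_mul_of_nonneg_right hl0 (nrm_nonneg u)
    have h4 := mul_le_mul_of_nonneg_right hE (nrm_nonneg u)
    linarith
  obtain ⟨u, hu0, hu⟩ := hex
  set y := κ * (rv σ ⬝ᵥ u) with hy
  have hupos := nrm_pos hu0
  have hyne : y ≠ 0 := by
    intro h
    have h1 := hlow u hu
    rw [← hy, h] at h1
    simp only [abs_zero, zero_mul] at h1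
    have : 0 < m / 2 * nrm u := by positivity
    linarith
  refine ⟨Finset.univ.filter fun v => l * u v * (y * rv σ v) ≤ 0, ?_, ?_⟩
  · set Z := Finset.univ.filter fun v => l * u v * (y * rv σ v) ≤ 0
    have hN : nrm (rv σ) ^ 2 = Fintype.card V := by rw [nrm_sq, rv_dot_self]
    have h1 : (Z.card : ℝ) * y ^ 2 ≤ (E * nrm u) ^ 2 := by
      calc (Z.card : ℝ) * y ^ 2 = ∑ v ∈ Z, y ^ 2 := by simp
        _ ≤ ∑ v ∈ Z, (l * u v - y * rv σ v) ^ 2 := by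
            refine Finset.sum_le_sum fun v hv => ?_
            have h2 : l * u v * (y * rv σ v) ≤ 0 := (Finset.mem_filter.1 hv).2
            have h3 : (y * rv σ v) ^ 2 = y ^ 2 := by
              rw [mul_pow, sq (rv σ v), rv_mul_self, mul_one]
            nlinarith [sq_nonneg (l * u v)]
        _ ≤ ∑ v, (l * u v - y * rv σ v) ^ 2 :=
            Finset.sum_le_univ_sum_of_nonneg fun v => sq_nonneg _
        _ = nrm (l • u - y • rv σ) ^ 2 := by
            rw [nrm_sq, dotProduct]
            exact Finset.sum_congr rfl fun v _ => by simp [sq]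
        _ ≤ (E * nrm u) ^ 2 := pow_le_pow_left₀ (nrm_nonneg _) (hclose u hu) 2
    have h2 : (m / 2 * nrm u) ^ 2 ≤ y ^ 2 * Fintype.card V := by
      have := pow_le_pow_left₀ (by positivity) (hlow u hu) 2
      rwa [mul_pow |κ * _|, sq_abs, hN] at this
    rw [div_mul_eq_mul_div, le_div_iff₀ (by positivity)]
    have hy2 : 0 < y ^ 2 := by positivity
    have hu2 : 0 < nrm u ^ 2 := by positivity
    have h3 : (Z.card : ℝ) * (m / 2 * nrm u) ^ 2 ≤ (E * nrm u) ^ 2 * Fintype.card V := by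
      calc _ ≤ (Z.card : ℝ) * (y ^ 2 * Fintype.card V) := by gcongr
        _ = (Z.card : ℝ) * y ^ 2 * Fintype.card V := by ring
        _ ≤ _ := by gcongr
    have h4 : (Z.card * m ^ 2) * nrm u ^ 2 ≤ (4 * E ^ 2 * Fintype.card V) * nrm u ^ 2 := by
      nlinarith
    exact le_of_mul_le_mul_right h4 hu2
  · intro u' hu'0 hu' τ hτ
    have hdep : (rv σ ⬝ᵥ u') • u = (rv σ ⬝ᵥ u) • u' := by
      by_contra hne
      have h0 : (rv σ ⬝ᵥ u') • u - (rv σ ⬝ᵥ u) • u' ≠ 0 := sub_ne_zero.2 hne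
      have h1 := hlow ((rv σ ⬝ᵥ u') • u - (rv σ ⬝ᵥ u) • u') (by
        rw [mulVec_sub, mulVec_smul, mulVec_smul, hu, hu', smul_sub, smul_comm l, smul_comm l])
      have h2 : rv σ ⬝ᵥ ((rv σ ⬝ᵥ u') • u - (rv σ ⬝ᵥ u) • u') = 0 := by
        simp only [dotProduct_sub, dotProduct_smul, smul_eq_mul]; ring
      rw [h2] at h1
      simp only [mul_zero, abs_zero, zero_mul] at h1
      have := nrm_pos h0
      have : 0 < m / 2 * nrm ((rv σ ⬝ᵥ u') • u - (rv σ ⬝ᵥ u) • u') := by positivity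
      linarith
    have hσu : rv σ ⬝ᵥ u ≠ 0 := fun h => hyne (by rw [hy, h, mul_zero])
    have hσu' : rv σ ⬝ᵥ u' ≠ 0 := by
      intro h
      rw [h, zero_smul] at hdep
      exact hu'0 ((smul_eq_zero.1 hdep.symm).resolve_left hσu)
    set k := (rv σ ⬝ᵥ u') / (rv σ ⬝ᵥ u) with hk
    have hk0 : k ≠ 0 := div_ne_zero hσu' hσu
    have hku : ∀ v, u' v = k * u v := by
      intro v
      have := congrFun hdep v
      simp only [Pi.smul_apply, smul_eq_mul] at this
      rw [hk, div_mul_eq_mul_div, eq_div_iff hσu]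
      linarith
    have hl : l ≠ 0 := by
      intro h; rw [h, abs_zero] at hl0; linarith
    have hx : k * l * y ≠ 0 := mul_ne_zero (mul_ne_zero hk0 hl) hyne
    refine ⟨if 0 < k * l * y then 1 else -1, fun v hv => ?_⟩
    have hv' : 0 < l * u v * (y * rv σ v) := by
      by_contra h
      exact hv (by simpa using h)
    have h6 : 0 < (k * l * y) * (u' v * rv σ v) := by
      rw [hku]
      have : (k * l * y) * (k * u v * rv σ v) = k ^ 2 * (l * u v * (y * rv σ v)) := by ring
      rw [this]
      positivity
    rcases Int.units_eq_one_or (σ v) with hσ | hσ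
    · have hr : rv σ v = 1 := by simp [rv, hσ]
      rw [hr, mul_one] at h6
      rw [hσ, mul_one]
      split_ifs with hpos
      · exact (hτ v).1 ((mul_pos_iff_of_pos_left hpos).1 h6)
      · exact (hτ v).2 ((neg_iff_neg_of_mul_pos h6).1 (lt_of_le_of_ne (not_lt.1 hpos) hx))
    · have hr : rv σ v = -1 := by simp [rv, hσ]
      rw [hr] at h6
      rw [hσ]
      split_ifs with hpos
      · rw [one_mul]
        exact (hτ v).2 (by have := (mul_pos_iff_of_pos_left hpos).1 h6; linarith)
      · rw [neg_mul_neg, one_mul]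
        have := (neg_iff_neg_of_mul_pos h6).1 (lt_of_le_of_ne (not_lt.1 hpos) hx)
        exact (hτ v).1 (by linarith)

/-- If the adjacency matrix is close to the matrix of edge probabilities, the spectral method
recovers the labels up to a small set of vertices depending on the graph only. -/
theorem spectral_bad_set (G : SimpleGraph V) (σ : V → ℤˣ) {p q K ρ m a b : ℝ} (hab : a ≠ b)
    (hp : 0 ≤ p) (hq : 0 ≤ q) (hK : 0 < K) (hm : 0 < m)
    (hX : ∀ x, |x ⬝ᵥ (adj G - probMatrix p q σ) *ᵥ x| ≤ K * (x ⬝ᵥ x))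
    (hρ : |(1 : V → ℝ) ⬝ᵥ rv σ| ≤ ρ) (hcard : 1 < Fintype.card V)
    (h1 : b < a → q ≤ p ∧ m ≤ (p - q) / 2 * (Fintype.card V - ρ) - K ∧ m ≤ q * Fintype.card V - K
      ∧ ρ < Fintype.card V)
    (h2 : a < b → (p + q) / 2 * ρ ^ 2 + (p - q) / 2 * (Fintype.card V : ℝ) ^ 2 +
      K * Fintype.card V ≤ - m * Fintype.card V)
    (hE : (p + q) / 2 * Fintype.card V * ((|p - q| / 2 * ρ + K) / m) + K ≤ m / 2) :
    ∃ Z : Finset V, (Z.card : ℝ) ≤ 4 * ((p + q) / 2 * Fintype.card V *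
        ((|p - q| / 2 * ρ + K) / m) + K) ^ 2 / m ^ 2 * Fintype.card V ∧
      ∀ τ, IsSpectral a b G τ → ∃ η : ℤˣ, ∀ v, v ∉ Z → τ v = η * σ v := by
  have hNpos : (0 : ℝ) < Fintype.card V := by exact_mod_cast (zero_lt_one.trans hcard)
  set N : ℝ := (Fintype.card V : ℝ) with hN
  have hquad : ∀ x, x ⬝ᵥ adj G *ᵥ x = x ⬝ᵥ probMatrix p q σ *ᵥ x +
      x ⬝ᵥ (adj G - probMatrix p q σ) *ᵥ x := by
    intro x; rw [sub_mulVec, dotProduct_sub]; ring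
  rcases lt_or_gt_of_ne hab with hlt | hgt
  · set l := adjEig G ⟨Fintype.card V - 1, by omega⟩ with hldef
    have hl : l ≤ -m := by
      -- With `p < q` the label vector itself shows that the smallest eigenvalue is strongly
      -- negative.
      have h3 := adjEig_last_le G (by omega) (rv σ)
      rw [hquad, probMatrix_quad, rv_dot_self] at h3
      have h4 := (abs_le.1 (hX (rv σ))).2
      rw [rv_dot_self] at h4
      have h5 : ((1 : V → ℝ) ⬝ᵥ rv σ) ^ 2 ≤ ρ ^ 2 := by
        rw [← sq_abs]; exact pow_le_pow_left₀ (abs_nonneg _) hρ 2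
      have h6 := mul_le_mul_of_nonneg_left h5 (by positivity : 0 ≤ (p + q) / 2)
      have h7 := h2 hlt
      have h8 : l * N ≤ -m * N := by linarith
      exact le_of_mul_le_mul_right h8 hNpos
    obtain ⟨Z, hZ, hZ'⟩ := spectral_bad_set_aux G σ (κ := (p - q) / 2) hm
      (by rw [abs_of_nonpos (by linarith)]; linarith : m ≤ |l|) hE
      (fun u hu => eigenvector_close G σ hp hq hK hm hX hρ (by
        have : 0 ≤ (p + q) / 2 * N := by positivity
        rw [abs_of_nonpos (by linarith)]; linarith) u hu)
    refine ⟨Z, hZ, ?_⟩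
    rintro τ ⟨h, u, hu0, -, hu, hτ⟩
    exact hZ' u hu0 (hu hlt) τ hτ
  · obtain ⟨hqp, hm1, hm2, hρN⟩ := h1 hgt
    set l := adjEig G ⟨1, hcard⟩ with hldef
    have hl1 : m ≤ l := by
      obtain ⟨x, y, hxy, h3⟩ := le_adjEig_one G hcard 1 (rv σ)
      set w := x • (1 : V → ℝ) + y • rv σ with hw
      set A := (1 : V → ℝ) ⬝ᵥ w with hA
      set B := rv σ ⬝ᵥ w with hB
      set r0 := (1 : V → ℝ) ⬝ᵥ rv σ with hr0
      have hA' : A = x * N + y * r0 := by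
        rw [hA, hw, dotProduct_add, dotProduct_smul, dotProduct_smul, one_dot_self]; rfl
      have hB' : B = x * r0 + y * N := by
        rw [hB, hw, dotProduct_add, dotProduct_smul, dotProduct_smul, rv_dot_self,
          dotProduct_comm (rv σ) 1]; rfl
      have hww : w ⬝ᵥ w = x * A + y * B := by
        nth_rewrite 1 [hw]
        rw [add_dotProduct, smul_dotProduct, smul_dotProduct]; rfl
      have hxy2 : 0 < x ^ 2 + y ^ 2 := by
        rcases hxy with h | h
        · have := sq_nonneg y; positivity
        · have := sq_nonneg x; positivity
      have hr1 := abs_le.1 hρ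
      have hρ0 : 0 ≤ ρ := (abs_nonneg _).trans hρ
      have h5 : (N - ρ) * (x ^ 2 + y ^ 2) ≤ w ⬝ᵥ w := by
        rw [hww, hA', hB']
        have : -(ρ * (x ^ 2 + y ^ 2)) ≤ 2 * (x * y) * r0 := by
          have h6 : |2 * (x * y) * r0| ≤ (x ^ 2 + y ^ 2) * ρ := by
            rw [abs_mul]
            refine mul_le_mul ?_ hρ (abs_nonneg _) hxy2.le
            rw [abs_le]
            constructor <;> nlinarith [sq_nonneg (x - y), sq_nonneg (x + y)]
          have := (abs_le.1 h6).1
          linarith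
        linarith
      have hwpos : 0 < w ⬝ᵥ w := lt_of_lt_of_le (mul_pos (by linarith) hxy2) h5
      -- `A` and `B` are the coordinates of the Gram matrix applied to `(x, y)`. By `h5` its least
      -- eigenvalue is at least `N - ρ`, and Cauchy–Schwarz turns this into a bound for `A² + B²`.
      have h6 : (N - ρ) * (w ⬝ᵥ w) ≤ A ^ 2 + B ^ 2 := by
        have hcs : (w ⬝ᵥ w) ^ 2 ≤ (x ^ 2 + y ^ 2) * (A ^ 2 + B ^ 2) := by
          rw [hww]; nlinarith [sq_nonneg (x * B - y * A)]
        have h7 : (x ^ 2 + y ^ 2) * ((N - ρ) * (w ⬝ᵥ w)) ≤ (x ^ 2 + y ^ 2) * (A ^ 2 + B ^ 2) := by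
          have := mul_le_mul_of_nonneg_right h5 hwpos.le
          linarith
        exact le_of_mul_le_mul_left h7 hxy2
      rw [hquad, probMatrix_quad] at h3
      have h4 := (abs_le.1 (hX w)).1
      have h8 : ((p - q) / 2 * (N - ρ) - K) * (w ⬝ᵥ w) ≤ l * (w ⬝ᵥ w) := by
        have e1 := mul_le_mul_of_nonneg_left h6 (by linarith : 0 ≤ (p - q) / 2)
        have e2 := mul_nonneg hq (sq_nonneg A)
        linarith
      exact hm1.trans (le_of_mul_le_mul_right h8 hwpos)
    -- Testing orthogonally to the constant vector removes the average degree from the form. Since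
    -- `q N` exceeds `K` by `m`, this separates `l` from the average degree.
    have hl2 : l ≤ (p - q) / 2 * N + K := by
      obtain ⟨w, hw0, h1w, h3⟩ := adjEig_one_le G hcard 1
      rw [hquad, probMatrix_quad, h1w] at h3
      have h4 := (abs_le.1 (hX w)).2
      have h5 : (rv σ ⬝ᵥ w) ^ 2 ≤ N * (w ⬝ᵥ w) := by
        have := pow_le_pow_left₀ (abs_nonneg _) (abs_dotProduct_le (rv σ) w) 2
        rwa [sq_abs, mul_pow, nrm_sq, nrm_sq, rv_dot_self] at this
      have h6 := mul_le_mul_of_nonneg_left h5 (by linarith : 0 ≤ (p - q) / 2)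
      have hwpos : 0 < w ⬝ᵥ w := by
        rw [← nrm_sq]; have := nrm_pos hw0; positivity
      have h8 : l * (w ⬝ᵥ w) ≤ ((p - q) / 2 * N + K) * (w ⬝ᵥ w) := by linarith
      exact le_of_mul_le_mul_right h8 hwpos
    obtain ⟨Z, hZ, hZ'⟩ := spectral_bad_set_aux G σ (κ := (p - q) / 2) hm
      (by rw [abs_of_nonneg (by linarith)]; linarith : m ≤ |l|) hE
      (fun u hu => eigenvector_close G σ hp hq hK hm hX hρ (by
        rw [abs_of_nonpos (by linarith)]; linarith) u hu)
    refine ⟨Z, hZ, ?_⟩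
    rintro τ ⟨h, u, hu0, hu, -, hτ⟩
    exact hZ' u hu0 (hu hgt) τ hτ

end Spectral

end CorrSBM
end

/-! ### From sparsity and cut norm to discrepancy and the quadratic form. -/

noncomputable section
namespace CorrSBM

/-- Splitting `T` by the sign of `c` bounds the sum of `|c|` by `2 M`. -/
theorem abs_sum_mul_le {V : Type*} (T : Finset V) (c x : V → ℝ) {M B : ℝ} (hB : 0 ≤ B)
    (h : ∀ T' ⊆ T, |∑ w ∈ T', c w| ≤ M) (hx : ∀ w ∈ T, |x w| ≤ B) :
    |∑ w ∈ T, x w * c w| ≤ B * (2 * M) := by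
  classical
  have h1 : ∑ w ∈ T, |c w| ≤ 2 * M := by
    rw [← Finset.sum_filter_add_sum_filter_not T (fun w => 0 ≤ c w)]
    have h2 : ∑ w ∈ T with 0 ≤ c w, |c w| ≤ M := by
      rw [Finset.sum_congr rfl fun w hw => abs_of_nonneg (Finset.mem_filter.1 hw).2]
      exact (abs_le.1 (h _ (Finset.filter_subset _ _))).2
    have h3 : ∑ w ∈ T with ¬ 0 ≤ c w, |c w| ≤ M := by
      rw [Finset.sum_congr rfl fun w hw => abs_of_neg (not_le.1 (Finset.mem_filter.1 hw).2),
        Finset.sum_neg_distrib]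
      have := (abs_le.1 (h _ (Finset.filter_subset (fun w => ¬ 0 ≤ c w) T))).1
      linarith
    linarith
  calc |∑ w ∈ T, x w * c w| ≤ ∑ w ∈ T, |x w * c w| := Finset.abs_sum_le_sum_abs _ _
    _ ≤ ∑ w ∈ T, B * |c w| := Finset.sum_le_sum fun w hw => by
        rw [abs_mul]; exact mul_le_mul_of_nonneg_right (hx w hw) (abs_nonneg _)
    _ = B * ∑ w ∈ T, |c w| := by rw [Finset.mul_sum]
    _ ≤ _ := mul_le_mul_of_nonneg_left h1 hB

/-- Passing from indicators to bounded weights costs a factor 2 in each variable. -/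
theorem abs_bilinear_le {V : Type*} (X : V → V → ℝ) {a A B : ℝ} (ha : 0 ≤ a) (hA : 0 ≤ A)
    (hB : 0 ≤ B)
    (h : ∀ S T : Finset V, |∑ v ∈ S, ∑ w ∈ T, X v w| ≤ a * √((S.card : ℝ) * T.card))
    (S T : Finset V) (x : V → ℝ) (hxS : ∀ v ∈ S, |x v| ≤ A) (hxT : ∀ v ∈ T, |x v| ≤ B) :
    |∑ v ∈ S, ∑ w ∈ T, X v w * x v * x w| ≤ A * B * (4 * (a * √((S.card : ℝ) * T.card))) := by
  have h1 : ∑ v ∈ S, ∑ w ∈ T, X v w * x v * x w = ∑ v ∈ S, x v * ∑ w ∈ T, x w * X v w := by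
    refine Finset.sum_congr rfl fun v _ => ?_
    rw [Finset.mul_sum]
    exact Finset.sum_congr rfl fun w _ => by ring
  rw [h1]
  refine (abs_sum_mul_le S _ x hA (M := B * (2 * (a * √((S.card : ℝ) * T.card))))
    (fun S' hS' => ?_) hxS).trans (le_of_eq (by ring))
  rw [Finset.sum_comm]
  simp_rw [← Finset.mul_sum]
  refine abs_sum_mul_le T _ x hB (fun T' hT' => ?_) hxT
  rw [Finset.sum_comm]
  refine (h S' T').trans ?_
  have := Finset.card_le_card hS'
  have := Finset.card_le_card hT'
  gcongr

/-- A discrepancy bound and a bound on the row sums control the quadratic form. -/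
theorem abs_quad_le_of_discrepancy {V : Type} [Fintype V] (X : V → V → ℝ) {a d : ℝ} (ha : 0 ≤ a)
    (hrow : ∀ v, ∑ w, |X v w| ≤ d) (hcol : ∀ w, ∑ v, |X v w| ≤ d)
    (h : ∀ S T : Finset V, |∑ v ∈ S, ∑ w ∈ T, X v w| ≤ a * √((S.card : ℝ) * T.card))
    (γ : ℕ) (x : V → ℝ) :
    |∑ v, ∑ w, X v w * x v * x w| ≤
      (16 * a * (2 * γ + 1) + 2 * ((2 : ℝ) ^ γ)⁻¹ * d) * ∑ v, x v ^ 2 := by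
  classical
  -- Dyadic levels of `|x|`. Zero coordinates have no meaningful level and are excluded from the
  -- level sets `S`.
  let l : V → ℤ := fun v => Int.log 2 |x v|
  let S : ℤ → Finset V := fun k => Finset.univ.filter fun v => x v ≠ 0 ∧ l v = k
  let near : V → V → Prop := fun v w => x v ≠ 0 ∧ x w ≠ 0 ∧ |l v - l w| ≤ γ
  have hlow : ∀ v, x v ≠ 0 → (2 : ℝ) ^ l v ≤ |x v| := fun v hv => by
    have := Int.zpow_log_le_self (b := 2) (r := |x v|) (by norm_num) (abs_pos.2 hv)
    simpa using this
  have hupp : ∀ v, |x v| ≤ (2 : ℝ) ^ (l v + 1) := fun v => by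
    have := (Int.lt_zpow_succ_log_self (b := 2) (by norm_num) |x v|).le
    simpa using this
  have hsplit : ∑ v, ∑ w, X v w * x v * x w =
      ∑ v, ∑ w, (if near v w then X v w * x v * x w else 0) +
      ∑ v, ∑ w, (if near v w then 0 else X v w * x v * x w) := by
    rw [← Finset.sum_add_distrib]
    refine Finset.sum_congr rfl fun v _ => ?_
    rw [← Finset.sum_add_distrib]
    refine Finset.sum_congr rfl fun w _ => ?_
    split_ifs <;> simp
  -- If the levels differ by more than `γ`, then `|x v| |x w|` is at most `2^{-γ}` times the larger
  -- square, so absolute row and column sums suffice.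
  have hfar : |∑ v, ∑ w, (if near v w then 0 else X v w * x v * x w)| ≤
      2 * ((2 : ℝ) ^ γ)⁻¹ * d * ∑ v, x v ^ 2 := by
    have hterm : ∀ v w, |if near v w then 0 else X v w * x v * x w| ≤
        ((2 : ℝ) ^ γ)⁻¹ * (|X v w| * x v ^ 2) + ((2 : ℝ) ^ γ)⁻¹ * (|X v w| * x w ^ 2) := by
      intro v w
      have hpos : 0 < ((2 : ℝ) ^ γ)⁻¹ := by positivity
      have hX0 := abs_nonneg (X v w)
      split_ifs with hn
      · simp only [abs_zero]; positivity
      · have key : |x v| * |x w| ≤ ((2 : ℝ) ^ γ)⁻¹ * (x v ^ 2 + x w ^ 2) := by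
          by_cases hv : x v = 0
          · simp only [hv, abs_zero, zero_mul]; positivity
          by_cases hw : x w = 0
          · simp only [hw, abs_zero, mul_zero]; positivity
          have hn' : (γ : ℤ) < |l v - l w| := by
            by_contra hcon
            exact hn ⟨hv, hw, not_lt.1 hcon⟩
          have aux : ∀ v w, x v ≠ 0 → (γ : ℤ) < l v - l w →
              |x v| * |x w| ≤ ((2 : ℝ) ^ γ)⁻¹ * x v ^ 2 := by
            intro v w hv hvw
            have h1 : |x w| ≤ ((2 : ℝ) ^ γ)⁻¹ * |x v| := by
              calc |x w| ≤ (2 : ℝ) ^ (l w + 1) := hupp w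
                _ ≤ (2 : ℝ) ^ (-(γ : ℤ) + l v) := zpow_le_zpow_right₀ (by norm_num) (by omega)
                _ = ((2 : ℝ) ^ γ)⁻¹ * 2 ^ l v := by
                    rw [zpow_add₀ (by norm_num), zpow_neg, zpow_natCast]
                _ ≤ _ := mul_le_mul_of_nonneg_left (hlow v hv) hpos.le
            have := mul_le_mul_of_nonneg_left h1 (abs_nonneg (x v))
            have h2 : x v ^ 2 = |x v| * |x v| := by rw [← sq, sq_abs]
            rw [h2]
            linarith
          rcases lt_abs.1 hn' with h1 | h1
          · have := aux v w hv h1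
            nlinarith [mul_nonneg hpos.le (sq_nonneg (x w))]
          · have := aux w v hw (by omega)
            nlinarith [mul_nonneg hpos.le (sq_nonneg (x v))]
        rw [mul_assoc, abs_mul, abs_mul]
        have := mul_le_mul_of_nonneg_left key hX0
        linarith
    have hsq : ∀ v, 0 ≤ x v ^ 2 := fun v => sq_nonneg _
    calc _ ≤ ∑ v, ∑ w, |if near v w then 0 else X v w * x v * x w| :=
          (Finset.abs_sum_le_sum_abs _ _).trans
            (Finset.sum_le_sum fun v _ => Finset.abs_sum_le_sum_abs _ _)
      _ ≤ ∑ v, ∑ w, (((2 : ℝ) ^ γ)⁻¹ * (|X v w| * x v ^ 2) +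
            ((2 : ℝ) ^ γ)⁻¹ * (|X v w| * x w ^ 2)) :=
          Finset.sum_le_sum fun v _ => Finset.sum_le_sum fun w _ => hterm v w
      _ = ((2 : ℝ) ^ γ)⁻¹ * ∑ v, (∑ w, |X v w|) * x v ^ 2 +
            ((2 : ℝ) ^ γ)⁻¹ * ∑ w, (∑ v, |X v w|) * x w ^ 2 := by
          simp_rw [Finset.sum_add_distrib]
          congr 1
          · simp_rw [Finset.mul_sum, Finset.sum_mul, Finset.mul_sum]
          · rw [Finset.sum_comm]
            simp_rw [Finset.mul_sum, Finset.sum_mul, Finset.mul_sum]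
      _ ≤ ((2 : ℝ) ^ γ)⁻¹ * ∑ v, d * x v ^ 2 + ((2 : ℝ) ^ γ)⁻¹ * ∑ w, d * x w ^ 2 := by
          gcongr with v _ w _
          · exact hrow v
          · exact hcol w
      _ = _ := by rw [← Finset.mul_sum]; ring
  -- For nearby levels the discrepancy bound on `S k × S k'` gives `8 a (y k + y k')`, and each
  -- level is near at most `2 γ + 1` others.
  have hnear : |∑ v, ∑ w, (if near v w then X v w * x v * x w else 0)| ≤
      16 * a * (2 * γ + 1) * ∑ v, x v ^ 2 := by
    let D : Finset ℤ := (Finset.univ.image l)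
    let y : ℤ → ℝ := fun k => ∑ v ∈ S k, x v ^ 2
    have hy0 : ∀ k, 0 ≤ y k := fun k => Finset.sum_nonneg fun v _ => sq_nonneg _
    have hysum : ∑ k ∈ D, y k ≤ ∑ v, x v ^ 2 := by
      calc ∑ k ∈ D, y k ≤ ∑ k ∈ D, ∑ v with l v = k, x v ^ 2 := by
            refine Finset.sum_le_sum fun k _ => Finset.sum_le_sum_of_subset_of_nonneg ?_ ?_
            · intro v hv
              have := (Finset.mem_filter.1 hv).2
              simp [this.2]
            · intro v _ _; exact sq_nonneg _
        _ = ∑ v, x v ^ 2 := by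
            rw [Finset.sum_fiberwise_of_maps_to]
            intro v _
            exact Finset.mem_image_of_mem _ (Finset.mem_univ _)
    have hblock : ∀ k k', |∑ v ∈ S k, ∑ w ∈ S k', X v w * x v * x w| ≤ 8 * a * (y k + y k') := by
      intro k k'
      have hcard : ∀ k, (2 : ℝ) ^ k * (2 : ℝ) ^ k * (S k).card ≤ y k := by
        intro k
        have : ((S k).card : ℝ) * ((2 : ℝ) ^ k * (2 : ℝ) ^ k) = ∑ v ∈ S k, (2 : ℝ) ^ k * (2 : ℝ) ^ k := by
          simp
        rw [mul_comm, this]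
        refine Finset.sum_le_sum fun v hv => ?_
        have hv' := (Finset.mem_filter.1 hv).2
        rw [← sq_abs, sq]
        have := hlow v hv'.1
        rw [hv'.2] at this
        exact mul_self_le_mul_self (by positivity) this
      have h1 := abs_bilinear_le X ha (A := (2 : ℝ) ^ (k + 1)) (B := (2 : ℝ) ^ (k' + 1))
        (by positivity) (by positivity) h (S k) (S k') x
        (fun v hv => by have := hupp v; rwa [(Finset.mem_filter.1 hv).2.2] at this)
        (fun v hv => by have := hupp v; rwa [(Finset.mem_filter.1 hv).2.2] at this)
      refine h1.trans ?_
      have h2 : (2 : ℝ) ^ k * (2 : ℝ) ^ k' * √(((S k).card : ℝ) * (S k').card) ≤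
          (y k + y k') / 2 := by
        refine Real.abs_le_sqrt (by rfl : _ ^ 2 ≤ _) |>.trans ?_ |> (le_abs_self _).trans
        rw [mul_pow, mul_pow, Real.sq_sqrt (by positivity)]
        refine (Real.sqrt_le_sqrt (?_ : _ ≤ y k * y k')).trans ?_
        · calc _ = ((2 : ℝ) ^ k * (2 : ℝ) ^ k * (S k).card) *
                ((2 : ℝ) ^ k' * (2 : ℝ) ^ k' * (S k').card) := by ring
            _ ≤ _ := mul_le_mul (hcard k) (hcard k') (by positivity) (hy0 k)
        · refine Real.sqrt_le_iff.2 ⟨by have := hy0 k; have := hy0 k'; linarith, ?_⟩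
          nlinarith [sq_nonneg (y k - y k')]
      rw [zpow_add_one₀ two_ne_zero, zpow_add_one₀ two_ne_zero]
      have := mul_le_mul_of_nonneg_left h2 ha
      linarith
    have hdecomp : ∑ v, ∑ w, (if near v w then X v w * x v * x w else 0) =
        ∑ k ∈ D, ∑ k' ∈ D, if |k - k'| ≤ γ then ∑ v ∈ S k, ∑ w ∈ S k', X v w * x v * x w else 0 := by
      have e1 : ∀ f : V → ℝ, (∀ v, x v = 0 → f v = 0) → ∑ v, f v = ∑ k ∈ D, ∑ v ∈ S k, f v := by
        intro f hf
        rw [← Finset.sum_fiberwise_of_maps_to (s := Finset.univ) (t := D) (g := l)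
          (fun v _ => Finset.mem_image_of_mem _ (Finset.mem_univ _))]
        refine Finset.sum_congr rfl fun k _ => (Finset.sum_subset ?_ ?_).symm
        · intro v hv; simp [(Finset.mem_filter.1 hv).2.2]
        · intro v hv hv'
          refine hf v ?_
          by_contra hne
          exact hv' (by simpa [S, hne] using hv)
      rw [e1 _ (fun v hv => Finset.sum_eq_zero fun w _ => by simp [near, hv])]
      refine Finset.sum_congr rfl fun k _ => ?_
      have e2 : ∀ v ∈ S k, ∑ w, (if near v w then X v w * x v * x w else 0) =
          ∑ k' ∈ D, ∑ w ∈ S k', if |k - k'| ≤ γ then X v w * x v * x w else 0 := by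
        intro v hv
        have hv' := (Finset.mem_filter.1 hv).2
        rw [e1 _ (fun w hw => by simp [near, hw])]
        refine Finset.sum_congr rfl fun k' _ => Finset.sum_congr rfl fun w hw => ?_
        have hw' := (Finset.mem_filter.1 hw).2
        simp [near, hv', hw']
      rw [Finset.sum_congr rfl e2, Finset.sum_comm]
      refine Finset.sum_congr rfl fun k' _ => ?_
      split_ifs
      · rfl
      · simp
    have hcount : ∀ k, ((D.filter fun k' => |k - k'| ≤ (γ : ℤ)).card : ℝ) ≤ 2 * γ + 1 := by
      intro k
      have : (D.filter fun k' => |k - k'| ≤ (γ : ℤ)) ⊆ Finset.Icc (k - γ) (k + γ) := by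
        intro k' hk'
        have := abs_le.1 (Finset.mem_filter.1 hk').2
        rw [Finset.mem_Icc]
        omega
      have h2 := Finset.card_le_card this
      rw [Int.card_Icc] at h2
      have h3 : (k + γ + 1 - (k - γ)).toNat = 2 * γ + 1 := by omega
      rw [h3] at h2
      exact_mod_cast h2
    rw [hdecomp]
    have hsw : ∀ k k' : ℤ, |k - k'| = |k' - k| := fun k k' => abs_sub_comm _ _
    calc _ ≤ ∑ k ∈ D, ∑ k' ∈ D, (if |k - k'| ≤ γ then 8 * a * (y k + y k') else 0) := by
          refine (Finset.abs_sum_le_sum_abs _ _).trans (Finset.sum_le_sum fun k _ => ?_)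
          refine (Finset.abs_sum_le_sum_abs _ _).trans (Finset.sum_le_sum fun k' _ => ?_)
          split_ifs
          · exact hblock k k'
          · simp
      _ = 8 * a * (∑ k ∈ D, ∑ k' ∈ D, (if |k - k'| ≤ γ then y k else 0)) +
          8 * a * (∑ k ∈ D, ∑ k' ∈ D, (if |k - k'| ≤ γ then y k' else 0)) := by
          simp_rw [Finset.mul_sum]
          rw [← Finset.sum_add_distrib]
          refine Finset.sum_congr rfl fun k _ => ?_
          rw [← Finset.sum_add_distrib]
          refine Finset.sum_congr rfl fun k' _ => ?_
          split_ifs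
          · ring
          · simp
      _ = 16 * a * (∑ k ∈ D, ∑ k' ∈ D, (if |k - k'| ≤ γ then y k else 0)) := by
          have : ∑ k ∈ D, ∑ k' ∈ D, (if |k - k'| ≤ γ then y k' else 0) =
              ∑ k ∈ D, ∑ k' ∈ D, (if |k - k'| ≤ γ then y k else 0) := by
            rw [Finset.sum_comm]
            simp_rw [hsw]
          rw [this]; ring
      _ ≤ 16 * a * (∑ k ∈ D, (2 * γ + 1) * y k) := by
          gcongr with k _
          rw [← Finset.sum_filter, Finset.sum_const, nsmul_eq_mul]
          exact mul_le_mul_of_nonneg_right (hcount k) (hy0 k)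
      _ ≤ _ := by
          rw [← Finset.mul_sum, ← mul_assoc]
          gcongr
  rw [hsplit]
  refine (abs_add_le _ _).trans ?_
  linarith

/-- Degree bounds, sparsity of small sets and a cut norm bound imply a discrepancy bound. -/
theorem discrepancy_of_sparse {n : ℕ} (A P : Fin n → Fin n → ℝ)
    {Δ ρ η κ ζ k a : ℝ} (hA0 : ∀ i j, 0 ≤ A i j) (hP0 : ∀ i j, 0 ≤ P i j) (hPρ : ∀ i j, P i j ≤ ρ)
    (hκ : 0 < κ) (hη : 0 ≤ η)
    (hrow : ∀ v, ∑ w, A v w ≤ Δ) (hcol : ∀ w, ∑ v, A v w ≤ Δ) (hρ : n * ρ ≤ Δ)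
    (hsmall : ∀ R : Finset (Fin n), (R.card : ℝ) ≤ κ * n → ∑ i ∈ R, ∑ j ∈ R, A i j ≤ η * R.card)
    (hcut : ∀ S T : Finset (Fin n), |∑ i ∈ S, ∑ j ∈ T, (A i j - P i j)| ≤ ζ * n)
    (h1 : Δ ≤ a * k) (h2 : 2 * η * k ≤ a) (h3 : ρ * (κ * n) ≤ a) (h4 : 2 * ζ * k ≤ a * κ)
    (ha : 0 ≤ a) (S T : Finset (Fin n)) :
    |∑ i ∈ S, ∑ j ∈ T, (A i j - P i j)| ≤ a * √((S.card : ℝ) * T.card) := by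
  have hX : ∑ i ∈ S, ∑ j ∈ T, (A i j - P i j) = ∑ i ∈ S, ∑ j ∈ T, A i j - ∑ i ∈ S, ∑ j ∈ T, P i j := by
    simp_rw [Finset.sum_sub_distrib]
  set s : ℝ := (S.card : ℝ) with hs
  set t : ℝ := (T.card : ℝ) with ht
  have hs0 : 0 ≤ s := Nat.cast_nonneg _
  have ht0 : 0 ≤ t := Nat.cast_nonneg _
  have hn0 : (0 : ℝ) ≤ n := Nat.cast_nonneg _
  have hsn : s ≤ n := by
    have := Finset.card_le_univ S; rw [Fintype.card_fin] at this; rw [hs]; exact_mod_cast this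
  have htn : t ≤ n := by
    have := Finset.card_le_univ T; rw [Fintype.card_fin] at this; rw [ht]; exact_mod_cast this
  have hA1 : 0 ≤ ∑ i ∈ S, ∑ j ∈ T, A i j :=
    Finset.sum_nonneg fun i _ => Finset.sum_nonneg fun j _ => hA0 i j
  have hP1 : 0 ≤ ∑ i ∈ S, ∑ j ∈ T, P i j :=
    Finset.sum_nonneg fun i _ => Finset.sum_nonneg fun j _ => hP0 i j
  have hPst : ∑ i ∈ S, ∑ j ∈ T, P i j ≤ s * t * ρ := by
    calc _ ≤ ∑ i ∈ S, ∑ j ∈ T, ρ :=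
          Finset.sum_le_sum fun i _ => Finset.sum_le_sum fun j _ => hPρ i j
      _ = _ := by simp [hs, ht]; ring
  have hAs : ∑ i ∈ S, ∑ j ∈ T, A i j ≤ s * Δ := by
    calc _ ≤ ∑ i ∈ S, ∑ j, A i j := Finset.sum_le_sum fun i _ =>
            Finset.sum_le_univ_sum_of_nonneg fun j => hA0 i j
      _ ≤ ∑ i ∈ S, Δ := Finset.sum_le_sum fun i _ => hrow i
      _ = _ := by simp [hs]
  have hAt : ∑ i ∈ S, ∑ j ∈ T, A i j ≤ t * Δ := by
    rw [Finset.sum_comm]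
    calc _ ≤ ∑ j ∈ T, ∑ i, A i j := Finset.sum_le_sum fun j _ =>
            Finset.sum_le_univ_sum_of_nonneg fun i => hA0 i j
      _ ≤ ∑ j ∈ T, Δ := Finset.sum_le_sum fun i _ => hcol i
      _ = _ := by simp [ht]
  by_cases hST : s * t = 0
  · have hz : ∑ i ∈ S, ∑ j ∈ T, (A i j - P i j) = 0 := by
      rcases mul_eq_zero.1 hST with h | h
      · have : S = ∅ := by rw [← Finset.card_eq_zero]; rw [hs] at h; exact_mod_cast h
        simp [this]
      · have : T = ∅ := by rw [← Finset.card_eq_zero]; rw [ht] at h; exact_mod_cast h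
        simp [this]
    rw [hz, hST]; simp
  have hspos : 0 < s := lt_of_le_of_ne hs0 fun h => hST (by rw [← h, zero_mul])
  have htpos : 0 < t := lt_of_le_of_ne ht0 fun h => hST (by rw [← h, mul_zero])
  have hnpos : (0 : ℝ) < n := lt_of_lt_of_le hspos hsn
  have hρ0 : 0 ≤ ρ := by
    obtain ⟨i, -⟩ := Finset.card_pos.1 (by rw [hs] at hspos; exact_mod_cast hspos : 0 < S.card)
    exact (hP0 i i).trans (hPρ i i)
  have hΔ0 : 0 ≤ Δ := (mul_nonneg hn0 hρ0).trans hρ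
  set g := √(s * t) with hg
  have hg2 : g * g = s * t := Real.mul_self_sqrt (by positivity)
  have hgpos : 0 < g := Real.sqrt_pos.2 (by positivity)
  have key : ∀ B, ∑ i ∈ S, ∑ j ∈ T, A i j ≤ B → ∑ i ∈ S, ∑ j ∈ T, P i j ≤ B →
      |∑ i ∈ S, ∑ j ∈ T, (A i j - P i j)| ≤ B := by
    intro B h h'
    rw [hX, abs_le]
    constructor <;> linarith
  have hcase : ∀ z : ℝ, 0 ≤ z → k * z < g → z * Δ ≤ a * g := by
    intro z hz hzg
    calc z * Δ ≤ z * (a * k) := mul_le_mul_of_nonneg_left h1 hz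
      _ = a * (k * z) := by ring
      _ ≤ a * g := mul_le_mul_of_nonneg_left hzg.le ha
  -- Very unequal sizes: the degree bound alone suffices, because `s Δ ≤ a k s < a √(s t)`, and
  -- symmetrically for `t`.
  by_cases c1 : k * s < g
  · refine key _ (hAs.trans (hcase s hs0 c1)) (hPst.trans (le_trans ?_ (hcase s hs0 c1)))
    rw [mul_assoc]
    exact mul_le_mul_of_nonneg_left ((mul_le_mul_of_nonneg_right htn hρ0).trans hρ) hs0
  by_cases c2 : k * t < g
  · refine key _ (hAt.trans (hcase t ht0 c2)) (hPst.trans (le_trans ?_ (hcase t ht0 c2)))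
    rw [mul_comm s, mul_assoc]
    exact mul_le_mul_of_nonneg_left ((mul_le_mul_of_nonneg_right hsn hρ0).trans hρ) ht0
  have c1' : t ≤ k * g := by
    have : g * g ≤ k * s * g := mul_le_mul_of_nonneg_right (not_lt.1 c1) hgpos.le
    rw [hg2] at this
    exact le_of_mul_le_mul_left (by linarith : s * t ≤ s * (k * g)) hspos
  have c2' : s ≤ k * g := by
    have : g * g ≤ k * t * g := mul_le_mul_of_nonneg_right (not_lt.1 c2) hgpos.le
    rw [hg2] at this
    exact le_of_mul_le_mul_left (by linarith : t * s ≤ t * (k * g)) htpos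
  -- Now `s` and `t` are both at most `k √(s t)`. Small sets are handled by the sparsity of `S ∪ T`,
  -- large ones by the cut norm.
  by_cases c3 : s + t ≤ κ * n
  · refine key _ ?_ (hPst.trans ?_)
    · have hU : ((S ∪ T).card : ℝ) ≤ s + t := by
        rw [hs, ht]; exact_mod_cast Finset.card_union_le S T
      calc _ ≤ ∑ i ∈ S ∪ T, ∑ j ∈ S ∪ T, A i j := by
            refine (Finset.sum_le_sum fun i _ => Finset.sum_le_sum_of_subset_of_nonneg
              (Finset.subset_union_right (s₁ := S)) fun j _ _ => hA0 i j).trans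
              (Finset.sum_le_sum_of_subset_of_nonneg Finset.subset_union_left fun i _ _ =>
                Finset.sum_nonneg fun j _ => hA0 i j)
        _ ≤ η * (S ∪ T).card := hsmall _ (hU.trans c3)
        _ ≤ η * (2 * (k * g)) := by
            refine mul_le_mul_of_nonneg_left ?_ hη
            linarith
        _ = 2 * η * k * g := by ring
        _ ≤ a * g := mul_le_mul_of_nonneg_right h2 hgpos.le
    · have : g ≤ κ * n := by
        have : g ≤ s + t := by
          rw [hg, Real.sqrt_le_iff]
          constructor
          · positivity
          · nlinarith [mul_pos hspos htpos, sq_nonneg s, sq_nonneg t]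
        linarith
      calc s * t * ρ = g * (g * ρ) := by rw [← hg2]; ring
        _ ≤ g * (ρ * (κ * n)) := by
            refine mul_le_mul_of_nonneg_left ?_ hgpos.le
            rw [mul_comm]
            exact mul_le_mul_of_nonneg_left this hρ0
        _ ≤ g * a := mul_le_mul_of_nonneg_left h3 hgpos.le
        _ = _ := mul_comm _ _
  · refine (hcut S T).trans ?_
    have h5 : κ * n ≤ 2 * k * g := by linarith [not_le.1 c3]
    by_cases hζ : ζ ≤ 0
    · exact (mul_nonpos_of_nonpos_of_nonneg hζ hn0).trans (by positivity)
    · have h6 : κ * (ζ * n) ≤ κ * (a * g) := by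
        have := mul_le_mul_of_nonneg_left h5 (not_le.1 hζ).le
        have := mul_le_mul_of_nonneg_right h4 hgpos.le
        linarith
      exact le_of_mul_le_mul_left h6 hκ

end CorrSBM
end

noncomputable section
namespace CorrSBM

open Filter Topology

/-! ### The weights of the model -/

/-- The probability that `e` is an edge of the parent graph. -/
def parentProb (α β : ℝ) {n : ℕ} (σ : Fin n → ℤˣ) (e : Sym2 (Fin n)) : ℝ :=
  sbmWeight (logProb α n) (logProb β n) σ e

/-- The law of the states of the pairs. -/
def stW (α β s : ℝ) {n : ℕ} (σ : Fin n → ℤˣ) (e : Sym2 (Fin n)) : St → ℝ :=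
  edgeW s (parentProb α β σ e)

/-- The parameters of the model, for `n` so large that the edge probabilities are at most `1/2`. -/
structure Adm (α β s : ℝ) (n : ℕ) : Prop where
  hα : 0 < α
  hβ : 0 < β
  hs0 : 0 ≤ s
  hs1 : s ≤ 1
  hn : 2 ≤ n
  half : max α β * Real.log n / n ≤ 1 / 2

theorem tendsto_log_nat : Tendsto (fun n : ℕ => Real.log n) atTop atTop :=
  Real.tendsto_log_atTop.comp tendsto_natCast_atTop_atTop

theorem tendsto_log_pow_div (k : ℕ) :
    Tendsto (fun n : ℕ => Real.log n ^ k / n) atTop (𝓝 0) := by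
  have h := (Real.isLittleO_pow_log_id_atTop (n := k)).tendsto_div_nhds_zero
  exact h.comp tendsto_natCast_atTop_atTop

theorem eventually_adm {α β s : ℝ} (hα : 0 < α) (hβ : 0 < β) (hs0 : 0 ≤ s) (hs1 : s ≤ 1) :
    ∀ᶠ n : ℕ in atTop, Adm α β s n := by
  have h := (tendsto_log_pow_div 1).const_mul (max α β)
  rw [mul_zero] at h
  filter_upwards [h.eventually_le_const (by norm_num : (0 : ℝ) < 1 / 2), eventually_ge_atTop 2]
    with n h1 h2
  exact ⟨hα, hβ, hs0, hs1, h2, by rw [pow_one] at h1; rwa [mul_div_assoc]⟩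

section
variable {α β s : ℝ} {n : ℕ}

theorem Adm.log_pos (h : Adm α β s n) : 0 < Real.log n :=
  Real.log_pos (by exact_mod_cast h.hn)

theorem Adm.n_pos (h : Adm α β s n) : (0 : ℝ) < n := by
  have := h.hn; positivity

theorem logProb_coe {a C : ℝ} (ha : 0 ≤ a) (haC : a ≤ C) (hC : C * Real.log n / n ≤ 1) :
    (logProb a n : ℝ) = a * Real.log n / n := by
  unfold logProb
  rw [Set.coe_projIcc]
  have h0 : 0 ≤ Real.log n := Real.log_natCast_nonneg n
  have h1 : a * Real.log n / n ≤ 1 := le_trans (by gcongr) hC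
  rw [min_eq_right h1, max_eq_right (by positivity)]

open Classical in
theorem parentProb_mk (h : Adm α β s n) (σ : Fin n → ℤˣ) (i j : Fin n) :
    parentProb α β σ s(i, j) = (if σ i = σ j then α else β) * Real.log n / n := by
  have hh := h.half
  have : (∃ i' j', s(i, j) = s(i', j') ∧ σ i' = σ j') ↔ σ i = σ j := by
    constructor
    · rintro ⟨i', j', he, hσ⟩
      rcases Sym2.eq_iff.1 he with ⟨rfl, rfl⟩ | ⟨rfl, rfl⟩
      · exact hσ
      · exact hσ.symm
    · exact fun hσ => ⟨i, j, rfl, hσ⟩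
  unfold parentProb sbmWeight
  simp only [this]
  split_ifs
  · exact logProb_coe h.hα.le (le_max_left _ _) (by linarith)
  · exact logProb_coe h.hβ.le (le_max_right _ _) (by linarith)

theorem parentProb_nonneg (σ : Fin n → ℤˣ) (e : Sym2 (Fin n)) : 0 ≤ parentProb α β σ e :=
  (sbmWeight _ _ σ e).2.1

theorem parentProb_le (h : Adm α β s n) (σ : Fin n → ℤˣ) (e : Sym2 (Fin n)) :
    parentProb α β σ e ≤ max α β * Real.log n / n := by
  classical
  induction e with
  | _ i j =>
    rw [parentProb_mk h]
    have := h.log_pos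
    split_ifs
    · gcongr; exact le_max_left _ _
    · gcongr; exact le_max_right _ _

theorem stW_isWeight (h : Adm α β s n) (σ : Fin n → ℤˣ) : IsWeight (stW α β s σ) :=
  edgeW_isWeight h.hs0 h.hs1 (fun e => parentProb_nonneg σ e)
    (fun e => (parentProb_le h σ e).trans h.half)

/-- A kind of pairs which occurs with `κ` times the probability of a parent edge. -/
def KindProb (s : ℝ) (b : St → Bool) (κ : ℝ) : Prop :=
  (0 ≤ κ ∧ κ ≤ 1) ∧ ∀ p : ℝ, p * s < 1 → ∑ x, edgeW s p x * (if b x then 1 else 0) = p * κ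

theorem kindProb_isG1 (h0 : 0 ≤ s) (h1 : s ≤ 1) : KindProb s isG1 s :=
  ⟨⟨h0, h1⟩, fun _ h => edgeW_isG1 h⟩

theorem kindProb_isG2 (h0 : 0 ≤ s) (h1 : s ≤ 1) : KindProb s isG2 s :=
  ⟨⟨h0, h1⟩, fun _ _ => edgeW_isG2⟩

theorem kindProb_isH (h0 : 0 ≤ s) (h1 : s ≤ 1) : KindProb s isH (s ^ 2) :=
  ⟨⟨by positivity, pow_le_one₀ h0 h1⟩, fun _ _ => edgeW_isH⟩

theorem kindProb_isUn (h0 : 0 ≤ s) (h1 : s ≤ 1) : KindProb s isUn (1 - (1 - s) ^ 2) :=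
  ⟨⟨by nlinarith, by nlinarith⟩, fun _ h => edgeW_isUn h⟩

theorem parentProb_mul_lt (h : Adm α β s n) (σ : Fin n → ℤˣ) (e : Sym2 (Fin n)) :
    parentProb α β σ e * s < 1 := by
  have h1 := (parentProb_le h σ e).trans h.half
  nlinarith [parentProb_nonneg (α := α) (β := β) σ e, h.hs0, h.hs1]

theorem stW_kind (h : Adm α β s n) (σ : Fin n → ℤˣ) {b : St → Bool} {κ : ℝ}
    (hb : KindProb s b κ) (e : Sym2 (Fin n)) :
    ∑ x, stW α β s σ e x * (if b x then 1 else 0) = parentProb α β σ e * κ :=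
  hb.2 _ (parentProb_mul_lt h σ e)

theorem parentProb_mul_le (h : Adm α β s n) (σ : Fin n → ℤˣ) {b : St → Bool} {κ : ℝ}
    (hb : KindProb s b κ) (e : Sym2 (Fin n)) :
    parentProb α β σ e * κ ≤ max α β * Real.log n / n :=
  (mul_le_of_le_one_right (parentProb_nonneg σ e) hb.1.2).trans (parentProb_le h σ e)

/-- Upper tail for the number of pairs of a given kind in an indexed family of pairs. -/
theorem Pr_count_ge_le (h : Adm α β s n) (σ : Fin n → ℤˣ) {b : St → Bool} {κ : ℝ}
    (hb : KindProb s b κ) {K : Type*} (T : Finset K) (ι : K → Sym2 (Fin n))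
    (hι : Set.InjOn ι T) (l x : ℝ) (hl : 0 ≤ l) :
    Pr (stW α β s σ) {ω | x ≤ ∑ k ∈ T, if b (ω (ι k)) then (1 : ℝ) else 0} ≤
      Real.exp (T.card * (max α β * Real.log n / n) * (Real.exp l - 1) - l * x) := by
  have hw := stW_isWeight h σ
  have h1 := Ex_exp_sum_le hw T ι hι (fun _ => b) (fun k => parentProb α β σ (ι k) * κ)
    (fun _ => l) (fun k _ => stW_kind h σ hb (ι k))
  refine (Pr_le_Ex hw (f := fun ω => Real.exp (-(l * x)) *
    Real.exp (∑ k ∈ T, if b (ω (ι k)) then l else 0)) (fun ω => by positivity) fun ω hω => ?_).trans ?_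
  · rw [← Real.exp_add, Real.one_le_exp_iff]
    have h2 : x ≤ ∑ k ∈ T, if b (ω (ι k)) then (1 : ℝ) else 0 := hω
    have h3 := mul_le_mul_of_nonneg_left h2 hl
    rw [Finset.mul_sum] at h3
    simp only [mul_ite, mul_one, mul_zero] at h3
    linarith
  · rw [Ex_const_mul]
    have h4 : ∑ k ∈ T, parentProb α β σ (ι k) * κ * (Real.exp l - 1) ≤
        T.card * (max α β * Real.log n / n) * (Real.exp l - 1) := by
      rw [← Finset.sum_mul]
      refine mul_le_mul_of_nonneg_right ?_ (by linarith [Real.one_le_exp hl])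
      calc _ ≤ ∑ k ∈ T, max α β * Real.log n / n :=
            Finset.sum_le_sum fun k _ => parentProb_mul_le h σ hb _
        _ = _ := by simp
    calc _ ≤ Real.exp (-(l * x)) *
          Real.exp (T.card * (max α β * Real.log n / n) * (Real.exp l - 1)) :=
          mul_le_mul_of_nonneg_left (h1.trans (Real.exp_le_exp.2 h4)) (Real.exp_pos _).le
      _ = _ := by rw [← Real.exp_add]; ring_nf

open Classical in
/-- The number of neighbours in `A`, as a sum over pairs. -/
theorem nbrCount_gr (b : St → Bool) (ω : Sym2 (Fin n) → St) (A : Finset (Fin n)) (v : Fin n) :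
    (nbrCount (gr b ω) A v : ℝ) =
      ∑ j ∈ A.erase v, if b (ω s(v, j)) then (1 : ℝ) else 0 := by
  unfold nbrCount
  rw [Finset.card_filter]
  push_cast
  rw [← Finset.sum_subset (Finset.erase_subset v A)]
  · refine Finset.sum_congr rfl fun j hj => ?_
    simp [gr_adj, (Finset.ne_of_mem_erase hj).symm]
  · intro j hj hj'
    have : j = v := by by_contra hne; exact hj' (Finset.mem_erase.2 ⟨hne, hj⟩)
    simp [this]

theorem star_injOn (v : Fin n) (T : Set (Fin n)) : Set.InjOn (fun j => s(v, j)) T := by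
  intro i _ j _ hij
  exact Sym2.congr_right.1 hij

end

/-! ### Degrees and sparsity of small sets. -/

theorem tendsto_rpow_neg_nat {x : ℝ} (hx : 0 < x) :
    Tendsto (fun n : ℕ => Real.exp (-(x * Real.log n))) atTop (𝓝 0) := by
  refine Real.tendsto_exp_atBot.comp ?_
  exact tendsto_neg_atTop_atBot.comp (tendsto_log_nat.const_mul_atTop hx)

/-- The degrees are of logarithmic order. -/
theorem eventually_degree_le {α β s : ℝ} (hα : 0 < α) (hβ : 0 < β) (hs0 : 0 ≤ s) (hs1 : s ≤ 1)
    {b : St → Bool} {κ : ℝ} (hb : KindProb s b κ) :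
    ∀ η > 0, ∀ᶠ n : ℕ in atTop, ∀ σ : Fin n → ℤˣ,
      Pr (stW α β s σ) {ω | ∃ v, (2 * max α β + 2) * Real.log n ≤
        nbrCount (gr b ω) Finset.univ v} ≤ η := by
  intro η hη
  filter_upwards [eventually_adm hα hβ hs0 hs1,
    (tendsto_rpow_neg_nat one_pos).eventually_le_const hη] with n hn hsmall σ
  have hw := stW_isWeight hn σ
  refine le_trans ?_ hsmall
  refine (Pr_biUnion_le hw Finset.univ (fun v => {ω | (2 * max α β + 2) * Real.log n ≤
        nbrCount (gr b ω) Finset.univ v}) (by rintro ω ⟨v, hv⟩; exact ⟨v, by simp, hv⟩)).trans ?_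
  have hL := hn.log_pos
  have hnp := hn.n_pos
  have hM : 0 < max α β := lt_max_of_lt_left hα
  have h1 : ∀ v : Fin n, Pr (stW α β s σ) {ω | (2 * max α β + 2) * Real.log n ≤
        nbrCount (gr b ω) Finset.univ v} ≤ Real.exp (-(2 * Real.log n)) := by
    intro v
    simp_rw [nbrCount_gr]
    refine (Pr_count_ge_le hn σ hb (Finset.univ.erase v) (fun j => s(v, j)) (star_injOn v _) 1 _
      zero_le_one).trans (Real.exp_le_exp.2 ?_)
    have hc : ((Finset.univ.erase v).card : ℝ) ≤ n := by
      have := Finset.card_le_univ (Finset.univ.erase v)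
      rw [Fintype.card_fin] at this
      exact_mod_cast this
    have he : Real.exp 1 - 1 ≤ 2 := by linarith [Real.exp_one_lt_three]
    have he0 : 0 ≤ Real.exp 1 - 1 := by linarith [Real.add_one_le_exp (1 : ℝ)]
    have : ((Finset.univ.erase v).card : ℝ) * (max α β * Real.log n / n) * (Real.exp 1 - 1) ≤
        n * (max α β * Real.log n / n) * 2 := by gcongr
    have h3 : (n : ℝ) * (max α β * Real.log n / n) * 2 = 2 * max α β * Real.log n := by
      field_simp
    linarith
  refine (Finset.sum_le_sum fun v _ => h1 v).trans ?_
  simp only [Finset.sum_const, Finset.card_univ, Fintype.card_fin, nsmul_eq_mul]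
  nth_rewrite 1 [← Real.exp_log hnp]
  rw [← Real.exp_add, Real.exp_le_exp]
  linarith

/-- By the binomial theorem the full sum is `(1 + t)^n ≤ e^{n t}`. The empty set accounts for the 1.
-/
theorem sum_pow_card_le {n : ℕ} {t : ℝ} (ht : 0 ≤ t) (hnt : n * t ≤ 1) :
    ∑ R : Finset (Fin n) with R.Nonempty, t ^ R.card ≤ 2 * (n * t) := by
  classical
  have h1 := Finset.sum_pow_mul_eq_add_pow t 1 (Finset.univ : Finset (Fin n))
  simp only [one_pow, mul_one, Finset.powerset_univ, Finset.card_univ, Fintype.card_fin] at h1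
  rw [← Finset.sum_filter_add_sum_filter_not _ (fun R : Finset (Fin n) => R.Nonempty)] at h1
  have h2 : ∑ R : Finset (Fin n) with ¬ R.Nonempty, t ^ R.card = 1 := by
    have : (Finset.univ.filter fun R : Finset (Fin n) => ¬ R.Nonempty) = {∅} := by
      ext R; simp
    rw [this]; simp
  rw [h2] at h1
  have h3 : (t + 1) ^ n ≤ Real.exp (n * t) := by
    rw [Real.exp_nat_mul]
    exact pow_le_pow_left₀ (by linarith) (Real.add_one_le_exp t) n
  have h4 := (abs_le.1 (Real.abs_exp_sub_one_le (x := n * t) (by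
    rw [abs_of_nonneg (by positivity)]; exact hnt))).2
  rw [abs_of_nonneg (by positivity : (0 : ℝ) ≤ n * t)] at h4
  linarith

open Classical in
/-- The ordered pairs `i < j` in `S × T`. -/
def ltPairs {n : ℕ} (S T : Finset (Fin n)) : Finset (Fin n × Fin n) :=
  (S ×ˢ T).filter fun x => x.1 < x.2

theorem ltPairs_injOn {n : ℕ} (S T : Finset (Fin n)) :
    Set.InjOn (fun x : Fin n × Fin n => s(x.1, x.2)) (ltPairs S T) := by
  rintro ⟨i, j⟩ h ⟨i', j'⟩ h' he
  simp only [ltPairs, Finset.coe_filter, Finset.mem_product, Set.mem_ofPred_eq] at h h'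
  rcases Sym2.eq_iff.1 he with ⟨rfl, rfl⟩ | ⟨rfl, rfl⟩
  · rfl
  · exact absurd h.2 (not_lt.2 h'.2.le)

theorem sum_prod_eq_ltPairs {n : ℕ} (S T : Finset (Fin n)) (f : Fin n → Fin n → ℝ)
    (hf : ∀ i j, f i j = f j i) :
    ∑ i ∈ S, ∑ j ∈ T, f i j = ∑ x ∈ ltPairs S T, f x.1 x.2 + ∑ x ∈ ltPairs T S, f x.1 x.2 +
      ∑ i ∈ S ∩ T, f i i := by
  classical
  rw [← Finset.sum_product', ← Finset.sum_filter_add_sum_filter_not (S ×ˢ T) (fun x => x.1 < x.2),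
    ← Finset.sum_filter_add_sum_filter_not ((S ×ˢ T).filter fun x => ¬ x.1 < x.2)
      (fun x => x.2 < x.1), add_assoc]
  congr 1
  congr 1
  · refine Finset.sum_nbij' (fun x => (x.2, x.1)) (fun x => (x.2, x.1)) ?_ ?_ ?_ ?_ ?_
    · rintro ⟨i, j⟩ h
      simp only [ltPairs, Finset.mem_filter, Finset.mem_product] at h ⊢
      tauto
    · rintro ⟨i, j⟩ h
      simp only [ltPairs, Finset.mem_filter, Finset.mem_product] at h ⊢
      exact ⟨⟨⟨h.1.2, h.1.1⟩, not_lt.2 h.2.le⟩, h.2⟩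
    · intros; rfl
    · intros; rfl
    · rintro ⟨i, j⟩ _; exact hf _ _
  · refine Finset.sum_nbij' (fun x => x.1) (fun i => (i, i)) ?_ ?_ ?_ ?_ ?_
    · rintro ⟨i, j⟩ h
      simp only [Finset.mem_filter, Finset.mem_product, not_lt] at h
      have : i = j := le_antisymm h.2 h.1.2
      subst this
      simpa using h.1.1
    · intro i h
      simpa using h
    · rintro ⟨i, j⟩ h
      simp only [Finset.mem_filter, Finset.mem_product, not_lt] at h
      have : i = j := le_antisymm h.2 h.1.2
      simp [this]
    · intros; rfl
    · rintro ⟨i, j⟩ h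
      simp only [Finset.mem_filter, Finset.mem_product, not_lt] at h
      have : i = j := le_antisymm h.2 h.1.2
      simp [this]

open Classical in
/-- Small sets of vertices are sparse. -/
theorem eventually_sparse {α β s : ℝ} (hα : 0 < α) (hβ : 0 < β) (hs0 : 0 ≤ s) (hs1 : s ≤ 1)
    {b : St → Bool} {κ : ℝ} (hb : KindProb s b κ) {x κ₀ : ℝ} (hκ0 : 0 < κ₀) (hκ1 : κ₀ ≤ 1)
    (hx : max α β + 2 ≤ Real.log (κ₀⁻¹) * x) :
    ∀ η > 0, ∀ᶠ n : ℕ in atTop, ∀ σ : Fin n → ℤˣ,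
      Pr (stW α β s σ) {ω | ∃ R : Finset (Fin n), R.Nonempty ∧ (R.card : ℝ) ≤ κ₀ * n ∧
        x * Real.log n * R.card ≤ ∑ y ∈ ltPairs R R, if b (ω s(y.1, y.2)) then (1 : ℝ) else 0} ≤ η := by
  intro η hη
  have hlim := ((tendsto_rpow_neg_nat one_pos).const_mul 2)
  rw [mul_zero] at hlim
  filter_upwards [eventually_adm hα hβ hs0 hs1, hlim.eventually_le_const hη,
    (tendsto_rpow_neg_nat one_pos).eventually_le_const one_pos] with n hn hsmall hone σ
  have hw := stW_isWeight hn σ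
  have hL := hn.log_pos
  have hnp := hn.n_pos
  have hM : 0 < max α β := lt_max_of_lt_left hα
  have hnt : (n : ℝ) * Real.exp (-(2 * Real.log n)) = Real.exp (-(1 * Real.log n)) := by
    nth_rewrite 1 [← Real.exp_log hnp]
    rw [← Real.exp_add]; ring_nf
  refine (Pr_biUnion_le hw (Finset.univ.filter fun R : Finset (Fin n) => R.Nonempty)
    (fun R => {ω | (R.card : ℝ) ≤ κ₀ * n ∧ x * Real.log n * R.card ≤
      ∑ y ∈ ltPairs R R, if b (ω s(y.1, y.2)) then (1 : ℝ) else 0})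
    (by rintro ω ⟨R, h1, h2⟩; exact ⟨R, by simpa using h1, h2⟩)).trans ?_
  have hterm : ∀ R : Finset (Fin n), Pr (stW α β s σ) {ω | (R.card : ℝ) ≤ κ₀ * n ∧
      x * Real.log n * R.card ≤ ∑ y ∈ ltPairs R R, if b (ω s(y.1, y.2)) then (1 : ℝ) else 0} ≤
      Real.exp (-(2 * Real.log n)) ^ R.card := by
    intro R
    by_cases hR : (R.card : ℝ) ≤ κ₀ * n
    · have hl : 0 ≤ Real.log κ₀⁻¹ := Real.log_nonneg (one_le_inv_iff₀.2 ⟨hκ0, hκ1⟩)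
      refine (Pr_mono hw fun ω hω => hω.2).trans ((Pr_count_ge_le hn σ hb (ltPairs R R)
        (fun y => s(y.1, y.2)) (ltPairs_injOn R R) (Real.log κ₀⁻¹) _ hl).trans ?_)
      rw [← Real.exp_nat_mul, Real.exp_le_exp, Real.exp_log (by positivity)]
      have hc : ((ltPairs R R).card : ℝ) ≤ (R.card : ℝ) * R.card := by
        have := Finset.card_filter_le (R ×ˢ R) fun x => x.1 < x.2
        rw [Finset.card_product] at this
        exact_mod_cast this
      have h1 : ((ltPairs R R).card : ℝ) * (max α β * Real.log n / n) * (κ₀⁻¹ - 1) ≤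
          R.card * (max α β * Real.log n) := by
        calc _ ≤ (R.card : ℝ) * R.card * (max α β * Real.log n / n) * κ₀⁻¹ := by
              have : κ₀⁻¹ - 1 ≤ κ₀⁻¹ := by linarith
              gcongr
              linarith [one_le_inv_iff₀.2 ⟨hκ0, hκ1⟩]
          _ ≤ (R.card : ℝ) * (κ₀ * n) * (max α β * Real.log n / n) * κ₀⁻¹ := by gcongr
          _ = _ := by field_simp
      have h2 : R.card * (max α β * Real.log n) + 2 * Real.log n * R.card ≤
          Real.log κ₀⁻¹ * (x * Real.log n * R.card) := by
        have : 0 ≤ Real.log n * R.card := by positivity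
        nlinarith [mul_le_mul_of_nonneg_right hx this]
      linarith
    · have : {ω | (R.card : ℝ) ≤ κ₀ * n ∧ x * Real.log n * R.card ≤
        ∑ y ∈ ltPairs R R, if b (ω s(y.1, y.2)) then (1 : ℝ) else 0} ⊆ (∅ : Set (Sym2 (Fin n) → St)) :=
        fun ω hω => hR hω.1
      refine (Pr_mono hw this).trans ?_
      simp only [Pr, Set.indicator_empty, Ex_const hw]
      positivity
  refine (Finset.sum_le_sum fun R _ => hterm R).trans
    ((sum_pow_card_le (Real.exp_pos _).le ?_).trans ?_)
  · rw [hnt]; exact hone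
  · rw [hnt]; exact hsmall

end CorrSBM
end

/-! ### Operator norm of the centered adjacency matrix. -/

noncomputable section
namespace CorrSBM

open Filter Topology Matrix

/-- Cut norm bound for the centered adjacency matrix of the first graph. -/
theorem eventually_cut {α β s : ℝ} (hα : 0 < α) (hβ : 0 < β) (hs0 : 0 ≤ s) (hs1 : s ≤ 1)
    {ζ : ℝ} (hζ : 0 < ζ) :
    ∀ η > 0, ∀ᶠ n : ℕ in atTop, ∀ σ : Fin n → ℤˣ,
      Pr (stW α β s σ) {ω | ∃ S T : Finset (Fin n), ζ * Real.log n * n <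
        |∑ y ∈ ltPairs S T, ((if isG1 (ω s(y.1, y.2)) then (1 : ℝ) else 0) -
          parentProb α β σ s(y.1, y.2) * s)|} ≤ η := by
  intro η hη
  have hM : 0 < max α β := lt_max_of_lt_left hα
  -- The variance term `t² · max α β · n log n` uses up at most half of `t ζ n log n`. The other
  -- half eventually exceeds `(2 log 2 + 1) n` and beats the `4^n` pairs `(S, T)`.
  set t := min 1 (ζ / (2 * max α β)) with ht
  have ht0 : 0 < t := by positivity
  have ht1 : t ≤ 1 := min_le_left _ _
  have htM : t * max α β ≤ ζ / 2 := by
    have : t ≤ ζ / (2 * max α β) := min_le_right _ _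
    calc _ ≤ ζ / (2 * max α β) * max α β := by gcongr
      _ = _ := by field_simp
  have hlim : Tendsto (fun n : ℕ => 2 * Real.exp (-(n : ℝ))) atTop (𝓝 0) := by
    simpa using (Real.tendsto_exp_atBot.comp
      (tendsto_neg_atTop_atBot.comp tendsto_natCast_atTop_atTop)).const_mul (2 : ℝ)
  filter_upwards [eventually_adm hα hβ hs0 hs1, hlim.eventually_le_const hη,
    (tendsto_log_nat.const_mul_atTop (by positivity : 0 < t * ζ / 2)).eventually_ge_atTop
      (2 * Real.log 2 + 1)] with n hn hsmall hbig σ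
  have hw := stW_isWeight hn σ
  have hL := hn.log_pos
  have hnp := hn.n_pos
  refine le_trans ?_ hsmall
  refine (Pr_biUnion_le hw (Finset.univ : Finset (Finset (Fin n) × Finset (Fin n)))
    (fun z => {ω | ζ * Real.log n * n < |∑ y ∈ ltPairs z.1 z.2,
      ((if isG1 (ω s(y.1, y.2)) then (1 : ℝ) else 0) - parentProb α β σ s(y.1, y.2) * s)|})
    (by rintro ω ⟨S, T, h⟩; exact ⟨(S, T), by simp, h⟩)).trans ?_
  have hterm : ∀ z : Finset (Fin n) × Finset (Fin n),
      Pr (stW α β s σ) {ω | ζ * Real.log n * n < |∑ y ∈ ltPairs z.1 z.2,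
      ((if isG1 (ω s(y.1, y.2)) then (1 : ℝ) else 0) - parentProb α β σ s(y.1, y.2) * s)|} ≤
      2 * Real.exp (-((2 * Real.log 2 + 1) * n)) := by
    intro z
    have hq1 : ∀ e, parentProb α β σ e * s < 1 := parentProb_mul_lt hn σ
    have hq0 : ∀ e, 0 ≤ parentProb α β σ e * s := fun e => mul_nonneg (parentProb_nonneg σ e) hs0
    have hk := stW_kind hn σ (kindProb_isG1 hs0 hs1)
    have hbd : ∀ e, parentProb α β σ e * s ≤ max α β * Real.log n / n :=
      parentProb_mul_le hn σ (kindProb_isG1 hs0 hs1)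
    have hmain := Pr_centered_le hw (ltPairs z.1 z.2) (fun y => s(y.1, y.2))
      (ltPairs_injOn z.1 z.2)
      (fun y x => (if isG1 x then (1 : ℝ) else 0) - parentProb α β σ s(y.1, y.2) * s)
      (fun _ => max α β * Real.log n / n) t (ζ * Real.log n * n)
      (by rw [abs_of_nonneg ht0.le]; exact ht1) ht0.le ?_ ?_ ?_
    · refine hmain.trans ?_
      have hc : ((ltPairs z.1 z.2).card : ℝ) ≤ n * n := by
        have := Finset.card_le_univ (ltPairs z.1 z.2)
        simp only [Fintype.card_prod, Fintype.card_fin] at this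
        exact_mod_cast this
      have h1 : t ^ 2 * ∑ _k ∈ ltPairs z.1 z.2, max α β * Real.log n / n ≤
          t * (ζ / 2) * Real.log n * n := by
        rw [Finset.sum_const, nsmul_eq_mul]
        calc _ ≤ t ^ 2 * (n * n * (max α β * Real.log n / n)) := by gcongr
          _ = t * (t * max α β) * Real.log n * n := by field_simp
          _ ≤ _ := by gcongr
      have h2 := mul_le_mul_of_nonneg_right hbig hnp.le
      gcongr
      nlinarith
    · intro y _ x
      have h1 := hq1 s(y.1, y.2)
      have h0 := hq0 s(y.1, y.2)
      rw [abs_le]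
      split_ifs <;> constructor <;> linarith
    · intro y _
      simp_rw [mul_sub]
      rw [Finset.sum_sub_distrib, hk, ← Finset.sum_mul, hw.sum_one, one_mul, sub_self]
    · intro y _
      refine le_trans ?_ (hbd s(y.1, y.2))
      calc _ = ∑ x, (stW α β s σ s(y.1, y.2) x * (if isG1 x then 1 else 0) *
          (1 - 2 * (parentProb α β σ s(y.1, y.2) * s)) +
          stW α β s σ s(y.1, y.2) x * (parentProb α β σ s(y.1, y.2) * s) ^ 2) := by
            refine Finset.sum_congr rfl fun x _ => ?_
            split_ifs <;> ring
        _ ≤ _ := by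
            rw [Finset.sum_add_distrib, ← Finset.sum_mul, ← Finset.sum_mul, hk, hw.sum_one]
            nlinarith [sq_nonneg (parentProb α β σ s(y.1, y.2) * s)]
  refine (Finset.sum_le_sum fun z _ => hterm z).trans (le_of_eq ?_)
  simp only [Finset.sum_const, Finset.card_univ, Fintype.card_prod, Fintype.card_finset,
    Fintype.card_fin, nsmul_eq_mul]
  push_cast
  have : (2 : ℝ) ^ n = Real.exp (n * Real.log 2) := by
    rw [Real.exp_nat_mul, Real.exp_log two_pos]
  rw [this, ← Real.exp_add, mul_left_comm, ← Real.exp_add]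
  congr 2
  ring

theorem probMatrix_apply {n : ℕ} {α β s : ℝ} (hn : Adm α β s n) (σ : Fin n → ℤˣ) (i j : Fin n) :
    probMatrix (s * α * Real.log n / n) (s * β * Real.log n / n) σ i j =
      parentProb α β σ s(i, j) * s := by
  classical
  rw [parentProb_mk hn, probMatrix, of_apply]
  split_ifs <;> ring

open Classical in
theorem adj_gr_apply {n : ℕ} (b : St → Bool) (ω : Sym2 (Fin n) → St) (i j : Fin n) :
    adj (gr b ω) i j = if i ≠ j ∧ b (ω s(i, j)) = true then (1 : ℝ) else 0 := by
  simp [adj, SimpleGraph.adjMatrix_apply, gr_adj]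

/-- The adjacency matrix of the first graph is close to its mean in operator norm. -/
theorem eventually_quad {α β s : ℝ} (hα : 0 < α) (hβ : 0 < β) (hs0 : 0 ≤ s) (hs1 : s ≤ 1)
    {δ : ℝ} (hδ : 0 < δ) :
    ∀ η > 0, ∀ᶠ n : ℕ in atTop, ∀ σ : Fin n → ℤˣ,
      Pr (stW α β s σ) {ω | ∃ x : Fin n → ℝ, δ * Real.log n * (x ⬝ᵥ x) <
        |x ⬝ᵥ (adj (gr isG1 ω) -
          probMatrix (s * α * Real.log n / n) (s * β * Real.log n / n) σ) *ᵥ x|} ≤ η := by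
  classical
  intro η hη
  set C := max α β with hC
  have hC0 : 0 < C := lt_max_of_lt_left hα
  set Δ := 2 * C + 2 with hΔ
  have hΔ0 : 0 < Δ := by positivity
  -- `γ` makes the contribution of distant dyadic levels at most `δ/2`, and `a` makes that of close
  -- levels equal to `δ/2`. Then `k`, `η'`, `κ`, `ζ` are read off from the four numerical hypotheses
  -- of `discrepancy_of_sparse`, with `κ` small enough for `eventually_sparse` too.
  obtain ⟨γ, hγ⟩ : ∃ γ : ℕ, 2 * ((2 : ℝ) ^ γ)⁻¹ * (2 * Δ) ≤ δ / 2 := by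
    obtain ⟨γ, hγ⟩ := exists_pow_lt_of_lt_one (by positivity : 0 < δ / (8 * Δ))
      (by norm_num : (1 / 2 : ℝ) < 1)
    refine ⟨γ, ?_⟩
    rw [one_div, inv_pow] at hγ
    have h1 : ((2 : ℝ) ^ γ)⁻¹ * (8 * Δ) ≤ δ := by
      rw [lt_div_iff₀ (by positivity)] at hγ; exact hγ.le
    linarith
  set a := δ / (32 * (2 * γ + 1)) with ha
  have ha0 : 0 < a := by positivity
  set k := Δ / a with hk
  have hk0 : 0 < k := by positivity
  set η' := a / (2 * k) with hη'
  have hη'0 : 0 < η' := by positivity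
  set κ := min 1 (min (a / C) (Real.exp (-((C + 2) / (η' / 2))))) with hκ
  have hκ0 : 0 < κ := lt_min one_pos (lt_min (by positivity) (Real.exp_pos _))
  have hκ1 : κ ≤ 1 := min_le_left _ _
  have hκC : C * κ ≤ a := by
    have : κ ≤ a / C := (min_le_right _ _).trans (min_le_left _ _)
    rw [le_div_iff₀ hC0] at this; linarith
  have hκlog : C + 2 ≤ Real.log κ⁻¹ * (η' / 2) := by
    have h1 : κ ≤ Real.exp (-((C + 2) / (η' / 2))) := (min_le_right _ _).trans (min_le_right _ _)
    have h2 : (C + 2) / (η' / 2) ≤ Real.log κ⁻¹ := by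
      rw [Real.log_inv]
      have := Real.log_le_log hκ0 h1
      rw [Real.log_exp] at this
      linarith
    rwa [div_le_iff₀ (by positivity)] at h2
  set ζ := a * κ / (2 * k) with hζ
  have hζ0 : 0 < ζ := by positivity
  filter_upwards [eventually_adm hα hβ hs0 hs1,
    eventually_degree_le hα hβ hs0 hs1 (kindProb_isG1 hs0 hs1) (η / 3) (by positivity),
    eventually_sparse hα hβ hs0 hs1 (kindProb_isG1 hs0 hs1) hκ0 hκ1 hκlog (η / 3) (by positivity),
    eventually_cut hα hβ hs0 hs1 (by positivity : 0 < ζ / 3) (η / 3) (by positivity),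
    tendsto_natCast_atTop_atTop.eventually_ge_atTop (C / (ζ / 3))] with n hn hdeg hspa hcut hbig σ
  have hw := stW_isWeight hn σ
  have hL := hn.log_pos
  have hnp := hn.n_pos
  have hbig' : C ≤ ζ / 3 * n := by
    rw [div_le_iff₀ (by positivity)] at hbig; linarith
  refine (Pr_mono hw (T := {ω | ∃ v, Δ * Real.log n ≤ nbrCount (gr isG1 ω) Finset.univ v} ∪
    ({ω | ∃ R : Finset (Fin n), R.Nonempty ∧ (R.card : ℝ) ≤ κ * n ∧ η' / 2 * Real.log n * R.card ≤
        ∑ y ∈ ltPairs R R, if isG1 (ω s(y.1, y.2)) then (1 : ℝ) else 0} ∪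
      {ω | ∃ S T : Finset (Fin n), ζ / 3 * Real.log n * n <
        |∑ y ∈ ltPairs S T, ((if isG1 (ω s(y.1, y.2)) then (1 : ℝ) else 0) -
          parentProb α β σ s(y.1, y.2) * s)|})) ?_).trans ?_
  swap
  · refine (Pr_union_le hw _ _).trans ?_
    have := Pr_union_le hw {ω | ∃ R : Finset (Fin n), R.Nonempty ∧ (R.card : ℝ) ≤ κ * n ∧
        η' / 2 * Real.log n * R.card ≤
        ∑ y ∈ ltPairs R R, if isG1 (ω s(y.1, y.2)) then (1 : ℝ) else 0}
      {ω | ∃ S T : Finset (Fin n), ζ / 3 * Real.log n * n <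
        |∑ y ∈ ltPairs S T, ((if isG1 (ω s(y.1, y.2)) then (1 : ℝ) else 0) -
          parentProb α β σ s(y.1, y.2) * s)|}
    have := hdeg σ
    have := hspa σ
    have := hcut σ
    linarith
  intro ω hω
  by_contra hcon
  simp only [Set.mem_union, Set.mem_ofPred_eq, not_or, not_exists, not_and, not_le, not_lt] at hcon
  obtain ⟨hdeg', hspa', hcut'⟩ := hcon
  obtain ⟨x, hx⟩ := hω
  refine absurd hx (not_lt.2 ?_)
  set A : Fin n → Fin n → ℝ := fun i j => adj (gr isG1 ω) i j with hA
  set P : Fin n → Fin n → ℝ := fun i j => parentProb α β σ s(i, j) * s with hP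
  have hA0 : ∀ i j, 0 ≤ A i j := by
    intro i j
    simp only [hA, adj_gr_apply]
    split_ifs <;> simp
  have hAsymm : ∀ i j, A i j = A j i := fun i j => by
    simp only [hA, adj_gr_apply, ne_comm, Sym2.eq_swap]
  have hPsymm : ∀ i j, P i j = P j i := fun i j => by simp only [hP, Sym2.eq_swap]
  have hP0 : ∀ i j, 0 ≤ P i j := fun i j => mul_nonneg (parentProb_nonneg _ _) hs0
  have hPρ : ∀ i j, P i j ≤ C * Real.log n / n := fun i j =>
    parentProb_mul_le hn σ (kindProb_isG1 hs0 hs1) _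
  have hρ : (n : ℝ) * (C * Real.log n / n) = C * Real.log n := by field_simp
  have hrow : ∀ v, ∑ w, A v w ≤ Δ * Real.log n := by
    intro v
    refine le_of_eq_of_le ?_ (hdeg' v).le
    simp only [nbrCount, Finset.card_filter, hA, adj, SimpleGraph.adjMatrix_apply]
    push_cast
    rfl
  have hcol : ∀ w, ∑ v, A v w ≤ Δ * Real.log n := fun w => by
    simp_rw [hAsymm _ w]; exact hrow w
  have hAlt : ∀ S T : Finset (Fin n), ∀ y ∈ ltPairs S T,
      A y.1 y.2 = if isG1 (ω s(y.1, y.2)) then (1 : ℝ) else 0 := by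
    intro S T y hy
    have : y.1 ≠ y.2 := (Finset.mem_filter.1 hy).2.ne
    simp only [hA, adj_gr_apply, this, ne_eq, not_false_eq_true, true_and]
  have hsmall : ∀ R : Finset (Fin n), (R.card : ℝ) ≤ κ * n →
      ∑ i ∈ R, ∑ j ∈ R, A i j ≤ η' * Real.log n * R.card := by
    intro R hR
    rcases R.eq_empty_or_nonempty with rfl | hne
    · simp
    have h1 := hspa' R hne hR
    rw [sum_prod_eq_ltPairs R R A hAsymm, Finset.sum_congr rfl (hAlt R R)]
    have h2 : ∑ i ∈ R ∩ R, A i i = 0 := Finset.sum_eq_zero fun i _ => by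
      simp [hA, adj_gr_apply]
    rw [h2]
    linarith
  have hcut'' : ∀ S T : Finset (Fin n), |∑ i ∈ S, ∑ j ∈ T, (A i j - P i j)| ≤
      ζ * Real.log n * n := by
    intro S T
    rw [sum_prod_eq_ltPairs S T (fun i j => A i j - P i j)
      (fun i j => by rw [hAsymm, hPsymm])]
    have e1 : ∀ S T : Finset (Fin n), |∑ y ∈ ltPairs S T, (A y.1 y.2 - P y.1 y.2)| ≤
        ζ / 3 * Real.log n * n := by
      intro S T
      refine le_trans (le_of_eq ?_) (hcut' S T)
      congr 1
      exact Finset.sum_congr rfl fun y hy => by rw [hAlt S T y hy]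
    -- The mean matrix has a nonzero diagonal and the adjacency matrix does not. The difference
    -- totals at most `C log n`, negligible against `ζ n log n / 3`.
    have e2 : |∑ i ∈ S ∩ T, (A i i - P i i)| ≤ ζ / 3 * Real.log n * n := by
      refine (Finset.abs_sum_le_sum_abs _ _).trans ?_
      calc _ ≤ ∑ i ∈ S ∩ T, C * Real.log n / n := Finset.sum_le_sum fun i _ => by
            have : A i i = 0 := by simp [hA, adj_gr_apply]
            rw [this, zero_sub, abs_neg, abs_of_nonneg (hP0 i i)]
            exact hPρ i i
        _ ≤ n * (C * Real.log n / n) := by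
            rw [Finset.sum_const, nsmul_eq_mul]
            have hc : ((S ∩ T).card : ℝ) ≤ n := by
              have := Finset.card_le_univ (S ∩ T)
              rw [Fintype.card_fin] at this
              exact_mod_cast this
            gcongr
        _ = C * Real.log n := hρ
        _ ≤ ζ / 3 * n * Real.log n := mul_le_mul_of_nonneg_right hbig' hL.le
        _ = _ := by ring
    have e3 := abs_add_le (∑ y ∈ ltPairs S T, (A y.1 y.2 - P y.1 y.2) +
      ∑ y ∈ ltPairs T S, (A y.1 y.2 - P y.1 y.2)) (∑ i ∈ S ∩ T, (A i i - P i i))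
    have e4 := abs_add_le (∑ y ∈ ltPairs S T, (A y.1 y.2 - P y.1 y.2))
      (∑ y ∈ ltPairs T S, (A y.1 y.2 - P y.1 y.2))
    have := e1 S T
    have := e1 T S
    linarith
  have hak : a * k = Δ := by rw [hk]; field_simp
  have hη'k : 2 * η' * k = a := by rw [hη']; field_simp
  have hζk : 2 * ζ * k = a * κ := by rw [hζ]; field_simp
  have hdisc := discrepancy_of_sparse A P (a := a * Real.log n) (k := k) hA0 hP0 hPρ hκ0
    (by positivity : 0 ≤ η' * Real.log n) hrow hcol
    (by rw [hρ]; exact mul_le_mul_of_nonneg_right (by rw [hΔ]; linarith) hL.le) hsmall hcut''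
    (by rw [← hak]; exact le_of_eq (by ring))
    (by rw [← hη'k]; exact le_of_eq (by ring))
    (by
      calc C * Real.log n / n * (κ * n) = C * κ * Real.log n := by field_simp
        _ ≤ _ := mul_le_mul_of_nonneg_right hκC hL.le)
    (by
      calc 2 * (ζ * Real.log n) * k = 2 * ζ * k * Real.log n := by ring
        _ ≤ _ := by rw [hζk]; exact le_of_eq (by ring))
    (by positivity)
  have hrowX : ∀ v, ∑ w, |A v w - P v w| ≤ 2 * Δ * Real.log n := by
    intro v
    calc _ ≤ ∑ w, (A v w + P v w) := Finset.sum_le_sum fun w _ => by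
          have := hA0 v w; have := hP0 v w
          rw [abs_le]; constructor <;> linarith
      _ ≤ Δ * Real.log n + n * (C * Real.log n / n) := by
          rw [Finset.sum_add_distrib]
          refine add_le_add (hrow v) ?_
          calc _ ≤ ∑ _w : Fin n, C * Real.log n / n := Finset.sum_le_sum fun w _ => hPρ v w
            _ = _ := by simp
      _ ≤ _ := by
          rw [hρ, hΔ]
          nlinarith
  have hquad := abs_quad_le_of_discrepancy (fun i j => A i j - P i j)
    (by positivity : 0 ≤ a * Real.log n) hrowX
    (fun w => by
      have := hrowX w
      simp_rw [hAsymm w, hPsymm w] at this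
      exact this) hdisc γ x
  have heq : x ⬝ᵥ (adj (gr isG1 ω) -
          probMatrix (s * α * Real.log n / n) (s * β * Real.log n / n) σ) *ᵥ x =
      ∑ v, ∑ w, (A v w - P v w) * x v * x w := by
    simp only [dotProduct, mulVec, Finset.mul_sum, Matrix.sub_apply, probMatrix_apply hn]
    refine Finset.sum_congr rfl fun v _ => Finset.sum_congr rfl fun w _ => ?_
    simp only [hA, hP]
    ring
  rw [heq]
  refine hquad.trans ?_
  have hxx : x ⬝ᵥ x = ∑ v, x v ^ 2 := by
    simp [dotProduct, sq]
  rw [hxx]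
  refine mul_le_mul_of_nonneg_right ?_ (Finset.sum_nonneg fun v _ => sq_nonneg _)
  have h16 : 16 * a * (2 * γ + 1) = δ / 2 := by
    rw [ha]; field_simp; norm_num
  calc 16 * (a * Real.log n) * (2 * γ + 1) + 2 * ((2 : ℝ) ^ γ)⁻¹ * (2 * Δ * Real.log n) =
      (16 * a * (2 * γ + 1) + 2 * ((2 : ℝ) ^ γ)⁻¹ * (2 * Δ)) * Real.log n := by ring
    _ ≤ (δ / 2 + δ / 2) * Real.log n := by
        rw [h16]
        gcongr
    _ = _ := by ring

end CorrSBM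
end

noncomputable section
namespace CorrSBM

open Filter Topology

/-! ### Correctness of core matchings -/

/-- A set on which an injective map without fixed points acts has a subset of at least a third of the
weight which is disjoint from its image. -/
theorem exists_disjoint_image {E : Type*} [DecidableEq E] (f : E → E) (w : E → ℕ) (A : Finset E)
    (hinj : Set.InjOn f A) (hfix : ∀ e ∈ A, f e ≠ e) :
    ∃ T ⊆ A, (∀ e ∈ T, ∀ e' ∈ T, f e ≠ e') ∧ ∑ e ∈ A, w e ≤ 3 * ∑ e ∈ T, w e := by
  induction A using Finset.strongInduction with
  | H A ih =>
    rcases A.eq_empty_or_nonempty with rfl | hne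
    · exact ⟨∅, by simp, by simp, by simp⟩
    obtain ⟨e, he, hmax⟩ := Finset.exists_max_image A w hne
    -- Greedy choice: the heaviest element conflicts only with itself, its image and at most one
    -- preimage, so discarding `N` costs at most three times its weight.
    set N := A.filter fun x => x = e ∨ x = f e ∨ f x = e with hN
    have heN : e ∈ N := Finset.mem_filter.2 ⟨he, Or.inl rfl⟩
    have hNA : N ⊆ A := Finset.filter_subset _ _
    have hss : A \ N ⊂ A := Finset.sdiff_ssubset hNA ⟨e, heN⟩
    obtain ⟨T, hT, hT1, hT2⟩ := ih (A \ N) hss (hinj.mono (by exact_mod_cast hss.subset))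
      (fun x hx => hfix x (hss.subset hx))
    have heT : e ∉ T := fun h => (Finset.mem_sdiff.1 (hT h)).2 heN
    have hTA : ∀ x ∈ T, x ∈ A ∧ x ≠ e ∧ x ≠ f e ∧ f x ≠ e := by
      intro x hx
      have h1 := Finset.mem_sdiff.1 (hT hx)
      have h2 : ¬ (x = e ∨ x = f e ∨ f x = e) := fun h => h1.2 (Finset.mem_filter.2 ⟨h1.1, h⟩)
      push Not at h2
      exact ⟨h1.1, h2⟩
    refine ⟨insert e T, ?_, ?_, ?_⟩
    · intro x hx
      rcases Finset.mem_insert.1 hx with rfl | hx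
      · exact he
      · exact (hTA x hx).1
    · intro x hx y hy
      rcases Finset.mem_insert.1 hx with hx | hx <;> rcases Finset.mem_insert.1 hy with hy | hy
      · rw [hx, hy]; exact hfix _ he
      · rw [hx]; exact fun h => (hTA y hy).2.2.1 h.symm
      · rw [hy]; exact (hTA x hx).2.2.2
      · exact hT1 x hx y hy
    · rw [Finset.sum_insert heT, ← Finset.sum_sdiff hNA]
      have hcard : N.card ≤ 3 := by
        have hsub : N ⊆ {e} ∪ ({f e} ∪ A.filter fun x => f x = e) := by
          intro x hx
          have := Finset.mem_filter.1 hx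
          simp only [Finset.mem_union, Finset.mem_singleton, Finset.mem_filter]
          tauto
        have h3 : (A.filter fun x => f x = e).card ≤ 1 := by
          rw [Finset.card_le_one]
          intro x hx y hy
          have hx := Finset.mem_filter.1 hx
          have hy := Finset.mem_filter.1 hy
          exact hinj hx.1 hy.1 (hx.2.trans hy.2.symm)
        have h4 := Finset.card_le_card hsub
        have h5 := Finset.card_union_le {e} ({f e} ∪ A.filter fun x => f x = e)
        have h6 := Finset.card_union_le {f e} (A.filter fun x => f x = e)
        simp only [Finset.card_singleton] at h5 h6
        omega
      have hNsum : ∑ x ∈ N, w x ≤ 3 * w e := by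
        calc _ ≤ ∑ _x ∈ N, w e := Finset.sum_le_sum fun x hx => hmax x (hNA hx)
          _ = N.card * w e := by simp
          _ ≤ _ := Nat.mul_le_mul_right _ hcard
      omega

open Classical in
/-- The number of points of `D` in the pair `e`. -/
def wt {n : ℕ} (D : Finset (Fin n)) (e : Sym2 (Fin n)) : ℕ := (D.filter fun i => i ∈ e).card

open Classical in
/-- The points moved by `φ`. -/
def moved {n : ℕ} (φ : Fin n → Fin n) : Finset (Fin n) := Finset.univ.filter fun i => φ i ≠ i

theorem sum_wt {n : ℕ} [DecidableEq (Sym2 (Fin n))] (D : Finset (Fin n))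
    (A : Finset (Sym2 (Fin n))) [∀ i, DecidablePred fun e : Sym2 (Fin n) => i ∈ e] :
    ∑ e ∈ A, wt D e = ∑ i ∈ D, (A.filter fun e => i ∈ e).card := by
  classical
  simp only [wt, Finset.card_filter]
  rw [Finset.sum_comm]
  refine Finset.sum_congr rfl fun i _ => Finset.sum_congr rfl fun e _ => ?_
  congr

/-- A wrong core matching yields many pairs which are edges of the first graph and whose images are
edges of the second one. -/
theorem exists_pairs_of_wrong {n : ℕ} {G₁ G₂ : SimpleGraph (Fin n)} {m : Matching n}
    (hm : m.IsKCore 13 G₁ G₂) (hwrong : ∃ i ∈ m.M, m.μ i ≠ i) :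
    ∃ φ : Fin n → Fin n, (moved φ).Nonempty ∧ ∃ T : Finset (Sym2 (Fin n)),
      (∀ e ∈ T, e ∈ G₁.edgeSet ∧ e.map φ ∈ G₂.edgeSet ∧ 1 ≤ wt (moved φ) e) ∧
      (∀ e ∈ T, ∀ e' ∈ T, e.map φ ≠ e') ∧ Set.InjOn (Sym2.map φ) T ∧
      4 * (moved φ).card ≤ ∑ e ∈ T, wt (moved φ) e := by
  classical
  -- Extended by the identity, so every moved point is matched. `φ` is injective on `m.M` but
  -- perhaps not globally.
  let φ : Fin n → Fin n := fun i => if i ∈ m.M then m.μ i else i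
  have hφM : ∀ i ∈ m.M, φ i = m.μ i := fun i hi => by simp [φ, hi]
  have hD : ∀ i ∈ moved φ, i ∈ m.M := by
    intro i hi
    by_contra h
    have := (Finset.mem_filter.1 hi).2
    simp [φ, h] at this
  obtain ⟨i₀, hi₀, hi₀'⟩ := hwrong
  set H := m.inter G₁ G₂ with hH
  set A : Finset (Sym2 (Fin n)) := H.edgeFinset.filter fun e => 1 ≤ wt (moved φ) e with hA
  have hAH : ∀ e ∈ A, e ∈ H.edgeSet := fun e he => by
    have := (Finset.mem_filter.1 he).1
    simpa using this
  have hAedge : ∀ e ∈ A, e ∈ G₁.edgeSet ∧ e.map φ ∈ G₂.edgeSet ∧ ∀ i ∈ e, i ∈ m.M := by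
    intro e he
    have he' := hAH e he
    clear he
    induction e with
    | _ i j =>
      have h : i ∈ m.M ∧ j ∈ m.M ∧ G₁.Adj i j ∧ G₂.Adj (m.μ i) (m.μ j) := he'
      refine ⟨h.2.2.1, ?_, ?_⟩
      · rw [Sym2.map_mk, hφM i h.1, hφM j h.2.1]
        exact h.2.2.2
      · intro k hk
        rcases Sym2.mem_iff.1 hk with rfl | rfl
        · exact h.1
        · exact h.2.1
  have hinjA : Set.InjOn (Sym2.map φ) A := by
    intro e he e' he' h
    have h1 := (hAedge e he).2.2
    have h2 := (hAedge e' he').2.2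
    clear he he'
    have hφinj : ∀ a ∈ m.M, ∀ b ∈ m.M, φ a = φ b → a = b := fun a ha b hb hab =>
      m.injOn ha hb (by rwa [hφM a ha, hφM b hb] at hab)
    induction e with
    | _ i j =>
      induction e' with
      | _ i' j' =>
        rw [Sym2.map_mk, Sym2.map_mk, Sym2.eq_iff] at h
        have hi := h1 i (by simp)
        have hj := h1 j (by simp)
        have hi' := h2 i' (by simp)
        have hj' := h2 j' (by simp)
        rw [Sym2.eq_iff]
        rcases h with ⟨h, h'⟩ | ⟨h, h'⟩
        · exact Or.inl ⟨hφinj _ hi _ hi' h, hφinj _ hj _ hj' h'⟩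
        · exact Or.inr ⟨hφinj _ hi _ hj' h, hφinj _ hj _ hi' h'⟩
  have hAfilter : ∀ i ∈ moved φ, (A.filter fun e => i ∈ e) = H.incidenceFinset i := by
    intro i hi
    ext e
    simp only [hA, Finset.mem_filter, SimpleGraph.mem_edgeFinset, SimpleGraph.mem_incidenceFinset,
      SimpleGraph.incidenceSet, Set.mem_ofPred_eq]
    constructor
    · tauto
    · rintro ⟨h1, h2⟩
      refine ⟨⟨h1, ?_⟩, h2⟩
      exact Finset.card_pos.2 ⟨i, Finset.mem_filter.2 ⟨hi, h2⟩⟩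
  have hsumA : 13 * (moved φ).card ≤ ∑ e ∈ A, wt (moved φ) e := by
    rw [sum_wt]
    calc 13 * (moved φ).card = ∑ _i ∈ moved φ, 13 := by simp [mul_comm]
      _ ≤ _ := Finset.sum_le_sum fun i hi => by
          rw [hAfilter i hi, SimpleGraph.card_incidenceFinset_eq_degree]
          have h13 := hm i (hD i hi)
          convert h13
  set B := A.filter fun e => e.map φ ≠ e with hB
  -- A pair that contains a moved point `i` and is mapped to itself must be `{i, φ i}`, so each
  -- moved point loses at most one of its 13 edges.
  have hsumF : ∑ e ∈ A.filter (fun e => ¬ e.map φ ≠ e), wt (moved φ) e ≤ (moved φ).card := by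
    rw [sum_wt, Finset.card_eq_sum_ones]
    refine Finset.sum_le_sum fun i hi => ?_
    rw [Finset.card_le_one]
    have hmv : φ i ≠ i := (Finset.mem_filter.1 hi).2
    have key : ∀ e ∈ (A.filter (fun e => ¬ e.map φ ≠ e)).filter (fun e => i ∈ e),
        e = s(i, φ i) := by
      intro e he
      obtain ⟨he1, hie⟩ := Finset.mem_filter.1 he
      have hfix : e.map φ = e := not_not.1 (Finset.mem_filter.1 he1).2
      obtain ⟨j, rfl⟩ := Sym2.mem_iff_exists.1 hie
      rw [Sym2.map_mk, Sym2.eq_iff] at hfix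
      rcases hfix with ⟨h, -⟩ | ⟨h, -⟩
      · exact absurd h hmv
      · rw [h]
    intro e he e' he'
    rw [key e he, key e' he']
  have hsumB : 12 * (moved φ).card ≤ ∑ e ∈ B, wt (moved φ) e := by
    have h1 := Finset.sum_filter_add_sum_filter_not A (fun e => e.map φ ≠ e) (wt (moved φ))
    have h2 : ∑ e ∈ B, wt (moved φ) e = ∑ e ∈ A.filter (fun e => e.map φ ≠ e), wt (moved φ) e :=
      Finset.sum_congr (by ext; simp [hB]) fun _ _ => rfl
    rw [h2]
    omega
  have hBA : B ⊆ A := Finset.filter_subset _ _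
  -- A third of the remaining weight `12 d`. This is where 13 comes from: 4 per moved point is what
  -- the union bound needs.
  obtain ⟨T, hTB, hT1, hT2⟩ := exists_disjoint_image (Sym2.map φ) (wt (moved φ)) B
    (hinjA.mono (by exact_mod_cast hBA)) (fun e he => (Finset.mem_filter.1 he).2)
  refine ⟨φ, ⟨i₀, ?_⟩, T, fun e he => ?_, hT1, hinjA.mono (by exact_mod_cast hTB.trans hBA), by omega⟩
  · simp only [moved, Finset.mem_filter, Finset.mem_univ, true_and]
    rwa [hφM i₀ hi₀]
  · have := hAedge e (hBA (hTB he))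
    exact ⟨this.1, this.2.1, (Finset.mem_filter.1 (hBA (hTB he))).2⟩

/-- `T` is disjoint from its image and `f` is injective on it, so `2 |T|` distinct pairs are
involved and their states are independent. -/
theorem Pr_pairs_le {α β s : ℝ} {n : ℕ} (h : Adm α β s n) (σ : Fin n → ℤˣ)
    (f : Sym2 (Fin n) → Sym2 (Fin n)) (T : Finset (Sym2 (Fin n)))
    (hT : ∀ e ∈ T, ∀ e' ∈ T, f e ≠ e') (hinj : Set.InjOn f T) :
    Pr (stW α β s σ) {ω | ∀ e ∈ T, isG1 (ω e) = true ∧ isG2 (ω (f e)) = true} ≤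
      ((max α β * Real.log n / n) ^ 2) ^ T.card := by
  classical
  have hw := stW_isWeight h σ
  have hρ : 0 ≤ max α β * Real.log n / n := (parentProb_nonneg (α := α) (β := β) σ s(⟨0, by
    have := h.hn; omega⟩, ⟨0, by have := h.hn; omega⟩)).trans (parentProb_le h σ _)
  have h1 := Ex_prod_injOn hw (T ×ˢ (Finset.univ : Finset Bool))
    (fun k => if k.2 then f k.1 else k.1) (by
      rintro ⟨e, b⟩ he ⟨e', b'⟩ he' hee
      have he := (Finset.mem_product.1 he).1
      have he' := (Finset.mem_product.1 he').1
      cases b <;> cases b' <;> simp at hee he he' ⊢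
      · exact hee
      · exact hT e' he' e he hee.symm
      · exact hT e he e' he' hee
      · exact hinj he he' hee)
    (fun k x => if k.2 then (if isG2 x then 1 else 0) else (if isG1 x then 1 else 0))
  refine (Pr_le_Ex hw (f := fun ω => ∏ k ∈ T ×ˢ (Finset.univ : Finset Bool),
    (if k.2 then (if isG2 (ω (if k.2 then f k.1 else k.1)) then (1 : ℝ) else 0) else
      (if isG1 (ω (if k.2 then f k.1 else k.1)) then 1 else 0))) ?_ ?_).trans ?_
  · intro ω
    exact Finset.prod_nonneg fun k _ => by split_ifs <;> simp
  · intro ω hω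
    rw [Finset.prod_eq_one]
    rintro ⟨e, b⟩ he
    have := hω e (Finset.mem_product.1 he).1
    cases b <;> simp [this]
  · rw [h1]
    rw [Finset.prod_product]
    rw [← Finset.prod_const]
    refine Finset.prod_le_prod (fun e _ => Finset.prod_nonneg fun b _ => Finset.sum_nonneg
      fun x _ => mul_nonneg (hw.nonneg _ _) (by split_ifs <;> simp)) fun e _ => ?_
    rw [Fintype.prod_bool]
    simp only [if_true, Bool.false_eq_true, if_false]
    rw [stW_kind h σ (kindProb_isG2 h.hs0 h.hs1), stW_kind h σ (kindProb_isG1 h.hs0 h.hs1), sq]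
    exact mul_le_mul (parentProb_mul_le h σ (kindProb_isG2 h.hs0 h.hs1) _)
      (parentProb_mul_le h σ (kindProb_isG1 h.hs0 h.hs1) _)
      (mul_nonneg (parentProb_nonneg _ _) h.hs0) hρ

open Classical in
-- A pair has weight at most two. At most `|D| n` pairs have weight one and at most `|D|²` have
-- weight two.
theorem sum_pow_wt_le {n : ℕ} (D : Finset (Fin n)) {z : ℝ} (hz : 0 ≤ z) :
    ∑ e : Sym2 (Fin n) with 1 ≤ wt D e, z ^ wt D e ≤ D.card * n * z + (D.card : ℝ) ^ 2 * z ^ 2 := by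
  have hle : ∀ e : Sym2 (Fin n), wt D e ≤ 2 := by
    intro e
    induction e with
    | _ i j =>
      have : (D.filter fun k => k ∈ s(i, j)) ⊆ {i, j} := by
        intro k hk
        simpa using (Finset.mem_filter.1 hk).2
      exact (Finset.card_le_card this).trans Finset.card_le_two
  have hsplit : (Finset.univ.filter fun e : Sym2 (Fin n) => 1 ≤ wt D e) ⊆
      (Finset.univ.filter fun e : Sym2 (Fin n) => wt D e = 1) ∪
      (Finset.univ.filter fun e : Sym2 (Fin n) => wt D e = 2) := by
    intro e he
    have h1 := (Finset.mem_filter.1 he).2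
    have h2 := hle e
    simp only [Finset.mem_union, Finset.mem_filter, Finset.mem_univ, true_and]
    omega
  have hc1 : ((Finset.univ.filter fun e : Sym2 (Fin n) => wt D e = 1).card : ℝ) ≤ D.card * n := by
    have : (Finset.univ.filter fun e : Sym2 (Fin n) => wt D e = 1) ⊆
        (D ×ˢ (Finset.univ : Finset (Fin n))).image fun x => s(x.1, x.2) := by
      intro e he
      have h1 := (Finset.mem_filter.1 he).2
      obtain ⟨i, hi⟩ := Finset.card_pos.1 (by rw [← wt, h1]; norm_num :
        0 < (D.filter fun i => i ∈ e).card)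
      have hi := Finset.mem_filter.1 hi
      obtain ⟨j, rfl⟩ := Sym2.mem_iff_exists.1 hi.2
      exact Finset.mem_image.2 ⟨(i, j), by simpa using hi.1, rfl⟩
    have h2 := (Finset.card_le_card this).trans Finset.card_image_le
    rw [Finset.card_product, Finset.card_univ, Fintype.card_fin] at h2
    exact_mod_cast h2
  have hc2 : ((Finset.univ.filter fun e : Sym2 (Fin n) => wt D e = 2).card : ℝ) ≤
      (D.card : ℝ) ^ 2 := by
    have : (Finset.univ.filter fun e : Sym2 (Fin n) => wt D e = 2) ⊆
        (D ×ˢ D).image fun x => s(x.1, x.2) := by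
      intro e he
      have h1 := (Finset.mem_filter.1 he).2
      obtain ⟨i, j, hij, hD⟩ := Finset.card_eq_two.1 (by rw [← wt, h1] :
        (D.filter fun i => i ∈ e).card = 2)
      have hi : i ∈ D.filter fun i => i ∈ e := by rw [hD]; simp
      have hj : j ∈ D.filter fun i => i ∈ e := by rw [hD]; simp
      have hi := Finset.mem_filter.1 hi
      have hj := Finset.mem_filter.1 hj
      refine Finset.mem_image.2 ⟨(i, j), Finset.mem_product.2 ⟨hi.1, hj.1⟩, ?_⟩
      exact ((Sym2.mem_and_mem_iff hij).1 ⟨hi.2, hj.2⟩).symm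
    have h2 := (Finset.card_le_card this).trans Finset.card_image_le
    rw [Finset.card_product] at h2
    rw [sq]
    exact_mod_cast h2
  calc _ ≤ ∑ e ∈ (Finset.univ.filter fun e : Sym2 (Fin n) => wt D e = 1) ∪
      (Finset.univ.filter fun e : Sym2 (Fin n) => wt D e = 2), z ^ wt D e :=
        Finset.sum_le_sum_of_subset_of_nonneg hsplit fun e _ _ => by positivity
    _ ≤ ∑ e : Sym2 (Fin n) with wt D e = 1, z ^ wt D e +
        ∑ e : Sym2 (Fin n) with wt D e = 2, z ^ wt D e := by
        rw [← Finset.sum_union_inter]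
        have : 0 ≤ ∑ e ∈ (Finset.univ.filter fun e : Sym2 (Fin n) => wt D e = 1) ∩
          (Finset.univ.filter fun e : Sym2 (Fin n) => wt D e = 2), z ^ wt D e :=
          Finset.sum_nonneg fun e _ => by positivity
        linarith
    _ = (Finset.univ.filter fun e : Sym2 (Fin n) => wt D e = 1).card * z +
        (Finset.univ.filter fun e : Sym2 (Fin n) => wt D e = 2).card * z ^ 2 := by
        rw [Finset.sum_congr rfl fun e he => by rw [(Finset.mem_filter.1 he).2],
          Finset.sum_congr (s₁ := Finset.univ.filter fun e : Sym2 (Fin n) => wt D e = 2) rfl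
            fun e he => by rw [(Finset.mem_filter.1 he).2]]
        simp
    _ ≤ _ := by gcongr

end CorrSBM
end

/-! ### Union bound over wrong matchings. -/

noncomputable section
namespace CorrSBM

open Filter Topology

/-- The event that there are many pairs which are edges of the first graph and whose images under `φ`
are edges of the second graph. -/
def ManyPairs {n : ℕ} (φ : Fin n → Fin n) : Set (Sym2 (Fin n) → St) :=
  {ω | ∃ T : Finset (Sym2 (Fin n)),
      (∀ e ∈ T, isG1 (ω e) = true ∧ isG2 (ω (e.map φ)) = true ∧ 1 ≤ wt (moved φ) e) ∧
      (∀ e ∈ T, ∀ e' ∈ T, e.map φ ≠ e') ∧ Set.InjOn (Sym2.map φ) T ∧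
      4 * (moved φ).card ≤ ∑ e ∈ T, wt (moved φ) e}

/-- A union bound over `T` in which each set is charged `z` to the power of its weight minus `4 d`.
The sum over `T` factorizes into factors `1 + ρ² z^{wt}`, bounded by exponentials. -/
theorem Pr_manyPairs_le {α β s : ℝ} {n : ℕ} (h : Adm α β s n) (σ : Fin n → ℤˣ)
    (φ : Fin n → Fin n) {z : ℝ} (hz : 1 ≤ z) :
    Pr (stW α β s σ) (ManyPairs φ) ≤ (z ^ (4 * (moved φ).card))⁻¹ *
      Real.exp ((max α β * Real.log n / n) ^ 2 *
        ((moved φ).card * n * z + ((moved φ).card : ℝ) ^ 2 * z ^ 2)) := by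
  classical
  have hw := stW_isWeight h σ
  have hz0 : 0 < z := by linarith
  set ρ := max α β * Real.log n / n
  set D := moved φ
  set Q : Finset (Sym2 (Fin n)) := Finset.univ.filter fun e => 1 ≤ wt D e with hQ
  have h1 : Pr (stW α β s σ) (ManyPairs φ) ≤ ∑ T ∈ Q.powerset,
      (z ^ (4 * D.card))⁻¹ * ∏ e ∈ T, (ρ ^ 2 * z ^ wt D e) := by
    refine (Pr_biUnion_le hw Q.powerset (fun T => {ω |
      (∀ e ∈ T, isG1 (ω e) = true ∧ isG2 (ω (e.map φ)) = true) ∧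
      (∀ e ∈ T, ∀ e' ∈ T, e.map φ ≠ e') ∧ Set.InjOn (Sym2.map φ) T ∧
      4 * D.card ≤ ∑ e ∈ T, wt D e}) ?_).trans (Finset.sum_le_sum fun T _ => ?_)
    · rintro ω ⟨T, hT, hT'⟩
      refine ⟨T, Finset.mem_powerset.2 fun e he => ?_, fun e he => ⟨(hT e he).1, (hT e he).2.1⟩, hT'⟩
      exact Finset.mem_filter.2 ⟨Finset.mem_univ _, (hT e he).2.2⟩
    · rw [Finset.prod_mul_distrib, Finset.prod_const, Finset.prod_pow_eq_pow_sum]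
      by_cases hc : (∀ e ∈ T, ∀ e' ∈ T, e.map φ ≠ e') ∧ Set.InjOn (Sym2.map φ) T ∧
          4 * D.card ≤ ∑ e ∈ T, wt D e
      · refine (Pr_mono hw fun ω hω => hω.1).trans ((Pr_pairs_le h σ _ T hc.1 hc.2.1).trans ?_)
        have h2 : 1 ≤ (z ^ (4 * D.card))⁻¹ * z ^ (∑ e ∈ T, wt D e) := by
          rw [inv_mul_eq_div, one_le_div (by positivity)]
          exact pow_le_pow_right₀ hz hc.2.2
        have h3 : 0 ≤ (ρ ^ 2) ^ T.card := by positivity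
        nlinarith
      · refine (Pr_mono hw (T := ∅) fun ω hω => hc hω.2).trans ?_
        simp only [Pr, Set.indicator_empty, Ex_const hw]
        positivity
  refine h1.trans ?_
  rw [← Finset.mul_sum, ← Finset.prod_one_add]
  refine mul_le_mul_of_nonneg_left ?_ (by positivity)
  calc ∏ e ∈ Q, (1 + ρ ^ 2 * z ^ wt D e) ≤ ∏ e ∈ Q, Real.exp (ρ ^ 2 * z ^ wt D e) :=
        Finset.prod_le_prod (fun e _ => by positivity) fun e _ => by
          rw [add_comm]; exact Real.add_one_le_exp _
    _ = Real.exp (ρ ^ 2 * ∑ e ∈ Q, z ^ wt D e) := by rw [← Real.exp_sum, Finset.mul_sum]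
    _ ≤ _ := by
        have := sum_pow_wt_le D hz0.le
        gcongr

/-- The choice `z = n / (√d log² n)` keeps the exponent `O(d)`, while `z^{-4d}` supplies `(d² log⁸ n
/ n⁴)^d`. The hypothesis on the fourth power of the logarithm gives `z ≥ 1`. -/
theorem Pr_manyPairs_le' {α β s : ℝ} {n : ℕ} (h : Adm α β s n) (σ : Fin n → ℤˣ)
    (φ : Fin n → Fin n) (hφ : (moved φ).Nonempty) (hL1 : 1 ≤ Real.log n)
    (hL4 : Real.log n ^ 4 ≤ n) :
    Pr (stW α β s σ) (ManyPairs φ) ≤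
      (Real.exp (2 * max α β ^ 2) * Real.log n ^ 8 * ((moved φ).card : ℝ) ^ 2 / n ^ 4) ^
        (moved φ).card := by
  set d := (moved φ).card with hd
  have hd1 : (1 : ℝ) ≤ d := by exact_mod_cast Finset.card_pos.2 hφ
  have hdn : (d : ℝ) ≤ n := by
    have := Finset.card_le_univ (moved φ)
    rw [Fintype.card_fin] at this
    exact_mod_cast this
  set L := Real.log n with hL
  have hL0 : 0 < L := by linarith
  have hnp := h.n_pos
  have hsd1 : 1 ≤ √(d : ℝ) := Real.one_le_sqrt.2 hd1
  have hsd2 : √(d : ℝ) * √(d : ℝ) = d := Real.mul_self_sqrt (by linarith)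
  set z := (n : ℝ) / (√(d : ℝ) * L ^ 2) with hz
  have hz1 : 1 ≤ z := by
    rw [hz, one_le_div (by positivity)]
    refine le_of_abs_le (abs_le_of_sq_le_sq ?_ hnp.le)
    rw [mul_pow, Real.sq_sqrt (by linarith), ← pow_mul]
    calc (d : ℝ) * L ^ (2 * 2) ≤ n * n := mul_le_mul hdn (by simpa using hL4) (by positivity) hnp.le
      _ = _ := by ring
  refine (Pr_manyPairs_le h σ φ hz1).trans ?_
  have hexp : (max α β * L / n) ^ 2 * (d * n * z + (d : ℝ) ^ 2 * z ^ 2) ≤ d * (2 * max α β ^ 2) := by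
    have e1 : (max α β * L / n) ^ 2 * (d * n * z) = max α β ^ 2 * √(d : ℝ) := by
      rw [hz]
      nth_rewrite 1 [← hsd2]
      field_simp
    have e2 : (max α β * L / n) ^ 2 * ((d : ℝ) ^ 2 * z ^ 2) = max α β ^ 2 * (d / L ^ 2) := by
      rw [hz, div_pow (n : ℝ), mul_pow (√(d : ℝ)), Real.sq_sqrt (by linarith)]
      field_simp
    rw [mul_add, e1, e2]
    have e3 : √(d : ℝ) ≤ d := by nlinarith
    have e4 : (d : ℝ) / L ^ 2 ≤ d := div_le_self (by linarith) (one_le_pow₀ hL1)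
    have e5 : 0 ≤ max α β ^ 2 := sq_nonneg _
    nlinarith
  calc _ ≤ (z ^ (4 * d))⁻¹ * Real.exp (d * (2 * max α β ^ 2)) := by gcongr
    _ = ((z ^ 4)⁻¹ * Real.exp (2 * max α β ^ 2)) ^ d := by
        rw [Real.exp_nat_mul, mul_pow, inv_pow, ← pow_mul]
    _ = _ := by
        congr 1
        have : z ^ 4 = n ^ 4 / (d ^ 2 * L ^ 8) := by
          rw [hz, div_pow, mul_pow, ← pow_mul]
          congr 2
          calc √(d : ℝ) ^ 4 = (√(d : ℝ) * √(d : ℝ)) ^ 2 := by ring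
            _ = _ := by rw [hsd2]
        rw [this]
        field_simp

open Classical in
theorem card_moved_eq_le {n : ℕ} (D : Finset (Fin n)) :
    ((Finset.univ.filter fun φ : Fin n → Fin n => moved φ = D).card : ℝ) ≤ (n : ℝ) ^ D.card := by
  have h : (Finset.univ.filter fun φ : Fin n → Fin n => moved φ = D).card ≤
      (Finset.univ : Finset (D → Fin n)).card := by
    refine Finset.card_le_card_of_injOn (fun φ i => φ i) (fun _ _ => Finset.mem_univ _) ?_
    intro φ hφ ψ hψ hh
    have hφ : moved φ = D := by simpa using hφ
    have hψ : moved ψ = D := by simpa using hψ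
    ext i
    by_cases hi : i ∈ D
    · exact congrArg Fin.val (congrFun hh ⟨i, hi⟩)
    · have h1 : φ i = i := by
        by_contra hne
        exact hi (hφ ▸ Finset.mem_filter.2 ⟨Finset.mem_univ _, hne⟩)
      have h2 : ψ i = i := by
        by_contra hne
        exact hi (hψ ▸ Finset.mem_filter.2 ⟨Finset.mem_univ _, hne⟩)
      rw [h1, h2]
  rw [Finset.card_univ, Fintype.card_fun, Fintype.card_fin, Fintype.card_coe] at h
  exact_mod_cast h

theorem choose_mul_pow_le {n d : ℕ} : (n.choose d : ℝ) * (d : ℝ) ^ d ≤ (Real.exp 1 * n) ^ d := by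
  have h1 := Nat.choose_le_pow_div (α := ℝ) d n
  have h2 := Real.pow_div_factorial_le_exp (d : ℝ) (Nat.cast_nonneg d) d
  have h3 : (0 : ℝ) < d.factorial := by exact_mod_cast Nat.factorial_pos d
  calc (n.choose d : ℝ) * (d : ℝ) ^ d ≤ (n : ℝ) ^ d / d.factorial * (d : ℝ) ^ d := by gcongr
    _ = (n : ℝ) ^ d * ((d : ℝ) ^ d / d.factorial) := by ring
    _ ≤ (n : ℝ) ^ d * Real.exp d := by gcongr
    _ = _ := by rw [mul_pow, ← Real.exp_nat_mul, mul_one]; ring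

theorem sum_pow_pos_le {y : ℝ} (hy0 : 0 ≤ y) (hy : y ≤ 1 / 2) (n : ℕ) :
    ∑ d ∈ Finset.range n, (if d = 0 then 0 else y ^ d) ≤ 4 * y := by
  have h1 : ∀ d ∈ Finset.range n, (if d = 0 then 0 else y ^ d) ≤ 2 * y * (1 / 2 : ℝ) ^ d := by
    intro d _
    split_ifs with hd
    · positivity
    · obtain ⟨k, rfl⟩ := Nat.exists_eq_succ_of_ne_zero hd
      rw [pow_succ, pow_succ]
      have := pow_le_pow_left₀ hy0 hy k
      nlinarith
  refine (Finset.sum_le_sum h1).trans ?_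
  rw [← Finset.mul_sum]
  have := sum_geometric_two_le n
  nlinarith

open Classical in
/-- With high probability, core matchings have no wrong pairs. -/
theorem eventually_matching {α β s : ℝ} (hα : 0 < α) (hβ : 0 < β) (hs0 : 0 ≤ s) (hs1 : s ≤ 1) :
    ∀ η > 0, ∀ᶠ n : ℕ in atTop, ∀ σ : Fin n → ℤˣ,
      Pr (stW α β s σ) {ω | ∃ m : Matching n, m.IsKCore 13 (gr isG1 ω) (gr isG2 ω) ∧
        ∃ i ∈ m.M, m.μ i ≠ i} ≤ η := by
  intro η hη
  set A := Real.exp 1 * Real.exp (2 * max α β ^ 2) with hA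
  have hA0 : 0 < A := by positivity
  have hlim : Tendsto (fun n : ℕ => A * (Real.log n ^ 8 / n)) atTop (𝓝 0) := by
    simpa using (tendsto_log_pow_div 8).const_mul A
  filter_upwards [eventually_adm hα hβ hs0 hs1,
    hlim.eventually_le_const (by positivity : 0 < min (1 / 2) (η / 4)),
    tendsto_log_nat.eventually_ge_atTop 1,
    (tendsto_log_pow_div 4).eventually_le_const one_pos] with n hn hy hL1 hL4 σ
  have hw := stW_isWeight hn σ
  have hnp := hn.n_pos
  have hL := hn.log_pos
  rw [div_le_one hnp] at hL4
  set y := A * (Real.log n ^ 8 / n) with hydef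
  have hy0 : 0 ≤ y := by positivity
  let g : ℕ → ℝ := fun d => (Real.exp (2 * max α β ^ 2) * Real.log n ^ 8 * (d : ℝ) ^ 2 / n ^ 4) ^ d
  have hg0 : ∀ d, 0 ≤ g d := fun d => by positivity
  calc _ ≤ ∑ φ ∈ Finset.univ.filter (fun φ : Fin n → Fin n => (moved φ).Nonempty),
        Pr (stW α β s σ) (ManyPairs φ) := by
        refine Pr_biUnion_le hw _ ManyPairs ?_
        rintro ω ⟨m, hm, hwrong⟩
        obtain ⟨φ, hφ, T, h1, h2⟩ := exists_pairs_of_wrong hm hwrong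
        refine ⟨φ, by simpa using hφ, T, fun e he => ?_, h2⟩
        obtain ⟨he1, he2, he3⟩ := h1 e he
        have hgr : ∀ (b : St → Bool) (e : Sym2 (Fin n)), e ∈ (gr b ω).edgeSet → b (ω e) = true := by
          intro b e he
          induction e with
          | _ i j => exact (gr_adj.1 he).2
        exact ⟨hgr _ _ he1, hgr _ _ he2, he3⟩
    _ ≤ ∑ φ ∈ Finset.univ.filter (fun φ : Fin n → Fin n => (moved φ).Nonempty),
        g (moved φ).card := Finset.sum_le_sum fun φ hφ =>
          Pr_manyPairs_le' hn σ φ (Finset.mem_filter.1 hφ).2 hL1 hL4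
    _ = ∑ φ : Fin n → Fin n, if (moved φ).card = 0 then 0 else g (moved φ).card := by
        rw [Finset.sum_filter]
        refine Finset.sum_congr rfl fun φ _ => ?_
        by_cases hc : (moved φ).Nonempty
        · simp [hc, hc.ne_empty]
        · simp [Finset.not_nonempty_iff_eq_empty.1 hc]
    _ = ∑ D : Finset (Fin n), ∑ φ : Fin n → Fin n with moved φ = D,
          if (moved φ).card = 0 then 0 else g (moved φ).card := by
        rw [Finset.sum_fiberwise]
    _ ≤ ∑ D : Finset (Fin n), if D.card = 0 then 0 else (n : ℝ) ^ D.card * g D.card := by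
        refine Finset.sum_le_sum fun D _ => ?_
        rw [Finset.sum_congr rfl fun φ hφ => by rw [(Finset.mem_filter.1 hφ).2]]
        rw [Finset.sum_const, nsmul_eq_mul]
        split_ifs
        · simp
        · exact mul_le_mul_of_nonneg_right (card_moved_eq_le D) (hg0 _)
    _ = ∑ d ∈ Finset.range (n + 1), (n.choose d : ℝ) *
          (if d = 0 then 0 else (n : ℝ) ^ d * g d) := by
        have := Finset.sum_powerset_apply_card (fun d => if d = 0 then 0 else (n : ℝ) ^ d * g d)
          (x := (Finset.univ : Finset (Fin n)))
        simpa only [Finset.powerset_univ, Finset.card_univ, Fintype.card_fin, nsmul_eq_mul] using this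
    _ ≤ ∑ d ∈ Finset.range (n + 1), (if d = 0 then 0 else y ^ d) := by
        -- One factor `d^d` of `g d` is absorbed by the binomial coefficient, and in the other `d ≤
        -- n`. Against the `n^d` maps there remains `(A log⁸ n / n)^d`.
        refine Finset.sum_le_sum fun d hd => ?_
        split_ifs with h0
        · simp
        · have hdn : (d : ℝ) ≤ n := by
            have := Finset.mem_range.1 hd
            exact_mod_cast Nat.lt_succ_iff.1 this
          calc (n.choose d : ℝ) * ((n : ℝ) ^ d * g d) = ((n.choose d : ℝ) * (d : ℝ) ^ d) *
                (Real.exp (2 * max α β ^ 2) * Real.log n ^ 8 * d / n ^ 3) ^ d := by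
                simp only [g]
                have : (n : ℝ) ^ d * (Real.exp (2 * max α β ^ 2) * Real.log n ^ 8 * (d : ℝ) ^ 2 / n ^ 4) ^ d
                    = (d : ℝ) ^ d * (Real.exp (2 * max α β ^ 2) * Real.log n ^ 8 * d / n ^ 3) ^ d := by
                  rw [← mul_pow, ← mul_pow]
                  congr 1
                  field_simp
                rw [this]; ring
            _ ≤ (Real.exp 1 * n) ^ d *
                (Real.exp (2 * max α β ^ 2) * Real.log n ^ 8 * n / n ^ 3) ^ d := by
                have := choose_mul_pow_le (n := n) (d := d)
                gcongr
            _ = y ^ d := by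
                rw [← mul_pow, hydef, hA]
                congr 1
                field_simp
    _ ≤ 4 * y := sum_pow_pos_le hy0 (hy.trans (min_le_left _ _)) _
    _ ≤ η := by
        have := hy.trans (min_le_right _ _)
        linarith

end CorrSBM
end

noncomputable section
namespace CorrSBM

open Filter Topology

/-! ### Exponential moments of signed degrees -/

/-- Upper tail for the number of occurrences in a family of independent rare events. -/
theorem Pr_count_ge_le_of {I X : Type*} [Fintype I] [DecidableEq I] [Fintype X] {w : I → X → ℝ}
    (hw : IsWeight w) {K : Type*} (T : Finset K) (ι : K → I) (hι : Set.InjOn ι T) (b : X → Bool)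
    {ρ : ℝ} (hq : ∀ k ∈ T, ∑ x, w (ι k) x * (if b x then 1 else 0) ≤ ρ) (l x : ℝ) (hl : 0 ≤ l) :
    Pr w {ω | x ≤ ∑ k ∈ T, if b (ω (ι k)) then (1 : ℝ) else 0} ≤
      Real.exp (T.card * ρ * (Real.exp l - 1) - l * x) := by
  have h1 := Ex_exp_sum_le hw T ι hι (fun _ => b)
    (fun k => ∑ x, w (ι k) x * (if b x then 1 else 0)) (fun _ => l) (fun k _ => rfl)
  refine (Pr_le_Ex hw (f := fun ω => Real.exp (-(l * x)) *
    Real.exp (∑ k ∈ T, if b (ω (ι k)) then l else 0)) (fun ω => by positivity) fun ω hω => ?_).trans ?_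
  · rw [← Real.exp_add, Real.one_le_exp_iff]
    have h2 : x ≤ ∑ k ∈ T, if b (ω (ι k)) then (1 : ℝ) else 0 := hω
    have h3 := mul_le_mul_of_nonneg_left h2 hl
    rw [Finset.mul_sum] at h3
    simp only [mul_ite, mul_one, mul_zero] at h3
    linarith
  · rw [Ex_const_mul]
    have h4 : ∑ k ∈ T, (∑ x, w (ι k) x * (if b x then 1 else 0)) * (Real.exp l - 1) ≤
        T.card * ρ * (Real.exp l - 1) := by
      rw [← Finset.sum_mul]
      refine mul_le_mul_of_nonneg_right ?_ (by linarith [Real.one_le_exp hl])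
      calc _ ≤ ∑ k ∈ T, ρ := Finset.sum_le_sum hq
        _ = _ := by simp
    calc _ ≤ Real.exp (-(l * x)) * Real.exp (T.card * ρ * (Real.exp l - 1)) :=
          mul_le_mul_of_nonneg_left (h1.trans (Real.exp_le_exp.2 h4)) (Real.exp_pos _).le
      _ = _ := by rw [← Real.exp_add]; ring_nf

theorem rv_mul_eq {n : ℕ} (σ : Fin n → ℤˣ) (i j : Fin n) :
    rv σ i * rv σ j = if σ i = σ j then 1 else -1 := by
  unfold rv
  rcases Int.units_eq_one_or (σ i) with h | h <;> rcases Int.units_eq_one_or (σ j) with h' | h' <;>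
    simp [h, h']

theorem abs_rv {V : Type} (σ : V → ℤˣ) (i : V) : |rv σ i| = 1 := by
  unfold rv
  rcases Int.units_eq_one_or (σ i) with h | h <;> simp [h]

section
variable {α β s : ℝ} {n : ℕ}

/-- Sums of the parent probabilities at a vertex. -/
theorem sum_parentProb (h : Adm α β s n) (σ : Fin n → ℤˣ) (v : Fin n) (J : Finset (Fin n))
    (f : ℝ → ℝ) :
    ∑ j ∈ J, parentProb α β σ s(v, j) * f (rv σ v * rv σ j) =
      Real.log n / n * ((α * f 1 + β * f (-1)) / 2 * J.card +
        (α * f 1 - β * f (-1)) / 2 * (rv σ v * ∑ j ∈ J, rv σ j)) := by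
  have h1 : ∀ j ∈ J, parentProb α β σ s(v, j) * f (rv σ v * rv σ j) =
      Real.log n / n * ((α * f 1 + β * f (-1)) / 2 +
        (α * f 1 - β * f (-1)) / 2 * (rv σ v * rv σ j)) := by
    intro j _
    rw [parentProb_mk h, rv_mul_eq]
    split_ifs <;> ring
  rw [Finset.sum_congr rfl h1, ← Finset.mul_sum, Finset.sum_add_distrib, ← Finset.mul_sum,
    ← Finset.mul_sum]
  simp only [Finset.sum_const, nsmul_eq_mul]
  ring

/-- Half the logarithm of the ratio of the two intensities. -/
def tilt (α β : ℝ) : ℝ := 1 / 2 * Real.log (α / β)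

/-- `tilt` is the minimizer of `α e^{-t} + β e^{t}`, with minimum `2 √(αβ)`. This is how `Dplus`
becomes the exponent of a wrong vote. -/
theorem exp_tilt_mul (hα : 0 < α) (hβ : 0 < β) : β * Real.exp (tilt α β) = √α * √β := by
  have : Real.exp (tilt α β) = √(α / β) := by
    rw [Real.sqrt_eq_rpow, Real.rpow_def_of_pos (by positivity)]
    unfold tilt; ring_nf
  rw [this, Real.sqrt_div hα.le, ← mul_div_assoc]
  rw [div_eq_iff (by positivity)]
  have := Real.mul_self_sqrt hβ.le
  linear_combination (-√α) * this

theorem exp_neg_tilt_mul (hα : 0 < α) (hβ : 0 < β) : α * Real.exp (-tilt α β) = √α * √β := by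
  have h1 := exp_tilt_mul hβ hα
  have : tilt β α = - tilt α β := by
    unfold tilt; rw [← inv_div α β, Real.log_inv]; ring
  rw [this] at h1
  rw [h1]; ring

theorem Dplus_eq (hα : 0 ≤ α) (hβ : 0 ≤ β) : Dplus α β = (α + β) / 2 - √α * √β := by
  unfold Dplus
  rw [div_pow, Real.sq_sqrt (by norm_num), sub_sq, Real.sq_sqrt hα, Real.sq_sqrt hβ]
  ring

theorem Dplus_nonneg : 0 ≤ Dplus α β := sq_nonneg _

theorem abs_exp_sub_one_le_exp_abs (x : ℝ) : |Real.exp x - 1| ≤ Real.exp |x| := by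
  have h1 := Real.exp_le_exp.2 (le_abs_self x)
  have h2 := Real.one_le_exp (abs_nonneg x)
  have h3 := Real.exp_pos x
  rw [abs_le]; constructor <;> linarith

/-- The logarithm of the exponential moment of a signed degree. -/
theorem sum_signed_le (h : Adm α β s n) (σ : Fin n → ℤˣ) (v : Fin n) (J Z : Finset (Fin n))
    {q : Sym2 (Fin n) → ℝ} {κ ξ g : ℝ} (hκ1 : κ ≤ 1) (hg : 0 ≤ g)
    (hξ : ∀ e, |q e - parentProb α β σ e * κ| ≤ ξ) :
    ∑ j ∈ J, q s(v, j) * (Real.exp (-(tilt α β * (rv σ v * rv σ j)) +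
        if j ∈ Z then g else 0) - 1) ≤
      κ * (Real.log n / n * (-(Dplus α β * J.card) + (β - α) / 2 * (rv σ v * ∑ j ∈ J, rv σ j))) +
        n * ξ * Real.exp |tilt α β| +
        Z.card * (max α β * Real.log n / n + ξ) * Real.exp (|tilt α β| + g) := by
  have hξ0 : 0 ≤ ξ := (abs_nonneg _).trans (hξ s(v, v))
  have hL := h.log_pos
  have hn := h.n_pos
  have hM : 0 < max α β := lt_max_of_lt_left h.hα
  have hρ : 0 ≤ max α β * Real.log n / n + ξ := by positivity
  have hqle : ∀ e, q e ≤ max α β * Real.log n / n + ξ := fun e => by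
    have h1 := (abs_le.1 (hξ e)).2
    have h2 := parentProb_le h σ e
    have h3 := mul_le_of_le_one_right (parentProb_nonneg (α := α) (β := β) σ e) hκ1
    linarith
  have habs : ∀ j, |-(tilt α β * (rv σ v * rv σ j))| = |tilt α β| := fun j => by
    rw [abs_neg, abs_mul, abs_mul, abs_rv, abs_rv]; ring
  have hmain := sum_parentProb h σ v J (fun y => Real.exp (-(tilt α β * y)) - 1)
  -- At the optimal tilt the mean over the two communities is `-Dplus`. The antisymmetric part,
  -- computed next, only multiplies the imbalance of the labels on `J`.
  have e1 : (α * (Real.exp (-(tilt α β * 1)) - 1) + β * (Real.exp (-(tilt α β * -1)) - 1)) / 2 =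
      - Dplus α β := by
    have := exp_tilt_mul h.hα h.hβ
    have := exp_neg_tilt_mul h.hα h.hβ
    rw [Dplus_eq h.hα.le h.hβ.le, mul_one, mul_neg_one, neg_neg]; linarith
  have e2 : (α * (Real.exp (-(tilt α β * 1)) - 1) - β * (Real.exp (-(tilt α β * -1)) - 1)) / 2 =
      (β - α) / 2 := by
    have := exp_tilt_mul h.hα h.hβ
    have := exp_neg_tilt_mul h.hα h.hβ
    rw [mul_one, mul_neg_one, neg_neg]; linarith
  rw [e1, e2] at hmain
  have hterm : ∀ j ∈ J, q s(v, j) * (Real.exp (-(tilt α β * (rv σ v * rv σ j)) +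
        if j ∈ Z then g else 0) - 1) ≤
      κ * (parentProb α β σ s(v, j) * (Real.exp (-(tilt α β * (rv σ v * rv σ j))) - 1)) +
        ξ * Real.exp |tilt α β| +
        if j ∈ Z then (max α β * Real.log n / n + ξ) * Real.exp (|tilt α β| + g) else 0 := by
    intro j _
    have hx1 := abs_exp_sub_one_le_exp_abs (-(tilt α β * (rv σ v * rv σ j)))
    rw [habs] at hx1
    have hx2 : Real.exp (-(tilt α β * (rv σ v * rv σ j))) ≤ Real.exp |tilt α β| := by
      rw [Real.exp_le_exp, ← habs j]; exact le_abs_self _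
    have hd : (q s(v, j) - parentProb α β σ s(v, j) * κ) *
        (Real.exp (-(tilt α β * (rv σ v * rv σ j))) - 1) ≤ ξ * Real.exp |tilt α β| := by
      refine (le_abs_self _).trans ?_
      rw [abs_mul]
      exact mul_le_mul (hξ _) hx1 (abs_nonneg _) hξ0
    -- The points of `Z`, whose labels are not trusted, carry an extra weight `g` and are bounded
    -- crudely. There are few of them.
    split_ifs with hj
    · have hz : q s(v, j) * (Real.exp (-(tilt α β * (rv σ v * rv σ j)) + g) -
          Real.exp (-(tilt α β * (rv σ v * rv σ j)))) ≤
          (max α β * Real.log n / n + ξ) * Real.exp (|tilt α β| + g) := by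
        refine mul_le_mul (hqle _) ?_ ?_ hρ
        · have : Real.exp (-(tilt α β * (rv σ v * rv σ j)) + g) ≤ Real.exp (|tilt α β| + g) := by
            rw [Real.exp_le_exp, ← habs j]
            linarith [le_abs_self (-(tilt α β * (rv σ v * rv σ j)))]
          linarith [Real.exp_pos (-(tilt α β * (rv σ v * rv σ j)))]
        · rw [sub_nonneg, Real.exp_le_exp]; linarith
      linarith
    · rw [add_zero, add_zero]; linarith
  refine (Finset.sum_le_sum hterm).trans ?_
  rw [Finset.sum_add_distrib, Finset.sum_add_distrib, ← Finset.mul_sum, hmain]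
  have h3 : ∑ j ∈ J, ξ * Real.exp |tilt α β| ≤ n * ξ * Real.exp |tilt α β| := by
    simp only [Finset.sum_const, nsmul_eq_mul]
    have hc : (J.card : ℝ) ≤ n := by
      have := Finset.card_le_univ J
      rw [Fintype.card_fin] at this
      exact_mod_cast this
    rw [mul_assoc]
    exact mul_le_mul_of_nonneg_right hc (by positivity)
  have h4 : (∑ j ∈ J, if j ∈ Z then (max α β * Real.log n / n + ξ) * Real.exp (|tilt α β| + g)
      else 0) ≤ Z.card * (max α β * Real.log n / n + ξ) * Real.exp (|tilt α β| + g) := by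
    rw [← Finset.sum_filter, Finset.sum_const, nsmul_eq_mul, mul_assoc]
    refine mul_le_mul_of_nonneg_right ?_ (by positivity)
    have : (J.filter fun j => j ∈ Z).card ≤ Z.card :=
      Finset.card_le_card fun j hj => (Finset.mem_filter.1 hj).2
    exact_mod_cast this
  have h5 : κ * (Real.log n / n * (-Dplus α β * J.card +
      (β - α) / 2 * (rv σ v * ∑ j ∈ J, rv σ j))) = κ * (Real.log n / n * (-(Dplus α β * J.card) +
      (β - α) / 2 * (rv σ v * ∑ j ∈ J, rv σ j))) := by ring
  linarith

/-- Lower tail of a signed degree. -/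
theorem Pr_signed_le (h : Adm α β s n) (σ : Fin n → ℤˣ) (v : Fin n) (J : Finset (Fin n))
    {b : St → Bool} {κ ξ : ℝ} (hκ1 : κ ≤ 1)
    (hξ : ∀ e, |∑ x, stW α β s σ e x * (if b x then 1 else 0) - parentProb α β σ e * κ| ≤ ξ)
    (x : ℝ) :
    Pr (stW α β s σ) {ω | tilt α β * (rv σ v * ∑ j ∈ J, if b (ω s(v, j)) then rv σ j else 0) ≤ x} ≤
      Real.exp (x + κ * (Real.log n / n * (-(Dplus α β * J.card) +
        (β - α) / 2 * (rv σ v * ∑ j ∈ J, rv σ j))) + n * ξ * Real.exp |tilt α β|) := by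
  have hw := stW_isWeight h σ
  have h1 := Ex_exp_sum_le hw J (fun j => s(v, j)) (star_injOn v _) (fun _ => b)
    (fun j => ∑ x, stW α β s σ s(v, j) x * (if b x then 1 else 0))
    (fun j => -(tilt α β * (rv σ v * rv σ j))) (fun k _ => rfl)
  have h2 := sum_signed_le h σ v J ∅ (g := 0)
    (q := fun e => ∑ x, stW α β s σ e x * (if b x then 1 else 0)) hκ1 le_rfl hξ
  simp only [Finset.notMem_empty, if_false, add_zero, Finset.card_empty, Nat.cast_zero, zero_mul]
    at h2
  refine (Pr_le_Ex hw (f := fun ω => Real.exp x * Real.exp (∑ j ∈ J,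
    if b (ω s(v, j)) then -(tilt α β * (rv σ v * rv σ j)) else 0))
    (fun ω => by positivity) fun ω hω => ?_).trans ?_
  · rw [← Real.exp_add, Real.one_le_exp_iff]
    have h3 : tilt α β * (rv σ v * ∑ j ∈ J, if b (ω s(v, j)) then rv σ j else 0) ≤ x := hω
    have h4 : (∑ j ∈ J, if b (ω s(v, j)) then -(tilt α β * (rv σ v * rv σ j)) else 0) =
        -(tilt α β * (rv σ v * ∑ j ∈ J, if b (ω s(v, j)) then rv σ j else 0)) := by
      rw [Finset.mul_sum, Finset.mul_sum, ← Finset.sum_neg_distrib]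
      exact Finset.sum_congr rfl fun j _ => by split_ifs <;> simp
    rw [h4]; linarith
  · rw [Ex_const_mul, add_assoc, Real.exp_add x]
    exact mul_le_mul_of_nonneg_left (h1.trans (Real.exp_le_exp.2 h2)) (Real.exp_pos _).le

end

end CorrSBM
end

noncomputable section
namespace CorrSBM

open Filter Topology

/-! ### Cores and expansions -/

section Deterministic
variable {n : ℕ}

theorem nbrCount_mono {G G' : SimpleGraph (Fin n)} (hG : G ≤ G') {A B : Finset (Fin n)} (h : A ⊆ B)
    (v : Fin n) : nbrCount G A v ≤ nbrCount G' B v := by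
  classical
  refine Finset.card_le_card fun x hx => ?_
  rw [Finset.mem_filter] at hx ⊢
  exact ⟨h hx.1, hG hx.2⟩

theorem nbrCount_union_le (G : SimpleGraph (Fin n)) (A B : Finset (Fin n)) (v : Fin n) :
    nbrCount G (A ∪ B) v ≤ nbrCount G A v + nbrCount G B v := by
  classical
  unfold nbrCount
  rw [Finset.filter_union]
  exact Finset.card_union_le _ _

/-- Every vertex of `S` has at least `k` neighbours in `S`. -/
def IsCore (H : SimpleGraph (Fin n)) (k : ℕ) (S : Finset (Fin n)) : Prop :=
  ∀ v ∈ S, k ≤ nbrCount H S v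

open Classical in
/-- The `k`-core. -/
def coreSet (H : SimpleGraph (Fin n)) (k : ℕ) : Finset (Fin n) :=
  Finset.univ.filter fun v => ∃ S, IsCore H k S ∧ v ∈ S

theorem IsCore.subset_coreSet {H : SimpleGraph (Fin n)} {k : ℕ} {S : Finset (Fin n)}
    (h : IsCore H k S) : S ⊆ coreSet H k := fun v hv => by
  classical
  simp only [coreSet, Finset.mem_filter, Finset.mem_univ, true_and]
  exact ⟨S, h, hv⟩

theorem coreSet_isCore (H : SimpleGraph (Fin n)) (k : ℕ) : IsCore H k (coreSet H k) := by
  classical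
  intro v hv
  simp only [coreSet, Finset.mem_filter, Finset.mem_univ, true_and] at hv
  obtain ⟨S, hS, hvS⟩ := hv
  exact (hS v hvS).trans (nbrCount_mono le_rfl hS.subset_coreSet v)

/-- A vertex outside the `k`-core has fewer than `k` neighbours in it. -/
theorem nbrCount_coreSet_lt {H : SimpleGraph (Fin n)} {k : ℕ} {v : Fin n} (hv : v ∉ coreSet H k) :
    nbrCount H (coreSet H k) v < k := by
  classical
  by_contra! h
  refine hv ((IsCore.subset_coreSet (S := insert v (coreSet H k)) ?_) (Finset.mem_insert_self _ _))
  intro w hw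
  rcases Finset.mem_insert.1 hw with rfl | hw
  · exact h.trans (nbrCount_mono le_rfl (Finset.subset_insert _ _) _)
  · exact (coreSet_isCore H k w hw).trans (nbrCount_mono le_rfl (Finset.subset_insert _ _) _)

/-- No vertex outside `W` has two neighbours in `W`. -/
def IsExpClosed (G : SimpleGraph (Fin n)) (W : Finset (Fin n)) : Prop :=
  ∀ v ∉ W, nbrCount G W v < 2

open Classical in
/-- The smallest closed set containing `F`. -/
def expHull (G : SimpleGraph (Fin n)) (F : Finset (Fin n)) : Finset (Fin n) :=
  Finset.univ.filter fun v => ∀ W, F ⊆ W → IsExpClosed G W → v ∈ W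

theorem subset_expHull (G : SimpleGraph (Fin n)) (F : Finset (Fin n)) : F ⊆ expHull G F := by
  classical
  intro v hv
  simp only [expHull, Finset.mem_filter, Finset.mem_univ, true_and]
  exact fun W h _ => h hv

theorem expHull_subset {G : SimpleGraph (Fin n)} {F W : Finset (Fin n)} (h : F ⊆ W)
    (hW : IsExpClosed G W) : expHull G F ⊆ W := by
  classical
  intro v hv
  simp only [expHull, Finset.mem_filter, Finset.mem_univ, true_and] at hv
  exact hv W h hW

theorem expHull_isExpClosed (G : SimpleGraph (Fin n)) (F : Finset (Fin n)) :
    IsExpClosed G (expHull G F) := by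
  classical
  intro v hv
  have hv' : ∃ W, F ⊆ W ∧ IsExpClosed G W ∧ v ∉ W := by
    by_contra! hne
    exact hv (by simpa [expHull] using hne)
  obtain ⟨W, h1, h2, h3⟩ := hv'
  exact (nbrCount_mono le_rfl (expHull_subset h1 h2) v).trans_lt (h2 v h3)

theorem IsExpClosed.of_luczak {G : SimpleGraph (Fin n)} {W : Finset (Fin n)}
    (h : ∀ U', ¬ LuczakStep G W U') : IsExpClosed G W := by
  intro v hv
  by_contra! h2
  exact h _ ⟨v, hv, h2, rfl⟩

/-- The expansion does not depend on the order of insertions. -/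
theorem isLuczak_iff {G : SimpleGraph (Fin n)} {F W : Finset (Fin n)} :
    IsLuczak G F W ↔ W = expHull G F := by
  classical
  have hsub : ∀ {W}, Relation.ReflTransGen (LuczakStep G) F W → F ⊆ W ∧ W ⊆ expHull G F := by
    intro W h
    induction h with
    | refl => exact ⟨subset_rfl, subset_expHull G F⟩
    | tail _ hs ih =>
      obtain ⟨v, h1, h2, rfl⟩ := hs
      refine ⟨ih.1.trans (Finset.subset_insert _ _), Finset.insert_subset ?_ ih.2⟩
      by_contra hv
      exact absurd (h2.trans (nbrCount_mono le_rfl ih.2 v)) (not_le.2 (expHull_isExpClosed G F v hv))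
  constructor
  · rintro ⟨h1, h2⟩
    exact subset_antisymm (hsub h1).2 (expHull_subset (hsub h1).1 (IsExpClosed.of_luczak h2))
  · rintro rfl
    -- Induction on the number of vertices of the hull still missing: an expansion that is not
    -- closed admits a further insertion, which stays inside the hull.
    have hex : ∀ k, ∀ W, (expHull G F \ W).card = k → Relation.ReflTransGen (LuczakStep G) F W →
        Relation.ReflTransGen (LuczakStep G) F (expHull G F) := by
      intro k
      induction k with
      | zero =>
        intro W hk hW
        have : W = expHull G F := subset_antisymm (hsub hW).2
          (Finset.sdiff_eq_empty_iff_subset.1 (Finset.card_eq_zero.1 hk))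
        rwa [← this]
      | succ k ih =>
        intro W hk hW
        have hne : ¬ IsExpClosed G W := fun hc => by
          have := expHull_subset (hsub hW).1 hc
          rw [Finset.sdiff_eq_empty_iff_subset.2 this] at hk
          simp at hk
        unfold IsExpClosed at hne
        push Not at hne
        obtain ⟨v, hv, h2⟩ := hne
        have hstep : Relation.ReflTransGen (LuczakStep G) F (insert v W) := hW.tail ⟨v, hv, h2, rfl⟩
        refine ih _ ?_ hstep
        have hvh : v ∈ expHull G F \ W :=
          Finset.mem_sdiff.2 ⟨(hsub hstep).2 (Finset.mem_insert_self _ _), hv⟩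
        rw [Finset.sdiff_insert, Finset.card_erase_of_mem hvh, hk]; rfl
    refine ⟨hex _ F rfl .refl, ?_⟩
    rintro U' ⟨v, h1, h2, -⟩
    exact absurd h2 (not_le.2 (expHull_isExpClosed G F v h1))

open Classical in
/-- The number of edges inside `S`. -/
def edgeCount (G : SimpleGraph (Fin n)) (S : Finset (Fin n)) : ℕ :=
  ((ltPairs S S).filter fun x => G.Adj x.1 x.2).card

theorem edgeCount_insert (G : SimpleGraph (Fin n)) {S : Finset (Fin n)} {v : Fin n} (hv : v ∉ S) :
    edgeCount G S + nbrCount G S v ≤ edgeCount G (insert v S) := by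
  classical
  unfold edgeCount nbrCount
  let f : Fin n → Fin n × Fin n := fun w => if w < v then (w, v) else (v, w)
  have hf : Function.Injective f := by
    intro a b hab
    simp only [f] at hab
    split_ifs at hab with h1 h2 h2 <;> simp only [Prod.mk.injEq] at hab
    · exact hab.1
    · rw [hab.1] at h1; exact absurd h1 (lt_irrefl _)
    · rw [← hab.1] at h2; exact absurd h2 (lt_irrefl _)
    · exact hab.2
  rw [← Finset.card_image_of_injective (S.filter fun w => G.Adj v w) hf, ← Finset.card_union_of_disjoint]
  · refine Finset.card_le_card (Finset.union_subset ?_ ?_)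
    · rintro ⟨a, b⟩ hx
      simp only [ltPairs, Finset.mem_filter, Finset.mem_product, Finset.mem_insert] at hx ⊢
      tauto
    · intro x hx
      obtain ⟨w, hw, rfl⟩ := Finset.mem_image.1 hx
      rw [Finset.mem_filter] at hw
      have hne : w ≠ v := fun h => hv (h ▸ hw.1)
      simp only [ltPairs, Finset.mem_filter, Finset.mem_product, Finset.mem_insert, f]
      split_ifs with h
      · exact ⟨⟨⟨.inr hw.1, .inl rfl⟩, h⟩, hw.2.symm⟩
      · exact ⟨⟨⟨.inl rfl, .inr hw.1⟩, lt_of_le_of_ne (not_lt.1 h) hne.symm⟩, hw.2⟩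
  · rw [Finset.disjoint_left]
    rintro ⟨a, b⟩ hx hx'
    obtain ⟨w, hw, hwx⟩ := Finset.mem_image.1 hx'
    simp only [ltPairs, Finset.mem_filter, Finset.mem_product] at hx
    simp only [f] at hwx
    split_ifs at hwx <;> simp only [Prod.mk.injEq] at hwx
    · exact hv (hwx.2 ▸ hx.1.1.2)
    · exact hv (hwx.1 ▸ hx.1.1.1)

/-- If the expansion of `U` has at least `|U| + k` vertices, some set of `|U| + k` vertices spans
at least `2 k` edges. -/
theorem exists_dense_of_expHull {G : SimpleGraph (Fin n)} {U : Finset (Fin n)} (k : ℕ)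
    (h : U.card + k ≤ (expHull G U).card) :
    ∃ S, U ⊆ S ∧ S ⊆ expHull G U ∧ S.card = U.card + k ∧ 2 * k ≤ edgeCount G S := by
  classical
  induction k with
  | zero => exact ⟨U, subset_rfl, subset_expHull G U, rfl, by simp⟩
  | succ k ih =>
    obtain ⟨S, h1, h2, h3, h4⟩ := ih (by omega)
    have hne : ¬ IsExpClosed G S := fun hc => by
      have := Finset.card_le_card (expHull_subset h1 hc)
      omega
    unfold IsExpClosed at hne
    push Not at hne
    obtain ⟨v, hv, hv2⟩ := hne
    refine ⟨insert v S, h1.trans (Finset.subset_insert _ _), Finset.insert_subset ?_ h2, ?_, ?_⟩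
    · by_contra hvh
      exact absurd (hv2.trans (nbrCount_mono le_rfl h2 v)) (not_le.2 (expHull_isExpClosed G U v hvh))
    · rw [Finset.card_insert_of_notMem hv]; omega
    · have := edgeCount_insert G hv; omega

open Classical in
/-- The expansion of the complement of the `k`-core of `H` in a supergraph `G` is contained in the
expansion of the set of the vertices of small degree. -/
theorem expHull_compl_coreSet_subset {G H : SimpleGraph (Fin n)} (hHG : H ≤ G) (k : ℕ) :
    expHull G (coreSet H k)ᶜ ⊆
      expHull G (Finset.univ.filter fun v => nbrCount H Finset.univ v ≤ k) := by
  set U := Finset.univ.filter fun v => nbrCount H Finset.univ v ≤ k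
  refine expHull_subset ?_ (expHull_isExpClosed G U)
  -- Outside the hull the degree in `H` is at least `k + 1`, and closedness lets at most one
  -- neighbour fall into the hull. Hence `≤ k`, not `< k`, in the definition of `U`.
  have hc : IsCore H k (expHull G U)ᶜ := by
    intro v hv
    have hv' : v ∉ expHull G U := Finset.mem_compl.1 hv
    have hU : ¬ nbrCount H Finset.univ v ≤ k := fun hle =>
      hv' (subset_expHull G U (by simpa [U] using hle))
    have h1 := nbrCount_union_le H (expHull G U)ᶜ (expHull G U) v
    rw [Finset.union_comm, Finset.union_compl] at h1
    have h2 := nbrCount_mono hHG (subset_refl (expHull G U)) v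
    have h3 := expHull_isExpClosed G U v hv'
    omega
  intro v hv
  by_contra hv'
  exact Finset.mem_compl.1 hv (hc.subset_coreSet (Finset.mem_compl.2 hv'))

end Deterministic

end CorrSBM
end

/-! ### Sparse sets, vertices of low degree and the size of the fringe. -/

noncomputable section
namespace CorrSBM

open Filter Topology

theorem edgeCount_gr {n : ℕ} (b : St → Bool) (ω : Sym2 (Fin n) → St) (S : Finset (Fin n)) :
    (edgeCount (gr b ω) S : ℝ) =
      ∑ y ∈ ltPairs S S, if b (ω s(y.1, y.2)) then (1 : ℝ) else 0 := by
  classical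
  unfold edgeCount
  rw [Finset.card_filter]
  push_cast
  refine Finset.sum_congr rfl fun y hy => ?_
  have : y.1 ≠ y.2 := (Finset.mem_filter.1 hy).2.ne
  simp [gr_adj, this]

/-- There are roughly `(n/u)^{3u}` sets against a probability `(u log n / n)^{4u}`, so one factor
`u/n` per `u` survives. The bound on `u` lets it absorb the logarithms and leave a factor `1/L`. -/
theorem choose_mul_pow_dense_le {n u : ℕ} {L B : ℝ} (hn : 0 < n) (hu : 0 < u) (hL : 0 < L)
    (hB : 0 ≤ B) (huL : u * L ^ 5 ≤ n) :
    (n.choose (3 * u) : ℝ) * (B ^ u * ((u * L / n) ^ 4) ^ u) ≤ (Real.exp 3 * B / L) ^ u := by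
  have hn' : (0 : ℝ) < n := by exact_mod_cast hn
  have hu' : (0 : ℝ) < u := by exact_mod_cast hu
  have h1 := choose_mul_pow_le (n := n) (d := 3 * u)
  have h2 : (n.choose (3 * u) : ℝ) ≤ (Real.exp 3 * n ^ 3 / (3 * u) ^ 3) ^ u := by
    rw [div_pow, le_div_iff₀ (by positivity), ← pow_mul]
    push_cast at h1
    refine h1.trans (le_of_eq ?_)
    rw [pow_mul, mul_pow (Real.exp 1), ← Real.exp_nat_mul]
    norm_num
  have h0 : 0 ≤ B ^ u * ((u * L / n) ^ 4) ^ u := by positivity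
  refine (mul_le_mul_of_nonneg_right h2 h0).trans ?_
  rw [← mul_pow, ← mul_pow]
  refine pow_le_pow_left₀ (by positivity) ?_ u
  have h3 : Real.exp 3 * n ^ 3 / (3 * u) ^ 3 * (B * (u * L / n) ^ 4) =
      Real.exp 3 * B * (u * L ^ 4 / n) / 27 := by
    field_simp; ring
  rw [h3]
  have h4 : u * L ^ 4 / n ≤ 1 / L := by
    rw [div_le_div_iff₀ hn' hL]
    linarith [show u * L ^ 4 * L = u * L ^ 5 by ring]
  have h5 : Real.exp 3 * B * (u * L ^ 4 / n) ≤ Real.exp 3 * B * (1 / L) :=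
    mul_le_mul_of_nonneg_left h4 (by positivity)
  have h6 : 0 ≤ Real.exp 3 * B * (1 / L) := by positivity
  calc _ ≤ Real.exp 3 * B * (1 / L) := by linarith
    _ = _ := by ring

/-- Small sets of `3 u` vertices span fewer than `4 u` edges. -/
theorem eventually_no_dense {α β s : ℝ} (hα : 0 < α) (hβ : 0 < β) (hs0 : 0 ≤ s) (hs1 : s ≤ 1)
    {b : St → Bool} {κ : ℝ} (hb : KindProb s b κ) :
    ∀ η > 0, ∀ᶠ n : ℕ in atTop, ∀ σ : Fin n → ℤˣ,
      Pr (stW α β s σ) {ω | ∃ (u : ℕ) (S : Finset (Fin n)), 0 < u ∧ u * Real.log n ^ 5 ≤ n ∧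
        S.card = 3 * u ∧ 4 * u ≤ edgeCount (gr b ω) S} ≤ η := by
  intro η hη
  set A := Real.exp 3 * Real.exp (9 * max α β) with hA
  have hA0 : 0 < A := by positivity
  filter_upwards [eventually_adm hα hβ hs0 hs1,
    tendsto_log_nat.eventually_ge_atTop (max 1 (max (2 * A) (4 * A / η)))] with n hn hlarge σ
  have hw := stW_isWeight hn σ
  have hL := hn.log_pos
  have hnp := hn.n_pos
  have hM : 0 < max α β := lt_max_of_lt_left hα
  have hL1 : 1 ≤ Real.log n := (le_max_left _ _).trans hlarge
  have hL2 : 2 * A ≤ Real.log n := (le_max_left _ _).trans ((le_max_right _ _).trans hlarge)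
  have hL3 : 4 * A / η ≤ Real.log n := (le_max_right _ _).trans ((le_max_right _ _).trans hlarge)
  have hy : A / Real.log n ≤ 1 / 2 := by rw [div_le_div_iff₀ hL (by norm_num)]; linarith
  have hyη : 4 * (A / Real.log n) ≤ η := by
    rw [div_le_iff₀ hη] at hL3
    rw [← mul_div_assoc, div_le_iff₀ hL]; linarith
  refine (Pr_biUnion_le hw (Finset.range (n + 1)) (fun u => {ω | ∃ S : Finset (Fin n), 0 < u ∧
    u * Real.log n ^ 5 ≤ n ∧ S.card = 3 * u ∧ 4 * u ≤ edgeCount (gr b ω) S}) ?_).trans ?_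
  · rintro ω ⟨u, S, h1, h2, h3, h4⟩
    refine ⟨u, ?_, S, h1, h2, h3, h4⟩
    have := Finset.card_le_univ S
    rw [Fintype.card_fin] at this
    simp only [Finset.mem_range]; omega
  refine (Finset.sum_le_sum (g := fun u => if u = 0 then 0 else (A / Real.log n) ^ u)
    fun u _ => ?_).trans ((sum_pow_pos_le (by positivity) hy _).trans hyη)
  by_cases hu : 0 < u ∧ u * Real.log n ^ 5 ≤ n
  swap
  · have : {ω | ∃ S : Finset (Fin n), 0 < u ∧ u * Real.log n ^ 5 ≤ n ∧ S.card = 3 * u ∧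
        4 * u ≤ edgeCount (gr b ω) S} ⊆ (∅ : Set (Sym2 (Fin n) → St)) := by
      rintro ω ⟨S, h1, h2, -⟩
      exact hu ⟨h1, h2⟩
    refine (Pr_mono hw this).trans ?_
    simp only [Pr, Set.indicator_empty, Ex_const hw]
    split_ifs <;> positivity
  obtain ⟨hu0, huL⟩ := hu
  rw [if_neg hu0.ne']
  have hu' : (0 : ℝ) < u := by exact_mod_cast hu0
  refine (Pr_biUnion_le hw (Finset.powersetCard (3 * u) Finset.univ) (fun S => {ω | ((4 * u : ℕ) : ℝ) ≤
    ∑ y ∈ ltPairs S S, if b (ω s(y.1, y.2)) then (1 : ℝ) else 0}) ?_).trans ?_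
  · rintro ω ⟨S, -, -, h3, h4⟩
    refine ⟨S, Finset.mem_powersetCard.2 ⟨Finset.subset_univ _, h3⟩, ?_⟩
    show ((4 * u : ℕ) : ℝ) ≤ ∑ y ∈ ltPairs S S, if b (ω s(y.1, y.2)) then (1 : ℝ) else 0
    rw [← edgeCount_gr]
    exact_mod_cast h4
  have hge : 1 ≤ n / (u * Real.log n) := by
    rw [le_div_iff₀ (by positivity), one_mul]
    refine le_trans ?_ huL
    have : Real.log n ≤ Real.log n ^ 5 := by
      calc Real.log n = Real.log n ^ 1 := (pow_one _).symm
        _ ≤ _ := pow_le_pow_right₀ hL1 (by norm_num)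
    gcongr
  have hterm : ∀ S ∈ Finset.powersetCard (3 * u) (Finset.univ : Finset (Fin n)),
      Pr (stW α β s σ) {ω | ((4 * u : ℕ) : ℝ) ≤
        ∑ y ∈ ltPairs S S, if b (ω s(y.1, y.2)) then (1 : ℝ) else 0} ≤
      Real.exp (9 * max α β) ^ u * ((u * Real.log n / n) ^ 4) ^ u := by
    intro S hS
    have hSc := (Finset.mem_powersetCard.1 hS).2
    -- The parameter `log (n / (u log n))` yields the fourth power for the `4 u` edges, while the
    -- exponential moment costs only `e^{9 u max α β}`.
    refine (Pr_count_ge_le hn σ hb (ltPairs S S) (fun y => s(y.1, y.2)) (ltPairs_injOn S S)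
      (Real.log (n / (u * Real.log n))) _ (Real.log_nonneg hge)).trans ?_
    rw [Real.exp_log (by positivity), ← Real.exp_nat_mul]
    have e1 : ((u * Real.log n / n) ^ 4) ^ u =
        Real.exp (-(Real.log (n / (u * Real.log n)) * (4 * u : ℕ))) := by
      rw [← pow_mul, mul_comm (Real.log _), ← mul_neg, Real.exp_nat_mul, Real.exp_neg,
        Real.exp_log (by positivity), inv_div]
    rw [e1, ← Real.exp_add, Real.exp_le_exp]
    have hc : ((ltPairs S S).card : ℝ) ≤ 9 * u ^ 2 := by
      have := Finset.card_filter_le (S ×ˢ S) fun x => x.1 < x.2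
      rw [Finset.card_product, hSc] at this
      calc ((ltPairs S S).card : ℝ) ≤ ((3 * u * (3 * u) : ℕ) : ℝ) := by
            unfold ltPairs; exact_mod_cast this
        _ = _ := by push_cast; ring
    have h5 : ((ltPairs S S).card : ℝ) * (max α β * Real.log n / n) * (n / (u * Real.log n) - 1) ≤
        u * (9 * max α β) := by
      calc _ ≤ 9 * (u : ℝ) ^ 2 * (max α β * Real.log n / n) * (n / (u * Real.log n)) := by
            have h7 : n / (u * Real.log n) - 1 ≤ n / (u * Real.log n) := by linarith
            have h8 : 0 ≤ n / (u * Real.log n) - 1 := by linarith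
            gcongr
        _ = _ := by field_simp
    linarith
  refine (Finset.sum_le_sum hterm).trans ?_
  rw [Finset.sum_const, Finset.card_powersetCard, Finset.card_univ, Fintype.card_fin, nsmul_eq_mul]
  exact choose_mul_pow_dense_le (by exact_mod_cast hnp) hu0 hL (Real.exp_pos _).le huL

end CorrSBM
end

noncomputable section
namespace CorrSBM

open Filter Topology

theorem tendsto_log_pow_mul_exp (k : ℕ) {c : ℝ} (hc : 0 < c) :
    Tendsto (fun n : ℕ => Real.log n ^ k * Real.exp (-(c * Real.log n))) atTop (𝓝 0) := by
  have h1 := ((Real.tendsto_pow_mul_exp_neg_atTop_nhds_zero k).comp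
    (tendsto_log_nat.const_mul_atTop hc)).const_mul ((c ^ k)⁻¹)
  rw [mul_zero] at h1
  refine h1.congr fun n => ?_
  simp only [Function.comp]
  rw [mul_pow]
  field_simp

/-- Markov's inequality for the number of the indices whose event occurs. -/
theorem Pr_card_ge_le {I X : Type*} [Fintype I] [DecidableEq I] [Fintype X] {w : I → X → ℝ}
    (hw : IsWeight w) {K : Type*} [Fintype K] (A : (I → X) → Finset K) {x p : ℝ} (hx : 0 < x)
    (hp : ∀ k, Pr w {ω | k ∈ A ω} ≤ p) :
    Pr w {ω | x ≤ (A ω).card} ≤ x⁻¹ * (Fintype.card K * p) := by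
  classical
  refine (Pr_le_Ex hw (f := fun ω => x⁻¹ * ∑ k : K, ({ω | k ∈ A ω} : Set (I → X)).indicator 1 ω)
    (fun ω => ?_) fun ω hω => ?_).trans ?_
  · refine mul_nonneg (by positivity) (Finset.sum_nonneg fun k _ => Set.indicator_nonneg (by simp) _)
  · have h1 : ∑ k : K, ({ω | k ∈ A ω} : Set (I → X)).indicator (1 : (I → X) → ℝ) ω =
        (A ω).card := by
      simp [Set.indicator_apply]
    rw [h1, inv_mul_eq_div, one_le_div hx]
    exact hω
  · rw [Ex_const_mul, Ex_sum]
    refine mul_le_mul_of_nonneg_left ?_ (by positivity)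
    refine (Finset.sum_le_sum fun k _ => hp k).trans ?_
    simp

section
variable {α β s : ℝ}

/-- Exponential Markov for the lower tail. As `t` grows this approaches the probability of having no
neighbour, up to the factor `e^{t k}`, harmless for bounded `k`. -/
theorem Pr_nbrCount_le_le {n : ℕ} (h : Adm α β s n) (σ : Fin n → ℤˣ) {b : St → Bool} {κ : ℝ}
    (hb : KindProb s b κ) (v : Fin n) (k : ℕ) (t : ℝ) (ht : 0 ≤ t) :
    Pr (stW α β s σ) {ω | nbrCount (gr b ω) Finset.univ v ≤ k} ≤
      Real.exp (t * k + (Real.exp (-t) - 1) * κ *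
        ∑ j ∈ Finset.univ.erase v, parentProb α β σ s(v, j)) := by
  have hw := stW_isWeight h σ
  have h1 := Ex_exp_sum_le hw (Finset.univ.erase v) (fun j => s(v, j)) (star_injOn v _)
    (fun _ => b) (fun j => parentProb α β σ s(v, j) * κ) (fun _ => -t)
    (fun j _ => stW_kind h σ hb _)
  refine (Pr_le_Ex hw (f := fun ω => Real.exp (t * k) * Real.exp (∑ j ∈ Finset.univ.erase v,
    if b (ω s(v, j)) then -t else 0)) (fun ω => by positivity) fun ω hω => ?_).trans ?_
  · rw [← Real.exp_add, Real.one_le_exp_iff]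
    have h2 : (nbrCount (gr b ω) Finset.univ v : ℝ) ≤ k := by
      have : nbrCount (gr b ω) Finset.univ v ≤ k := hω
      exact_mod_cast this
    rw [nbrCount_gr] at h2
    have h3 := mul_le_mul_of_nonneg_left h2 ht
    have h4 : (∑ j ∈ Finset.univ.erase v, if b (ω s(v, j)) then -t else 0) =
        -(t * ∑ j ∈ Finset.univ.erase v, if b (ω s(v, j)) then (1 : ℝ) else 0) := by
      rw [Finset.mul_sum, ← Finset.sum_neg_distrib]
      exact Finset.sum_congr rfl fun j _ => by split_ifs <;> simp
    rw [h4]; linarith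
  · rw [Ex_const_mul, Real.exp_add]
    refine mul_le_mul_of_nonneg_left (h1.trans (le_of_eq ?_)) (Real.exp_pos _).le
    rw [Finset.mul_sum]
    congr 1
    exact Finset.sum_congr rfl fun j _ => by ring

theorem le_sum_parentProb {n : ℕ} (h : Adm α β s n) (σ : Fin n → ℤˣ) (v : Fin n) {δ : ℝ}
    (hσ : |∑ i, rv σ i| ≤ δ * n) :
    Real.log n * (Tc α β - |α - β| * δ) - max α β * Real.log n / n ≤
      ∑ j ∈ Finset.univ.erase v, parentProb α β σ s(v, j) := by
  have h1 := sum_parentProb h σ v Finset.univ (fun _ => 1)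
  simp only [mul_one, Finset.card_univ, Fintype.card_fin] at h1
  rw [← Finset.sum_erase_add _ _ (Finset.mem_univ v)] at h1
  have h2 := parentProb_le h σ s(v, v)
  have hn := h.n_pos
  have hL := h.log_pos
  have h3 : |(α - β) / 2 * (rv σ v * ∑ j, rv σ j)| ≤ |α - β| * δ * n := by
    rw [abs_mul, abs_mul, abs_rv, abs_div, one_mul, mul_assoc, abs_two]
    have := mul_le_mul_of_nonneg_left hσ (abs_nonneg (α - β))
    have h0 : 0 ≤ |α - β| * |∑ j, rv σ j| := by positivity
    linarith
  have h4 := (abs_le.1 h3).1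
  have h5 : Real.log n * (Tc α β - |α - β| * δ) ≤
      Real.log n / n * ((α + β) / 2 * n + (α - β) / 2 * (rv σ v * ∑ j, rv σ j)) := by
    have h6 : Real.log n * (Tc α β - |α - β| * δ) =
      Real.log n / n * ((α + β) / 2 * n - |α - β| * δ * n) := by
      unfold Tc; field_simp
    rw [h6]
    refine mul_le_mul_of_nonneg_left (by linarith) (by positivity)
  linarith

open Classical in
/-- The number of the vertices of bounded degree. -/
theorem eventually_lowDegree (hα : 0 < α) (hβ : 0 < β) (hs0 : 0 ≤ s) (hs1 : s ≤ 1)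
    {b : St → Bool} {κ : ℝ} (hb : KindProb s b κ) (k : ℕ) {δ : ℝ} (hδ : 0 < δ) :
    ∃ δ₀ > 0, ∀ η > 0, ∀ᶠ n : ℕ in atTop, ∀ σ : Fin n → ℤˣ, |∑ i, rv σ i| ≤ δ₀ * n →
      Pr (stW α β s σ) {ω | Real.exp ((1 - κ * Tc α β + δ) * Real.log n) ≤
        (Finset.univ.filter fun v => nbrCount (gr b ω) Finset.univ v ≤ k).card} ≤ η := by
  have hM : 0 < max α β := lt_max_of_lt_left hα
  refine ⟨δ / (8 * (|α - β| + 1)), by positivity, fun η hη => ?_⟩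
  -- `ζ` plays the role of `e^{-t}`, so small that the loss `ζ κ S` is at most `(δ/8) log n`. The
  -- term `t k` is constant and also negligible.
  set ζ : ℝ := min 1 (δ / (8 * max α β)) with hζ
  have hζ0 : 0 < ζ := lt_min one_pos (by positivity)
  set t := -Real.log ζ with ht
  have ht0 : 0 ≤ t := by
    rw [ht]; linarith [Real.log_nonpos hζ0.le (min_le_left _ _)]
  have hlim := (tendsto_log_pow_div 1).const_mul (max α β)
  rw [mul_zero] at hlim
  filter_upwards [eventually_adm hα hβ hs0 hs1, hlim.eventually_le_const (one_pos),
    tendsto_log_nat.eventually_ge_atTop ((t * k + 1) / (δ / 8)),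
    (tendsto_rpow_neg_nat (half_pos hδ)).eventually_le_const hη] with n hn hML hlarge hsmall σ hσ
  have hw := stW_isWeight hn σ
  have hL := hn.log_pos
  have hnp := hn.n_pos
  rw [div_le_iff₀ (by positivity)] at hlarge
  rw [pow_one, ← mul_div_assoc] at hML
  have hδ0 : |α - β| * (δ / (8 * (|α - β| + 1))) ≤ δ / 8 := by
    rw [← mul_div_assoc, div_le_div_iff₀ (by positivity) (by norm_num)]
    nlinarith [abs_nonneg (α - β)]
  have hp : ∀ v, Pr (stW α β s σ) {ω | v ∈ Finset.univ.filter fun v =>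
      nbrCount (gr b ω) Finset.univ v ≤ k} ≤ Real.exp (-((κ * Tc α β - δ / 2) * Real.log n)) := by
    intro v
    simp only [Finset.mem_filter, Finset.mem_univ, true_and]
    refine (Pr_nbrCount_le_le hn σ hb v k t ht0).trans (Real.exp_le_exp.2 ?_)
    have e1 : Real.exp (-t) = ζ := by rw [ht, neg_neg, Real.exp_log hζ0]
    rw [e1]
    set S := ∑ j ∈ Finset.univ.erase v, parentProb α β σ s(v, j) with hS
    have h1 := le_sum_parentProb hn σ v hσ
    rw [← hS] at h1
    have h2 : S ≤ max α β * Real.log n := by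
      calc S ≤ ∑ j ∈ Finset.univ.erase v, max α β * Real.log n / n :=
            Finset.sum_le_sum fun j _ => parentProb_le hn σ _
        _ = ((Finset.univ.erase v).card : ℝ) * (max α β * Real.log n / n) := by simp
        _ ≤ n * (max α β * Real.log n / n) := by
            have hc : ((Finset.univ.erase v).card : ℝ) ≤ n := by
              have := Finset.card_le_univ (Finset.univ.erase v)
              rw [Fintype.card_fin] at this
              exact_mod_cast this
            gcongr
        _ = _ := by field_simp
    have hS0 : 0 ≤ S := Finset.sum_nonneg fun j _ => parentProb_nonneg σ _
    have h3 : ζ * κ * S ≤ δ / 8 * Real.log n := by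
      calc ζ * κ * S ≤ (δ / (8 * max α β)) * 1 * (max α β * Real.log n) := by
            have := hb.1.1
            have := hb.1.2
            have : ζ ≤ δ / (8 * max α β) := min_le_right _ _
            gcongr
        _ = _ := by field_simp
    have h4 : κ * S ≥ κ * Tc α β * Real.log n - δ / 8 * Real.log n - 1 := by
      have h5 := mul_le_mul_of_nonneg_left h1 hb.1.1
      have h6 : κ * (Real.log n * (|α - β| * (δ / (8 * (|α - β| + 1)))) +
          max α β * Real.log n / n) ≤ 1 * (Real.log n * (δ / 8) + 1) := by
        have := hb.1.2
        gcongr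
      linarith
    have h7 : (ζ - 1) * κ * S = ζ * κ * S - κ * S := by ring
    rw [h7]
    have h8 : t * k + 1 ≤ δ / 8 * Real.log n := by linarith
    linarith [mul_pos hδ hL]
  refine (Pr_card_ge_le hw _ (Real.exp_pos _) hp).trans ?_
  rw [Fintype.card_fin, ← Real.exp_neg]
  nth_rewrite 2 [← Real.exp_log hnp]
  rw [← Real.exp_add, ← Real.exp_add]
  refine le_trans (le_of_eq ?_) hsmall
  congr 1; ring

/-- The expansion of the complement of the core is small. -/
theorem eventually_hull_le (hα : 0 < α) (hβ : 0 < β) (hs0 : 0 ≤ s) (hs1 : s ≤ 1) (k : ℕ)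
    {δ : ℝ} (hδ : 0 < δ) (hδs : δ < s ^ 2 * Tc α β) :
    ∃ δ₀ > 0, ∀ η > 0, ∀ᶠ n : ℕ in atTop, ∀ σ : Fin n → ℤˣ, |∑ i, rv σ i| ≤ δ₀ * n →
      Pr (stW α β s σ) {ω | 3 * Real.exp ((1 - s ^ 2 * Tc α β + δ) * Real.log n) <
        (expHull (gr isG2 ω) (coreSet (gr isH ω) k)ᶜ).card} ≤ η := by
  classical
  obtain ⟨δ₀, hδ₀, H⟩ := eventually_lowDegree hα hβ hs0 hs1 (kindProb_isH hs0 hs1) k hδ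
  refine ⟨δ₀, hδ₀, fun η hη => ?_⟩
  filter_upwards [H (η / 2) (half_pos hη),
    eventually_no_dense hα hβ hs0 hs1 (kindProb_isG2 hs0 hs1) (η / 2) (half_pos hη),
    (tendsto_log_pow_mul_exp 5 (sub_pos.2 hδs)).eventually_le_const one_pos,
    eventually_adm hα hβ hs0 hs1] with n h1 h2 h3 hn σ hσ
  have hw := stW_isWeight hn σ
  refine le_trans ((Pr_mono hw ?_).trans (Pr_union_le hw _ _))
    ((add_le_add (h1 σ hσ) (h2 σ)).trans (le_of_eq (add_halves η)))
  intro ω hω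
  have hω' : 3 * Real.exp ((1 - s ^ 2 * Tc α β + δ) * Real.log n) <
        (expHull (gr isG2 ω) (coreSet (gr isH ω) k)ᶜ).card := hω
  set U := Finset.univ.filter fun v => nbrCount (gr isH ω) Finset.univ v ≤ k with hU
  by_cases hbig : Real.exp ((1 - s ^ 2 * Tc α β + δ) * Real.log n) ≤ U.card
  · exact Or.inl hbig
  right
  push Not at hbig
  have hle : gr isH ω ≤ gr isG2 ω := by
    intro i j hij
    rw [gr_adj] at hij ⊢
    refine ⟨hij.1, ?_⟩
    have := hij.2
    simp only [isH, Bool.and_eq_true] at this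
    exact this.1
  have hcard := Finset.card_le_card (expHull_compl_coreSet_subset hle k)
  rw [← hU] at hcard
  have hbig' : 3 * (U.card : ℝ) < (expHull (gr isG2 ω) U).card := by
    have : ((expHull (gr isG2 ω) (coreSet (gr isH ω) k)ᶜ).card : ℝ) ≤
      (expHull (gr isG2 ω) U).card := by exact_mod_cast hcard
    linarith
  have hbig'' : 3 * U.card < (expHull (gr isG2 ω) U).card := by exact_mod_cast hbig'
  have hpos : 0 < U.card := by
    rw [Finset.card_pos, Finset.nonempty_iff_ne_empty]
    intro he
    have : expHull (gr isG2 ω) U ⊆ ∅ := by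
      refine expHull_subset (by rw [he]) fun v _ => ?_
      simp [nbrCount]
    rw [Finset.subset_empty.1 this] at hbig''
    simp at hbig''
  -- More than tripling would produce `3 |U|` vertices that span at least `4 |U|` edges, contrary to
  -- `eventually_no_dense`.
  obtain ⟨S, -, -, hSc, hSe⟩ := exists_dense_of_expHull (G := gr isG2 ω) (U := U) (2 * U.card)
    (by omega)
  refine ⟨U.card, S, hpos, ?_, by omega, by omega⟩
  have hL := hn.log_pos
  calc (U.card : ℝ) * Real.log n ^ 5 ≤
      Real.exp ((1 - s ^ 2 * Tc α β + δ) * Real.log n) * Real.log n ^ 5 := by gcongr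
    _ = Real.exp (Real.log n) *
        (Real.log n ^ 5 * Real.exp (-((s ^ 2 * Tc α β - δ) * Real.log n))) := by
        rw [mul_comm (Real.log n ^ 5), ← mul_assoc, ← Real.exp_add]; ring_nf
    _ ≤ Real.exp (Real.log n) * 1 := by gcongr
    _ = n := by rw [mul_one, Real.exp_log hn.n_pos]

end

end CorrSBM
end

noncomputable section
namespace CorrSBM

open Filter Topology

/-! ### Resampling the edges of the first graph outside the second one -/

/-- Fubini for `Ex_mix`: a bound that holds after resampling for every frozen `ω` holds on average.
-/
theorem Pr_resample_le {I X : Type*} [Fintype I] [DecidableEq I] [Fintype X] {w : I → X → ℝ}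
    (hw : IsWeight w) (m : I → X × X → X × X) (hm : ∀ i z, m i (m i z) = z)
    (hwm : ∀ i z, w i (m i z).1 * w i (m i z).2 = w i z.1 * w i z.2) {S : Set (I → X)} {η : ℝ}
    (h : ∀ ω : I → X, Pr w {ω' : I → X | (fun i => (m i (ω i, ω' i)).1) ∈ S} ≤ η) : Pr w S ≤ η := by
  unfold Pr
  rw [Ex_mix hw m hm hwm]
  exact (Ex_mono hw fun ω => h ω).trans (le_of_eq (Ex_const hw η))

/-- The states with the third component replaced by that of `ω'`. -/
def mixY {n : ℕ} (ω ω' : Sym2 (Fin n) → St) : Sym2 (Fin n) → St :=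
  fun e => ((ω e).1, (ω e).2.1, (ω' e).2.2)

/-- The expansion in the second graph of the complement of the `k`-core of the intersection graph. -/
def fringe {n : ℕ} (k : ℕ) (ω : Sym2 (Fin n) → St) : Finset (Fin n) :=
  expHull (gr isG2 ω) (coreSet (gr isH ω) k)ᶜ

/-- Both the second graph and the intersection graph read the first two bits only. -/
theorem fringe_mixY {n : ℕ} (k : ℕ) (ω ω' : Sym2 (Fin n) → St) :
    fringe k (mixY ω ω') = fringe k ω := rfl

section
variable {α β s : ℝ} {n : ℕ}

/-- The weight is a product over the three bits, so swapping the third ones preserves it. Thus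
exclusive edges may be treated as fresh once the fringe is known. -/
theorem Pr_mixY_le (h : Adm α β s n) (σ : Fin n → ℤˣ) {S : Set (Sym2 (Fin n) → St)} {η : ℝ}
    (hS : ∀ ω, Pr (stW α β s σ) {ω' | mixY ω ω' ∈ S} ≤ η) : Pr (stW α β s σ) S ≤ η := by
  refine Pr_resample_le (stW_isWeight h σ)
    (fun _ z => ((z.1.1, z.1.2.1, z.2.2.2), (z.2.1, z.2.2.1, z.1.2.2))) (fun _ _ => rfl) ?_ hS
  intro e z
  simp only [stW, edgeW]
  ring

/-- The denominator `1 - p s` changes the probability to second order only. Over the at most `n`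
pairs at a vertex the error is `O(log² n / n)`. -/
theorem abs_isY_sub_le (h : Adm α β s n) (σ : Fin n → ℤˣ) (e : Sym2 (Fin n)) :
    |∑ x, stW α β s σ e x * (if isY x then 1 else 0) - parentProb α β σ e * (s * (1 - s))| ≤
      2 * (max α β * Real.log n / n) ^ 2 := by
  have h1 := parentProb_le h σ e
  have h0 := parentProb_nonneg (α := α) (β := β) σ e
  have h2 := h.half
  have hs0 := h.hs0
  have hs1 := h.hs1
  show |∑ x, edgeW s (parentProb α β σ e) x * (if isY x then 1 else 0) - _| ≤ _
  rw [edgeW_isY]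
  set p := parentProb α β σ e
  set M := max α β * Real.log n / n
  have hps0 : 0 ≤ p * s := mul_nonneg h0 hs0
  have hps : p * s ≤ p := mul_le_of_le_one_right h0 hs1
  have hd : 0 < 1 - p * s := by linarith
  have e1 : p * s * (1 - s) / (1 - p * s) - p * (s * (1 - s)) =
      (p * s) ^ 2 * (1 - s) / (1 - p * s) := by
    field_simp; ring
  rw [e1, abs_of_nonneg (div_nonneg (mul_nonneg (sq_nonneg _) (by linarith)) hd.le),
    div_le_iff₀ hd]
  have h3 : (p * s) ^ 2 ≤ M ^ 2 := pow_le_pow_left₀ hps0 (hps.trans h1) 2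
  have h4 : (p * s) ^ 2 * (1 - s) ≤ (p * s) ^ 2 := mul_le_of_le_one_right (sq_nonneg _) (by linarith)
  have h5 : 1 / 2 ≤ 1 - p * s := by linarith
  have h6 : 2 * M ^ 2 * (1 / 2) ≤ 2 * M ^ 2 * (1 - p * s) :=
    mul_le_mul_of_nonneg_left h5 (by positivity)
  linarith

theorem isY_le (h : Adm α β s n) (σ : Fin n → ℤˣ) (e : Sym2 (Fin n)) :
    ∑ x, stW α β s σ e x * (if isY x then 1 else 0) ≤ 2 * (max α β * Real.log n / n) := by
  have h1 := (abs_le.1 (abs_isY_sub_le h σ e)).2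
  have h2 := parentProb_le h σ e
  have h0 := parentProb_nonneg (α := α) (β := β) σ e
  have hs0 := h.hs0
  have hs1 := h.hs1
  have h3 : parentProb α β σ e * (s * (1 - s)) ≤ parentProb α β σ e :=
    mul_le_of_le_one_right h0 (by nlinarith)
  have h4 := h.half
  have h5 : 0 ≤ max α β * Real.log n / n := h0.trans h2
  nlinarith

theorem signed_exponent_le (σ : Fin n → ℤˣ) (v : Fin n) (J : Finset (Fin n)) {N B : ℝ}
    (hN : N ≤ J.card) (hB : |∑ j ∈ J, rv σ j| ≤ B) :
    -(Dplus α β * J.card) + (β - α) / 2 * (rv σ v * ∑ j ∈ J, rv σ j) ≤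
      -(Dplus α β * N) + |α - β| * B := by
  have h1 := mul_le_mul_of_nonneg_left hN (Dplus_nonneg (α := α) (β := β))
  have h2 : |(β - α) / 2 * (rv σ v * ∑ j ∈ J, rv σ j)| ≤ |α - β| * B := by
    rw [abs_mul, abs_mul, abs_rv, abs_div, abs_two, one_mul, abs_sub_comm]
    have h3 := mul_le_mul_of_nonneg_left hB (abs_nonneg (α - β))
    have h4 := mul_nonneg (abs_nonneg (α - β)) (abs_nonneg (∑ j ∈ J, rv σ j))
    linarith
  linarith [(abs_le.1 h2).2]

/-- The sum of labels over a set with a small complement. -/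
theorem abs_sum_rv_le (σ : Fin n → ℤˣ) (J : Finset (Fin n)) :
    |∑ j ∈ J, rv σ j| ≤ |∑ j, rv σ j| + (Jᶜ.card : ℝ) := by
  classical
  have h1 : ∑ j ∈ J, rv σ j = ∑ j, rv σ j - ∑ j ∈ Jᶜ, rv σ j := by
    rw [← Finset.sum_add_sum_compl J]; ring
  rw [h1]
  refine (abs_sub _ _).trans (add_le_add le_rfl ?_)
  refine (Finset.abs_sum_le_sum_abs _ _).trans ?_
  simp [abs_rv]

/-- Every vertex has few neighbours in the fringe along the edges of the first graph which are not
in the second one. -/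
theorem eventually_diff_fringe_le (hα : 0 < α) (hβ : 0 < β) (hs0 : 0 ≤ s) (hs1 : s ≤ 1) (k : ℕ)
    (hT : 0 < s ^ 2 * Tc α β) :
    ∃ K₁ : ℕ, ∃ δ₀ > 0, ∀ η > 0, ∀ᶠ n : ℕ in atTop, ∀ σ : Fin n → ℤˣ, |∑ i, rv σ i| ≤ δ₀ * n →
      Pr (stW α β s σ) {ω | ∃ v, K₁ ≤ nbrCount (gr isD ω) (fringe k ω) v} ≤ η := by
  classical
  set c := s ^ 2 * Tc α β / 2 with hc
  have hc0 : 0 < c := half_pos hT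
  obtain ⟨δ₀, hδ₀, H⟩ := eventually_hull_le hα hβ hs0 hs1 k hc0 (half_lt_self hT)
  -- The fringe has at most `3 n^{1-c}` vertices, so the Chernoff parameter `(c/2) log n` is
  -- affordable. Then `4/c` neighbours cost `n^{-2}`, enough for all `n` vertices.
  obtain ⟨K₁, hK₁⟩ := exists_nat_ge (4 / c)
  refine ⟨K₁, δ₀, hδ₀, fun η hη => ?_⟩
  have hM : 0 < max α β := lt_max_of_lt_left hα
  have hl1 := (tendsto_log_pow_mul_exp 1 (half_pos hc0)).const_mul (6 * max α β)
  rw [mul_zero] at hl1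
  have hl2 := (tendsto_rpow_neg_nat one_pos).const_mul (Real.exp 1)
  rw [mul_zero] at hl2
  filter_upwards [H (η / 2) (half_pos hη), hl1.eventually_le_const one_pos,
    hl2.eventually_le_const (half_pos hη), eventually_adm hα hβ hs0 hs1] with n h1 h2 h3 hn σ hσ
  have hw := stW_isWeight hn σ
  have hL := hn.log_pos
  have hnp := hn.n_pos
  set x := 3 * Real.exp ((1 - s ^ 2 * Tc α β + c) * Real.log n) with hx
  have hxc : x = 3 * (n * Real.exp (-(c * Real.log n))) := by
    rw [hx]
    nth_rewrite 2 [← Real.exp_log hnp]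
    rw [← Real.exp_add]
    congr 2
    rw [hc]; ring
  have hsub : {ω : Sym2 (Fin n) → St | ∃ v, K₁ ≤ nbrCount (gr isD ω) (fringe k ω) v} ⊆
      {ω | x < (fringe k ω).card} ∪ {ω | (fringe k ω).card ≤ x ∧
        ∃ v, K₁ ≤ nbrCount (gr isD ω) (fringe k ω) v} := by
    rintro ω hω
    by_cases hb : x < (fringe k ω).card
    · exact Or.inl hb
    · exact Or.inr ⟨not_lt.1 hb, hω⟩
  refine (Pr_mono hw hsub).trans ((Pr_union_le hw _ _).trans
    ((add_le_add (h1 σ hσ) ?_).trans (le_of_eq (add_halves η))))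
  refine Pr_mixY_le hn σ fun ω => ?_
  by_cases hb : (fringe k ω).card ≤ x
  swap
  · have : {ω' | mixY ω ω' ∈ {ω : Sym2 (Fin n) → St | (fringe k ω).card ≤ x ∧
        ∃ v, K₁ ≤ nbrCount (gr isD ω) (fringe k ω) v}} ⊆ ∅ := fun ω' hω' => hb hω'.1
    refine (Pr_mono hw this).trans ?_
    simp only [Pr, Set.indicator_empty, Ex_const hw]
    positivity
  refine (Pr_biUnion_le hw Finset.univ (fun v => {ω' | (K₁ : ℝ) ≤ ∑ j ∈ (fringe k ω).erase v,
    if isY (ω' s(v, j)) then (1 : ℝ) else 0}) ?_).trans ?_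
  · rintro ω' ⟨-, v, hv⟩
    refine ⟨v, Finset.mem_univ _, ?_⟩
    have h5 : (K₁ : ℝ) ≤ nbrCount (gr isD (mixY ω ω')) (fringe k ω) v := by exact_mod_cast hv
    rw [nbrCount_gr] at h5
    -- Passing from `isD` to `isY` can only increase the count and removes the dependence on the
    -- frozen second graph.
    refine h5.trans (Finset.sum_le_sum fun j _ => ?_)
    have : isD (mixY ω ω' s(v, j)) = true → isY (ω' s(v, j)) = true := by
      simp only [isD, mixY, isY, Bool.and_eq_true]
      exact fun h => h.2
    split_ifs <;> simp_all
  · have hterm : ∀ v, Pr (stW α β s σ) {ω' | (K₁ : ℝ) ≤ ∑ j ∈ (fringe k ω).erase v,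
        if isY (ω' s(v, j)) then (1 : ℝ) else 0} ≤ Real.exp (1 - 2 * Real.log n) := by
      intro v
      refine (Pr_count_ge_le_of hw ((fringe k ω).erase v) (fun j => s(v, j)) (star_injOn v _) isY
        (fun j _ => isY_le hn σ _) (c / 2 * Real.log n) K₁ (by positivity)).trans
        (Real.exp_le_exp.2 ?_)
      have h6 : (((fringe k ω).erase v).card : ℝ) ≤ x :=
        le_trans (by exact_mod_cast Finset.card_le_card (Finset.erase_subset _ _)) hb
      have h7 : (((fringe k ω).erase v).card : ℝ) * (2 * (max α β * Real.log n / n)) *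
          (Real.exp (c / 2 * Real.log n) - 1) ≤ 1 := by
        calc _ ≤ x * (2 * (max α β * Real.log n / n)) * Real.exp (c / 2 * Real.log n) := by
              have := Real.one_le_exp (show 0 ≤ c / 2 * Real.log n by positivity)
              have h8 : 0 ≤ Real.exp (c / 2 * Real.log n) - 1 := by linarith
              have h9 : Real.exp (c / 2 * Real.log n) - 1 ≤ Real.exp (c / 2 * Real.log n) := by
                linarith
              have hx0 : 0 ≤ x := by positivity
              gcongr
          _ = 6 * max α β * (Real.log n ^ 1 *
              (Real.exp (-(c * Real.log n)) * Real.exp (c / 2 * Real.log n))) := by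
              rw [hxc]; field_simp; ring
          _ = 6 * max α β * (Real.log n ^ 1 * Real.exp (-(c / 2 * Real.log n))) := by
              rw [← Real.exp_add]; ring_nf
          _ ≤ 1 := h2
      have h8 : 2 ≤ c / 2 * K₁ := by
        rw [div_le_iff₀ hc0] at hK₁; linarith
      have h9 := mul_le_mul_of_nonneg_right h8 hL.le
      linarith
    refine (Finset.sum_le_sum fun v _ => hterm v).trans ?_
    simp only [Finset.sum_const, Finset.card_univ, Fintype.card_fin, nsmul_eq_mul]
    refine le_trans (le_of_eq ?_) h3
    nth_rewrite 1 [← Real.exp_log hnp]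
    rw [← Real.exp_add, ← Real.exp_add]; ring_nf

end

end CorrSBM
end

/-! ### Classification of the fringe by exclusive edges. -/

noncomputable section
namespace CorrSBM

open Filter Topology

/-- The vertices of the fringe are classified correctly, with a margin, by the edges of the first
graph which lead out of the fringe and are not in the second graph. -/
theorem eventually_signed_diff {α β s : ℝ} (hα : 0 < α) (hβ : 0 < β) (hs0 : 0 ≤ s) (hs1 : s ≤ 1)
    (k : ℕ) (hT : 0 < s ^ 2 * Tc α β)
    (hgap : 1 < s ^ 2 * Tc α β + s * (1 - s) * Dplus α β) (x : ℝ) :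
    ∃ δ₀ > 0, ∀ η > 0, ∀ᶠ n : ℕ in atTop, ∀ σ : Fin n → ℤˣ, |∑ i, rv σ i| ≤ δ₀ * n →
      Pr (stW α β s σ) {ω | ∃ v ∈ fringe k ω, tilt α β * (rv σ v *
        ∑ j ∈ (fringe k ω)ᶜ, if isD (ω s(v, j)) then rv σ j else 0) ≤ x} ≤ η := by
  classical
  set gap := s ^ 2 * Tc α β + s * (1 - s) * Dplus α β - 1 with hgapd
  have hgap0 : 0 < gap := by rw [hgapd]; linarith
  -- `δ` is lost twice, in the size of the fringe and in the imbalance of the labels, so half of the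
  -- gap remains.
  set δ := min (gap / 4) (s ^ 2 * Tc α β / 2) with hδd
  have hδ : 0 < δ := lt_min (by positivity) (by positivity)
  have hδ1 : δ ≤ gap / 4 := min_le_left _ _
  have hδ2 : δ < s ^ 2 * Tc α β := (min_le_right _ _).trans_lt (half_lt_self hT)
  set c := s ^ 2 * Tc α β - δ with hc
  have hc0 : 0 < c := sub_pos.2 hδ2
  obtain ⟨δ₁, hδ₁, H⟩ := eventually_hull_le hα hβ hs0 hs1 k hδ hδ2
  have hM : 0 < max α β := lt_max_of_lt_left hα
  set Δ := 2 * max α β + 2 with hΔ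
  have hΔ0 : 0 < Δ := by positivity
  set D := Dplus α β with hD
  have hD0 : 0 ≤ D := Dplus_nonneg
  set κ := s * (1 - s) with hκ
  have hκ0 : 0 ≤ κ := mul_nonneg hs0 (by linarith)
  have hκ1 : κ ≤ 1 := by rw [hκ]; nlinarith
  set a := |α - β| with ha
  have ha0 : 0 ≤ a := abs_nonneg _
  refine ⟨min δ₁ (δ / (a + 1)), lt_min hδ₁ (by positivity), fun η hη => ?_⟩
  have hl1 := ((tendsto_log_pow_mul_exp 1 hc0).const_mul 3).add ((tendsto_log_pow_div 2).const_mul Δ)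
  have hl1' := hl1.const_mul (D + a)
  rw [mul_zero, mul_zero, add_zero, mul_zero] at hl1'
  have hl2 := (tendsto_log_pow_div 2).const_mul (2 * max α β ^ 2 * Real.exp |tilt α β|)
  rw [mul_zero] at hl2
  have hl3 := (tendsto_rpow_neg_nat (half_pos hgap0)).const_mul (3 * Real.exp (x + 2))
  rw [mul_zero] at hl3
  filter_upwards [H (η / 3) (by positivity),
    eventually_degree_le hα hβ hs0 hs1 (kindProb_isG2 hs0 hs1) (η / 3) (by positivity),
    hl1'.eventually_le_const one_pos, hl2.eventually_le_const one_pos,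
    hl3.eventually_le_const (show 0 < η / 3 by positivity),
    eventually_adm hα hβ hs0 hs1] with n h1 h2 h3 h4 h5 hn σ hσ
  have hw := stW_isWeight hn σ
  have hL := hn.log_pos
  have hnp := hn.n_pos
  set L := Real.log n with hLd
  have hσ1 : |∑ i, rv σ i| ≤ δ₁ * n :=
    hσ.trans (mul_le_mul_of_nonneg_right (min_le_left _ _) hnp.le)
  have hσ2 : |∑ i, rv σ i| ≤ δ / (a + 1) * n :=
    hσ.trans (mul_le_mul_of_nonneg_right (min_le_right _ _) hnp.le)
  set y := 3 * Real.exp ((1 - s ^ 2 * Tc α β + δ) * L) with hy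
  have hyc : y = 3 * (n * Real.exp (-(c * L))) := by
    rw [hy]
    nth_rewrite 1 [← Real.exp_log hnp]
    rw [← Real.exp_add]
    congr 2
    rw [hc]; ring
  have hsub : {ω : Sym2 (Fin n) → St | ∃ v ∈ fringe k ω, tilt α β * (rv σ v *
        ∑ j ∈ (fringe k ω)ᶜ, if isD (ω s(v, j)) then rv σ j else 0) ≤ x} ⊆
      ({ω | y < (fringe k ω).card} ∪ {ω | ∃ v, Δ * L ≤ nbrCount (gr isG2 ω) Finset.univ v}) ∪
      {ω | ((fringe k ω).card ≤ y ∧ ∀ v, nbrCount (gr isG2 ω) Finset.univ v ≤ Δ * L) ∧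
        ∃ v ∈ fringe k ω, tilt α β * (rv σ v *
        ∑ j ∈ (fringe k ω)ᶜ, if isD (ω s(v, j)) then rv σ j else 0) ≤ x} := by
    intro ω hω
    by_cases hb : y < (fringe k ω).card
    · exact Or.inl (Or.inl hb)
    by_cases hd : ∃ v, Δ * L ≤ nbrCount (gr isG2 ω) Finset.univ v
    · exact Or.inl (Or.inr hd)
    · push Not at hd
      exact Or.inr ⟨⟨not_lt.1 hb, fun v => (hd v).le⟩, hω⟩
  refine (Pr_mono hw hsub).trans ((Pr_union_le hw _ _).trans ((add_le_add ((Pr_union_le hw _ _).trans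
    (add_le_add (h1 σ hσ1) (h2 σ))) (c := _) (d := η / 3) ?_).trans (le_of_eq (by ring))))
  refine Pr_mixY_le hn σ fun ω => ?_
  by_cases hb : (fringe k ω).card ≤ y ∧ ∀ v, nbrCount (gr isG2 ω) Finset.univ v ≤ Δ * L
  swap
  · refine (Pr_mono hw (T := ∅) fun ω' hω' => hb hω'.1).trans ?_
    simp only [Pr, Set.indicator_empty, Ex_const hw]
    positivity
  obtain ⟨hbF, hbd⟩ := hb
  -- For frozen `ω` these are the vertices at which `isD` and `isY` agree. All other vertices
  -- outside the fringe contribute nothing, and `J` omits only the fringe and the `O(log n)`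
  -- neighbours of `v` in the second graph.
  let J : Fin n → Finset (Fin n) := fun v => (fringe k ω)ᶜ.filter fun j => ¬ (gr isG2 ω).Adj v j
  refine (Pr_biUnion_le hw (fringe k ω) (fun v => {ω' | tilt α β * (rv σ v *
    ∑ j ∈ J v, if isY (ω' s(v, j)) then rv σ j else 0) ≤ x}) ?_).trans ?_
  · rintro ω' ⟨-, v, hv, hvx⟩
    rw [fringe_mixY] at hv hvx
    refine ⟨v, hv, ?_⟩
    have e1 : ∑ j ∈ J v, (if isY (ω' s(v, j)) then rv σ j else 0) =
        ∑ j ∈ (fringe k ω)ᶜ, if isD (mixY ω ω' s(v, j)) then rv σ j else 0 := by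
      rw [Finset.sum_filter]
      refine Finset.sum_congr rfl fun j hj => ?_
      have hne : v ≠ j := fun h => Finset.mem_compl.1 hj (h ▸ hv)
      simp only [gr_adj, isD, isY, isG2, mixY]
      rcases Bool.eq_false_or_eq_true (ω s(v, j)).1 with hb1 | hb1 <;> simp [hb1]
      · exact fun h => absurd h hne
      · congr
    show tilt α β * (rv σ v * ∑ j ∈ J v, if isY (ω' s(v, j)) then rv σ j else 0) ≤ x
    rw [e1]; exact hvx
  · have hterm : ∀ v, Pr (stW α β s σ) {ω' | tilt α β * (rv σ v *
        ∑ j ∈ J v, if isY (ω' s(v, j)) then rv σ j else 0) ≤ x} ≤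
        Real.exp (x + 2 - (κ * D - δ) * L) := by
      intro v
      refine (Pr_signed_le hn σ v (J v) hκ1 (abs_isY_sub_le hn σ) x).trans (Real.exp_le_exp.2 ?_)
      have hJc : ((J v)ᶜ.card : ℝ) ≤ y + Δ * L := by
        have h6 : (J v)ᶜ ⊆ fringe k ω ∪ Finset.univ.filter fun j => (gr isG2 ω).Adj v j := by
          intro j hj
          simp only [J, Finset.mem_compl, Finset.mem_filter, not_and, not_not] at hj
          by_cases hjf : j ∈ fringe k ω
          · exact Finset.mem_union_left _ hjf
          · exact Finset.mem_union_right _ (by simpa using hj hjf)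
        have h7 := (Finset.card_le_card h6).trans (Finset.card_union_le _ _)
        have h8 := hbd v
        unfold nbrCount at h8
        have h9 : ((J v)ᶜ.card : ℝ) ≤ (fringe k ω).card +
          ((Finset.univ.filter fun j => (gr isG2 ω).Adj v j).card : ℝ) := by exact_mod_cast h7
        linarith
      have hJN : (n : ℝ) - (y + Δ * L) ≤ (J v).card := by
        have h6 := Finset.card_add_card_compl (J v)
        rw [Fintype.card_fin] at h6
        have h7 : ((J v).card : ℝ) + (J v)ᶜ.card = n := by exact_mod_cast h6
        linarith
      have hJB : |∑ j ∈ J v, rv σ j| ≤ δ / (a + 1) * n + (y + Δ * L) :=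
        (abs_sum_rv_le σ (J v)).trans (add_le_add hσ2 hJc)
      have h6 := signed_exponent_le (α := α) (β := β) σ v (J v) hJN hJB
      have h7 : κ * (L / n * (-(D * (J v).card) + (β - α) / 2 * (rv σ v * ∑ j ∈ J v, rv σ j))) ≤
          κ * (L / n * (-(D * (n - (y + Δ * L))) + a * (δ / (a + 1) * n + (y + Δ * L)))) := by
        refine mul_le_mul_of_nonneg_left (mul_le_mul_of_nonneg_left h6 (by positivity)) hκ0
      have h8 : κ * (L / n * (-(D * (n - (y + Δ * L))) + a * (δ / (a + 1) * n + (y + Δ * L)))) =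
          -(κ * D * L) + κ * (a / (a + 1) * δ * L) +
          κ * ((D + a) * (3 * (L ^ 1 * Real.exp (-(c * L))) + Δ * (L ^ 2 / n))) := by
        rw [hyc]; field_simp; ring
      have h9 : κ * ((D + a) * (3 * (L ^ 1 * Real.exp (-(c * L))) + Δ * (L ^ 2 / n))) ≤ 1 * 1 := by
        refine mul_le_mul hκ1 h3 ?_ zero_le_one
        positivity
      have h10 : κ * (a / (a + 1) * δ * L) ≤ 1 * (1 * δ * L) := by
        have : a / (a + 1) ≤ 1 := by rw [div_le_one (by positivity)]; linarith
        gcongr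
      have h11 : n * (2 * (max α β * L / n) ^ 2) * Real.exp |tilt α β| ≤ 1 := by
        refine le_trans (le_of_eq ?_) h4
        field_simp
      linarith
    -- The union runs over the fringe only: the exponents of its size and of a wrong vote add up to
    -- `-(gap - 2 δ)`.
    refine (Finset.sum_le_sum fun v _ => hterm v).trans ?_
    rw [Finset.sum_const, nsmul_eq_mul]
    calc ((fringe k ω).card : ℝ) * Real.exp (x + 2 - (κ * D - δ) * L) ≤
        y * Real.exp (x + 2 - (κ * D - δ) * L) := by gcongr
      _ = 3 * Real.exp (x + 2) * Real.exp (-((gap - 2 * δ) * L)) := by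
          have e2 : (1 - s ^ 2 * Tc α β + δ) * L + (x + 2 - (κ * D - δ) * L) =
              (x + 2) + -((gap - 2 * δ) * L) := by rw [hgapd]; ring
          rw [hy, mul_assoc 3, ← Real.exp_add, e2, Real.exp_add, mul_assoc]
      _ ≤ 3 * Real.exp (x + 2) * Real.exp (-(gap / 2 * L)) := by
          have : gap / 2 * L ≤ (gap - 2 * δ) * L := by
            apply mul_le_mul_of_nonneg_right _ hL.le; linarith
          gcongr
      _ ≤ η / 3 := h5

end CorrSBM
end

/-! ### Margins in the union graph and neighbours in the own class. -/

noncomputable section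
namespace CorrSBM

open Filter Topology

section
variable {α β s : ℝ}

/-- Above the threshold, every vertex is classified correctly with a logarithmic margin. -/
theorem eventually_signed (hα : 0 < α) (hβ : 0 < β) (hs0 : 0 ≤ s) (hs1 : s ≤ 1)
    {b : St → Bool} {κ z : ℝ} (hb : KindProb s b κ) (hz : 1 + z < κ * Dplus α β) :
    ∃ δ₀ > 0, ∀ η > 0, ∀ᶠ n : ℕ in atTop, ∀ σ : Fin n → ℤˣ, |∑ i, rv σ i| ≤ δ₀ * n →
      Pr (stW α β s σ) {ω | ∃ v, tilt α β * (rv σ v *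
        ∑ j ∈ Finset.univ.erase v, if b (ω s(v, j)) then rv σ j else 0) ≤ z * Real.log n} ≤ η := by
  classical
  set D := Dplus α β with hD
  have hD0 : 0 ≤ D := Dplus_nonneg
  set a := |α - β| with ha
  have ha0 : 0 ≤ a := abs_nonneg _
  -- Half of the gap pays for the imbalance of the labels. The other half survives the union bound
  -- over all vertices.
  set gap := κ * D - 1 - z with hgap
  have hgap0 : 0 < gap := by rw [hgap]; linarith
  refine ⟨gap / (2 * (a + 1)), by positivity, fun η hη => ?_⟩
  have hl1 := (tendsto_log_pow_div 1).const_mul (D + a)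
  rw [mul_zero] at hl1
  have hl3 := (tendsto_rpow_neg_nat (half_pos hgap0)).const_mul (Real.exp 1)
  rw [mul_zero] at hl3
  filter_upwards [hl1.eventually_le_const one_pos, hl3.eventually_le_const hη,
    eventually_adm hα hβ hs0 hs1] with n h1 h2 hn σ hσ
  have hw := stW_isWeight hn σ
  have hL := hn.log_pos
  have hnp := hn.n_pos
  set L := Real.log n with hLd
  refine (Pr_biUnion_le hw Finset.univ (fun v => {ω | tilt α β * (rv σ v *
    ∑ j ∈ Finset.univ.erase v, if b (ω s(v, j)) then rv σ j else 0) ≤ z * L})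
    (by rintro ω ⟨v, hv⟩; exact ⟨v, by simp, hv⟩)).trans ?_
  have hterm : ∀ v, Pr (stW α β s σ) {ω | tilt α β * (rv σ v *
      ∑ j ∈ Finset.univ.erase v, if b (ω s(v, j)) then rv σ j else 0) ≤ z * L} ≤
      Real.exp (1 - (1 + gap / 2) * L) := by
    intro v
    refine (Pr_signed_le hn σ v (Finset.univ.erase v) (κ := κ) (ξ := 0) hb.1.2
      (fun e => by rw [stW_kind hn σ hb]; simp) (z * L)).trans (Real.exp_le_exp.2 ?_)
    have hJc : ((Finset.univ.erase v)ᶜ.card : ℝ) = 1 := by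
      rw [Finset.compl_erase]; simp
    have hJN : (n : ℝ) - 1 ≤ (Finset.univ.erase v).card := by
      have h6 := Finset.card_add_card_compl (Finset.univ.erase v)
      rw [Fintype.card_fin] at h6
      have h7 : ((Finset.univ.erase v).card : ℝ) + (Finset.univ.erase v)ᶜ.card = n := by
        exact_mod_cast h6
      linarith
    have hJB : |∑ j ∈ Finset.univ.erase v, rv σ j| ≤ gap / (2 * (a + 1)) * n + 1 :=
      (abs_sum_rv_le σ _).trans (add_le_add hσ hJc.le)
    have h6 := signed_exponent_le (α := α) (β := β) σ v (Finset.univ.erase v) hJN hJB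
    have h7 : κ * (L / n * (-(D * (Finset.univ.erase v).card) +
        (β - α) / 2 * (rv σ v * ∑ j ∈ Finset.univ.erase v, rv σ j))) ≤
        κ * (L / n * (-(D * (n - 1)) + a * (gap / (2 * (a + 1)) * n + 1))) :=
      mul_le_mul_of_nonneg_left (mul_le_mul_of_nonneg_left h6 (by positivity)) hb.1.1
    have h8 : κ * (L / n * (-(D * (n - 1)) + a * (gap / (2 * (a + 1)) * n + 1))) =
        -(κ * D * L) + κ * (a / (a + 1) * (gap / 2) * L) +
          κ * ((D + a) * (L ^ 1 / n)) := by
      field_simp; ring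
    have hκ1 := hb.1.2
    have hκ0 := hb.1.1
    have h9 : κ * ((D + a) * (L ^ 1 / n)) ≤ 1 * 1 := by
      refine mul_le_mul hκ1 h1 ?_ zero_le_one
      positivity
    have h10 : κ * (a / (a + 1) * (gap / 2) * L) ≤ 1 * (1 * (gap / 2) * L) := by
      have : a / (a + 1) ≤ 1 := by rw [div_le_one (by positivity)]; linarith
      gcongr
    have h11 : gap * L = κ * D * L - L - z * L := by rw [hgap]; ring
    rw [mul_zero, zero_mul, add_zero]
    linarith
  refine (Finset.sum_le_sum fun v _ => hterm v).trans ?_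
  simp only [Finset.sum_const, Finset.card_univ, Fintype.card_fin, nsmul_eq_mul]
  refine le_trans (le_of_eq ?_) h2
  nth_rewrite 1 [← Real.exp_log hnp]
  rw [← Real.exp_add, ← Real.exp_add, ← hLd]; ring_nf

open Classical in
/-- The vertices have few neighbours in their own class of the partition. -/
theorem eventually_ownClass_le (hα : 0 < α) (hβ : 0 < β) (hs0 : 0 ≤ s) (hs1 : s ≤ 1)
    {ε : ℝ} (hε : 0 < ε) {r : ℕ} (hr : 0 < r) (hc : ClassesCondition (s * α) (s * β) ε r) :
    ∀ η > 0, ∀ᶠ n : ℕ in atTop, ∀ (σ : Fin n → ℤˣ) (c : Fin n → Fin r),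
      (∀ i, ((Finset.univ.filter fun v => c v = i).card : ℝ) ≤ 2 * n / r) →
      Pr (stW α β s σ) {ω | ∃ v, ε / 2 * Real.log n ≤
        nbrCount (gr isUn ω) (Finset.univ.filter fun w => c w = c v) v} ≤ η := by
  intro η hη
  unfold ClassesCondition at hc
  set M := max 1 (max (s * α) (s * β)) with hM
  set ξ := ε * r * (200 * M)⁻¹ with hξ
  have hM1 : 1 ≤ M := le_max_left _ _
  have hr' : (0 : ℝ) < r := by exact_mod_cast hr
  have hξ0 : 0 < ξ := by positivity
  have hlog : 0 < Real.log ξ := by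
    by_contra! h
    have : (Real.log ξ - 1) * ε ≤ 0 := mul_nonpos_of_nonpos_of_nonneg (by linarith) hε.le
    linarith
  set gap := (Real.log ξ - 1) * ε / 2 - 1 with hgap
  have hgap0 : 0 < gap := by rw [hgap]; linarith
  filter_upwards [(tendsto_rpow_neg_nat hgap0).eventually_le_const hη,
    eventually_adm hα hβ hs0 hs1] with n h2 hn σ c hcard
  have hw := stW_isWeight hn σ
  have hL := hn.log_pos
  have hnp := hn.n_pos
  set L := Real.log n with hLd
  refine (Pr_biUnion_le hw Finset.univ (fun v => {ω | ε / 2 * L ≤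
    nbrCount (gr isUn ω) (Finset.univ.filter fun w => c w = c v) v})
    (by rintro ω ⟨v, hv⟩; exact ⟨v, by simp, hv⟩)).trans ?_
  have hsm : max α β * s ≤ M := by
    rcases max_choice α β with h | h <;> rw [h, mul_comm]
    · exact (le_max_left _ _).trans (le_max_right _ _)
    · exact (le_max_right _ _).trans (le_max_right _ _)
  have hq : ∀ e, ∑ x, stW α β s σ e x * (if isUn x then 1 else 0) ≤ 2 * (M * L / n) := by
    intro e
    rw [stW_kind hn σ (kindProb_isUn hs0 hs1)]
    have h3 := parentProb_le hn σ e
    have h4 := parentProb_nonneg (α := α) (β := β) σ e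
    calc parentProb α β σ e * (1 - (1 - s) ^ 2) ≤ parentProb α β σ e * (2 * s) := by
          apply mul_le_mul_of_nonneg_left _ h4; nlinarith
      _ ≤ max α β * L / n * (2 * s) := mul_le_mul_of_nonneg_right h3 (by positivity)
      _ = 2 * (max α β * s * L / n) := by ring
      _ ≤ 2 * (M * L / n) := by gcongr
  have hterm : ∀ v, Pr (stW α β s σ) {ω | ε / 2 * L ≤
      nbrCount (gr isUn ω) (Finset.univ.filter fun w => c w = c v) v} ≤
      Real.exp (-((1 + gap) * L)) := by
    intro v
    simp_rw [nbrCount_gr]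
    -- With parameter `log ξ` the moment costs `(ε/50) log n`, bounded by `(ε/2) log n`. The
    -- exponent is then `-(log ξ - 1)(ε/2) log n`, and `ClassesCondition` makes it smaller than
    -- `-log n`.
    refine (Pr_count_ge_le_of hw _ (fun j => s(v, j)) (star_injOn v _) isUn
      (fun j _ => hq _) (Real.log ξ) _ hlog.le).trans (Real.exp_le_exp.2 ?_)
    rw [Real.exp_log hξ0]
    have hξ1 : 0 ≤ ξ - 1 := by
      have := Real.add_one_le_exp (Real.log ξ)
      rw [Real.exp_log hξ0] at this; linarith
    have h3 : (((Finset.univ.filter fun w => c w = c v).erase v).card : ℝ) ≤ 2 * n / r :=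
      le_trans (by exact_mod_cast Finset.card_le_card (Finset.erase_subset _ _)) (hcard (c v))
    have h4 : (((Finset.univ.filter fun w => c w = c v).erase v).card : ℝ) * (2 * (M * L / n)) *
        (ξ - 1) ≤ ε / 2 * L := by
      calc _ ≤ 2 * n / r * (2 * (M * L / n)) * ξ := by
            have : ξ - 1 ≤ ξ := by linarith
            gcongr
        _ = ε / 50 * L := by rw [hξ]; field_simp; ring
        _ ≤ ε / 2 * L := by
            apply mul_le_mul_of_nonneg_right _ hL.le; linarith
    have h5 : (1 + gap) * L = (Real.log ξ - 1) * ε / 2 * L := by rw [hgap]; ring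
    rw [h5]
    linarith
  refine (Finset.sum_le_sum fun v _ => hterm v).trans ?_
  simp only [Finset.sum_const, Finset.card_univ, Fintype.card_fin, nsmul_eq_mul]
  refine le_trans (le_of_eq ?_) h2
  nth_rewrite 1 [← Real.exp_log hnp]
  rw [← Real.exp_add, ← hLd]; ring_nf

end

end CorrSBM
end

noncomputable section
namespace CorrSBM

open Filter Topology Matrix

/-! ### The spectral method on induced subgraphs -/

/-- Extension by zero: one bound for the form of the whole graph is inherited by every induced
subgraph. -/
theorem quad_comap {n : ℕ} {V : Type} [Fintype V] (ι : V → Fin n) (hι : Function.Injective ι)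
    (G : SimpleGraph (Fin n)) (p q : ℝ) (σ : Fin n → ℤˣ) (x : V → ℝ) :
    ∃ y : Fin n → ℝ, y ⬝ᵥ y = x ⬝ᵥ x ∧
      y ⬝ᵥ (adj G - probMatrix p q σ) *ᵥ y =
        x ⬝ᵥ (adj (G.comap ι) - probMatrix p q (fun v => σ (ι v))) *ᵥ x := by
  classical
  have hy : ∀ v, Function.extend ι x 0 (ι v) = x v := fun v => hι.extend_apply x 0 v
  have hy0 : ∀ w, w ∉ Set.range ι → Function.extend ι x 0 w = 0 := fun w hw =>
    Function.extend_apply' x (0 : Fin n → ℝ) w (by simpa using hw)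
  refine ⟨Function.extend ι x 0, ?_, ?_⟩
  · refine (Fintype.sum_of_injective ι hι _ _ ?_ ?_).symm
    · intro w hw; simp [hy0 w hw]
    · intro v; rw [hy]
  · refine (Fintype.sum_of_injective ι hι _ _ ?_ ?_).symm
    · intro w hw; simp [hy0 w hw]
    · intro v
      rw [hy]
      congr 1
      refine Fintype.sum_of_injective ι hι _ _ ?_ ?_
      · intro w hw; simp [hy0 w hw]
      · intro v'
        rw [hy]
        congr 1

/-- Dividing by `log n` turns the hypotheses of `spectral_bad_set` into inequalities between
constants, with eigenvalue gap `m₀` and noise `δ₁`. The statement is deterministic and uniform in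
`ι`, so the single event of `eventually_quad` covers the graph and all the graphs induced outside a
class. -/
theorem spectral_comap_bad_set {a b δ : ℝ} (ha : 0 < a) (hb : 0 < b) (hab : a ≠ b) (hδ : 0 < δ) :
    ∃ δ₁ > 0, ∀ (n : ℕ) (σ : Fin n → ℤˣ) (G : SimpleGraph (Fin n)), 0 < Real.log n →
      (∀ x : Fin n → ℝ, |x ⬝ᵥ (adj G -
        probMatrix (a * Real.log n / n) (b * Real.log n / n) σ) *ᵥ x| ≤
          δ₁ * Real.log n * (x ⬝ᵥ x)) →
      ∀ (V : Type) [Fintype V] (ι : V → Fin n), Function.Injective ι → 1 < Fintype.card V →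
        (n : ℝ) / 2 ≤ Fintype.card V → |∑ v, rv σ (ι v)| ≤ δ₁ * n →
        ∃ Z : Finset V, (Z.card : ℝ) ≤ δ * n ∧
          ∀ τ, IsSpectral a b (G.comap ι) τ → ∃ η : ℤˣ, ∀ v, v ∉ Z → τ v = η * σ (ι v) := by
  set d := |a - b| with hd
  have hd0 : 0 < d := abs_pos.2 (sub_ne_zero.2 hab)
  set m₀ := min d (min a b) / 16 with hm₀
  have hm0 : 0 < m₀ := by positivity
  have hm1 : 16 * m₀ ≤ d := by rw [hm₀]; linarith [min_le_left d (min a b)]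
  have hm2 : 16 * m₀ ≤ b := by
    rw [hm₀]; linarith [(min_le_right d (min a b)).trans (min_le_right _ _)]
  set Cc := (a + b) / 2 * ((d / 2 + 1) / m₀) + 1 with hCc
  have hCc0 : 0 < Cc := by positivity
  -- The error is kept below `m₀ t log n`: `t ≤ 1/2` is the requirement of `spectral_bad_set`, and
  -- the exceptional set has size at most `4 t² n ≤ δ n`.
  set t := min (1 / 2) (δ / 4) with ht
  have ht0 : 0 < t := lt_min (by norm_num) (by positivity)
  have ht1 : t ≤ 1 / 2 := min_le_left _ _
  have ht2 : t ≤ δ / 4 := min_le_right _ _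
  set δ₁ := min (min (1 / 4) m₀) (min (1 / (a + b)) (m₀ * t / Cc)) with hδ₁
  have hδ₁0 : 0 < δ₁ := lt_min (lt_min (by norm_num) hm0) (lt_min (by positivity) (by positivity))
  have hδa : δ₁ ≤ 1 / 4 := (min_le_left _ _).trans (min_le_left _ _)
  have hδb : δ₁ ≤ m₀ := (min_le_left _ _).trans (min_le_right _ _)
  have hδc : (a + b) * δ₁ ≤ 1 := by
    have : δ₁ ≤ 1 / (a + b) := (min_le_right _ _).trans (min_le_left _ _)
    rw [le_div_iff₀ (by positivity)] at this; linarith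
  have hδd : δ₁ * Cc ≤ m₀ * t := by
    have : δ₁ ≤ m₀ * t / Cc := (min_le_right _ _).trans (min_le_right _ _)
    rwa [le_div_iff₀ hCc0] at this
  refine ⟨δ₁, hδ₁0, fun n σ G hL hquad V _ ι hι hcard hhalf hbal => ?_⟩
  set L := Real.log n with hLd
  have hn0 : n ≠ 0 := by rintro rfl; simp [hLd] at hL
  have hnp : (0 : ℝ) < n := by positivity
  have hNle : (Fintype.card V : ℝ) ≤ n := by
    have := Fintype.card_le_of_injective ι hι
    rw [Fintype.card_fin] at this; exact_mod_cast this
  set N : ℝ := (Fintype.card V : ℝ) with hN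
  have hN0 : 0 < N := by linarith
  have hν1 : N / n ≤ 1 := by rw [div_le_one hnp]; exact hNle
  have hν2 : 1 / 2 ≤ N / n := by rw [le_div_iff₀ hnp]; linarith
  have hpq : |a * L / n - b * L / n| = d * L / n := by
    rw [← sub_div, ← sub_mul, abs_div, abs_mul, abs_of_pos hL, abs_of_pos hnp]
  have hEeq : (a * L / n + b * L / n) / 2 * N * ((|a * L / n - b * L / n| / 2 * (δ₁ * n) + δ₁ * L) /
      (m₀ * L)) + δ₁ * L = ((a + b) / 2 * (N / n) * ((d / 2 + 1) / m₀) + 1) * (δ₁ * L) := by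
    rw [hpq]; field_simp
  have hEle : ((a + b) / 2 * (N / n) * ((d / 2 + 1) / m₀) + 1) * (δ₁ * L) ≤ m₀ * t * L := by
    calc _ ≤ ((a + b) / 2 * 1 * ((d / 2 + 1) / m₀) + 1) * (δ₁ * L) := by gcongr
      _ = δ₁ * Cc * L := by rw [hCc]; ring
      _ ≤ _ := by gcongr
  refine (spectral_bad_set (G.comap ι) (fun v => σ (ι v)) (p := a * L / n)
    (q := b * L / n) (K := δ₁ * L) (ρ := δ₁ * n) (m := m₀ * L) hab (by positivity) (by positivity)
    (by positivity) (by positivity) ?_ ?_ hcard ?_ ?_ ?_).imp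
    fun Z hZ => ⟨hZ.1.trans ?_, hZ.2⟩
  · intro x
    obtain ⟨y, hy1, hy2⟩ := quad_comap ι hι G (a * L / n) (b * L / n) σ x
    rw [← hy1, ← hy2]
    exact hquad y
  · have : (1 : V → ℝ) ⬝ᵥ rv (fun v => σ (ι v)) = ∑ v, rv σ (ι v) := by
      simp [dotProduct, rv]
    rw [this]; exact hbal
  · intro hlt
    have hdab : d = a - b := by rw [hd, abs_of_pos (sub_pos.2 hlt)]
    refine ⟨by gcongr, ?_, ?_, ?_⟩
    · have e1 : (a * L / n - b * L / n) / 2 * (N - δ₁ * n) - δ₁ * L =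
          (d / 2 * (N / n - δ₁) - δ₁) * L := by
        rw [hdab]; field_simp
      rw [e1]
      refine mul_le_mul_of_nonneg_right ?_ hL.le
      have : d / 2 * (1 / 4) ≤ d / 2 * (N / n - δ₁) :=
        mul_le_mul_of_nonneg_left (by linarith) (by positivity)
      linarith
    · have e1 : b * L / n * N - δ₁ * L = (b * (N / n) - δ₁) * L := by field_simp
      rw [e1]
      refine mul_le_mul_of_nonneg_right ?_ hL.le
      have : b * (1 / 2) ≤ b * (N / n) := mul_le_mul_of_nonneg_left hν2 hb.le
      linarith
    · have : δ₁ * n ≤ 1 / 4 * n := by gcongr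
      linarith
  · intro hlt
    have hdab : d = b - a := by rw [hd, abs_of_neg (sub_neg.2 hlt)]; ring
    have e1 : (a * L / n + b * L / n) / 2 * (δ₁ * n) ^ 2 + (a * L / n - b * L / n) / 2 * N ^ 2 +
        δ₁ * L * N = ((a + b) * δ₁ * δ₁ / 2 * (n / N) - d / 2 * (N / n) + δ₁) * (L * N) := by
      rw [hdab]; field_simp; ring
    have e2 : -(m₀ * L) * N = (-m₀) * (L * N) := by ring
    rw [e1, e2]
    refine mul_le_mul_of_nonneg_right ?_ (by positivity)
    have h1 : (a + b) * δ₁ * δ₁ / 2 * (n / N) ≤ 1 * δ₁ / 2 * 2 := by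
      have : (n : ℝ) / N ≤ 2 := by rw [div_le_iff₀ hN0]; linarith
      gcongr
    have h2 : d / 2 * (1 / 2) ≤ d / 2 * (N / n) := mul_le_mul_of_nonneg_left hν2 (by positivity)
    linarith
  · rw [hEeq]
    refine hEle.trans ?_
    have : m₀ * L * t ≤ m₀ * L * (1 / 2) := mul_le_mul_of_nonneg_left ht1 (by positivity)
    linarith
  · rw [hEeq]
    set E := ((a + b) / 2 * (N / n) * ((d / 2 + 1) / m₀) + 1) * (δ₁ * L) with hE
    have hE0 : 0 ≤ E := by positivity
    calc 4 * E ^ 2 / (m₀ * L) ^ 2 * N ≤ 4 * (m₀ * t * L) ^ 2 / (m₀ * L) ^ 2 * n := by gcongr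
      _ = 4 * t * t * n := by field_simp
      _ ≤ 4 * (1 / 2) * (δ / 4) * n := by gcongr
      _ ≤ δ * n := by apply mul_le_mul_of_nonneg_right _ hnp.le; linarith

end CorrSBM
end

noncomputable section
namespace CorrSBM

open Filter Topology

/-! ### Vertices misclassified by the preliminary labeling -/

/-- If any `K` given events of the family occur together with probability at most `p ^ K`, then `K`
of them occur with probability at most `(n p) ^ K`. -/
theorem Pr_card_filter_ge_le {I X : Type*} [Fintype I] [DecidableEq I] [Fintype X] {w : I → X → ℝ}
    (hw : IsWeight w) {n : ℕ} (A : (I → X) → Finset (Fin n)) (U : Finset (Fin n))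
    (hA : ∀ ω, A ω ⊆ U) {K : ℕ} {p : ℝ} (hp : 0 ≤ p)
    (h : ∀ W ⊆ U, W.card = K → Pr w {ω | W ⊆ A ω} ≤ p ^ K) :
    Pr w {ω | K ≤ (A ω).card} ≤ (n * p) ^ K := by
  refine (Pr_biUnion_le hw (Finset.powersetCard K U) (fun W => {ω | W ⊆ A ω}) ?_).trans ?_
  · intro ω hω
    obtain ⟨W, hW, hc⟩ := Finset.exists_subset_card_eq (show K ≤ (A ω).card from hω)
    exact ⟨W, Finset.mem_powersetCard.2 ⟨hW.trans (hA ω), hc⟩, hW⟩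
  · refine (Finset.sum_le_sum fun W hW => h W (Finset.mem_powersetCard.1 hW).1
      (Finset.mem_powersetCard.1 hW).2).trans ?_
    rw [Finset.sum_const, Finset.card_powersetCard, nsmul_eq_mul, mul_pow]
    refine mul_le_mul_of_nonneg_right ?_ (by positivity)
    have h1 := Nat.choose_le_pow U.card K
    have h2 : U.card ≤ n := by simpa using Finset.card_le_univ U
    exact_mod_cast h1.trans (Nat.pow_le_pow_left h2 K)

/-- Joint exponential moments of the stars with centers in `W`. -/
theorem Ex_prod_star_le {X : Type*} [Fintype X] {n : ℕ} {w : Sym2 (Fin n) → X → ℝ}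
    (hw : IsWeight w) (W J : Finset (Fin n)) (v : Fin n) (hvJ : v ∉ J) (hvW : v ∉ W)
    (hWJ : Disjoint W J) (b₁ b₂ : X → Bool) (a : Fin n → Fin n → ℝ) {ρ B : ℝ}
    (hρ : ∀ e, ∑ x, w e x * (if b₁ x then 1 else 0) ≤ ρ)
    (hB : ∀ u ∈ W, ∑ j ∈ J, (∑ x, w s(u, j) x * (if b₂ x then 1 else 0)) *
      (Real.exp (a u j) - 1) ≤ B) :
    Ex w (fun ω => ∏ u ∈ W, ((if b₁ (ω s(u, v)) then 1 else 0) *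
      Real.exp (∑ j ∈ J, if b₂ (ω s(u, j)) then a u j else 0))) ≤ (ρ * Real.exp B) ^ W.card := by
  classical
  -- Since `W` is disjoint from `J` and `v ∉ W`, the stars share no pair, so their states are
  -- independent.
  have hinj : Set.InjOn (fun y : Fin n × Fin n => s(y.1, y.2)) (W ×ˢ insert v J : Finset _) := by
    rintro ⟨u, j⟩ h ⟨u', j'⟩ h' he
    simp only [Finset.coe_product, Set.mem_prod, Finset.mem_coe, Finset.mem_insert] at h h'
    rcases Sym2.eq_iff.1 he with ⟨rfl, rfl⟩ | ⟨rfl, rfl⟩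
    · rfl
    · exfalso
      rcases h.2 with h2 | h2
      · exact hvW (h2 ▸ h'.1)
      · exact Finset.disjoint_left.1 hWJ h'.1 h2
  set f : Fin n × Fin n → X → ℝ := fun y x =>
    if y.2 = v then (if b₁ x then 1 else 0) else Real.exp (if b₂ x then a y.1 y.2 else 0) with hf
  have e1 : ∀ ω : Sym2 (Fin n) → X, (∏ u ∈ W, ((if b₁ (ω s(u, v)) then 1 else 0) *
      Real.exp (∑ j ∈ J, if b₂ (ω s(u, j)) then a u j else 0))) =
      ∏ y ∈ W ×ˢ insert v J, f y (ω s(y.1, y.2)) := by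
    intro ω
    rw [Finset.prod_product]
    refine Finset.prod_congr rfl fun u _ => ?_
    rw [Finset.prod_insert hvJ, Real.exp_sum]
    simp only [hf, if_true]
    congr 1
    refine Finset.prod_congr rfl fun j hj => ?_
    rw [if_neg (fun h : j = v => hvJ (h ▸ hj))]
  simp_rw [e1]
  rw [Ex_prod_injOn hw _ (fun y : Fin n × Fin n => s(y.1, y.2)) hinj f, Finset.prod_product,
    ← Finset.prod_const]
  have hnn : ∀ (y : Fin n × Fin n), 0 ≤ ∑ x, w s(y.1, y.2) x * f y x := fun y =>
    Finset.sum_nonneg fun x _ => mul_nonneg (hw.nonneg _ _) (by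
      simp only [hf]; split_ifs <;> positivity)
  refine Finset.prod_le_prod (fun u _ => Finset.prod_nonneg fun j _ => hnn (u, j)) fun u hu => ?_
  rw [Finset.prod_insert hvJ]
  refine mul_le_mul ?_ ?_ (Finset.prod_nonneg fun j _ => hnn (u, j)) ?_
  · simp only [hf, if_true]
    exact hρ _
  · refine le_trans ?_ (Real.exp_le_exp.2 (hB u hu))
    rw [Real.exp_sum]
    refine Finset.prod_le_prod (fun j _ => hnn (u, j)) fun j hj => ?_
    have hj' : j ≠ v := fun h => hvJ (h ▸ hj)
    simp only [hf, if_neg hj']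
    have h2 : ∑ x, w s(u, j) x * Real.exp (if b₂ x then a u j else 0) =
        (∑ x, w s(u, j) x * (if b₂ x then 1 else 0)) * (Real.exp (a u j) - 1) + 1 := by
      have h3 : ∀ x, w s(u, j) x * Real.exp (if b₂ x then a u j else 0) =
          w s(u, j) x * (if b₂ x then 1 else 0) * (Real.exp (a u j) - 1) + w s(u, j) x := by
        intro x
        by_cases h : b₂ x = true
        · simp only [h, if_true]; ring
        · simp [h]
      rw [Finset.sum_congr rfl fun x _ => h3 x, Finset.sum_add_distrib, ← Finset.sum_mul,
        hw.sum_one]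
    rw [h2]
    exact Real.add_one_le_exp _
  · refine le_trans (Finset.sum_nonneg fun x _ => mul_nonneg (hw.nonneg _ _) ?_) (hρ s(u, v))
    split_ifs <;> norm_num

section
variable {α β s : ℝ} {n r : ℕ}

open Classical in
/-- The states with those of the pairs which meet the class `i` replaced by those of `ω'`. -/
def mixAt (c : Fin n → Fin r) (i : Fin r) (ω ω' : Sym2 (Fin n) → St) : Sym2 (Fin n) → St :=
  fun e => if ∃ u ∈ e, c u = i then ω' e else ω e

/-- Swapping whole states at the pairs that meet class `i` preserves the weight: these pairs are
independent of the rest. -/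
theorem Pr_mixAt_le (h : Adm α β s n) (σ : Fin n → ℤˣ) (c : Fin n → Fin r) (i : Fin r)
    {S : Set (Sym2 (Fin n) → St)} {η : ℝ}
    (hS : ∀ ω, Pr (stW α β s σ) {ω' | mixAt c i ω ω' ∈ S} ≤ η) : Pr (stW α β s σ) S ≤ η := by
  classical
  have e1 : ∀ ω ω' : Sym2 (Fin n) → St, mixAt c i ω ω' =
      fun e => ((fun z : St × St => if ∃ u ∈ e, c u = i then z.swap else z) (ω e, ω' e)).1 := by
    intro ω ω'
    funext e
    simp only [mixAt]
    split_ifs <;> rfl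
  simp_rw [e1] at hS
  refine Pr_resample_le (stW_isWeight h σ)
    (fun e z => if ∃ u ∈ e, c u = i then z.swap else z) ?_ ?_ hS
  · intro e z
    split_ifs <;> simp
  · intro e z
    split_ifs
    · simp [mul_comm]
    · rfl

/-- Hence the spectral labels outside class `i`, and any exceptional set computed from that graph,
are unaffected by resampling the pairs at the class. -/
theorem comap_mixAt (c : Fin n → Fin r) (i : Fin r) (b : St → Bool) (ω ω' : Sym2 (Fin n) → St) :
    (gr b (mixAt c i ω ω')).comap (Subtype.val : {v : Fin n // c v ≠ i} → Fin n) =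
      (gr b ω).comap (Subtype.val : {v : Fin n // c v ≠ i} → Fin n) := by
  classical
  ext x y
  have : ¬ ∃ u ∈ s(x.1, y.1), c u = i := by
    rintro ⟨u, hu, hc⟩
    rcases Sym2.mem_iff.1 hu with rfl | rfl
    · exact x.2 hc
    · exact y.2 hc
  simp only [SimpleGraph.comap_adj, gr_adj, mixAt, if_neg this]

theorem mixAt_apply (c : Fin n → Fin r) {i : Fin r} (ω ω' : Sym2 (Fin n) → St) {u : Fin n}
    (hu : c u = i) (x : Fin n) : mixAt c i ω ω' s(u, x) = ω' s(u, x) := by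
  classical
  simp only [mixAt]
  rw [if_pos ⟨u, Sym2.mem_mk_left u x, hu⟩]

open Classical in
/-- The labels of the neighbours of `w` outside the class `i` may be outweighed by those of its
neighbours in `Z`. -/
def BadAt (α β : ℝ) (σ : Fin n → ℤˣ) (c : Fin n → Fin r) (i : Fin r) (Z : Finset (Fin n))
    (ω : Sym2 (Fin n) → St) (w : Fin n) : Prop :=
  tilt α β * (rv σ w * ∑ x with c x ≠ i, if isG1 (ω s(w, x)) then rv σ x else 0) ≤
    2 * |tilt α β| * ∑ x ∈ Z, if isG1 (ω s(w, x)) then (1 : ℝ) else 0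

theorem badAt_mixAt (σ : Fin n → ℤˣ) (c : Fin n → Fin r) {i : Fin r} (Z : Finset (Fin n))
    (ω ω' : Sym2 (Fin n) → St) {w : Fin n} (hw : c w = i) :
    BadAt α β σ c i Z (mixAt c i ω ω') w ↔ BadAt α β σ c i Z ω' w := by
  simp only [BadAt, mixAt_apply c ω ω' hw]

end

end CorrSBM
end

/-! ### Few bad neighbours in the other classes. -/

noncomputable section
namespace CorrSBM

open Filter Topology

section
variable {α β s : ℝ} {n r : ℕ}

/-- Joint probability that the vertices of `W` are adjacent to `v` and bad. -/
theorem Pr_all_bad_le (h : Adm α β s n) (σ : Fin n → ℤˣ) (c : Fin n → Fin r) {i : Fin r}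
    {v : Fin n} (hv : c v ≠ i) (Z : Finset (Fin n)) (hZ : ∀ x ∈ Z, c x ≠ i) {N B : ℝ}
    (hN : N + 1 ≤ (Finset.univ.filter fun x => c x ≠ i).card)
    (hB : |∑ x with c x ≠ i, rv σ x| + 1 ≤ B) (W : Finset (Fin n)) (hW : ∀ w ∈ W, c w = i) :
    Pr (stW α β s σ) {ω | ∀ w ∈ W, isUn (ω s(w, v)) ∧ BadAt α β σ c i Z ω w} ≤
      (max α β * Real.log n / n * Real.exp (s * (Real.log n / n * (-(Dplus α β * N) + |α - β| * B)) +
        Z.card * (max α β * Real.log n / n) * Real.exp (3 * |tilt α β|) + 3 * |tilt α β|)) ^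
          W.card := by
  classical
  have hw := stW_isWeight h σ
  have hL := h.log_pos
  have hnp := h.n_pos
  have hM : 0 < max α β := lt_max_of_lt_left h.hα
  set t := tilt α β with ht
  set A := Finset.univ.filter fun x => c x ≠ i with hA
  have hvA : v ∈ A := by simpa [hA] using hv
  -- The pairs to `v` carry the adjacency event and are kept apart. Their effect on each exponent is
  -- at most `3 |t|`, paid by the factor `exp (3 |t|)`.
  set J := A.erase v with hJ
  -- Being bad says that the sum of these weights over the neighbours outside the class is
  -- nonnegative, so the exponential of that sum dominates the indicator.
  set a : Fin n → Fin n → ℝ := fun w x =>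
    -(t * (rv σ w * rv σ x)) + if x ∈ Z then 2 * |t| else 0 with ha
  have hWA : ∀ w ∈ W, w ∉ A := fun w hw' hwA => by
    simp only [hA, Finset.mem_filter, Finset.mem_univ, true_and] at hwA
    exact hwA (hW w hw')
  have hJN : N ≤ J.card := by
    have h1 := Finset.card_erase_add_one hvA
    have h2 : (J.card : ℝ) + 1 = A.card := by exact_mod_cast h1
    linarith
  have hJB : |∑ x ∈ J, rv σ x| ≤ B := by
    have h1 := Finset.sum_erase_add A (rv σ) hvA
    have h2 : ∑ x ∈ J, rv σ x = ∑ x ∈ A, rv σ x - rv σ v := by rw [← h1]; ring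
    rw [h2]
    refine (abs_sub _ _).trans ?_
    rw [abs_rv]; exact hB
  set E := s * (Real.log n / n * (-(Dplus α β * N) + |α - β| * B)) +
        Z.card * (max α β * Real.log n / n) * Real.exp (3 * |t|) with hE
  have hbound := Ex_prod_star_le hw W J v (Finset.notMem_erase v A) (fun hvW => hWA v hvW hvA)
    (Finset.disjoint_left.2 fun w hw' hwJ => hWA w hw' (Finset.mem_of_mem_erase hwJ)) isUn isG1 a
    (ρ := max α β * Real.log n / n) (B := E) ?_ ?_
  · refine (Pr_le_Ex hw (f := fun ω => ∏ u ∈ W, (Real.exp (3 * |t|) *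
      ((if isUn (ω s(u, v)) then 1 else 0) *
      Real.exp (∑ j ∈ J, if isG1 (ω s(u, j)) then a u j else 0)))) (fun ω => ?_) fun ω hω => ?_).trans ?_
    · refine Finset.prod_nonneg fun u _ => ?_
      split_ifs <;> positivity
    · refine le_trans (le_of_eq (Finset.prod_const_one (s := W)).symm)
        (Finset.prod_le_prod (fun _ _ => zero_le_one) fun u hu => ?_)
      obtain ⟨h1, h2⟩ := hω u hu
      rw [if_pos h1, one_mul, ← Real.exp_add, Real.one_le_exp_iff]
      have h3 : ∑ j ∈ A, (if isG1 (ω s(u, j)) then a u j else 0) =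
          -(t * (rv σ u * ∑ x ∈ A, if isG1 (ω s(u, x)) then rv σ x else 0)) +
          2 * |t| * ∑ x ∈ Z, if isG1 (ω s(u, x)) then (1 : ℝ) else 0 := by
        have h4 : ∑ x ∈ Z, (if isG1 (ω s(u, x)) then (1 : ℝ) else 0) =
            ∑ x ∈ A, if x ∈ Z then (if isG1 (ω s(u, x)) then (1 : ℝ) else 0) else 0 := by
          have hZA : Z = A.filter fun x => x ∈ Z := by
            ext x
            simp only [hA, Finset.mem_filter, Finset.mem_univ, true_and]
            exact ⟨fun hx => ⟨hZ x hx, hx⟩, fun hx => hx.2⟩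
          conv_lhs => rw [hZA, Finset.sum_filter]
        rw [h4, Finset.mul_sum, Finset.mul_sum, Finset.mul_sum, ← Finset.sum_neg_distrib,
          ← Finset.sum_add_distrib]
        refine Finset.sum_congr rfl fun x _ => ?_
        simp only [ha]
        split_ifs <;> ring
      rw [← Finset.sum_erase_add A _ hvA] at h3
      have h5 : |(if isG1 (ω s(u, v)) then a u v else 0)| ≤ 3 * |t| := by
        split_ifs
        · simp only [ha]
          refine (abs_add_le _ _).trans ?_
          rw [abs_neg, abs_mul, abs_mul, abs_rv, abs_rv]
          have : |if v ∈ Z then 2 * |t| else 0| ≤ 2 * |t| := by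
            split_ifs
            · rw [abs_of_nonneg (by positivity)]
            · simp
          linarith
        · simp
      have h6 : t * (rv σ u * ∑ x ∈ A, if isG1 (ω s(u, x)) then rv σ x else 0) ≤
          2 * |t| * ∑ x ∈ Z, if isG1 (ω s(u, x)) then (1 : ℝ) else 0 := h2
      linarith [(abs_le.1 h5).2]
    · simp_rw [Finset.prod_mul_distrib (f := fun _ => Real.exp (3 * |t|)), Finset.prod_const]
      rw [Ex_const_mul]
      refine (mul_le_mul_of_nonneg_left hbound (by positivity)).trans (le_of_eq ?_)
      rw [← mul_pow]
      congr 1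
      rw [Real.exp_add E]; ring
  · intro e
    rw [stW_kind h σ (kindProb_isUn h.hs0 h.hs1)]
    exact parentProb_mul_le h σ (kindProb_isUn h.hs0 h.hs1) e
  · intro u hu
    have h1 := sum_signed_le h σ u J Z (κ := s) (ξ := 0) (g := 2 * |t|)
      (q := fun e => ∑ x, stW α β s σ e x * (if isG1 x then 1 else 0)) h.hs1 (by positivity)
      (fun e => by simp only [stW_kind h σ (kindProb_isG1 h.hs0 h.hs1)]; simp)
    refine h1.trans ?_
    rw [mul_zero, zero_mul, add_zero, add_zero, show |tilt α β| + 2 * |t| = 3 * |t| by rw [ht]; ring]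
    have h2 := signed_exponent_le (α := α) (β := β) σ u J hJN hJB
    refine add_le_add ?_ le_rfl
    exact mul_le_mul_of_nonneg_left (mul_le_mul_of_nonneg_left h2 (by positivity)) h.hs0

open Classical in
/-- No vertex has many bad neighbours in a class other than its own. -/
theorem eventually_few_bad (hα : 0 < α) (hβ : 0 < β) (hs0 : 0 ≤ s) (hs1 : s ≤ 1) (hr : 2 ≤ r)
    (hsD : 0 < s * Dplus α β) :
    ∃ K₂ : ℕ, ∃ δ₀ > 0, ∀ η > 0, ∀ᶠ n : ℕ in atTop, ∀ (σ : Fin n → ℤˣ) (c : Fin n → Fin r),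
      GoodPart δ₀ σ c → ∀ Z : (i : Fin r) → SimpleGraph {v : Fin n // c v ≠ i} → Finset (Fin n),
      (∀ i G, (∀ x ∈ Z i G, c x ≠ i) ∧ ((Z i G).card : ℝ) ≤ δ₀ * n) →
      Pr (stW α β s σ) {ω | ∃ v i, c v ≠ i ∧ K₂ ≤ (Finset.univ.filter fun w =>
        c w = i ∧ isUn (ω s(w, v)) ∧ BadAt α β σ c i (Z i ((gr isG1 ω).comap Subtype.val)) ω w).card}
        ≤ η := by
  set D := Dplus α β with hD
  set t := |tilt α β| with ht
  set a := |α - β| with ha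
  have ha0 : 0 ≤ a := abs_nonneg _
  have hM : 0 < max α β := lt_max_of_lt_left hα
  -- At least `n/4 + 1` vertices lie outside a class, which gives the exponent `s D / 4 = 2 c₀`. The
  -- choice of `δ₀` spends half of it on imbalance and on `Z`.
  set c₀ := s * D / 8 with hc₀
  have hc0 : 0 < c₀ := by positivity
  -- Up to logarithms, being adjacent to `v` and bad has probability `n^{-1-c₀}`. So `K ≥ 2/c₀` of
  -- them have probability about `n^{-2}`, enough for the `n r` choices of vertex and class.
  obtain ⟨K, hK⟩ := exists_nat_ge (2 / c₀)
  rw [div_le_iff₀ hc0] at hK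
  set Q := 2 * a + max α β * Real.exp (3 * t) with hQ
  have hQ0 : 0 < Q := by positivity
  set A := max α β * Real.exp (3 * t + 1) with hA
  have hA0 : 0 < A := by positivity
  refine ⟨K, min (1 / 8) (c₀ / Q), lt_min (by norm_num) (by positivity), fun η hη => ?_⟩
  have hl1 := (tendsto_log_pow_div 1).const_mul (a : ℝ)
  rw [mul_zero] at hl1
  have hl2 := (tendsto_log_pow_mul_exp K (c := c₀ * K - 1) (by linarith)).const_mul (r * A ^ K)
  rw [mul_zero] at hl2
  filter_upwards [hl1.eventually_le_const one_pos, hl2.eventually_le_const hη,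
    eventually_adm hα hβ hs0 hs1, eventually_ge_atTop 8] with n h1 h2 hn hn8 σ c hgood Z hZ
  have hw := stW_isWeight hn σ
  have hL := hn.log_pos
  have hnp := hn.n_pos
  set L := Real.log n with hLd
  have hn8' : (8 : ℝ) ≤ n := by exact_mod_cast hn8
  set δ₀ := min (1 / 8) (c₀ / Q) with hδ₀
  have hδ1 : δ₀ ≤ 1 / 8 := min_le_left _ _
  have hδ2 : δ₀ * Q ≤ c₀ := by
    have : δ₀ ≤ c₀ / Q := min_le_right _ _
    rwa [le_div_iff₀ hQ0] at this
  have hr' : (2 : ℝ) ≤ r := by exact_mod_cast hr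
  refine (Pr_biUnion_le hw (Finset.univ ×ˢ Finset.univ) (fun y : Fin n × Fin r =>
    {ω | c y.1 ≠ y.2 ∧ K ≤ (Finset.univ.filter fun w =>
      c w = y.2 ∧ isUn (ω s(w, y.1)) ∧
        BadAt α β σ c y.2 (Z y.2 ((gr isG1 ω).comap Subtype.val)) ω w).card}) ?_).trans ?_
  · rintro ω ⟨v, i, h3, h4⟩
    exact ⟨(v, i), by simp, h3, h4⟩
  have hterm : ∀ y : Fin n × Fin r, Pr (stW α β s σ) {ω | c y.1 ≠ y.2 ∧
      K ≤ (Finset.univ.filter fun w => c w = y.2 ∧ isUn (ω s(w, y.1)) ∧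
        BadAt α β σ c y.2 (Z y.2 ((gr isG1 ω).comap Subtype.val)) ω w).card} ≤
      (A * L * Real.exp (-(c₀ * L))) ^ K := by
    rintro ⟨v, i⟩
    by_cases hvi : c v ≠ i
    swap
    · refine (Pr_mono hw (T := ∅) fun ω' hω' => hvi hω'.1).trans ?_
      simp only [Pr, Set.indicator_empty, Ex_const hw]
      positivity
    refine Pr_mixAt_le hn σ c i fun ω => ?_
    -- Once `ω` is frozen this set is fixed, while all pairs at class `i` are fresh.
    set Z₀ := Z i ((gr isG1 ω).comap Subtype.val) with hZ₀
    have hsub : {ω' | mixAt c i ω ω' ∈ {ω : Sym2 (Fin n) → St | c v ≠ i ∧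
        K ≤ (Finset.univ.filter fun w => c w = i ∧ isUn (ω s(w, v)) ∧
        BadAt α β σ c i (Z i ((gr isG1 ω).comap Subtype.val)) ω w).card}} ⊆
        {ω' | K ≤ (Finset.univ.filter fun w => c w = i ∧ isUn (ω' s(w, v)) ∧
          BadAt α β σ c i Z₀ ω' w).card} := by
      rintro ω' ⟨-, h4⟩
      refine le_trans h4 (Finset.card_le_card fun w hw' => ?_)
      simp only [Finset.mem_filter, Finset.mem_univ, true_and] at hw' ⊢
      obtain ⟨h5, h6, h7⟩ := hw'
      rw [mixAt_apply c ω ω' h5] at h6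
      rw [comap_mixAt, badAt_mixAt σ c _ ω ω' h5] at h7
      exact ⟨h5, h6, h7⟩
    refine (Pr_mono hw hsub).trans ?_
    have hcard : ((Finset.univ.filter fun x => c x ≠ i).card : ℝ) +
        (Finset.univ.filter fun x => c x = i).card = n := by
      have h5 := Finset.card_filter_add_card_filter_not (s := (Finset.univ : Finset (Fin n)))
        (fun x => c x = i)
      rw [Finset.card_univ, Fintype.card_fin] at h5
      rw [add_comm]
      exact_mod_cast h5
    have hci := (abs_le.1 (hgood.card i)).2
    have hnr : (n : ℝ) / r ≤ n / 2 := by gcongr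
    have hδn : δ₀ * n ≤ 1 / 8 * n := by gcongr
    have hN : (n : ℝ) / 4 + 1 ≤ (Finset.univ.filter fun x => c x ≠ i).card := by linarith
    have hB : |∑ x with c x ≠ i, rv σ x| + 1 ≤ 2 * (δ₀ * n) + 1 := by
      have h5 := Finset.sum_filter_add_sum_filter_not (Finset.univ : Finset (Fin n))
        (fun x => c x = i) (rv σ)
      have h6 : ∑ x with c x ≠ i, rv σ x = ∑ x, rv σ x - ∑ x with c x = i, rv σ x := by
        rw [← h5]; ring
      rw [h6]
      have h7 := abs_sub (∑ x, rv σ x) (∑ x with c x = i, rv σ x)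
      have h8 : |∑ x, rv σ x| ≤ δ₀ * n := hgood.bal
      have h9 : |∑ x with c x = i, rv σ x| ≤ δ₀ * n := hgood.balClass i
      linarith
    have hZc := hZ i ((gr isG1 ω).comap Subtype.val)
    rw [← hZ₀] at hZc
    have hfac : max α β * L / n * Real.exp (s * (L / n * (-(D * (n / 4)) +
        a * (2 * (δ₀ * n) + 1))) + Z₀.card * (max α β * L / n) * Real.exp (3 * t) + 3 * t) ≤
        A * L * Real.exp (-(c₀ * L)) / n := by
      have h5 : s * (L / n * (-(D * (n / 4)) + a * (2 * (δ₀ * n) + 1))) +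
          Z₀.card * (max α β * L / n) * Real.exp (3 * t) + 3 * t ≤ 3 * t + 1 + -(c₀ * L) := by
        have e1 : s * (L / n * (-(D * (n / 4)) + a * (2 * (δ₀ * n) + 1))) =
            -(2 * c₀ * L) + s * (2 * a * δ₀ * L + a * (L ^ 1 / n)) := by
          rw [hc₀]; field_simp; ring
        have e2 : s * (2 * a * δ₀ * L + a * (L ^ 1 / n)) ≤ 1 * (2 * a * δ₀ * L + 1) := by
          have hδ0 : 0 < δ₀ := lt_min (by norm_num) (by positivity)
          gcongr
        have e3 : (Z₀.card : ℝ) * (max α β * L / n) * Real.exp (3 * t) ≤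
            δ₀ * (max α β * Real.exp (3 * t)) * L := by
          calc _ ≤ δ₀ * n * (max α β * L / n) * Real.exp (3 * t) := by
                have := hZc.2; gcongr
            _ = _ := by field_simp
        have e4 := mul_le_mul_of_nonneg_right hδ2 hL.le
        have e5 : δ₀ * Q * L = 2 * a * δ₀ * L + δ₀ * (max α β * Real.exp (3 * t)) * L := by
          rw [hQ]; ring
        linarith
      calc _ ≤ max α β * L / n * Real.exp (3 * t + 1 + -(c₀ * L)) := by gcongr
        _ = _ := by rw [Real.exp_add (3 * t + 1), hA]; ring
    refine (Pr_card_filter_ge_le hw _ (Finset.univ.filter fun w => c w = i) (fun ω' w hw' => ?_)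
      (K := K) (p := A * L * Real.exp (-(c₀ * L)) / n) (by positivity) fun W hWU hWK => ?_).trans ?_
    · simp only [Finset.mem_filter, Finset.mem_univ, true_and] at hw' ⊢
      exact hw'.1
    · have hWi : ∀ w ∈ W, c w = i := fun w hw' => (Finset.mem_filter.1 (hWU hw')).2
      refine le_trans (Pr_mono hw ?_) ((Pr_all_bad_le hn σ c hvi Z₀ hZc.1 hN hB W hWi).trans ?_)
      · intro ω' hω' w hw'
        have := hω' hw'
        simp only [Finset.mem_filter, Finset.mem_univ, true_and] at this
        exact this.2
      · rw [hWK]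
        exact pow_le_pow_left₀ (by positivity) hfac K
    · refine le_of_eq ?_
      congr 1
      field_simp
  refine (Finset.sum_le_sum fun y _ => hterm y).trans ?_
  rw [Finset.sum_const, Finset.card_product, Finset.card_univ, Finset.card_univ, Fintype.card_fin,
    Fintype.card_fin, nsmul_eq_mul]
  refine le_trans (le_of_eq ?_) h2
  have e1 : Real.exp (-((c₀ * K - 1) * L)) = n * Real.exp (-(c₀ * L)) ^ K := by
    rw [← Real.exp_nat_mul]
    nth_rewrite 1 [← Real.exp_log hnp]
    rw [← Real.exp_add, ← hLd]
    congr 1; ring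
  rw [e1]
  push_cast
  ring

end

end CorrSBM
end

noncomputable section
namespace CorrSBM

/-! ### Votes -/

/-- Multiplication by `t`, of the sign of `a - b`, treats majority and minority votes alike. Strict
positivity excludes ties, so the vote is forced. -/
theorem isVote_iff {a b t : ℝ} {S : ℤ} {x y : ℤˣ} (ht : 0 < t ↔ b < a) (ht' : t < 0 ↔ a < b)
    (h : 0 < t * ((S : ℝ) * ((y : ℤ) : ℝ))) : IsVote a b S x ↔ x = y := by
  unfold IsVote
  rcases lt_trichotomy t 0 with h0 | rfl | h0
  · have hab := ht'.1 h0
    have hab' : ¬ b < a := not_lt.2 hab.le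
    have h1 := neg_of_mul_pos_right h h0.le
    rcases Int.units_eq_one_or y with rfl | rfl
    · have hS : S < 0 := by simpa using h1
      simp [hab, hab', hS, not_lt.2 hS.le]
    · have hS : 0 < S := by simpa using h1
      simp [hab, hab', hS, not_lt.2 hS.le]
  · simp at h
  · have hab := ht.1 h0
    have hab' : ¬ a < b := not_lt.2 hab.le
    have h1 := pos_of_mul_pos_right h h0.le
    rcases Int.units_eq_one_or y with rfl | rfl
    · have hS : 0 < S := by simpa using h1
      simp [hab, hab', hS, not_lt.2 hS.le]
    · have hS : S < 0 := by simpa using h1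
      simp [hab, hab', hS, not_lt.2 hS.le]

theorem exists_isVote (a b : ℝ) (S : ℤ) : ∃ x, IsVote a b S x := by
  unfold IsVote
  rcases lt_trichotomy a b with h | h | h
  · rcases lt_trichotomy S 0 with hS | hS | hS
    · exact ⟨1, by simp [not_lt.2 h.le, not_lt.2 hS.le]⟩
    · exact ⟨1, by simp [hS]⟩
    · exact ⟨-1, by simp [not_lt.2 h.le, not_lt.2 hS.le]⟩
  · exact ⟨1, by simp [h]⟩
  · rcases lt_trichotomy S 0 with hS | hS | hS
    · exact ⟨-1, by simp [not_lt.2 h.le, not_lt.2 hS.le]⟩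
    · exact ⟨1, by simp [hS]⟩
    · exact ⟨1, by simp [not_lt.2 h.le, not_lt.2 hS.le]⟩

/-- A vote over `A` with few wrong labels agrees with the vote of the true labels over `B`. -/
theorem signed_sum_pos {V : Type} [DecidableEq V] (A B : Finset V) (τ σ : V → ℤˣ) (η y : ℤˣ) {t m : ℝ}
    (hm : m < t * (((y : ℤ) : ℝ) * ∑ x ∈ B, rv σ x))
    (hle : |t| * ((B \ A).card + (A \ B).card + 2 * (A.filter fun x => τ x ≠ η * σ x).card) ≤ m) :
    0 < t * (((∑ x ∈ A, (τ x : ℤ) : ℤ) : ℝ) * (((η * y : ℤˣ) : ℤ) : ℝ)) := by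
  have h1 : |∑ x ∈ A, ((η : ℤ) : ℝ) * rv τ x - ∑ x ∈ A, rv σ x| ≤
      2 * (A.filter fun x => τ x ≠ η * σ x).card := by
    rw [← Finset.sum_sub_distrib]
    refine (Finset.abs_sum_le_sum_abs _ _).trans ?_
    rw [Finset.card_filter]
    push_cast
    rw [Finset.mul_sum]
    refine Finset.sum_le_sum fun x _ => ?_
    split_ifs with hx
    · refine (abs_sub _ _).trans ?_
      rw [abs_mul, abs_rv, abs_rv, abs_units_cast]; norm_num
    · push Not at hx
      simp only [rv, hx]
      rcases Int.units_eq_one_or η with rfl | rfl <;> simp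
  have h2 : |∑ x ∈ A, rv σ x - ∑ x ∈ B, rv σ x| ≤ (B \ A).card + (A \ B).card := by
    rw [← Finset.sum_sdiff_sub_sum_sdiff]
    refine (abs_sub _ _).trans ?_
    rw [add_comm]
    refine add_le_add ?_ ?_ <;>
    · refine (Finset.abs_sum_le_sum_abs _ _).trans ?_
      simp [abs_rv]
  set X := ∑ x ∈ A, ((η : ℤ) : ℝ) * rv τ x with hX
  have h3 : |X - ∑ x ∈ B, rv σ x| ≤
      (B \ A).card + (A \ B).card + 2 * (A.filter fun x => τ x ≠ η * σ x).card := by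
    have := abs_sub_le X (∑ x ∈ A, rv σ x) (∑ x ∈ B, rv σ x)
    linarith
  have h4 : t * (((∑ x ∈ A, (τ x : ℤ) : ℤ) : ℝ) * (((η * y : ℤˣ) : ℤ) : ℝ)) =
      t * (((y : ℤ) : ℝ) * X) := by
    rw [hX, ← Finset.mul_sum]
    simp only [rv]
    push_cast
    ring
  have h5 : |t * (((y : ℤ) : ℝ) * (X - ∑ x ∈ B, rv σ x))| ≤ m := by
    rw [abs_mul, abs_mul, abs_units_cast, one_mul]
    exact (mul_le_mul_of_nonneg_left h3 (abs_nonneg t)).trans hle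
  have h6 := (abs_le.1 h5).1
  rw [h4]
  have h7 : t * (((y : ℤ) : ℝ) * X) = t * (((y : ℤ) : ℝ) * (X - ∑ x ∈ B, rv σ x)) +
      t * (((y : ℤ) : ℝ) * ∑ x ∈ B, rv σ x) := by ring
  linarith

theorem tilt_pos_iff {α β : ℝ} (hα : 0 < α) (hβ : 0 < β) : 0 < tilt α β ↔ β < α := by
  unfold tilt
  rw [mul_pos_iff_of_pos_left (by norm_num), Real.log_pos_iff (by positivity), one_lt_div hβ]

theorem tilt_neg_iff {α β : ℝ} (hα : 0 < α) (hβ : 0 < β) : tilt α β < 0 ↔ α < β := by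
  have := tilt_pos_iff hβ hα
  have h1 : tilt β α = - tilt α β := by
    unfold tilt; rw [← inv_div α β, Real.log_inv]; ring
  rw [h1] at this
  rw [← this]; constructor <;> intro h <;> linarith

/-! ### The preliminary labeling -/

section
variable {n r : ℕ}

open Classical in
/-- The comparison of positive parts aligns the signs of two labelings. -/
theorem align_sign {σ τ : Fin n → ℤˣ} {c : Fin n → Fin r} {i : Fin r}
    {ρ : {v : Fin n // c v ≠ i} → ℤˣ} {Z : Finset (Fin n)} {η₀ η₁ : ℤˣ}
    (hZ : (Z.card : ℝ) < n / 2) (hU : ∀ v, c v = i → v ∈ Z) (hτ : ∀ v ∉ Z, τ v = η₀ * σ v)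
    (hρ : ∀ v : {v : Fin n // c v ≠ i}, v.1 ∉ Z → ρ v = η₁ * σ v) :
    (if (n : ℝ) / 2 ≤
        ((symmDiff (Finset.univ.filter fun x => ∃ h : c x ≠ i, ρ ⟨x, h⟩ = 1)
          (Finset.univ.filter fun x => τ x = 1)).card : ℝ) then - η₁ else η₁) = η₀ := by
  have hmem : ∀ x ∉ Z, ((∃ h : c x ≠ i, ρ ⟨x, h⟩ = 1) ↔ η₁ * σ x = 1) := by
    intro x hx
    have hc : c x ≠ i := fun h => hx (hU x h)
    rw [← hρ ⟨x, hc⟩ hx]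
    exact ⟨fun ⟨_, h⟩ => h, fun h => ⟨hc, h⟩⟩
  -- With equal signs the positive parts differ only inside `Z`, with opposite signs they differ
  -- everywhere outside it. As `|Z| < n/2`, the threshold `n/2` tells the two cases apart. `Z`
  -- contains the class, where `ρ` is undefined.
  by_cases hη : η₁ = η₀
  · rw [if_neg, hη]
    rw [not_le]
    refine lt_of_le_of_lt ?_ hZ
    refine Nat.cast_le.2 (Finset.card_le_card fun x hx => ?_)
    by_contra hxZ
    rw [Finset.mem_symmDiff] at hx
    simp only [Finset.mem_filter, Finset.mem_univ, true_and, hmem x hxZ, hτ x hxZ, hη] at hx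
    tauto
  · have hη' : η₁ = -η₀ := by
      rcases Int.units_eq_one_or η₁ with h | h <;> rcases Int.units_eq_one_or η₀ with h' | h' <;>
        simp_all
    rw [if_pos, hη', neg_neg]
    have h1 : Zᶜ ⊆ symmDiff (Finset.univ.filter fun x => ∃ h : c x ≠ i, ρ ⟨x, h⟩ = 1)
          (Finset.univ.filter fun x => τ x = 1) := by
      intro x hx
      have hxZ := Finset.mem_compl.1 hx
      rw [Finset.mem_symmDiff]
      simp only [Finset.mem_filter, Finset.mem_univ, true_and, hmem x hxZ, hτ x hxZ, hη']
      rcases Int.units_eq_one_or (σ x) with h | h <;> rcases Int.units_eq_one_or η₀ with h' | h' <;>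
        simp [h, h']
    have h2 := Finset.card_le_card h1
    have h3 := Finset.card_add_card_compl Z
    rw [Fintype.card_fin] at h3
    have h4 : (Z.card : ℝ) + (Zᶜ).card = n := by exact_mod_cast h3
    have h5 : ((Zᶜ).card : ℝ) ≤ (symmDiff (Finset.univ.filter fun x => ∃ h : c x ≠ i, ρ ⟨x, h⟩ = 1)
          (Finset.univ.filter fun x => τ x = 1)).card := by exact_mod_cast h2
    linarith

open Classical in
/-- Outside the bad vertices, the preliminary labeling is correct up to a global sign. -/
theorem IsAlmostExact.eq_of_not_badAt {α β a b : ℝ} {σ σ₁ : Fin n → ℤˣ} {c : Fin n → Fin r}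
    {ω : Sym2 (Fin n) → St} (hα : 0 < α) (hβ : 0 < β) (ha : β < α ↔ b < a) (hb : α < β ↔ a < b)
    {Z₀ : Finset (Fin n)} {Z : Fin r → Finset (Fin n)}
    (hZ : ∀ i, (((Finset.univ.filter fun v => c v = i) ∪ (Z₀ ∪ Z i)).card : ℝ) < n / 2)
    (h₀ : ∀ τ, IsSpectral a b (gr isG1 ω) τ → ∃ η : ℤˣ, ∀ v ∉ Z₀, τ v = η * σ v)
    (h₁ : ∀ i, ∀ ρ, IsSpectral a b
      ((gr isG1 ω).comap (Subtype.val : {v : Fin n // c v ≠ i} → Fin n)) ρ →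
      ∃ η : ℤˣ, ∀ v, v.1 ∉ Z i → ρ v = η * σ v)
    (h : IsAlmostExact a b c (gr isG1 ω) σ₁) :
    ∃ η : ℤˣ, ∀ v, ¬ BadAt α β σ c (c v) (Z (c v)) ω v → σ₁ v = η * σ v := by
  obtain ⟨τ, ρ, hτ, hρ, hvote⟩ := h
  obtain ⟨η, hη⟩ := h₀ τ hτ
  refine ⟨η, fun v hv => ?_⟩
  obtain ⟨η₁, hη₁⟩ := h₁ (c v) (ρ (c v)) (hρ (c v))
  -- The flipping rule gives every `ρ i` the sign of `τ`, so a single sign `η` serves all classes.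
  have hal := align_sign (σ := σ) (τ := τ) (ρ := ρ (c v)) (η₀ := η) (η₁ := η₁) (hZ (c v))
    (fun x hx => Finset.mem_union_left _ (by simpa using hx))
    (fun x hx => hη x fun h => hx (Finset.mem_union_right _ (Finset.mem_union_left _ h)))
    (fun x hx => hη₁ x fun h => hx (Finset.mem_union_right _ (Finset.mem_union_right _ h)))
  have hvote' := hvote v
  set P : Prop := (n : ℝ) / 2 ≤
        ((symmDiff (Finset.univ.filter fun x => ∃ h : c x ≠ c v, ρ (c v) ⟨x, h⟩ = 1)
          (Finset.univ.filter fun x => τ x = 1)).card : ℝ) with hP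
  set ρ' : {w : Fin n // c w ≠ c v} → ℤˣ := fun w => if P then - ρ (c v) w else ρ (c v) w with hρ'
  have hρ'eq : ∀ w, w.1 ∉ Z (c v) → ρ' w = η * σ w := by
    intro w hw
    simp only [hρ']
    rw [hη₁ w hw, ← hal]
    split_ifs <;> simp
  set A : Finset {w : Fin n // c w ≠ c v} :=
    Finset.univ.filter fun w => (gr isG1 ω).Adj v w with hA
  have hsum : (∑ w : {w : Fin n // c w ≠ c v}, if (gr isG1 ω).Adj v w then ((ρ' w : ℤˣ) : ℤ) else 0) =
      ∑ w ∈ A, (ρ' w : ℤ) := by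
    rw [hA, Finset.sum_filter]
  have hadj : ∀ w : {w : Fin n // c w ≠ c v}, (gr isG1 ω).Adj v w ↔ isG1 (ω s(v, w)) = true := by
    intro w
    rw [gr_adj]
    exact ⟨fun h => h.2, fun h => ⟨fun he => w.2 (by rw [← he]), h⟩⟩
  have hB : ∑ x with c x ≠ c v, (if isG1 (ω s(v, x)) then rv σ x else 0) =
      ∑ w ∈ A, rv (fun w : {w : Fin n // c w ≠ c v} => σ w) w := by
    refine (Finset.sum_subtype (Finset.univ.filter fun x => c x ≠ c v) (p := fun x => c x ≠ c v)
      (F := inferInstance) (by simp) _).trans ?_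
    rw [hA, Finset.sum_filter]
    refine Finset.sum_congr rfl fun w _ => ?_
    simp only [hadj, rv]
  have hwrong : ((A.filter fun w => ρ' w ≠ η * σ w).card : ℝ) ≤
      ∑ x ∈ Z (c v), if isG1 (ω s(v, x)) then (1 : ℝ) else 0 := by
    have h1 : (A.filter fun w => ρ' w ≠ η * σ w).map (Function.Embedding.subtype _) ⊆
        (Z (c v)).filter fun x => isG1 (ω s(v, x)) = true := by
      intro x hx
      obtain ⟨w, hw, rfl⟩ := Finset.mem_map.1 hx
      rw [Finset.mem_filter, hA, Finset.mem_filter] at hw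
      refine Finset.mem_filter.2 ⟨?_, (hadj w).1 hw.1.2⟩
      by_contra hne
      exact hw.2 (hρ'eq w hne)
    have h2 := Finset.card_le_card h1
    rw [Finset.card_map] at h2
    rw [Finset.sum_boole]
    exact_mod_cast h2
  unfold BadAt at hv
  rw [not_le, hB] at hv
  have hpos := signed_sum_pos A A ρ' (fun w : {w : Fin n // c w ≠ c v} => σ w) η (σ v) hv (by
    rw [Finset.sdiff_self]
    have := mul_le_mul_of_nonneg_left hwrong (abs_nonneg (tilt α β))
    rw [Finset.card_empty, Nat.cast_zero]
    linarith)
  rw [← hsum] at hpos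
  exact (isVote_iff ((tilt_pos_iff hα hβ).trans ha) ((tilt_neg_iff hα hβ).trans hb) hpos).1 hvote'

end

end CorrSBM
end

noncomputable section
namespace CorrSBM

/-! ### Existence of the preliminary labeling -/

theorem exists_isSpectral {V : Type} [Fintype V] (a b : ℝ) (G : SimpleGraph V)
    (h : 1 < Fintype.card V) : ∃ τ, IsSpectral a b G τ := by
  classical
  obtain ⟨u, hu, he⟩ := exists_eigenvector G
    (if b < a then ⟨1, h⟩ else ⟨Fintype.card V - 1, by omega⟩)
  refine ⟨fun v => if u v < 0 then -1 else 1, h, u, hu, fun hab => ?_, fun hab => ?_, fun v => ?_⟩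
  · rw [if_pos hab] at he; exact he
  · rw [if_neg (not_lt.2 hab.le)] at he; exact he
  · exact ⟨fun h => if_neg (not_lt.2 h.le), fun h => if_pos h⟩

theorem exists_isAlmostExact {n r : ℕ} (a b : ℝ) (c : Fin n → Fin r) (G : SimpleGraph (Fin n))
    (hn : 1 < n) (hc : ∀ i, 1 < Nat.card {v : Fin n // c v ≠ i}) :
    ∃ σ₁, IsAlmostExact a b c G σ₁ := by
  classical
  obtain ⟨τ, hτ⟩ := exists_isSpectral a b G (by rwa [Fintype.card_fin])
  choose ρ hρ using fun i => exists_isSpectral a b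
    (G.comap (Subtype.val : {v : Fin n // c v ≠ i} → Fin n)) (by
      rw [← Nat.card_eq_fintype_card]; exact hc i)
  exact ⟨fun v => (exists_isVote a b _).choose, τ, ρ, hτ, hρ, fun v => (exists_isVote a b _).choose_spec⟩

/-! ### The algorithm on a good outcome -/

section
variable {n r : ℕ}

open Classical in
/-- The properties of the graphs under which the algorithm succeeds. -/
structure GoodOutcome (α β s ε : ℝ) (K₁ K₂ : ℕ) (σ : Fin n → ℤˣ) (c : Fin n → Fin r)
    (ω : Sym2 (Fin n) → St) : Prop where
  matching : ∀ m : Matching n, m.IsKCore 13 (gr isG1 ω) (gr isG2 ω) → ∀ i ∈ m.M, m.μ i = i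
  fringeDiff : ∀ v, nbrCount (gr isD ω) (fringe 13 ω) v < K₁
  signedDiff : ∀ v ∈ fringe 13 ω, |tilt α β| * (K₁ + 13) < tilt α β * (rv σ v *
    ∑ j ∈ (fringe 13 ω)ᶜ, if isD (ω s(v, j)) then rv σ j else 0)
  signedUnion : ∀ v, 4 * ε * |tilt α β| * Real.log n < tilt α β * (rv σ v *
    ∑ j ∈ Finset.univ.erase v, if isUn (ω s(v, j)) then rv σ j else 0)
  ownClass : ∀ v, nbrCount (gr isUn ω) (Finset.univ.filter fun w => c w = c v) v <
    ε / 2 * Real.log n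
  spectral : ∃ (Z₀ : Finset (Fin n)) (Z : Fin r → Finset (Fin n)),
    (∀ i, (((Finset.univ.filter fun v => c v = i) ∪ (Z₀ ∪ Z i)).card : ℝ) < n / 2) ∧
    (∀ τ, IsSpectral (s * α) (s * β) (gr isG1 ω) τ → ∃ η : ℤˣ, ∀ v ∉ Z₀, τ v = η * σ v) ∧
    (∀ i, ∀ ρ, IsSpectral (s * α) (s * β)
      ((gr isG1 ω).comap (Subtype.val : {v : Fin n // c v ≠ i} → Fin n)) ρ →
      ∃ η : ℤˣ, ∀ v, v.1 ∉ Z i → ρ v = η * σ v) ∧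
    ∀ v i, c v ≠ i → (Finset.univ.filter fun w =>
      c w = i ∧ isUn (ω s(w, v)) ∧ BadAt α β σ c i (Z i) ω w).card < K₂

theorem isH_iff (x : St) : isH x = true ↔ isG1 x = true ∧ isG2 x = true := by
  rcases x with ⟨_ | _, _ | _, _ | _⟩ <;> simp [isH, isG1, isG2]

theorem isUn_iff (x : St) : isUn x = true ↔ isG1 x = true ∨ isG2 x = true := by
  rcases x with ⟨_ | _, _ | _, _ | _⟩ <;> simp [isUn, isG1, isG2]

theorem isUn_iff' (x : St) : isUn x = true ↔ isG2 x = true ∨ isD x = true := by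
  rcases x with ⟨_ | _, _ | _, _ | _⟩ <;> simp [isUn, isD, isG2]

theorem isD_iff (x : St) : isD x = true ↔ isG1 x = true ∧ ¬ isG2 x = true := by
  rcases x with ⟨_ | _, _ | _, _ | _⟩ <;> simp [isD, isG1, isG2]

theorem isG1_iff (x : St) : isG1 x = true ↔ isD x = true ∨ isH x = true := by
  rcases x with ⟨_ | _, _ | _, _ | _⟩ <;> simp [isD, isG1, isH]

open Classical in
theorem degree_inter {ω : Sym2 (Fin n) → St} {m : Matching n} (hm : ∀ i ∈ m.M, m.μ i = i) {i : Fin n}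
    (hi : i ∈ m.M) :
    (m.inter (gr isG1 ω) (gr isG2 ω)).degree i = nbrCount (gr isH ω) m.M i := by
  rw [← SimpleGraph.card_neighborFinset_eq_degree, nbrCount]
  congr 1
  ext j
  rw [SimpleGraph.mem_neighborFinset, Finset.mem_filter]
  simp only [Matching.inter, gr_adj, isH_iff]
  constructor
  · rintro ⟨-, h2, h3, h4⟩
    rw [hm i hi, hm j h2] at h4
    exact ⟨h2, h3.1, h3.2, h4.2⟩
  · rintro ⟨h2, h3, h4, h5⟩
    rw [hm i hi, hm j h2]
    exact ⟨hi, h2, ⟨h3, h4⟩, h3, h5⟩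

/-- The identity matching on the core. -/
def coreMatching (ω : Sym2 (Fin n) → St) : Matching n :=
  ⟨coreSet (gr isH ω) 13, id, Function.injective_id.injOn⟩

theorem coreMatching_isKCore (ω : Sym2 (Fin n) → St) :
    (coreMatching ω).IsKCore 13 (gr isG1 ω) (gr isG2 ω) := by
  intro i hi
  rw [degree_inter (fun _ _ => rfl) hi]
  exact coreSet_isCore _ _ i hi

variable {α β s ε : ℝ} {K₁ K₂ : ℕ} {σ : Fin n → ℤˣ} {c : Fin n → Fin r} {ω : Sym2 (Fin n) → St}

theorem GoodOutcome.subset_coreSet (h : GoodOutcome α β s ε K₁ K₂ σ c ω) {m : Matching n}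
    (hm : m.IsKCore 13 (gr isG1 ω) (gr isG2 ω)) : m.M ⊆ coreSet (gr isH ω) 13 := by
  refine IsCore.subset_coreSet fun v hv => ?_
  rw [← degree_inter (h.matching m hm) hv]
  exact hm v hv

theorem GoodOutcome.coreMatching_isMaxKCore (h : GoodOutcome α β s ε K₁ K₂ σ c ω) :
    (coreMatching ω).IsMaxKCore 13 (gr isG1 ω) (gr isG2 ω) :=
  ⟨coreMatching_isKCore ω, fun _ hm => Finset.card_le_card (h.subset_coreSet hm)⟩

/-- Every 13-core matching is the identity on a set inside the core, and the identity on the whole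
core is a competitor, so maximality leaves only the core. -/
theorem GoodOutcome.eq_coreSet (h : GoodOutcome α β s ε K₁ K₂ σ c ω) {m : Matching n}
    (hm : m.IsMaxKCore 13 (gr isG1 ω) (gr isG2 ω)) : m.M = coreSet (gr isH ω) 13 :=
  Finset.eq_of_subset_of_card_le (h.subset_coreSet hm.1) (hm.2 _ (coreMatching_isKCore ω))

theorem compl_coreSet_subset_fringe : (coreSet (gr isH ω) 13)ᶜ ⊆ fringe 13 ω :=
  subset_expHull _ _

theorem mem_coreSet_of_notMem_fringe {v : Fin n} (hv : v ∉ fringe 13 ω) :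
    v ∈ coreSet (gr isH ω) 13 := by
  by_contra hn
  exact hv (compl_coreSet_subset_fringe (Finset.mem_compl.2 hn))

theorem isLuczak_fringe_iff {m : Matching n} (hM : m.M = coreSet (gr isH ω) 13)
    (hμ : ∀ i ∈ m.M, m.μ i = i) {F' : Finset (Fin n)} :
    IsLuczak (gr isG2 ω) (m.M.image m.μ)ᶜ F' ↔ F' = fringe 13 ω := by
  classical
  have : m.M.image m.μ = coreSet (gr isH ω) 13 := by
    rw [← hM]
    ext x
    rw [Finset.mem_image]
    constructor
    · rintro ⟨y, hy, rfl⟩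
      rwa [hμ y hy]
    · exact fun hx => ⟨x, hx, hμ x hx⟩
  rw [isLuczak_iff, this]
  rfl

theorem fringe_eq {m : Matching n} (hM : m.M = coreSet (gr isH ω) 13)
    (hμ : ∀ i ∈ m.M, m.μ i = i) :
    ({i | i ∈ m.M ∧ m.μ i ∉ fringe 13 ω}ᶜ : Set (Fin n)) = (fringe 13 ω : Set (Fin n)) := by
  ext i
  simp only [Set.mem_compl_iff, Set.mem_ofPred_eq, Finset.mem_coe, not_and, not_not]
  constructor
  · intro hi
    by_contra hn
    have hiM : i ∈ m.M := hM ▸ mem_coreSet_of_notMem_fringe hn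
    exact hn (by have := hi hiM; rwa [hμ i hiM] at this)
  · intro hi hiM
    rwa [hμ i hiM]

end

end CorrSBM
end

/-! ### The votes on a good outcome. -/

noncomputable section
namespace CorrSBM

section
variable {n r : ℕ} {α β s ε : ℝ} {K₁ K₂ : ℕ} {σ : Fin n → ℤˣ} {c : Fin n → Fin r}
  {ω : Sym2 (Fin n) → St}

/-- An edge of the union graph is in the second graph or exclusive. Closedness of the fringe allows
at most one neighbour of the former kind, `fringeDiff` bounds the latter. -/
theorem nbrCount_isUn_fringe_le (h : GoodOutcome α β s ε K₁ K₂ σ c ω) {v : Fin n}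
    (hv : v ∉ fringe 13 ω) : nbrCount (gr isUn ω) (fringe 13 ω) v ≤ 1 + K₁ := by
  classical
  have h1 : nbrCount (gr isUn ω) (fringe 13 ω) v ≤
      nbrCount (gr isG2 ω) (fringe 13 ω) v + nbrCount (gr isD ω) (fringe 13 ω) v := by
    unfold nbrCount
    refine le_trans (Finset.card_le_card ?_) (Finset.card_union_le _ _)
    intro x hx
    simp only [Finset.mem_union, Finset.mem_filter, gr_adj, isUn_iff'] at hx ⊢
    tauto
  have h2 := expHull_isExpClosed (gr isG2 ω) (coreSet (gr isH ω) 13)ᶜ v hv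
  have h3 := h.fringeDiff v
  unfold fringe at *
  omega

/-- Few neighbours in the union graph have a wrong preliminary label. -/
theorem card_wrong_le {Z : Fin r → Finset (Fin n)} {τ : Fin n → ℤˣ} {η : ℤˣ} {v : Fin n}
    {A : Finset (Fin n)} (hA : ∀ x ∈ A, (gr isUn ω).Adj v x)
    (hτ : ∀ x, ¬ BadAt α β σ c (c x) (Z (c x)) ω x → τ x = η * σ x)
    (hbad : ∀ i, c v ≠ i → (open Classical in (Finset.univ.filter fun w =>
      c w = i ∧ isUn (ω s(w, v)) ∧ BadAt α β σ c i (Z i) ω w)).card < K₂) :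
    (A.filter fun x => τ x ≠ η * σ x).card ≤
      nbrCount (gr isUn ω) (Finset.univ.filter fun w => c w = c v) v + r * K₂ := by
  classical
  set B : Fin r → Finset (Fin n) := fun i => if c v ≠ i then Finset.univ.filter fun w =>
      c w = i ∧ isUn (ω s(w, v)) ∧ BadAt α β σ c i (Z i) ω w else ∅ with hB
  have h1 : A.filter (fun x => τ x ≠ η * σ x) ⊆
      ((Finset.univ.filter fun w => c w = c v).filter fun w => (gr isUn ω).Adj v w) ∪
        Finset.univ.biUnion B := by
    intro x hx
    rw [Finset.mem_filter] at hx
    have hadj := hA x hx.1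
    by_cases hc : c x = c v
    · refine Finset.mem_union_left _ (Finset.mem_filter.2 ⟨by simpa using hc, hadj⟩)
    · refine Finset.mem_union_right _ (Finset.mem_biUnion.2 ⟨c x, Finset.mem_univ _, ?_⟩)
      simp only [hB]
      rw [if_pos (Ne.symm hc)]
      refine Finset.mem_filter.2 ⟨Finset.mem_univ _, rfl, ?_, ?_⟩
      · rw [gr_adj] at hadj
        rw [Sym2.eq_swap]
        exact hadj.2
      · by_contra hn
        exact hx.2 (hτ x hn)
  refine (Finset.card_le_card h1).trans ((Finset.card_union_le _ _).trans (add_le_add le_rfl ?_))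
  refine Finset.card_biUnion_le.trans ?_
  calc ∑ i, (B i).card ≤ ∑ _i : Fin r, K₂ := by
        refine Finset.sum_le_sum fun i _ => ?_
        simp only [hB]
        split_ifs with hi
        · exact (hbad i hi).le
        · simp
    _ = r * K₂ := by simp

variable {m : Matching n}

/-- The votes for the vertices outside the fringe. -/
theorem vote_union_pos (h : GoodOutcome α β s ε K₁ K₂ σ c ω)
    (hL : (1 + K₁ + 2 * (r * K₂) : ℝ) ≤ 3 * ε * Real.log n)
    (hM : m.M = coreSet (gr isH ω) 13) (hμ : ∀ i ∈ m.M, m.μ i = i) {σ₁ : Fin n → ℤˣ} {η : ℤˣ}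
    {Z : Fin r → Finset (Fin n)}
    (hσ₁ : ∀ x, ¬ BadAt α β σ c (c x) (Z (c x)) ω x → σ₁ x = η * σ x)
    (hbad : ∀ v i, c v ≠ i → (open Classical in (Finset.univ.filter fun w =>
      c w = i ∧ isUn (ω s(w, v)) ∧ BadAt α β σ c i (Z i) ω w)).card < K₂)
    {v : Fin n} (hv : v ∉ fringe 13 ω) :
    0 < tilt α β * ((nbrSum (m.union (gr isG1 ω) (gr isG2 ω)) (fringe 13 ω : Set (Fin n))ᶜ σ₁ v : ℝ) *
      (((η * σ v : ℤˣ) : ℤ) : ℝ)) := by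
  classical
  set N := (Finset.univ.erase v).filter fun j => isUn (ω s(v, j)) = true with hN
  have hNadj : ∀ x, x ∈ N ↔ (gr isUn ω).Adj v x := by
    intro x
    simp only [hN, Finset.mem_filter, Finset.mem_erase, Finset.mem_univ, gr_adj, and_true]
    exact and_congr_left fun _ => ne_comm
  set A := N.filter fun j => j ∉ fringe 13 ω with hA
  have hvM : v ∈ m.M := hM ▸ mem_coreSet_of_notMem_fringe hv
  have hsum : nbrSum (m.union (gr isG1 ω) (gr isG2 ω)) (fringe 13 ω : Set (Fin n))ᶜ σ₁ v =
      ∑ x ∈ A, (σ₁ x : ℤ) := by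
    unfold nbrSum
    congr 1
    ext x
    simp only [hA, Finset.mem_filter, Finset.mem_univ, true_and, hNadj, Set.mem_compl_iff,
      Finset.mem_coe]
    refine and_congr_left fun hx => ?_
    have hxM : x ∈ m.M := hM ▸ mem_coreSet_of_notMem_fringe hx
    simp only [Matching.union, hμ v hvM, hμ x hxM, hvM, hxM, true_and, gr_adj, isUn_iff]
    tauto
  rw [hsum]
  have h1 := h.signedUnion v
  rw [← Finset.sum_filter, ← hN] at h1
  refine signed_sum_pos A N σ₁ σ η (σ v) h1 ?_
  have h2 : ((N \ A).card : ℝ) ≤ 1 + K₁ := by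
    have h3 : N \ A ⊆ (fringe 13 ω).filter fun x => (gr isUn ω).Adj v x := by
      intro x hx
      simp only [hA, Finset.mem_sdiff, Finset.mem_filter, not_and, not_not] at hx
      exact Finset.mem_filter.2 ⟨hx.2 hx.1, (hNadj x).1 hx.1⟩
    have h4 := (Finset.card_le_card h3).trans (nbrCount_isUn_fringe_le h hv)
    exact_mod_cast h4
  have h3 : (A \ N).card = 0 := by
    rw [Finset.card_eq_zero, Finset.sdiff_eq_empty_iff_subset]
    exact Finset.filter_subset _ _
  have h4 : ((A.filter fun x => σ₁ x ≠ η * σ x).card : ℝ) ≤ ε / 2 * Real.log n + r * K₂ := by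
    have h5 := card_wrong_le (τ := σ₁) (A := A) (v := v) (K₂ := K₂)
      (fun x hx => (hNadj x).1 (Finset.mem_filter.1 hx).1) hσ₁ (hbad v)
    have h6 := h.ownClass v
    have h7 : ((A.filter fun x => σ₁ x ≠ η * σ x).card : ℝ) ≤
        nbrCount (gr isUn ω) (Finset.univ.filter fun w => c w = c v) v + r * K₂ := by
      exact_mod_cast h5
    linarith
  rw [h3, Nat.cast_zero, add_zero]
  -- Error budget: `1 + K₁` neighbours lost to the fringe, and twice the `(ε/2) log n + r K₂` wrong
  -- labels. The constants fit into `3 ε log n` by `hL`, which makes `4 ε log n` in total.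
  calc |tilt α β| * ((N \ A).card + 2 * (A.filter fun x => σ₁ x ≠ η * σ x).card) ≤
      |tilt α β| * (4 * ε * Real.log n) :=
        mul_le_mul_of_nonneg_left (by linarith) (abs_nonneg _)
    _ = _ := by ring

/-- The neighbours outside the fringe along edges of the first graph only. -/
theorem exists_diffNbrs (h : GoodOutcome α β s ε K₁ K₂ σ c ω) {v : Fin n} (hv : v ∈ fringe 13 ω) :
    ∃ N : Finset (Fin n), (∀ x, x ∈ N ↔ (gr isD ω).Adj v x ∧ x ∉ fringe 13 ω) ∧
      |tilt α β| * (K₁ + 13) < tilt α β * (((σ v : ℤ) : ℝ) * ∑ x ∈ N, rv σ x) := by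
  classical
  refine ⟨(fringe 13 ω)ᶜ.filter fun j => isD (ω s(v, j)) = true, fun x => ?_, ?_⟩
  · simp only [Finset.mem_filter, Finset.mem_compl, gr_adj]
    constructor
    · exact fun hx => ⟨⟨fun he => hx.1 (he ▸ hv), hx.2⟩, hx.1⟩
    · exact fun hx => ⟨hx.2, hx.1.2⟩
  · have h1 := h.signedDiff v hv
    rw [← Finset.sum_filter] at h1
    exact h1

/-- The votes for the matched vertices in the fringe. -/
theorem vote_diff_pos (h : GoodOutcome α β s ε K₁ K₂ σ c ω)
    (hM : m.M = coreSet (gr isH ω) 13) (hμ : ∀ i ∈ m.M, m.μ i = i) {τ : Fin n → ℤˣ} {η : ℤˣ}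
    (hτ : ∀ x ∉ fringe 13 ω, τ x = η * σ x) {v : Fin n} (hv : v ∈ fringe 13 ω) (hvM : v ∈ m.M) :
    0 < tilt α β * ((nbrSum (m.diff (gr isG1 ω) (gr isG2 ω)) (fringe 13 ω : Set (Fin n))ᶜ τ v : ℝ) *
      (((η * σ v : ℤˣ) : ℤ) : ℝ)) := by
  classical
  obtain ⟨N, hN, h1⟩ := exists_diffNbrs h hv
  have hsum : nbrSum (m.diff (gr isG1 ω) (gr isG2 ω)) (fringe 13 ω : Set (Fin n))ᶜ τ v =
      ∑ x ∈ N, (τ x : ℤ) := by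
    unfold nbrSum
    congr 1
    ext x
    simp only [Finset.mem_filter, Finset.mem_univ, true_and, hN, Set.mem_compl_iff,
      Finset.mem_coe]
    refine and_congr_left fun hx => ?_
    have hxM : x ∈ m.M := hM ▸ mem_coreSet_of_notMem_fringe hx
    simp only [Matching.diff, hμ v hvM, hμ x hxM, hvM, hxM, true_and, gr_adj, isD_iff]
    tauto
  rw [hsum]
  refine signed_sum_pos N N τ σ η (σ v) h1 ?_
  rw [Finset.sdiff_self, Finset.filter_false_of_mem (fun x hx => not_not.2 (hτ x ((hN x).1 hx).2))]
  simp only [Finset.card_empty, Nat.cast_zero]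
  refine mul_le_mul_of_nonneg_left ?_ (abs_nonneg _)
  have : (0 : ℝ) ≤ K₁ := Nat.cast_nonneg _
  linarith

/-- The votes for the unmatched vertices. -/
theorem vote_unmatched_pos (h : GoodOutcome α β s ε K₁ K₂ σ c ω)
    (hM : m.M = coreSet (gr isH ω) 13) {τ : Fin n → ℤˣ} {η : ℤˣ}
    (hτ : ∀ x ∈ m.M, τ x = η * σ x) {v : Fin n} (hvM : v ∉ m.M) :
    0 < tilt α β * ((nbrSum (gr isG1 ω) (m.M : Set (Fin n)) τ v : ℝ) *
      (((η * σ v : ℤˣ) : ℤ) : ℝ)) := by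
  classical
  have hvc : v ∉ coreSet (gr isH ω) 13 := hM ▸ hvM
  have hv : v ∈ fringe 13 ω := compl_coreSet_subset_fringe (Finset.mem_compl.2 hvc)
  obtain ⟨N, hN, h1⟩ := exists_diffNbrs h hv
  set A := Finset.univ.filter fun j => (gr isG1 ω).Adj v j ∧ j ∈ m.M with hA
  have hsum : nbrSum (gr isG1 ω) (m.M : Set (Fin n)) τ v = ∑ x ∈ A, (τ x : ℤ) := by
    unfold nbrSum
    simp only [hA, Finset.mem_coe]
  rw [hsum]
  refine signed_sum_pos A N τ σ η (σ v) h1 ?_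
  have h2 : (N \ A).card = 0 := by
    rw [Finset.card_eq_zero, Finset.sdiff_eq_empty_iff_subset]
    intro x hx
    have hx' := (hN x).1 hx
    refine Finset.mem_filter.2 ⟨Finset.mem_univ _, ?_, hM ▸ mem_coreSet_of_notMem_fringe hx'.2⟩
    have := hx'.1
    rw [gr_adj, isD_iff] at this
    exact gr_adj.2 ⟨this.1, this.2.1⟩
  -- Besides the exclusive edges leaving the fringe there vote exclusive edges into the fringe,
  -- fewer than `K₁`, and edges of H into the core, fewer than 13 because `v` is outside the core.
  -- The margin in `signedDiff` is made for this.
  have h3 : (A \ N).card ≤ K₁ + 13 := by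
    have h4 : A \ N ⊆ ((fringe 13 ω).filter fun x => (gr isD ω).Adj v x) ∪
        ((coreSet (gr isH ω) 13).filter fun x => (gr isH ω).Adj v x) := by
      intro x hx
      simp only [hA, Finset.mem_sdiff, Finset.mem_filter, Finset.mem_univ, true_and, hN, gr_adj,
        isG1_iff, not_and, hM] at hx
      simp only [Finset.mem_union, Finset.mem_filter, gr_adj]
      tauto
    have h5 := (Finset.card_le_card h4).trans (Finset.card_union_le _ _)
    have h6 := h.fringeDiff v
    have h7 := nbrCount_coreSet_lt hvc
    unfold nbrCount at h6 h7
    omega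
  rw [h2, Finset.filter_false_of_mem (fun x hx => not_not.2 (hτ x (Finset.mem_filter.1 hx).2.2))]
  simp only [Finset.card_empty, Nat.cast_zero]
  refine mul_le_mul_of_nonneg_left ?_ (abs_nonneg _)
  have : ((A \ N).card : ℝ) ≤ K₁ + 13 := by exact_mod_cast h3
  linarith

/-- On a good outcome, every output of the algorithm is correct up to a global sign. -/
theorem GoodOutcome.eq_of_mem_recoveryOutputs (h : GoodOutcome α β s ε K₁ K₂ σ c ω) (hα : 0 < α)
    (hβ : 0 < β) (hs : 0 < s) (hL : (1 + K₁ + 2 * (r * K₂) : ℝ) ≤ 3 * ε * Real.log n)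
    {σ' : Fin n → ℤˣ} (hσ' : σ' ∈ recoveryOutputs α β s 13 c (gr isG1 ω) (gr isG2 ω)) :
    ∃ η : ℤˣ, ∀ v, σ' v = η * σ v := by
  obtain ⟨m, hmax, ⟨σ₁, F', B, hσ₁, hF', hB, hv1, hv2⟩, hv3⟩ := hσ'
  have hM := h.eq_coreSet hmax
  have hμ := h.matching m hmax.1
  rw [isLuczak_fringe_iff hM hμ] at hF'
  subst hF'
  rw [fringe_eq hM hμ] at hB
  subst hB
  obtain ⟨Z₀, Z, hZ, h₀, h₁, hbad⟩ := h.spectral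
  obtain ⟨η, hη⟩ := IsAlmostExact.eq_of_not_badAt hα hβ (mul_lt_mul_iff_right₀ hs).symm
    (mul_lt_mul_iff_right₀ hs).symm hZ h₀ h₁ hσ₁
  have s1 : ∀ x ∉ fringe 13 ω, σ' x = η * σ x := fun x hx =>
    (isVote_iff (tilt_pos_iff hα hβ) (tilt_neg_iff hα hβ)
      (vote_union_pos h hL hM hμ hη hbad hx)).1 (hv1 x (by simpa using hx))
  have s2 : ∀ x ∈ m.M, σ' x = η * σ x := by
    intro x hx
    by_cases hxf : x ∈ fringe 13 ω
    · exact (isVote_iff (tilt_pos_iff hα hβ) (tilt_neg_iff hα hβ)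
        (vote_diff_pos h hM hμ s1 hxf hx)).1 (hv2 x (by simpa using hxf) hx)
    · exact s1 x hxf
  refine ⟨η, fun x => ?_⟩
  by_cases hx : x ∈ m.M
  · exact s2 x hx
  · exact (isVote_iff (tilt_pos_iff hα hβ) (tilt_neg_iff hα hβ)
      (vote_unmatched_pos h hM s2 hx)).1 (hv3 x hx)

/-- On a good outcome, the algorithm produces an output. -/
theorem GoodOutcome.recoveryOutputs_nonempty (h : GoodOutcome α β s ε K₁ K₂ σ c ω) (hα : 0 < α)
    (hβ : 0 < β) (hs : 0 < s) (hL : (1 + K₁ + 2 * (r * K₂) : ℝ) ≤ 3 * ε * Real.log n)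
    (hn : 1 < n) (hc : ∀ i, 1 < Nat.card {v : Fin n // c v ≠ i}) :
    (recoveryOutputs α β s 13 c (gr isG1 ω) (gr isG2 ω)).Nonempty := by
  obtain ⟨σ₁, hσ₁⟩ := exists_isAlmostExact (s * α) (s * β) c (gr isG1 ω) hn hc
  obtain ⟨Z₀, Z, hZ, h₀, h₁, hbad⟩ := h.spectral
  obtain ⟨η, hη⟩ := IsAlmostExact.eq_of_not_badAt hα hβ (mul_lt_mul_iff_right₀ hs).symm
    (mul_lt_mul_iff_right₀ hs).symm hZ h₀ h₁ hσ₁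
  have hM : (coreMatching ω).M = coreSet (gr isH ω) 13 := rfl
  have hμ : ∀ i ∈ (coreMatching ω).M, (coreMatching ω).μ i = i := fun _ _ => rfl
  -- All votes are forced, so the true labels times `η` can be exhibited as an output.
  refine ⟨fun x => η * σ x, coreMatching ω, h.coreMatching_isMaxKCore,
    ⟨σ₁, fringe 13 ω, _, hσ₁, (isLuczak_fringe_iff hM hμ).2 rfl, (fringe_eq hM hμ).symm,
      fun x hx => ?_, fun x hx hxM => ?_⟩, fun x hx => ?_⟩
  · exact (isVote_iff (tilt_pos_iff hα hβ) (tilt_neg_iff hα hβ)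
      (vote_union_pos h hL hM hμ hη hbad (by simpa using hx))).2 rfl
  · exact (isVote_iff (tilt_pos_iff hα hβ) (tilt_neg_iff hα hβ)
      (vote_diff_pos h hM hμ (fun _ _ => rfl) (by simpa using hx) hxM)).2 rfl
  · exact (isVote_iff (tilt_pos_iff hα hβ) (tilt_neg_iff hα hβ)
      (vote_unmatched_pos h hM (fun _ _ => rfl) hx)).2 rfl

theorem ov_eq_one {n : ℕ} (hn : 0 < n) {σ σ' : Fin n → ℤˣ} {η : ℤˣ} (h : ∀ v, σ' v = η * σ v) :
    ov σ' σ = 1 := by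
  unfold ov
  have h1 : ∀ i, ((σ' i : ℤ) : ℝ) * ((σ i : ℤ) : ℝ) = ((η : ℤ) : ℝ) := by
    intro i
    rw [h i]
    have := rv_mul_self σ i
    simp only [rv] at this
    push_cast
    rw [mul_assoc, this, mul_one]
  rw [Finset.sum_congr rfl fun i _ => h1 i, Finset.sum_const, Finset.card_univ, Fintype.card_fin,
    nsmul_eq_mul, abs_mul, abs_units_cast, Nat.abs_cast]
  have : (n : ℝ) ≠ 0 := by positivity
  field_simp

end

end CorrSBM
end

noncomputable section
namespace CorrSBM

/-! ### Invariance under relabeling of the second graph -/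

section
variable {n : ℕ} (π : Equiv.Perm (Fin n)) (G₁ G₂ : SimpleGraph (Fin n))

theorem map_perm_adj {i j : Fin n} : (G₂.map π).Adj (π i) (π j) ↔ G₂.Adj i j :=
  SimpleGraph.map_adj_apply (f := π.toEmbedding)

/-- Composition of a matching with a permutation. -/
def Matching.comp (m : Matching n) : Matching n :=
  ⟨m.M, fun i => π (m.μ i), fun _ hi _ hj h => m.injOn hi hj (π.injective h)⟩

theorem Matching.comp_inter (m : Matching n) : (m.comp π).inter G₁ (G₂.map π) = m.inter G₁ G₂ := by
  ext i j
  simp only [Matching.inter, Matching.comp, map_perm_adj]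

theorem Matching.comp_union (m : Matching n) : (m.comp π).union G₁ (G₂.map π) = m.union G₁ G₂ := by
  ext i j
  simp only [Matching.union, Matching.comp, map_perm_adj]

theorem Matching.comp_diff (m : Matching n) : (m.comp π).diff G₁ (G₂.map π) = m.diff G₁ G₂ := by
  ext i j
  simp only [Matching.diff, Matching.comp, map_perm_adj]

theorem map_perm_symm : (G₂.map π).map π.symm = G₂ := by
  ext i j
  have h := map_perm_adj π.symm (G₂.map π) (i := π i) (j := π j)
  rw [Equiv.symm_apply_apply, Equiv.symm_apply_apply, map_perm_adj] at h
  exact h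

variable {π G₁ G₂}

theorem Matching.IsKCore.comp {k : ℕ} {m : Matching n} (h : m.IsKCore k G₁ G₂) :
    (m.comp π).IsKCore k G₁ (G₂.map π) := by
  unfold Matching.IsKCore
  rw [Matching.comp_inter]
  exact h

theorem Matching.IsMaxKCore.comp {k : ℕ} {m : Matching n} (h : m.IsMaxKCore k G₁ G₂) :
    (m.comp π).IsMaxKCore k G₁ (G₂.map π) := by
  refine ⟨h.1.comp, fun m' hm' => ?_⟩
  have h1 := hm'.comp (π := π.symm)
  rw [map_perm_symm] at h1
  exact h.2 (m'.comp π.symm) h1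

theorem nbrCount_of_adj_iff {G G' : SimpleGraph (Fin n)}
    (h : ∀ i j, G'.Adj (π i) (π j) ↔ G.Adj i j) (U : Finset (Fin n)) (v : Fin n) :
    nbrCount G' (U.map π.toEmbedding) (π v) = nbrCount G U v := by
  classical
  unfold nbrCount
  rw [Finset.filter_map, Finset.card_map]
  congr 1
  ext x
  simp only [Finset.mem_filter, Function.comp, Equiv.coe_toEmbedding, h]

theorem nbrCount_map_perm (U : Finset (Fin n)) (v : Fin n) :
    nbrCount (G₂.map π) (U.map π.toEmbedding) (π v) = nbrCount G₂ U v :=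
  nbrCount_of_adj_iff (fun _ _ => map_perm_adj π G₂) U v

theorem IsLuczak.map_perm {U W : Finset (Fin n)} (h : IsLuczak G₂ U W) :
    IsLuczak (G₂.map π) (U.map π.toEmbedding) (W.map π.toEmbedding) := by
  classical
  refine ⟨h.1.lift _ ?_, ?_⟩
  · rintro U U' ⟨v, h1, h2, rfl⟩
    refine ⟨π v, by simpa using h1, by rwa [nbrCount_map_perm], ?_⟩
    rw [Finset.map_insert]; rfl
  · rintro U' ⟨v, h1, h2, -⟩
    obtain ⟨w, rfl⟩ := π.surjective v
    rw [nbrCount_map_perm] at h2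
    exact h.2 _ ⟨w, by simpa using h1, h2, rfl⟩

/-- Composing the matching with `π` transports all the data. The three combined graphs and all
labels live on the vertices of the first graph and stay the same. The reverse inclusion is the same
fact for `π⁻¹`. -/
theorem recoveryOutputs_subset_map {r : ℕ} {α β s : ℝ} {k : ℕ} {c : Fin n → Fin r} :
    recoveryOutputs α β s k c G₁ G₂ ⊆ recoveryOutputs α β s k c G₁ (G₂.map π) := by
  classical
  rintro σ ⟨m, hm, ⟨σ₁, F', B, h1, h2, h3, h4, h5⟩, h6⟩
  refine ⟨m.comp π, hm.comp, ⟨σ₁, F'.map π.toEmbedding, B, h1, ?_, ?_, ?_, ?_⟩, h6⟩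
  · have h7 := h2.map_perm (π := π)
    convert h7 using 1
    ext x
    obtain ⟨y, rfl⟩ := π.surjective x
    simp [Matching.comp]
  · rw [h3]
    ext i
    simp [Matching.comp]
  · rw [Matching.comp_union]; exact h4
  · rw [Matching.comp_diff]; exact h5

theorem recoveryOutputs_map {r : ℕ} (α β s : ℝ) (k : ℕ) (c : Fin n → Fin r)
    (G₁ G₂ : SimpleGraph (Fin n)) (π : Equiv.Perm (Fin n)) :
    recoveryOutputs α β s k c G₁ (G₂.map π) = recoveryOutputs α β s k c G₁ G₂ := by
  refine subset_antisymm ?_ recoveryOutputs_subset_map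
  have h := recoveryOutputs_subset_map (π := π.symm) (G₁ := G₁) (G₂ := G₂.map π) (α := α) (β := β)
    (s := s) (k := k) (c := c)
  rwa [map_perm_symm] at h

end

end CorrSBM
end

/-! ### The good outcome has high probability. -/

noncomputable section
namespace CorrSBM

open Filter Topology Matrix

section
variable {α β s ε : ℝ}

theorem abs_tilt (α β : ℝ) : |tilt α β| = |Real.log (α / β)| / 2 := by
  unfold tilt
  rw [abs_mul, abs_of_pos (by norm_num : (0 : ℝ) < 1 / 2)]; ring

theorem Dplus_self (α : ℝ) : Dplus α α = 0 := by simp [Dplus]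

theorem Dplus_comm (α β : ℝ) : Dplus α β = Dplus β α := by
  unfold Dplus
  rw [div_pow, div_pow, ← neg_sub √β √α, neg_sq]

theorem log_ratio_ne_zero (hα : 0 < α) (hβ : 0 < β) (h : α ≠ β) : Real.log (α / β) ≠ 0 :=
  Real.log_ne_zero_of_pos_of_ne_one (by positivity) fun h1 => h ((div_eq_one_iff_eq hβ.ne').1 h1)

/-- From `√(αβ) ≥ min α β` and `1 - 1/x ≤ log x`. It bounds the admissible `ε` by the intensities
alone, however close `α` and `β` are. -/
theorem Dplus_le_log (hα : 0 < α) (hβ : 0 < β) :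
    Dplus α β ≤ max α β / 2 * |Real.log (α / β)| := by
  have key : ∀ {a b : ℝ}, 0 < a → 0 < b → b ≤ a → Dplus a b ≤ a / 2 * |Real.log (a / b)| := by
    intro a b ha hb hab
    have h1 : Dplus a b ≤ (a - b) / 2 := by
      rw [Dplus_eq ha.le hb.le]
      have h2 : b ≤ √a * √b := by
        calc b = √b * √b := (Real.mul_self_sqrt hb.le).symm
          _ ≤ √a * √b := mul_le_mul_of_nonneg_right (Real.sqrt_le_sqrt hab) (Real.sqrt_nonneg _)
      linarith
    have h3 := Real.one_sub_inv_le_log_of_pos (div_pos ha hb)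
    have h4 := mul_le_mul_of_nonneg_left (h3.trans (le_abs_self _)) (half_pos ha).le
    refine h1.trans (le_trans (le_of_eq ?_) h4)
    rw [inv_div]; field_simp
  rcases le_total β α with h | h
  · rw [max_eq_left h]; exact key hα hβ h
  · rw [max_eq_right h, Dplus_comm, ← inv_div β α, Real.log_inv, abs_neg]; exact key hβ hα h

/-- An admissible number of classes is large. -/
theorem ClassesCondition.three_le (hα : 0 < α) (hβ : 0 < β) (hs : 0 < s) (hαβ : α ≠ β) {r : ℕ}
    (hε : EpsCondition α β s ε) (hr : ClassesCondition (s * α) (s * β) ε r) : 3 ≤ r := by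
  obtain ⟨-, hε0, hε1⟩ := hε
  unfold ClassesCondition at hr
  set M := max 1 (max (s * α) (s * β)) with hM
  have hM1 : 1 ≤ M := le_max_left _ _
  have hl : 0 < |Real.log (α / β)| := abs_pos.2 (log_ratio_ne_zero hα hβ hαβ)
  -- The upper bound on `ε` in the parameter condition, used to force `r ≥ 3`: a class and the
  -- exceptional sets must together stay below `n/2`.
  have h1 : ε ≤ M / 8 := by
    refine hε1.trans ?_
    rw [div_le_iff₀ (by positivity)]
    have h2 := mul_le_mul_of_nonneg_left (Dplus_le_log hα hβ) hs.le
    have h3 : s * max α β ≤ M := by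
      rcases max_choice α β with h | h <;> rw [h]
      · exact (le_max_left _ _).trans (le_max_right _ _)
      · exact (le_max_right _ _).trans (le_max_right _ _)
    have h4 := mul_le_mul_of_nonneg_right h3 hl.le
    linarith
  have h2 : 1 < Real.log (ε * r * (200 * M)⁻¹) := by
    by_contra! h
    have : (Real.log (ε * r * (200 * M)⁻¹) - 1) * ε ≤ 0 :=
      mul_nonpos_of_nonpos_of_nonneg (by linarith) hε0.le
    linarith
  have h0 : 0 < ε * r * (200 * M)⁻¹ := by
    rcases Nat.eq_zero_or_pos r with rfl | hr0
    · simp at h2; linarith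
    · have : (0 : ℝ) < r := by exact_mod_cast hr0
      positivity
  have h3 : 1 < ε * r * (200 * M)⁻¹ := by
    have := Real.add_one_le_exp (Real.log (ε * r * (200 * M)⁻¹))
    rw [Real.exp_log h0] at this
    linarith
  rw [← div_eq_mul_inv, lt_div_iff₀ (by positivity)] at h3
  have h4 : ε * r ≤ M / 8 * r := mul_le_mul_of_nonneg_right h1 (Nat.cast_nonneg r)
  have h5 : (3 : ℝ) ≤ r := by
    by_contra! h
    have : M / 8 * r ≤ M / 8 * 3 := mul_le_mul_of_nonneg_left h.le (by positivity)
    linarith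
  exact_mod_cast h5

theorem GoodPart.mono {n r : ℕ} {δ δ' : ℝ} {σ : Fin n → ℤˣ} {c : Fin n → Fin r} (h : GoodPart δ σ c)
    (hδ : δ ≤ δ') : GoodPart δ' σ c := by
  have h1 : δ * n ≤ δ' * n := mul_le_mul_of_nonneg_right hδ (Nat.cast_nonneg n)
  exact ⟨h.bal.trans h1, fun i => (h.balClass i).trans h1, fun i => (h.card i).trans h1⟩

section
variable {n r : ℕ}

open Classical in
/-- A set outside which the spectral labelings of `G` are correct, of size at most `x` if there is
one. -/
def badSet (a b x : ℝ) (σ : Fin n → ℤˣ) (c : Fin n → Fin r) (i : Fin r)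
    (G : SimpleGraph {v : Fin n // c v ≠ i}) : Finset (Fin n) :=
  -- For fixed labels and classes the choice depends on the induced graph alone, as
  -- `eventually_few_bad` requires.
  if h : ∃ Z : Finset {v : Fin n // c v ≠ i}, (Z.card : ℝ) ≤ x ∧
      ∀ τ, IsSpectral a b G τ → ∃ η : ℤˣ, ∀ v, v ∉ Z → τ v = η * σ v
  then h.choose.map (Function.Embedding.subtype _) else ∅

theorem badSet_spec {a b x : ℝ} (hx : 0 ≤ x) (σ : Fin n → ℤˣ) (c : Fin n → Fin r) (i : Fin r)
    (G : SimpleGraph {v : Fin n // c v ≠ i}) :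
    (∀ v ∈ badSet a b x σ c i G, c v ≠ i) ∧ ((badSet a b x σ c i G).card : ℝ) ≤ x := by
  unfold badSet
  split_ifs with h
  · refine ⟨fun v hv => ?_, ?_⟩
    · obtain ⟨w, -, rfl⟩ := Finset.mem_map.1 hv
      exact w.2
    · rw [Finset.card_map]; exact h.choose_spec.1
  · simpa using hx

theorem badSet_eq {a b x : ℝ} {σ : Fin n → ℤˣ} {c : Fin n → Fin r} {i : Fin r}
    {G : SimpleGraph {v : Fin n // c v ≠ i}}
    (h : ∃ Z : Finset {v : Fin n // c v ≠ i}, (Z.card : ℝ) ≤ x ∧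
      ∀ τ, IsSpectral a b G τ → ∃ η : ℤˣ, ∀ v, v ∉ Z → τ v = η * σ v)
    (τ : {v : Fin n // c v ≠ i} → ℤˣ) (hτ : IsSpectral a b G τ) :
    ∃ η : ℤˣ, ∀ v, v.1 ∉ badSet a b x σ c i G → τ v = η * σ v := by
  obtain ⟨η, hη⟩ := h.choose_spec.2 τ hτ
  refine ⟨η, fun v hv => hη v fun hvZ => hv ?_⟩
  unfold badSet
  rw [dif_pos h]
  exact Finset.mem_map_of_mem (Function.Embedding.subtype _) hvZ

open Classical in
theorem GoodPart.card_ne {δ : ℝ} {σ : Fin n → ℤˣ} {c : Fin n → Fin r} (h : GoodPart δ σ c)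
    (hr : 3 ≤ r) (hδ : δ ≤ 1 / 24) (i : Fin r) :
    ((Finset.univ.filter fun v => c v = i).card : ℝ) ≤ n / 3 + n / 24 ∧
      (n : ℝ) / 2 ≤ Fintype.card {v : Fin n // c v ≠ i} := by
  have h1 := (abs_le.1 (h.card i)).2
  have hr' : (3 : ℝ) ≤ r := by exact_mod_cast hr
  have hn : (0 : ℝ) ≤ n := Nat.cast_nonneg n
  have h2 : (n : ℝ) / r ≤ n / 3 := by gcongr
  have h3 : δ * n ≤ 1 / 24 * n := by gcongr
  have h4 : ((Finset.univ.filter fun v => c v = i).card : ℝ) +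
      Fintype.card {v : Fin n // c v ≠ i} = n := by
    have h5 := Finset.card_filter_add_card_filter_not (s := (Finset.univ : Finset (Fin n)))
      (fun x => c x = i)
    rw [Finset.card_univ, Fintype.card_fin] at h5
    rw [Fintype.card_subtype]
    exact_mod_cast h5
  constructor <;> linarith

theorem GoodPart.abs_sum_ne {δ : ℝ} {σ : Fin n → ℤˣ} {c : Fin n → Fin r} (h : GoodPart δ σ c)
    (i : Fin r) : |∑ v : {v : Fin n // c v ≠ i}, rv σ v| ≤ 2 * δ * n := by
  classical
  have h1 : ∑ v : {v : Fin n // c v ≠ i}, rv σ v = ∑ v with c v ≠ i, rv σ v :=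
    (Finset.sum_subtype (Finset.univ.filter fun x => c x ≠ i) (p := fun x => c x ≠ i)
      (F := inferInstance) (by simp) _).symm
  have h5 := Finset.sum_filter_add_sum_filter_not (Finset.univ : Finset (Fin n))
    (fun x => c x = i) (rv σ)
  have h6 : ∑ x with c x ≠ i, rv σ x = ∑ x, rv σ x - ∑ x with c x = i, rv σ x := by
    rw [← h5]; ring
  rw [h1, h6]
  have h7 := abs_sub (∑ x, rv σ x) (∑ x with c x = i, rv σ x)
  have h8 : |∑ x, rv σ x| ≤ δ * n := h.bal
  have h9 : |∑ x with c x = i, rv σ x| ≤ δ * n := h.balClass i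
  linarith

end

/-- With high probability, the outcome is good. -/
theorem eventually_goodOutcome (hα : 0 < α) (hβ : 0 < β) (hs0 : 0 < s) (hs1 : s ≤ 1) (hαβ : α ≠ β)
    (h₂ : 1 < s ^ 2 * Tc α β + s * (1 - s) * Dplus α β) (hε : EpsCondition α β s ε) {r : ℕ}
    (hr : ClassesCondition (s * α) (s * β) ε r) :
    ∃ K₁ K₂ : ℕ, ∃ δ > 0, δ ≤ 1 / 24 ∧ ∀ η > 0, ∀ᶠ n : ℕ in atTop,
      ∀ (σ : Fin n → ℤˣ) (c : Fin n → Fin r), GoodPart δ σ c →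
        Pr (stW α β s σ) {ω | ¬ GoodOutcome α β s ε K₁ K₂ σ c ω} ≤ η := by
  classical
  have hr3 := ClassesCondition.three_le hα hβ hs0 hαβ hε hr
  have hr' : (0 : ℝ) < r := by
    have : 0 < r := by omega
    exact_mod_cast this
  have hTc : 0 < s ^ 2 * Tc α β := by unfold Tc; positivity
  have hD : 0 < Dplus α β := by
    have hne : √α - √β ≠ 0 := fun h =>
      hαβ ((Real.sqrt_inj hα.le hβ.le).1 (sub_eq_zero.1 h))
    unfold Dplus; positivity
  obtain ⟨K₁, δa, hδa, Ha⟩ := eventually_diff_fringe_le hα hβ hs0.le hs1 13 hTc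
  -- The margin is the one needed by the unmatched vertices, see `vote_unmatched_pos`.
  obtain ⟨δb, hδb, Hb⟩ := eventually_signed_diff hα hβ hs0.le hs1 13 hTc h₂
    (|tilt α β| * (K₁ + 13))
  -- `4 ε |tilt| = 2 ε |log (α/β)|`, so this is the first part of the condition on `ε`.
  obtain ⟨δc, hδc, Hc⟩ := eventually_signed (z := 4 * ε * |tilt α β|) hα hβ hs0.le hs1
    (kindProb_isUn hs0.le hs1) (by rw [abs_tilt]; linarith [hε.1])
  obtain ⟨K₂, δd, hδd, Hd⟩ := eventually_few_bad hα hβ hs0.le hs1 (r := r) (by omega)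
    (mul_pos hs0 hD)
  -- The bound `1/24`: a class has at most `n/3 + n/24` vertices and each of two exceptional sets at
  -- most `n/24`, altogether `11 n / 24 < n/2`.
  obtain ⟨δe, hδe, He⟩ := spectral_comap_bad_set (a := s * α) (b := s * β) (δ := min δd (1 / 24))
    (by positivity) (by positivity) (fun h => hαβ (mul_left_cancel₀ hs0.ne' h))
    (lt_min hδd (by norm_num))
  set δ := min (min (min δa δb) (min δc δd)) (min (min (δe / 2) (1 / r)) (1 / 24)) with hδ
  have hδ0 : 0 < δ := by positivity
  have la : δ ≤ δa := (min_le_left _ _).trans ((min_le_left _ _).trans (min_le_left _ _))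
  have lb : δ ≤ δb := (min_le_left _ _).trans ((min_le_left _ _).trans (min_le_right _ _))
  have lc : δ ≤ δc := (min_le_left _ _).trans ((min_le_right _ _).trans (min_le_left _ _))
  have ld : δ ≤ δd := (min_le_left _ _).trans ((min_le_right _ _).trans (min_le_right _ _))
  have le : δ ≤ δe / 2 := (min_le_right _ _).trans ((min_le_left _ _).trans (min_le_left _ _))
  have lr : δ ≤ 1 / r := (min_le_right _ _).trans ((min_le_left _ _).trans (min_le_right _ _))
  have l24 : δ ≤ 1 / 24 := (min_le_right _ _).trans (min_le_right _ _)
  refine ⟨K₁, K₂, δ, hδ0, l24, fun η hη => ?_⟩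
  have hη' : 0 < η / 7 := by positivity
  filter_upwards [eventually_matching hα hβ hs0.le hs1 (η / 7) hη', Ha (η / 7) hη', Hb (η / 7) hη',
    Hc (η / 7) hη', Hd (η / 7) hη',
    eventually_ownClass_le hα hβ hs0.le hs1 hε.2.1 (by omega) hr (η / 7) hη',
    eventually_quad hα hβ hs0.le hs1 hδe (η / 7) hη', eventually_adm hα hβ hs0.le hs1,
    eventually_ge_atTop 4] with n p1 p2 p3 p4 p5 p6 p7 hn hn4 σ c hg
  have hw := stW_isWeight hn σ
  have hnp := hn.n_pos
  have hbal : |∑ i, rv σ i| ≤ δ * n := hg.bal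
  have hmul : ∀ {x : ℝ}, δ ≤ x → δ * n ≤ x * n := fun h => mul_le_mul_of_nonneg_right h hnp.le
  set x := min δd (1 / 24) * (n : ℝ) with hx
  have hx0 : 0 ≤ x := by positivity
  have hxd : x ≤ δd * n := mul_le_mul_of_nonneg_right (min_le_left _ _) hnp.le
  have hx24 : x ≤ 1 / 24 * n := mul_le_mul_of_nonneg_right (min_le_right _ _) hnp.le
  have q1 := p1 σ
  have q2 := p2 σ (hbal.trans (hmul la))
  have q3 := p3 σ (hbal.trans (hmul lb))
  have q4 := p4 σ (hbal.trans (hmul lc))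
  have q5 := p5 σ c (hg.mono ld) (badSet (s * α) (s * β) x σ c) (fun i G =>
    ⟨(badSet_spec hx0 σ c i G).1, (badSet_spec hx0 σ c i G).2.trans hxd⟩)
  have q6 := p6 σ c (fun i => by
    have h1 := (abs_le.1 (hg.card i)).2
    have h2 := hmul lr
    have h3 : 2 * (n : ℝ) / r = n / r + 1 / r * n := by ring
    linarith)
  have q7 := p7 σ
  have key := (Pr_union_le hw _ _).trans (add_le_add q1 ((Pr_union_le hw _ _).trans (add_le_add q2
    ((Pr_union_le hw _ _).trans (add_le_add q3 ((Pr_union_le hw _ _).trans (add_le_add q4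
    ((Pr_union_le hw _ _).trans (add_le_add q5 ((Pr_union_le hw _ _).trans
      (add_le_add q6 q7)))))))))))
  refine le_trans (Pr_mono hw ?_) (key.trans (le_of_eq (by ring)))
  intro ω hω
  by_contra hcon
  simp only [Set.mem_union, not_or] at hcon
  obtain ⟨r1, r2, r3, r4, r5, r6, r7⟩ := hcon
  simp only [Set.mem_ofPred_eq, not_exists, not_and, not_le, not_lt, not_not] at r1 r2 r3 r4 r5 r6 r7
  refine hω ⟨fun m hm i hi => r1 m hm i hi, r2, r3, r4, r6, ?_⟩
  have hspec := He n σ (gr isG1 ω) hn.log_pos r7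
  obtain ⟨Z₀, hZ₀, hτ⟩ := hspec (Fin n) id Function.injective_id
    (by rw [Fintype.card_fin]; omega) (by rw [Fintype.card_fin]; linarith)
    (hbal.trans (hmul (le.trans (by linarith))))
  rw [SimpleGraph.comap_id] at hτ
  refine ⟨Z₀, fun i => badSet (s * α) (s * β) x σ c i ((gr isG1 ω).comap Subtype.val), ?_, hτ, ?_, r5⟩
  · intro i
    have h1 := (hg.card_ne hr3 l24 i).1
    have h2 := (badSet_spec (a := s * α) (b := s * β) hx0 σ c i
      ((gr isG1 ω).comap Subtype.val)).2
    have h3 := (Finset.card_union_le (Finset.univ.filter fun v => c v = i)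
      (Z₀ ∪ badSet (s * α) (s * β) x σ c i ((gr isG1 ω).comap Subtype.val))).trans
      (add_le_add le_rfl (Finset.card_union_le _ _))
    have h4 : (((Finset.univ.filter fun v => c v = i) ∪
        (Z₀ ∪ badSet (s * α) (s * β) x σ c i ((gr isG1 ω).comap Subtype.val))).card : ℝ) ≤
        (Finset.univ.filter fun v => c v = i).card + (Z₀.card +
        (badSet (s * α) (s * β) x σ c i ((gr isG1 ω).comap Subtype.val)).card) := by
      exact_mod_cast h3
    have h5 : (Z₀.card : ℝ) ≤ x := hZ₀
    linarith
  · intro i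
    have h2 := (hg.card_ne hr3 l24 i).2
    have hn4' : (4 : ℝ) ≤ n := by exact_mod_cast hn4
    refine badSet_eq (hspec {v : Fin n // c v ≠ i} Subtype.val Subtype.val_injective ?_ h2 ?_)
    · have : (1 : ℝ) < Fintype.card {v : Fin n // c v ≠ i} := by linarith
      exact_mod_cast this
    · refine (hg.abs_sum_ne i).trans (mul_le_mul_of_nonneg_right ?_ hnp.le)
      linarith

end

end CorrSBM
end

noncomputable section
namespace CorrSBM

open Filter Topology

/-! ### The main results -/

section
variable {α β ε : ℝ} {s : unitInterval}

theorem pos_of_threshold (h₁ : 1 < (1 - (1 - (s : ℝ)) ^ 2) * Dplus α β) : 0 < (s : ℝ) := by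
  refine lt_of_le_of_ne s.2.1 fun h => ?_
  rw [← h] at h₁
  norm_num at h₁

theorem ne_of_threshold (h₁ : 1 < (1 - (1 - (s : ℝ)) ^ 2) * Dplus α β) : α ≠ β := by
  rintro rfl
  rw [Dplus_self, mul_zero] at h₁
  linarith

theorem exists_epsCondition (hα : 0 < α) (hβ : 0 < β)
    (h₁ : 1 < (1 - (1 - (s : ℝ)) ^ 2) * Dplus α β) : ∃ ε : ℝ, EpsCondition α β s ε := by
  have hs := pos_of_threshold h₁
  have hl : 0 < |Real.log (α / β)| := abs_pos.2 (log_ratio_ne_zero hα hβ (ne_of_threshold h₁))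
  set l := |Real.log (α / β)| with hld
  set X := (1 - (1 - (s : ℝ)) ^ 2) * Dplus α β with hX
  have hD : 0 < Dplus α β := by
    refine lt_of_le_of_ne Dplus_nonneg fun h => ?_
    rw [hX, ← h, mul_zero] at h₁
    linarith
  -- The first term makes `2 ε l` at most half of the slack `X - 1`, so the inequality stays strict.
  refine ⟨min ((X - 1) / (4 * l)) (s * Dplus α β / (4 * l)), ?_,
    lt_min (div_pos (by linarith) (by positivity)) (by positivity), min_le_right _ _⟩
  have h2 : min ((X - 1) / (4 * l)) (s * Dplus α β / (4 * l)) * (4 * l) ≤ X - 1 := by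
    rw [← le_div_iff₀ (by positivity)]; exact min_le_left _ _
  rw [← hld, ← hX]
  linarith

theorem exists_classesCondition (a b : ℝ) (hε : 0 < ε) :
    ∃ r : ℕ, 0 < r ∧ ClassesCondition a b ε r := by
  set M := max 1 (max a b) with hM
  have hM1 : 1 ≤ M := le_max_left _ _
  -- Makes the logarithm at least `2/ε + 2`, so that the expression to be compared with 1 is at
  -- least `1 + ε/2`.
  obtain ⟨r, hr⟩ := exists_nat_ge (Real.exp (2 / ε + 2) * (200 * M) / ε)
  have hpos : 0 < Real.exp (2 / ε + 2) * (200 * M) / ε := by positivity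
  refine ⟨r, by exact_mod_cast hpos.trans_le hr, ?_⟩
  unfold ClassesCondition
  rw [← hM]
  rw [div_le_iff₀ hε] at hr
  have h1 : Real.exp (2 / ε + 2) ≤ ε * r * (200 * M)⁻¹ := by
    rw [← div_eq_mul_inv, le_div_iff₀ (by positivity)]; linarith
  have h2 : 2 / ε + 2 ≤ Real.log (ε * r * (200 * M)⁻¹) :=
    (Real.le_log_iff_exp_le ((Real.exp_pos _).trans_le h1)).2 h1
  have h3 : (2 / ε + 1) * ε ≤ (Real.log (ε * r * (200 * M)⁻¹) - 1) * ε :=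
    mul_le_mul_of_nonneg_right (by linarith) hε.le
  have h4 : (2 / ε + 1) * ε = 2 + ε := by field_simp
  linarith

/-- The outcomes and partitions for which the algorithm recovers the communities. -/
def successSet (α β s : ℝ) (n r : ℕ) : Set (Outcome n × (Fin n → Fin r)) :=
  {x | (recoveryOutputs α β s 13 x.2 x.1.G₁ x.1.G₂).Nonempty ∧
    ∀ σ ∈ recoveryOutputs α β s 13 x.2 x.1.G₁ x.1.G₂, ov σ x.1.labels = 1}

/-- The algorithm recovers the communities exactly with high probability. -/
theorem tendsto_successSet (hα : 0 < α) (hβ : 0 < β)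
    (h₁ : 1 < (1 - (1 - (s : ℝ)) ^ 2) * Dplus α β)
    (h₂ : 1 < (s : ℝ) ^ 2 * Tc α β + (s : ℝ) * (1 - (s : ℝ)) * Dplus α β)
    (hε : EpsCondition α β s ε) (r : ℕ) [NeZero r] (hr : ClassesCondition (s * α) (s * β) ε r) :
    Tendsto (fun n : ℕ => (csbmWithPartition n r (logProb α n) (logProb β n) s).toOuterMeasure
      (successSet α β s n r)) atTop (𝓝 1) := by
  classical
  have hs := pos_of_threshold h₁
  have hαβ := ne_of_threshold h₁
  have hr3 := ClassesCondition.three_le hα hβ hs hαβ hε hr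
  obtain ⟨K₁, K₂, δ, hδ, hδ24, H⟩ := eventually_goodOutcome hα hβ hs s.2.2 hαβ h₂ hε hr
  refine tendsto_one_of_compl _ _ fun η hη => ?_
  filter_upwards [H (η / 2) (half_pos hη), sum_not_goodPart_tendsto r δ hδ (η / 2) (half_pos hη),
    eventually_adm hα hβ s.2.1 s.2.2, eventually_ge_atTop 4,
    tendsto_log_nat.eventually_ge_atTop ((1 + K₁ + 2 * (r * K₂)) / (3 * ε))]
    with n p1 p2 hn hn4 hL
  have hεp := hε.2.1
  rw [div_le_iff₀ (by positivity)] at hL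
  have hL' : (1 + K₁ + 2 * (r * K₂) : ℝ) ≤ 3 * ε * Real.log n := by linarith
  have hhalf : max α β * Real.log n / n ≤ 1 := hn.half.trans (by norm_num)
  have hlp : ∀ {a : ℝ}, 0 ≤ a → a ≤ max α β → (logProb a n : ℝ) ≤ 1 / 2 := by
    intro a ha0 ha
    rw [logProb_coe ha0 ha hhalf]
    refine le_trans ?_ hn.half
    have := hn.log_pos
    gcongr
  have key := csbmWithPartition_le n r (logProb α n) (logProb β n) s (hlp hα.le (le_max_left _ _))
    (hlp hβ.le (le_max_right _ _)) (successSet α β s n r)ᶜ (GoodPart δ) (η / 2) (η / 2)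
    (half_pos hη).le ?_ (by convert p2)
  · rwa [add_halves] at key
  · intro σ c π hg
    refine le_trans (Pr_mono (stW_isWeight hn σ) ?_) (p1 σ c hg)
    intro ω hω hgood
    refine hω ⟨?_, ?_⟩
    · show (recoveryOutputs α β s 13 c (gr isG1 ω) ((gr isG2 ω).map π)).Nonempty
      rw [recoveryOutputs_map]
      refine hgood.recoveryOutputs_nonempty hα hβ hs hL' (by omega) fun i => ?_
      have h3 := (hg.card_ne hr3 hδ24 i).2
      have hn4' : (4 : ℝ) ≤ n := by exact_mod_cast hn4
      rw [Nat.card_eq_fintype_card]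
      have h4 : (1 : ℝ) < Fintype.card {v : Fin n // c v ≠ i} := by linarith
      exact_mod_cast h4
    · show ∀ σ' ∈ recoveryOutputs α β s 13 c (gr isG1 ω) ((gr isG2 ω).map π), ov σ' σ = 1
      rw [recoveryOutputs_map]
      intro σ' hσ'
      obtain ⟨η', hη'⟩ := hgood.eq_of_mem_recoveryOutputs hα hβ hs hL' hσ'
      exact ov_eq_one (by omega) hη'

/-- Some fixed partition is at least as good as the random one. -/
theorem exists_partition_ge (n r : ℕ) [NeZero r] (p q s : unitInterval)
    (S : Set (Outcome n × (Fin n → Fin r))) :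
    ∃ c : Fin n → Fin r, (csbmWithPartition n r p q s).toOuterMeasure S ≤
      (csbm n p q s).toOuterMeasure {ω | (ω, c) ∈ S} := by
  obtain ⟨c₀, hc₀⟩ := Finite.exists_max
    fun c : Fin n → Fin r => (csbm n p q s).toOuterMeasure {ω | (ω, c) ∈ S}
  refine ⟨c₀, ?_⟩
  have h1 : csbmWithPartition n r p q s =
      (PMF.uniformOfFintype (Fin n → Fin r)).bind fun c =>
        (csbm n p q s).map fun ω => (ω, c) := by
    have h2 : csbmWithPartition n r p q s = (csbm n p q s).bind fun ω =>
      (PMF.uniformOfFintype (Fin n → Fin r)).bind fun c => PMF.pure (ω, c) := rfl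
    rw [h2, PMF.bind_comm]
    rfl
  rw [h1, PMF.toOuterMeasure_bind_apply]
  calc _ ≤ ∑' c, PMF.uniformOfFintype (Fin n → Fin r) c *
        (csbm n p q s).toOuterMeasure {ω | (ω, c₀) ∈ S} := by
        refine ENNReal.tsum_le_tsum fun c => mul_le_mul_right ?_ _
        rw [PMF.toOuterMeasure_map_apply]
        exact hc₀ c
    _ = _ := by rw [ENNReal.tsum_mul_right, PMF.tsum_coe, one_mul]

/-- Exact recovery is possible. -/
theorem exists_estimator (hα : 0 < α) (hβ : 0 < β)
    (h₁ : 1 < (1 - (1 - (s : ℝ)) ^ 2) * Dplus α β)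
    (h₂ : 1 < (s : ℝ) ^ 2 * Tc α β + (s : ℝ) * (1 - (s : ℝ)) * Dplus α β) :
    ∃ est : (n : ℕ) → SimpleGraph (Fin n) → SimpleGraph (Fin n) → Fin n → ℤˣ,
      Tendsto (fun n : ℕ => (csbm n (logProb α n) (logProb β n) s).toOuterMeasure
          {ω | ov (est n ω.G₁ ω.G₂) ω.labels = 1}) atTop (𝓝 1) := by
  classical
  obtain ⟨ε, hε⟩ := exists_epsCondition hα hβ h₁
  obtain ⟨r, hr0, hr⟩ := exists_classesCondition (s * α) (s * β) hε.2.1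
  have : NeZero r := ⟨hr0.ne'⟩
  -- The estimator is allowed no randomness, so a best partition is fixed for each `n`.
  choose c hc using fun n => exists_partition_ge n r (logProb α n) (logProb β n) s
    (successSet α β s n r)
  refine ⟨fun n G₁ G₂ => if h : (recoveryOutputs α β s 13 (c n) G₁ G₂).Nonempty then h.some else 1, ?_⟩
  refine tendsto_of_tendsto_of_tendsto_of_le_of_le (tendsto_successSet hα hβ h₁ h₂ hε r hr)
    tendsto_const_nhds (fun n => ?_) fun n => ?_
  · refine (hc n).trans ((PMF.toOuterMeasure _).mono ?_)
    rintro ω ⟨hne, hov⟩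
    show ov (if h : (recoveryOutputs α β s 13 (c n) ω.G₁ ω.G₂).Nonempty then h.some else 1)
      ω.labels = 1
    rw [dif_pos hne]
    exact hov _ hne.some_mem
  · exact ((PMF.toOuterMeasure _).mono (Set.subset_univ _)).trans
      ((PMF.toOuterMeasure_apply_eq_one_iff _ _).2 (Set.subset_univ _)).le

end

end CorrSBM
end

open CorrSBM Filter Topology in
theorem theorem1 (α β : ℝ) (hα : 0 < α) (hβ : 0 < β) (s : unitInterval)
    (h₁ : 1 < (1 - (1 - (s : ℝ)) ^ 2) * Dplus α β)
    (h₂ : 1 < (s : ℝ) ^ 2 * Tc α β + (s : ℝ) * (1 - (s : ℝ)) * Dplus α β) :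
    (∃ est : (n : ℕ) → SimpleGraph (Fin n) → SimpleGraph (Fin n) → Fin n → ℤˣ,
      Tendsto (fun n : ℕ => (csbm n (logProb α n) (logProb β n) s).toOuterMeasure
          {ω | ov (est n ω.G₁ ω.G₂) ω.labels = 1}) atTop (𝓝 1)) ∧
    (∃ ε : ℝ, EpsCondition α β s ε) ∧
    ∀ ε : ℝ, EpsCondition α β s ε →
      (∃ r : ℕ, 0 < r ∧ ClassesCondition (s * α) (s * β) ε r) ∧
      ∀ (r : ℕ) [NeZero r], ClassesCondition (s * α) (s * β) ε r →
        Tendsto (fun n : ℕ =>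
          (csbmWithPartition n r (logProb α n) (logProb β n) s).toOuterMeasure
            {x | (recoveryOutputs α β s 13 x.2 x.1.G₁ x.1.G₂).Nonempty ∧
              ∀ σ ∈ recoveryOutputs α β s 13 x.2 x.1.G₁ x.1.G₂, ov σ x.1.labels = 1})
          atTop (𝓝 1) :=
  ⟨exists_estimator hα hβ h₁ h₂, exists_epsCondition hα hβ h₁, fun _ hε =>
    ⟨exists_classesCondition _ _ hε.2.1, fun r _ hr => tendsto_successSet hα hβ h₁ h₂ hε r hr⟩⟩
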